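/- **Problem.** Let $E\ge 2$ and let $a_e:\mathbb R^{d_{e-1}}\times\mathbb R^{d_{w_e}}\to\mathbb R^{d_e}$ ($e=1,\dots,E$, $d_E=1$) be the operators of a pipeline. For $w=(w_1,\dots,w_E)$ and a sample $x$ put $y_0=x$, $y_e=a_e(y_{e-1},w_e)$, $L(x;w)=y_E$, and $\ell(w)=\mathbb E_{x\sim\mathcal D}L(x;w)$, where $\mathcal D$ is a probability distribution on $\mathbb R^{d_0}$ and $L(\cdot;w)$ is integrable. **Algorithm (Clapping with batch size $B\ge1$).** Parameters: $\gamma>0$, $m\in(0,1)$, $p\in(0,1]$, an initial point $w^{(1)}$, and randomized compressors $\mathcal C$ in forward and backward direction for the links $e=1,\dots,E-1$. Put $\tilde y^{(0)}_{e,b}=0$, $\tilde v^{(0)}_{e,b}=0$, $\tilde u^{(0)}=0$. In iteration $t=1,2,\dots$: 1. *Lazy sampling.* For $t\in\{1,2\}$ all samples $x^{(t)}_b$, $b=1,\dots,B$, are drawn afresh, independently from $\mathcal D$. For $t\ge3$, under the sample-wise rule each $b$ independently is drawn afresh with probability $p$, and otherwise $x^{(t)}_b=x^{(t-1)}_b$;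 under the batch-wise rule the whole batch is drawn afresh with probability $p$, and otherwise kept. 2. *Forward.* $\tilde y^{(t)}_{0,b}=x^{(t)}_b$. For $e=1,\dots,E-1$: $y^{(t)}_{e,b}=a_e(\tilde y^{(t)}_{e-1,b},w_e^{(t)})$ and $\tilde y^{(t)}_{e,b}=\tilde y^{(t-1)}_{e,b}+\mathcal C(y^{(t)}_{e,b}-\tilde y^{(t-1)}_{e,b})$, except that in the variant **FU** $\tilde y^{(t)}_{e,b}=y^{(t)}_{e,b}$ when the sample $b$ is fresh in iteration $t$. The variant **FC** always compresses. 3. *Backward.* $\tilde v^{(t)}_{E,b}=1$. For $e=E,\dots,2$: $v^{(t)}_{e-1,b}=\nabla_1a_e(\tilde y^{(t)}_{e-1,b},w^{(t)}_e)^{\mathsf T}\tilde v^{(t)}_{e,b}$, and $\tilde v^{(t)}_{e-1,b}$ is obtained from $v^{(t)}_{e-1,b}$ and $\tilde v^{(t-1)}_{e-1,b}$ in the same way as in the forward pass. 4. *Update.* $\tilde u^{(t)}_e=(1-m)\tilde u^{(t-1)}_e+\frac mB\sum_{b=1}^B\nabla_2a_e(\tilde y^{(t)}_{e-1,b},w^{(t)}_e)^{\mathsf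 T}\tilde v^{(t)}_{e,b}$ and $w^{(t+1)}_e=w^{(t)}_e-\gamma\tilde u^{(t)}_e$, for $e=1,\dots,E$. Every use of a compressor has fresh independent randomness. **Assumptions.** (All Jacobians in operator norm, all other norms Euclidean.) * (A1) $\ell$ is differentiable and $\nabla\ell$ is $L_{\nabla\ell}$-Lipschitz; each $a_e$ is differentiable with $\|\nabla_1a_e\|,\|\nabla_2a_e\|\le C_a$; for $e=1,\dots,E-1$, $a_e$ is $L_a$-Lipschitz and $\nabla_1a_{e+1},\nabla_2a_{e+1}$ are $L_{\nabla a}$-Lipschitz, jointly in both variables; and $w_1\mapsto\nabla_2a_1(x,w_1)$ is $L_{\nabla a}$-Lipschitz for every $x$. Moreover $\ell(w^{(1)})-\ell(w)\le\Delta$ for all $w$. * (A2) $\mathbb E_x\nabla L(x;w)=\nabla\ell(w)$ and $\mathbb E_x\|\nabla L(x;w)-\nabla\ell(w)\|^2\le\sigma^2$ for all $w$. * (A3) $\mathbb E\|z-\mathcal C(z)\|^2\le\omega_F^2\|z\|^2$ for the forward compressors and $\le\omega_B^2\|z\|^2$ for the backward ones, for all $z$, with $\omega_F,\omega_B\in[0,1)$.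 * (A4) $\mathbb E_{x_1,x_2}\|x_1-x_2\|^2\le\varphi^2$ for independent $x_1,x_2\sim\mathcal D$. **Theorem (convergence rates with large batch).** Under either lazy sampling rule: 1. (Clapping-FU.) Suppose (A1)–(A3). For every $p\in(0,1]$ there is a constant $C\ge0$, depending only on $E,L_{\nabla\ell},C_a,L_{\nabla a},L_a,\Delta,p$, such that for all $\sigma\ge0$, $B,T\ge1$ there are $\gamma>0$ and $m\in(0,1)$ with $$\frac1T\sum_{t=1}^T\mathbb E\|\nabla\ell(w^{(t)})\|^2\le C\left(\frac{\sigma}{\sqrt{BT}}+\frac1{T(1-\omega_B)^{E-1}(1-\omega_F)^{E-1}}\right).$$ 2. (Clapping-FC.) Suppose (A1)–(A4), and let $M$ be such that the exact activations of $x\sim\mathcal D$ at $w^{(1)}$ satisfy $\mathbb E\|y_e\|^2\le M^2$ for $e=1,\dots,E-1$ (such an $M$ always exists). For every $\sigma_0>0$ there is a constant $C\ge0$, depending only on $E$, the dimensions $d_e,d_{w_e}$, $L_{\nabla\ell},C_a,L_{\nabla a},L_a,\Delta,\varphi,M,\sigma_0$, such that for all $\sigma$ with $\sigma=0$ or $\sigma\ge\sigma_0$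 and all $B,T\ge1$ there are $\gamma>0$, $m,p\in(0,1)$ with $$\frac1T\sum_{t=1}^T\mathbb E\|\nabla\ell(w^{(t)})\|^2\le C\left(\frac{\sigma^{4/3}}{(BT)^{1/3}(1-\omega_B)^{4(E-1)/3}(1-\omega_F)^{4(E-1)/3}}+\frac{\delta}{T}\right),$$ $$\delta=\frac1{(1-\omega_B)^{E-1}(1-\omega_F)^{E-1}}+\frac{\omega_F^2+\omega_B}{(1-\omega_B)^{2(E-1)}(1-\omega_F)^2}+\frac1{(1-\omega_F)^{2(E-2)-1}}.$$ In particular all the expectations on the left are finite. The constants do not depend on $\sigma$ (beyond $\sigma_0$), $B$, $T$, $\omega_F$, $\omega_B$, the compressors, the sampling rule, or otherwise on $\mathcal D$ and the $a_e$. -/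

import Mathlib

open MeasureTheory

noncomputable section

namespace Clapping

/-! ### The pipeline-parallel problem

Layers are numbered `0, …, E - 1`; layer `e` maps the activation number `e` to the
activation number `e + 1`, and activation number `0` is the data sample. -/

/-- The space of the activation number `e`. -/
abbrev Act (d : ℕ → ℕ) (e : ℕ) : Type := EuclideanSpace ℝ (Fin (d e))

/-- The operators of the pipeline. Only those with index `e < E` are used. -/
abbrev Layers (d dw : ℕ → ℕ) : Type :=
  ∀ e : ℕ, Act d e → EuclideanSpace ℝ (Fin (dw e)) → Act d (e + 1)

/-- Model parameters: `E` blocks, with the Euclidean norm of their concatenation. -/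
abbrev Weights (E : ℕ) (dw : ℕ → ℕ) : Type :=
  PiLp 2 (fun e : Fin E => EuclideanSpace ℝ (Fin (dw e)))

/-- The block of `w` held by worker `e` (zero when there is no such worker). -/
def block {E : ℕ} {dw : ℕ → ℕ} (w : Weights E dw) (e : ℕ) : EuclideanSpace ℝ (Fin (dw e)) :=
  if h : e < E then w ⟨e, h⟩ else 0

/-- The exact activations for the sample `x`. -/
def act {E : ℕ} {d dw : ℕ → ℕ} (a : Layers d dw) (x : Act d 0) (w : Weights E dw) :
    ∀ e : ℕ, Act d e
  | 0 => x
  | e + 1 => a e (act a x w e) (block w e)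

/-- The loss `L(x; w)`: the last activation, read as a number. The results assume `d E = 1`,
so that the sum has one term. -/
def loss {E : ℕ} {d dw : ℕ → ℕ} (a : Layers d dw) (x : Act d 0) (w : Weights E dw) : ℝ :=
  ∑ i, act a x w E i

/-- The objective `ℓ(w) = 𝔼 L(x; w)`, for `x` with law `D`. -/
def risk {E : ℕ} {d dw : ℕ → ℕ} (a : Layers d dw) (D : Measure (Act d 0))
    (w : Weights E dw) : ℝ :=
  ∫ x, loss a x w ∂D

/-- Jacobian of layer `e` in the incoming activation. -/
def jac1 {d dw : ℕ → ℕ} (a : Layers d dw) (e : ℕ) (y : Act d e)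
    (v : EuclideanSpace ℝ (Fin (dw e))) : Act d e →L[ℝ] Act d (e + 1) :=
  fderiv ℝ (fun y' => a e y' v) y

/-- Jacobian of layer `e` in its parameter block. -/
def jac2 {d dw : ℕ → ℕ} (a : Layers d dw) (e : ℕ) (y : Act d e)
    (v : EuclideanSpace ℝ (Fin (dw e))) : EuclideanSpace ℝ (Fin (dw e)) →L[ℝ] Act d (e + 1) :=
  fderiv ℝ (fun v' => a e y v') v

/-! ### The algorithm -/

/-- `FU`: uncompressed communication when a sample has just been drawn.
`FC`: communication is always compressed. -/
inductive Variant
  | FU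
  | FC

/-- Lazy sampling applied to each sample of the batch separately, or to the whole batch. -/
inductive SamplingRule
  | sampleWise
  | batchWise

/-- Randomness used for one batch entry in one iteration: a candidate new sample, a uniform
variable for the lazy sampling, and the randomness of the forward and backward compressors
of every link. -/
abbrev SampleSeed (d : ℕ → ℕ) (Ξ : Type*) : Type _ := Act d 0 × unitInterval × (ℕ → Ξ) × (ℕ → Ξ)

/-- Randomness used in one iteration: a uniform variable for the batch-wise lazy sampling, and
the randomness of the batch entries. -/
abbrev IterSeed (B : ℕ) (d : ℕ → ℕ) (Ξ : Type*) : Type _ := unitInterval × (Fin B → SampleSeed d Ξ)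

section Law

variable {Ξ : Type*} [MeasurableSpace Ξ]

/-- All the components of a `SampleSeed` are independent. -/
def sampleLaw {d : ℕ → ℕ} (D : Measure (Act d 0)) [IsProbabilityMeasure D]
    (ν : Measure Ξ) [IsProbabilityMeasure ν] : Measure (SampleSeed d Ξ) :=
  D.prod ((volume : Measure unitInterval).prod
    ((Measure.infinitePi fun _ : ℕ => ν).prod (Measure.infinitePi fun _ : ℕ => ν)))

instance {d : ℕ → ℕ} (D : Measure (Act d 0)) [IsProbabilityMeasure D]
    (ν : Measure Ξ) [IsProbabilityMeasure ν] : IsProbabilityMeasure (sampleLaw D ν) := by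
  unfold sampleLaw; infer_instance

/-- The coin and the entries of the batch are independent. -/
def iterLaw (B : ℕ) {d : ℕ → ℕ} (D : Measure (Act d 0)) [IsProbabilityMeasure D]
    (ν : Measure Ξ) [IsProbabilityMeasure ν] : Measure (IterSeed B d Ξ) :=
  (volume : Measure unitInterval).prod (Measure.pi fun _ : Fin B => sampleLaw D ν)

instance (B : ℕ) {d : ℕ → ℕ} (D : Measure (Act d 0)) [IsProbabilityMeasure D]
    (ν : Measure Ξ) [IsProbabilityMeasure ν] : IsProbabilityMeasure (iterLaw B D ν) := by
  unfold iterLaw; infer_instance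

/-- The iterations use independent seeds. Entry `t` of a sequence is used in iteration `t`. -/
def runLaw (B : ℕ) {d : ℕ → ℕ} (D : Measure (Act d 0)) [IsProbabilityMeasure D]
    (ν : Measure Ξ) [IsProbabilityMeasure ν] : Measure (ℕ → IterSeed B d Ξ) :=
  Measure.infinitePi fun _ : ℕ => iterLaw B D ν

end Law

/-- The state after an iteration: parameters, momentum, current batch, and the communicated
approximations of the activations and of the activation gradients (for every batch entry). -/
structure State (E B : ℕ) (d dw : ℕ → ℕ) where
  w : Weights E dw
  u : Weights E dw
  x : Fin B → Act d 0
  y : Fin B → ∀ e : ℕ, Act d e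
  v : Fin B → ∀ e : ℕ, Act d e

/-- All buffers start at zero. The initial value of `x` is never used. -/
def State.init {E : ℕ} (B : ℕ) (d : ℕ → ℕ) {dw : ℕ → ℕ} (w₁ : Weights E dw) :
    State E B d dw where
  w := w₁
  u := 0
  x := fun _ => 0
  y := fun _ _ => 0
  v := fun _ _ => 0

/-- One run's parameters and components. -/
structure Config (d : ℕ → ℕ) (Ξ : Type*) where
  variant : Variant
  rule : SamplingRule
  /-- forward compressor of each activation -/
  Cf : ∀ e : ℕ, Act d e → Ξ → Act d e
  /-- backward compressor of each activation gradient -/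
  Cb : ∀ e : ℕ, Act d e → Ξ → Act d e
  /-- learning rate -/
  γ : ℝ
  /-- momentum coefficient -/
  m : ℝ
  /-- lazy sampling rate, used from the third iteration on -/
  p : ℝ

section Algorithm

variable {E B : ℕ} {d dw : ℕ → ℕ} {Ξ : Type*}

/-- The lazy sampling rate of iteration `t ≥ 2`: fresh samples in the second iteration,
the constant rate `p` afterwards. -/
def lazyRate (p : ℝ) (t : ℕ) : ℝ := if t = 2 then 1 else p

/-- Whether the batch entry `b` is drawn afresh in iteration `t`. -/
def Fresh (cfg : Config d Ξ) (t : ℕ) (s : IterSeed B d Ξ) (b : Fin B) : Prop :=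
  t = 1 ∨
    match cfg.rule with
    | .sampleWise => ((s.2 b).2.1 : ℝ) ≤ lazyRate cfg.p t
    | .batchWise => (s.1 : ℝ) ≤ lazyRate cfg.p t

open Classical in
/-- The samples of iteration `t`. -/
def newSample (cfg : Config d Ξ) (t : ℕ) (S : State E B d dw) (s : IterSeed B d Ξ)
    (b : Fin B) : Act d 0 :=
  if Fresh cfg t s b then (s.2 b).1 else S.x b

/-- Communication is uncompressed for entry `b` in iteration `t`. -/
def Exact (cfg : Config d Ξ) (t : ℕ) (s : IterSeed B d Ξ) (b : Fin B) : Prop :=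
  cfg.variant = .FU ∧ Fresh cfg t s b

open Classical in
/-- What the receiver holds after `z` was sent, when both ends held `prev` before: `z` itself if
the communication is uncompressed, and `prev + C (z - prev)` otherwise. -/
def send {V : Type*} [AddCommGroup V] (exact : Prop) (C : V → Ξ → V) (ξ : Ξ) (prev z : V) : V :=
  if exact then z else prev + C (z - prev) ξ

/-- Forward pass for entry `b` in iteration `t`: the communicated activations. -/
def forward (a : Layers d dw) (cfg : Config d Ξ) (t : ℕ) (S : State E B d dw)
    (s : IterSeed B d Ξ) (b : Fin B) : ∀ e : ℕ, Act d e
  | 0 => newSample cfg t S s b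
  | e + 1 =>
      send (Exact cfg t s b) (cfg.Cf (e + 1)) ((s.2 b).2.2.1 (e + 1)) (S.y b (e + 1))
        (a e (forward a cfg t S s b e) (block S.w e))

/-- Backward pass for entry `b` in iteration `t`. When `e + k = E`, `backwardAux … k e` is the
communicated gradient in the activation number `e`. -/
def backwardAux (a : Layers d dw) (cfg : Config d Ξ) (t : ℕ) (S : State E B d dw)
    (s : IterSeed B d Ξ) (b : Fin B) : ℕ → ∀ e : ℕ, Act d e
  | 0, _ => WithLp.toLp 2 fun _ => 1
  | k + 1, e =>
      send (Exact cfg t s b) (cfg.Cb e) ((s.2 b).2.2.2 e) (S.v b e)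
        (ContinuousLinearMap.adjoint (jac1 a e (forward a cfg t S s b e) (block S.w e))
          (backwardAux a cfg t S s b k (e + 1)))

/-- The communicated gradient in the activation number `e`; it is `1` for `e = E`. -/
def backward (a : Layers d dw) (cfg : Config d Ξ) (t : ℕ) (S : State E B d dw)
    (s : IterSeed B d Ξ) (b : Fin B) (e : ℕ) : Act d e :=
  backwardAux a cfg t S s b (E - e) e

/-- The gradient estimate given by the batch entry `b`. -/
def gradEstimate (a : Layers d dw) (cfg : Config d Ξ) (t : ℕ) (S : State E B d dw)
    (s : IterSeed B d Ξ) (b : Fin B) : Weights E dw :=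
  WithLp.toLp 2 fun e : Fin E =>
    ContinuousLinearMap.adjoint (jac2 a e (forward a cfg t S s b e) (block S.w e))
      (backward a cfg t S s b (e + 1))

/-- The momentum after iteration `t`. -/
def newMomentum (a : Layers d dw) (cfg : Config d Ξ) (t : ℕ) (S : State E B d dw)
    (s : IterSeed B d Ξ) : Weights E dw :=
  (1 - cfg.m) • S.u + (cfg.m / B) • ∑ b, gradEstimate a cfg t S s b

/-- Iteration `t`. -/
def step (a : Layers d dw) (cfg : Config d Ξ) (t : ℕ) (S : State E B d dw)
    (s : IterSeed B d Ξ) : State E B d dw where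
  w := S.w - cfg.γ • newMomentum a cfg t S s
  u := newMomentum a cfg t S s
  x := newSample cfg t S s
  y := forward a cfg t S s
  v := backward a cfg t S s

/-- The state after `t` iterations. -/
def run (a : Layers d dw) (cfg : Config d Ξ) (w₁ : Weights E dw) (seeds : ℕ → IterSeed B d Ξ) :
    ℕ → State E B d dw
  | 0 => State.init B d w₁
  | t + 1 => step a cfg (t + 1) (run a cfg w₁ seeds t) (seeds (t + 1))

/-- The parameters `w^{(t)}` used in iteration `t ≥ 1`, so that `w^{(1)}` is `w₁`. -/
def iterate (a : Layers d dw) (cfg : Config d Ξ) (w₁ : Weights E dw)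
    (seeds : ℕ → IterSeed B d Ξ) (t : ℕ) : Weights E dw :=
  (run a cfg w₁ seeds (t - 1)).w

end Algorithm

/-- `(1/T) ∑_{t=1}^T 𝔼 ‖∇ℓ(w^{(t)})‖²` is at most `R` (with all the expectations finite). -/
def AvgGradSqLE {E : ℕ} {d dw : ℕ → ℕ} {Ξ : Type*} [MeasurableSpace Ξ] (a : Layers d dw)
    (D : Measure (Act d 0)) [IsProbabilityMeasure D] (ν : Measure Ξ) [IsProbabilityMeasure ν]
    (cfg : Config d Ξ) (w₁ : Weights E dw) (B T : ℕ) (R : ℝ) : Prop :=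
  (∀ t ∈ Finset.Icc 1 T, Integrable
    (fun s : ℕ → IterSeed B d Ξ => ‖gradient (risk a D) (iterate a cfg w₁ s t)‖ ^ 2)
    (runLaw B D ν)) ∧
  (1 / (T : ℝ)) * ∑ t ∈ Finset.Icc 1 T,
    ∫ s : ℕ → IterSeed B d Ξ, ‖gradient (risk a D) (iterate a cfg w₁ s t)‖ ^ 2 ∂(runLaw B D ν)
    ≤ R

/-! ### The assumptions -/

/-- Smoothness of the objective and of the layers. -/
structure Smooth {d dw : ℕ → ℕ} (E : ℕ) (a : Layers d dw) (D : Measure (Act d 0))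
    (Lℓ Ca Lg La : ℝ) : Prop where
  integrable_loss : ∀ w : Weights E dw, Integrable (fun x => loss a x w) D
  differentiable_risk : Differentiable ℝ (risk (E := E) a D)
  lipschitz_grad : ∀ w w' : Weights E dw,
    ‖gradient (risk a D) w - gradient (risk a D) w'‖ ≤ Lℓ * ‖w - w'‖
  differentiable_layer : ∀ e < E,
    Differentiable ℝ (fun q : Act d e × EuclideanSpace ℝ (Fin (dw e)) => a e q.1 q.2)
  jac1_le : ∀ e < E, ∀ y v, ‖jac1 a e y v‖ ≤ Ca
  jac2_le : ∀ e < E, ∀ y v, ‖jac2 a e y v‖ ≤ Ca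
  /-- the layers that send activations are Lipschitz in both variables -/
  lipschitz_layer : ∀ e, e + 1 < E → ∀ y y' v v',
    ‖a e y v - a e y' v'‖ ^ 2 ≤ La ^ 2 * (‖y - y'‖ ^ 2 + ‖v - v'‖ ^ 2)
  /-- the layers that receive activations have Lipschitz Jacobians in both variables -/
  lipschitz_jac1 : ∀ e, 1 ≤ e → e < E → ∀ y y' v v',
    ‖jac1 a e y v - jac1 a e y' v'‖ ^ 2 ≤ Lg ^ 2 * (‖y - y'‖ ^ 2 + ‖v - v'‖ ^ 2)
  lipschitz_jac2 : ∀ e, 1 ≤ e → e < E → ∀ y y' v v',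
    ‖jac2 a e y v - jac2 a e y' v'‖ ^ 2 ≤ Lg ^ 2 * (‖y - y'‖ ^ 2 + ‖v - v'‖ ^ 2)
  /-- the parameter Jacobian of the first layer is Lipschitz in the parameters -/
  lipschitz_first : ∀ (x : Act d 0) v v',
    ‖jac2 a 0 x v - jac2 a 0 x v'‖ ^ 2 ≤ Lg ^ 2 * ‖v - v'‖ ^ 2

/-- `∇L(x; w)` is an unbiased estimate of `∇ℓ(w)` with variance at most `σ²`. -/
structure StochasticGradient {d dw : ℕ → ℕ} (E : ℕ) (a : Layers d dw) (D : Measure (Act d 0))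
    (σ : ℝ) : Prop where
  integrable : ∀ w : Weights E dw, Integrable (fun x => gradient (fun w' => loss a x w') w) D
  unbiased : ∀ w : Weights E dw,
    ∫ x, gradient (fun w' => loss a x w') w ∂D = gradient (risk a D) w
  variance_le : ∀ w : Weights E dw,
    ∫⁻ x, ‖gradient (fun w' => loss a x w') w - gradient (risk a D) w‖ₑ ^ 2 ∂D
      ≤ ENNReal.ofReal (σ ^ 2)

/-- `C` is a (randomized) contractive compressor with constant `ω`. -/
structure IsCompressor {V Ξ : Type*} [NormedAddCommGroup V] [MeasurableSpace V]
    [MeasurableSpace Ξ] (ν : Measure Ξ) (C : V → Ξ → V) (ω : ℝ) : Prop where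
  measurable : Measurable (Function.uncurry C)
  contractive : ∀ z : V, ∫⁻ ξ, ‖z - C z ξ‖ₑ ^ 2 ∂ν ≤ ENNReal.ofReal (ω ^ 2 * ‖z‖ ^ 2)

/-- The compressors of the activations number `1, …, E - 1` and of the corresponding activation
gradients are contractive, with constants `ωF` and `ωB`. -/
structure Contractive {d : ℕ → ℕ} {Ξ : Type*} [MeasurableSpace Ξ] (E : ℕ) (ν : Measure Ξ)
    (Cf Cb : ∀ e : ℕ, Act d e → Ξ → Act d e) (ωF ωB : ℝ) : Prop where
  ωF_mem : ωF ∈ Set.Ico (0 : ℝ) 1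
  ωB_mem : ωB ∈ Set.Ico (0 : ℝ) 1
  forward : ∀ e, 1 ≤ e → e < E → IsCompressor ν (Cf e) ωF
  backward : ∀ e, 1 ≤ e → e < E → IsCompressor ν (Cb e) ωB

/-- Two independent samples are at mean square distance at most `φ`. -/
def SampleSpread {d : ℕ → ℕ} (D : Measure (Act d 0)) (φ : ℝ) : Prop :=
  ∫⁻ x₁, ∫⁻ x₂, ‖x₁ - x₂‖ₑ ^ 2 ∂D ∂D ≤ ENNReal.ofReal (φ ^ 2)

/-! ### The rates -/

def rateFU (E B T : ℕ) (σ ωF ωB : ℝ) : ℝ :=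
  σ / √((B : ℝ) * T) + 1 / (T * (1 - ωB) ^ (E - 1) * (1 - ωF) ^ (E - 1))

/-- The exponent `2(E - 2) - 1` is an integer, equal to `-1` for `E = 2`. -/
def deltaFC (E : ℕ) (ωF ωB : ℝ) : ℝ :=
  1 / ((1 - ωB) ^ (E - 1) * (1 - ωF) ^ (E - 1))
    + (ωF ^ 2 + ωB) / ((1 - ωB) ^ (2 * (E - 1)) * (1 - ωF) ^ 2)
    + 1 / (1 - ωF) ^ (2 * ((E : ℤ) - 2) - 1)

def rateFC (E B T : ℕ) (σ ωF ωB : ℝ) : ℝ :=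
  σ ^ (4 / 3 : ℝ)
      / (((B : ℝ) * T) ^ (1 / 3 : ℝ) * (1 - ωB) ^ (4 * ((E : ℝ) - 1) / 3)
          * (1 - ωF) ^ (4 * ((E : ℝ) - 1) / 3))
    + deltaFC E ωF ωB / T

end Clapping

end

/-! The momentum `u` is compared with the gradient at the current parameters. The descent inequality
gives `∑ ‖∇ℓ‖² + ½ ∑ ‖u‖² ≤ 2Δ/γ + ∑ ‖u - ∇ℓ‖²` along every run (`sum_norm_gradient_sq_le`). The
spare `½ ∑ ‖u‖²` closes the argument: a parameter move has length `γ‖u‖`, so each error estimate may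
contain a controlled multiple of the squared moves, which is absorbed at the end
(`avgGradSqLE_of_noise`). The error `u - ∇ℓ` is the sum of `driftError` (start at zero, motion of
the parameters, compression) and of `momentumNoise` (sampling).

Compression. A link sends the difference between its target and what the receiver already holds. In
mean square its new error is therefore at most `ω` times the previous error plus the change of the
target, that is, a geometric filter of ratio `ω`. Such a filter has norm `1/(1-ω)` on both `ℓ¹` and
`ℓ²`. `Dom` splits each error into an `ℓ¹` part from the start-up and an `ℓ²` part from the motion
of samples and parameters, and both survive the passage through all links. The total cost is `1/κ`,
where `κ` is `pipeRate` (`exists_gradBound`). In the variant FU the start-up and sample terms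
vanish; in FC the samples contribute mean square moves of order `p` per iteration.

Noise when `m ≤ p/2`. Lazy batches stay correlated for about `1/p` iterations. Adding a suitable
multiple of the current noise to the momentum noise gives a process that contracts by `1-m` in
conditional mean, so the momentum reduces the variance to order `(m/p) σ²/B`
(`sum_momentumNoise_le`). For FU, with `p` fixed, it remains to balance `1/m` against `m T σ²/B`.
For FC, taking `p` of order `κr`, and `m` and `γ` of order `κ/(rT)`, makes the other terms of order
`r/κ` and the noise of order `σ²/(r²BT)`, whence `r = (BT)^(-1/3)`. The condition `m ≤ p/2` then
holds if `B² ≤ T`.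

Noise when `T ≤ B²`. The momentum is not used for averaging here; the average over the batch must
itself be small, at parameters which depend on that batch. The parameters of `l` iterations ago are
independent of the entries drawn since then, and the effect of the shift `h` of the parameters is
bounded by `r + lam ‖h‖²` for all `h` at once, up to a small tail. At a fixed `h`, Hoeffding's lemma
bounds high moments; Lipschitz continuity lets an integral over a ball replace the supremum over `h`
(`norm_sq_le_ballMoment`). This is where the dimension enters. The term `lam ‖h‖²` is again a sum of
squared moves to be absorbed.

The Jacobian bounds already bound the noise, so in FC the variance is replaced by a structural
constant; the lower bound `σ₀` only serves to compare with `σ^(4/3)`. For `σ = 0` the noise vanishes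
almost surely. -/

noncomputable section

namespace Clapping

/-! ### Resampling one part of a product measure -/

section Resampling

variable {α β ι Ξ : Type*} [MeasurableSpace α] [MeasurableSpace β] [MeasurableSpace Ξ]

theorem MeasurePreserving.of_comp {γ : Type*} [MeasurableSpace γ] {μ : Measure α} {ν : Measure β}
    {τ : Measure γ} {f : α → β} {g : β → γ} (hgf : MeasurePreserving (g ∘ f) μ τ)
    (hf : MeasurePreserving f μ ν) (hg : Measurable g) : MeasurePreserving g ν τ :=
  ⟨hg, by rw [← hf.map_eq, Measure.map_map hg hf.measurable, hgf.map_eq]⟩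

/-- Replacing the coordinates outside `A` by those of an independent copy preserves a product
measure. -/
theorem measurePreserving_piecewise {X : ι → Type*} [∀ i, MeasurableSpace (X i)]
    (μ : ∀ i, Measure (X i)) [∀ i, IsProbabilityMeasure (μ i)] (A : Set ι)
    [DecidablePred (· ∈ A)] :
    MeasurePreserving (fun p : (∀ i, X i) × (∀ i, X i) => A.piecewise p.1 p.2)
      ((Measure.infinitePi μ).prod (Measure.infinitePi μ)) (Measure.infinitePi μ) := by
  have hm : Measurable (fun p : (∀ i, X i) × (∀ i, X i) => A.piecewise p.1 p.2) := by
    refine measurable_pi_iff.2 fun i => ?_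
    by_cases hi : i ∈ A
    · simp only [Set.piecewise, hi, if_true]; fun_prop
    · simp only [Set.piecewise, hi, if_false]; fun_prop
  refine ⟨hm, Measure.eq_infinitePi _ fun s t ht => ?_⟩
  rw [Measure.map_apply hm (.pi s.countable_toSet fun _ _ ↦ ht _)]
  have : (fun p : (∀ i, X i) × (∀ i, X i) => A.piecewise p.1 p.2) ⁻¹' ((s : Set ι).pi t) =
      ((s.filter (· ∈ A) : Finset ι) : Set ι).pi t ×ˢ
        ((s.filter (· ∉ A) : Finset ι) : Set ι).pi t := by
    ext p
    simp only [Set.mem_preimage, Set.mem_pi, Set.mem_prod, Finset.coe_filter, Set.mem_ofPred_eq,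
      Finset.mem_coe, Set.piecewise]
    constructor
    · refine fun h => ⟨fun i hi => ?_, fun i hi => ?_⟩
      · simpa [hi.2] using h i hi.1
      · simpa [hi.2] using h i hi.1
    · intro h i hi
      by_cases hA : i ∈ A
      · simpa [hA] using h.1 i ⟨hi, hA⟩
      · simpa [hA] using h.2 i ⟨hi, hA⟩
  rw [this, Measure.prod_prod, Measure.infinitePi_pi _ fun i _ => ht i,
    Measure.infinitePi_pi _ fun i _ => ht i, Finset.prod_filter_mul_prod_filter_not]

/-- Follows from the splice with a full independent copy, by forgetting all coordinates of the copy
but one. -/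
theorem measurePreserving_update [DecidableEq ι] {X : ι → Type*} [∀ i, MeasurableSpace (X i)]
    (μ : ∀ i, Measure (X i)) [∀ i, IsProbabilityMeasure (μ i)] (i : ι) :
    MeasurePreserving (fun p : (∀ i, X i) × X i => Function.update p.1 i p.2)
      ((Measure.infinitePi μ).prod (μ i)) (Measure.infinitePi μ) := by
  classical
  have h1 := measurePreserving_piecewise μ ({i}ᶜ : Set ι)
  have h2 : MeasurePreserving (Prod.map id (Function.eval i))
      ((Measure.infinitePi μ).prod (Measure.infinitePi μ)) ((Measure.infinitePi μ).prod (μ i)) :=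
    (MeasurePreserving.id _).prod (measurePreserving_eval_infinitePi μ i)
  have hm : Measurable (fun p : (∀ i, X i) × X i => Function.update p.1 i p.2) := by
    refine measurable_pi_iff.2 fun j => ?_
    by_cases hj : j = i
    · subst hj; simpa using measurable_snd
    · simp only [Function.update_of_ne hj]; fun_prop
  refine MeasurePreserving.of_comp ?_ h2 hm
  convert h1 using 1
  funext p
  ext j
  by_cases hj : j = i
  · subst hj; simp [Set.piecewise]
  · simp [Set.piecewise, hj]

/-- Resampling inside one coordinate of a product. -/
theorem MeasurePreserving.update_resample [DecidableEq ι] {X : ι → Type*}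
    [∀ i, MeasurableSpace (X i)] (μ : ∀ i, Measure (X i)) [∀ i, IsProbabilityMeasure (μ i)]
    {ν : Measure Ξ} [IsProbabilityMeasure ν] (i : ι) {R : X i × Ξ → X i}
    (hR : MeasurePreserving R ((μ i).prod ν) (μ i)) :
    MeasurePreserving (fun p : (∀ i, X i) × Ξ => Function.update p.1 i (R (p.1 i, p.2)))
      ((Measure.infinitePi μ).prod ν) (Measure.infinitePi μ) := by
  have hu := measurePreserving_update μ i
  have hm : Measurable
      (fun p : (∀ i, X i) × Ξ => Function.update p.1 i (R (p.1 i, p.2))) := by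
    have := hR.measurable
    exact hu.measurable.comp (f := fun p : (∀ i, X i) × Ξ => (p.1, R (p.1 i, p.2))) (by fun_prop)
  have h1 : MeasurePreserving (Prod.map (fun p : (∀ i, X i) × X i => Function.update p.1 i p.2)
      (id : Ξ → Ξ)) (((Measure.infinitePi μ).prod (μ i)).prod ν) ((Measure.infinitePi μ).prod ν) :=
    hu.prod (MeasurePreserving.id _)
  refine MeasurePreserving.of_comp ?_ h1 hm
  have h2 : MeasurePreserving (Prod.map id R)
      ((Measure.infinitePi μ).prod ((μ i).prod ν)) ((Measure.infinitePi μ).prod (μ i)) :=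
    (MeasurePreserving.id _).prod hR
  convert (hu.comp h2).comp
    (measurePreserving_prodAssoc (Measure.infinitePi μ) (μ i) ν) using 1
  funext p
  simp [MeasurableEquiv.prodAssoc]

theorem MeasurePreserving.update_resample_pi [Fintype ι] [DecidableEq ι] {X : ι → Type*}
    [∀ i, MeasurableSpace (X i)] (μ : ∀ i, Measure (X i)) [∀ i, IsProbabilityMeasure (μ i)]
    {ν : Measure Ξ} [IsProbabilityMeasure ν] (i : ι) {R : X i × Ξ → X i}
    (hR : MeasurePreserving R ((μ i).prod ν) (μ i)) :
    MeasurePreserving (fun p : (∀ i, X i) × Ξ => Function.update p.1 i (R (p.1 i, p.2)))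
      ((Measure.pi μ).prod ν) (Measure.pi μ) := by
  simpa only [Measure.infinitePi_eq_pi] using MeasurePreserving.update_resample μ i hR

/-- This lift, with `fst_resample` and `update_resample_pi`, carries a resampling of one compressor
seed through the nested products that make up the seed of an iteration. -/
theorem MeasurePreserving.snd_resample (μ : Measure α) (μ' : Measure β) [IsProbabilityMeasure μ]
    [IsProbabilityMeasure μ'] {ν : Measure Ξ} [IsProbabilityMeasure ν] {R : β × Ξ → β}
    (hR : MeasurePreserving R (μ'.prod ν) μ') :
    MeasurePreserving (fun p : (α × β) × Ξ => (p.1.1, R (p.1.2, p.2)))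
      ((μ.prod μ').prod ν) (μ.prod μ') :=
  ((MeasurePreserving.id μ).prod hR).comp (measurePreserving_prodAssoc μ μ' ν)

theorem MeasurePreserving.fst_resample (μ : Measure α) (μ' : Measure β) [IsProbabilityMeasure μ]
    [IsProbabilityMeasure μ'] {ν : Measure Ξ} [IsProbabilityMeasure ν] {R : α × Ξ → α}
    (hR : MeasurePreserving R (μ.prod ν) μ) :
    MeasurePreserving (fun p : (α × β) × Ξ => (R (p.1.1, p.2), p.1.2))
      ((μ.prod μ').prod ν) (μ.prod μ') := by
  have h1 := MeasurePreserving.snd_resample μ' μ hR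
  have h2 : MeasurePreserving (Prod.map Prod.swap id) ((μ.prod μ').prod ν) ((μ'.prod μ).prod ν) :=
    Measure.measurePreserving_swap.prod (MeasurePreserving.id _)
  exact (Measure.measurePreserving_swap.comp (h1.comp h2))

/-- The compression error in mean square: the compressor's seed `ξ` can be resampled without
changing the message `z`. -/
theorem IsCompressor.lintegral_le {V : Type*} [NormedAddCommGroup V] [MeasurableSpace V]
    [BorelSpace V] [SecondCountableTopology V] {ν : Measure Ξ} [IsProbabilityMeasure ν]
    {C : V → Ξ → V} {ω : ℝ} (hC : IsCompressor ν C ω) {μ : Measure α} [IsProbabilityMeasure μ]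
    {R : α × Ξ → α} (hR : MeasurePreserving R (μ.prod ν) μ) {ξ : α → Ξ} (hξ : Measurable ξ)
    (hξR : ∀ a x, ξ (R (a, x)) = x) {z : α → V} (hz : Measurable z)
    (hzR : ∀ a x, z (R (a, x)) = z a) :
    ∫⁻ a, ‖z a - C (z a) (ξ a)‖ₑ ^ 2 ∂μ ≤ ENNReal.ofReal (ω ^ 2) * ∫⁻ a, ‖z a‖ₑ ^ 2 ∂μ := by
  have hCm := hC.measurable
  have hm : Measurable fun a => ‖z a - C (z a) (ξ a)‖ₑ ^ 2 := by
    have : Measurable fun a => C (z a) (ξ a) := hCm.comp (hz.prodMk hξ)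
    fun_prop
  have hm2 : Measurable fun p : α × Ξ => ‖z p.1 - C (z p.1) p.2‖ₑ ^ 2 := by
    have : Measurable fun p : α × Ξ => C (z p.1) p.2 :=
      hCm.comp ((hz.comp measurable_fst).prodMk measurable_snd)
    fun_prop
  -- After resampling, the message is still `z a` while the seed is an independent variable, so
  -- Fubini reduces the claim to contraction at a fixed message.
  rw [← hR.lintegral_comp hm]
  simp only [fun p : α × Ξ => hξR p.1 p.2, fun p : α × Ξ => hzR p.1 p.2]
  rw [lintegral_prod _ hm2.aemeasurable, ← lintegral_const_mul _ (by fun_prop)]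
  refine lintegral_mono fun a => (hC.contractive (z a)).trans (le_of_eq ?_)
  rw [ENNReal.ofReal_mul (sq_nonneg _), ENNReal.ofReal_pow (norm_nonneg _), ofReal_norm]

end Resampling

/-! ### Exact back-propagation -/

section Backprop

variable {E : ℕ} {d dw : ℕ → ℕ}

theorem norm_block_sub_le (w w' : Weights E dw) (e : ℕ) :
    ‖block w e - block w' e‖ ≤ ‖w - w'‖ := by
  unfold block
  split_ifs with h
  · exact PiLp.norm_apply_le (w - w') ⟨e, h⟩
  · simp

theorem norm_weights_le_sum (w : Weights E dw) : ‖w‖ ≤ ∑ e, ‖w e‖ := by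
  rw [PiLp.norm_eq_of_L2]
  refine Real.sqrt_le_iff.2 ⟨Finset.sum_nonneg fun _ _ => norm_nonneg _, ?_⟩
  exact Finset.sum_sq_le_sq_sum_of_nonneg fun _ _ => norm_nonneg _

/-- Gradients in the activations, at given activations `ys`. When `e + k = E`, `backprop … k e` is
the gradient in the activation number `e`. -/
def backprop (a : Layers d dw) (w : Weights E dw) (ys : ∀ e, Act d e) : ℕ → ∀ e : ℕ, Act d e
  | 0, _ => WithLp.toLp 2 fun _ => 1
  | k + 1, e => ContinuousLinearMap.adjoint (jac1 a e (ys e) (block w e)) (backprop a w ys k (e + 1))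

/-- The gradient in the parameters, at given activations `ys`. -/
def paramGrad (a : Layers d dw) (ys : ∀ e, Act d e) (w : Weights E dw) : Weights E dw :=
  WithLp.toLp 2 fun e : Fin E =>
    ContinuousLinearMap.adjoint (jac2 a e (ys e) (block w e)) (backprop a w ys (E - (e + 1)) (e + 1))

theorem norm_ones {n : ℕ} (hn : n = 1) :
    ‖(WithLp.toLp 2 fun _ => 1 : EuclideanSpace ℝ (Fin n))‖ = 1 := by
  subst hn; simp [EuclideanSpace.norm_eq]

theorem norm_adjoint_apply_le {V W : Type*} [NormedAddCommGroup V] [InnerProductSpace ℝ V]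
    [CompleteSpace V] [NormedAddCommGroup W] [InnerProductSpace ℝ W] [CompleteSpace W]
    {A : V →L[ℝ] W} {c : ℝ} (hA : ‖A‖ ≤ c) (x : W) :
    ‖ContinuousLinearMap.adjoint A x‖ ≤ c * ‖x‖ := by
  refine (ContinuousLinearMap.le_opNorm _ _).trans ?_
  rw [LinearIsometryEquiv.norm_map]
  gcongr

theorem norm_adjoint_sub_le {V W : Type*} [NormedAddCommGroup V] [InnerProductSpace ℝ V]
    [CompleteSpace V] [NormedAddCommGroup W] [InnerProductSpace ℝ W] [CompleteSpace W]
    {A A' : V →L[ℝ] W} {c c' : ℝ} (hA : ‖A‖ ≤ c) (hA' : ‖A - A'‖ ≤ c') (x x' : W) :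
    ‖ContinuousLinearMap.adjoint A x - ContinuousLinearMap.adjoint A' x'‖
      ≤ c * ‖x - x'‖ + c' * ‖x'‖ := by
  have : ContinuousLinearMap.adjoint A x - ContinuousLinearMap.adjoint A' x' =
      ContinuousLinearMap.adjoint A (x - x') + ContinuousLinearMap.adjoint (A - A') x' := by
    simp [map_sub]
  rw [this]
  exact (norm_add_le _ _).trans (add_le_add (norm_adjoint_apply_le hA _)
    (norm_adjoint_apply_le hA' _))

/-- The squared Lipschitz assumptions do not fix the sign of the constant, whence the absolute
value. The sum in place of the Euclidean norm of the pair lets errors be added link by link. -/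
theorem le_abs_mul_add_of_sq_le {x L y z : ℝ} (hy : 0 ≤ y) (hz : 0 ≤ z)
    (h : x ^ 2 ≤ L ^ 2 * (y ^ 2 + z ^ 2)) : x ≤ |L| * (y + z) := by
  refine le_of_sq_le_sq ?_ (by positivity)
  rw [mul_pow, sq_abs]
  exact h.trans (mul_le_mul_of_nonneg_left (by nlinarith [mul_nonneg hy hz]) (sq_nonneg _))
where
  le_of_sq_le_sq {x y : ℝ} (h : x ^ 2 ≤ y ^ 2) (hy : 0 ≤ y) : x ≤ y :=
    le_of_abs_le (abs_of_nonneg hy ▸ sq_le_sq.1 h)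

/-- The distance of two lists of activations and parameters. -/
def actDist (ys ys' : ∀ e, Act d e) (w w' : Weights E dw) : ℝ :=
  ∑ i ∈ Finset.Ico 1 E, ‖ys i - ys' i‖ + ‖w - w'‖

theorem actDist_nonneg (ys ys' : ∀ e, Act d e) (w w' : Weights E dw) : 0 ≤ actDist ys ys' w w' :=
  add_nonneg (Finset.sum_nonneg fun _ _ => norm_nonneg _) (norm_nonneg _)

theorem add_le_actDist (ys ys' : ∀ e, Act d e) (w w' : Weights E dw) {e : ℕ} (h1 : 1 ≤ e)
    (h2 : e < E) : ‖ys e - ys' e‖ + ‖block w e - block w' e‖ ≤ actDist ys ys' w w' :=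
  add_le_add (Finset.single_le_sum (f := fun i => ‖ys i - ys' i‖) (fun _ _ => norm_nonneg _)
    (Finset.mem_Ico.2 ⟨h1, h2⟩)) (norm_block_sub_le w w' e)

variable {a : Layers d dw} {D : Measure (Act d 0)} {Lℓ Ca Lg La : ℝ}

namespace Smooth

variable (hS : Smooth E a D Lℓ Ca Lg La)
include hS

theorem Ca_nonneg (hE : 0 < E) : 0 ≤ Ca :=
  (norm_nonneg _).trans (hS.jac1_le 0 hE 0 0)

/-- The base `1 + Ca` rather than `Ca` makes the bound increase with the number of layers, so that
one power serves for all of them. -/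
theorem norm_backprop_le (hdE : d E = 1) (hE : 0 < E) (w : Weights E dw) (ys : ∀ e, Act d e)
    (k e : ℕ) (h : e + k = E) : ‖backprop a w ys k e‖ ≤ (1 + Ca) ^ k := by
  have hCa := hS.Ca_nonneg hE
  induction k generalizing e with
  | zero =>
    obtain rfl : e = E := by omega
    simp [backprop, norm_ones hdE]
  | succ k ih =>
    rw [backprop]
    refine (norm_adjoint_apply_le (hS.jac1_le e (by omega) _ _) _).trans ?_
    rw [pow_succ']
    exact mul_le_mul (by linarith) (ih (e + 1) (by omega)) (norm_nonneg _) (by linarith)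

theorem norm_backprop_le' (hdE : d E = 1) (hE : 0 < E) (w : Weights E dw) (ys : ∀ e, Act d e)
    (k e : ℕ) (h : e + k = E) : ‖backprop a w ys k e‖ ≤ (1 + Ca) ^ E :=
  (hS.norm_backprop_le hdE hE w ys k e h).trans
    (pow_le_pow_right₀ (by linarith [hS.Ca_nonneg hE]) (by omega))

theorem norm_jac1_sub_le {e : ℕ} (h1 : 1 ≤ e) (h2 : e < E) (ys ys' : ∀ e, Act d e)
    (w w' : Weights E dw) :
    ‖jac1 a e (ys e) (block w e) - jac1 a e (ys' e) (block w' e)‖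
      ≤ |Lg| * actDist ys ys' w w' :=
  (le_abs_mul_add_of_sq_le (norm_nonneg _) (norm_nonneg _)
    (hS.lipschitz_jac1 e h1 h2 _ _ _ _)).trans
    (mul_le_mul_of_nonneg_left (add_le_actDist ys ys' w w' h1 h2) (abs_nonneg _))

/-- The first layer has a Jacobian that is Lipschitz in the parameters only, so the two samples must
agree. This is why `actDist` leaves out activation `0`. -/
theorem norm_jac2_sub_le {e : ℕ} (h2 : e < E) (ys ys' : ∀ e, Act d e) (h0 : ys 0 = ys' 0)
    (w w' : Weights E dw) :
    ‖jac2 a e (ys e) (block w e) - jac2 a e (ys' e) (block w' e)‖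
      ≤ |Lg| * actDist ys ys' w w' := by
  rcases Nat.eq_zero_or_pos e with rfl | h1
  · have h := hS.lipschitz_first (ys 0) (block w 0) (block w' 0)
    rw [← h0]
    refine (le_abs_mul_add_of_sq_le le_rfl (norm_nonneg _)
      (by simpa using h)).trans (mul_le_mul_of_nonneg_left ?_ (abs_nonneg _))
    exact add_le_add (Finset.sum_nonneg fun _ _ => norm_nonneg _) (norm_block_sub_le w w' 0)
  · exact (le_abs_mul_add_of_sq_le (norm_nonneg _) (norm_nonneg _)
      (hS.lipschitz_jac2 e h1 h2 _ _ _ _)).trans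
      (mul_le_mul_of_nonneg_left (add_le_actDist ys ys' w w' h1 h2) (abs_nonneg _))

/-- Product rule: each layer adds the change of one Jacobian times a bounded gradient, and
transports the earlier changes with a factor `Ca`. This makes `k` terms. Starting from `1 ≤ e`
avoids the Jacobian in the sample. -/
theorem norm_backprop_sub_le (hdE : d E = 1) (w w' : Weights E dw) (ys ys' : ∀ e, Act d e)
    (k e : ℕ) (h1 : 1 ≤ e) (h : e + k = E) :
    ‖backprop a w ys k e - backprop a w' ys' k e‖
      ≤ k * (1 + Ca) ^ k * |Lg| * actDist ys ys' w w' := by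
  have hCa := hS.Ca_nonneg (by omega)
  have hD := actDist_nonneg ys ys' w w'
  induction k generalizing e with
  | zero => simp [backprop]
  | succ k ih =>
    rw [backprop, backprop]
    refine (norm_adjoint_sub_le (hS.jac1_le e (by omega) _ _)
      (hS.norm_jac1_sub_le h1 (by omega) ys ys' w w') _ _).trans ?_
    have h2 := ih (e + 1) (by omega) (by omega)
    have h3 := hS.norm_backprop_le hdE (by omega) w' ys' k (e + 1) (by omega)
    have hp : 0 ≤ (1 + Ca) ^ k := by positivity
    have hX : 0 ≤ |Lg| * actDist ys ys' w w' := by positivity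
    have hk : (0 : ℝ) ≤ k := by positivity
    calc Ca * ‖backprop a w ys k (e + 1) - backprop a w' ys' k (e + 1)‖
          + |Lg| * actDist ys ys' w w' * ‖backprop a w' ys' k (e + 1)‖
        ≤ Ca * (k * (1 + Ca) ^ k * |Lg| * actDist ys ys' w w')
          + |Lg| * actDist ys ys' w w' * (1 + Ca) ^ k := by gcongr
      _ ≤ (1 + Ca) * (k * (1 + Ca) ^ k * |Lg| * actDist ys ys' w w')
          + (1 + Ca) * (|Lg| * actDist ys ys' w w' * (1 + Ca) ^ k) := by
          have h4 : 0 ≤ k * (1 + Ca) ^ k * |Lg| * actDist ys ys' w w' := by positivity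
          have h5 : 0 ≤ |Lg| * actDist ys ys' w w' * (1 + Ca) ^ k := by positivity
          nlinarith [mul_nonneg hCa h5]
      _ = _ := by push_cast; ring

theorem norm_backprop_sub_le' (hdE : d E = 1) (w w' : Weights E dw) (ys ys' : ∀ e, Act d e)
    (k e : ℕ) (h1 : 1 ≤ e) (h : e + k = E) :
    ‖backprop a w ys k e - backprop a w' ys' k e‖
      ≤ E * (1 + Ca) ^ E * |Lg| * actDist ys ys' w w' := by
  have hCa := hS.Ca_nonneg (by omega)
  have hD := actDist_nonneg ys ys' w w'
  refine (hS.norm_backprop_sub_le hdE w w' ys ys' k e h1 h).trans ?_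
  have : (k : ℝ) ≤ E := by exact_mod_cast (by omega : k ≤ E)
  have : (1 + Ca) ^ k ≤ (1 + Ca) ^ E := pow_le_pow_right₀ (by linarith) (by omega)
  gcongr

theorem norm_paramGrad_le (hdE : d E = 1) (ys : ∀ e, Act d e) (w : Weights E dw) :
    ‖paramGrad a ys w‖ ≤ E * (1 + Ca) ^ (E + 1) := by
  refine (norm_weights_le_sum _).trans ?_
  calc ∑ e : Fin E, ‖paramGrad a ys w e‖ ≤ ∑ _e : Fin E, (1 + Ca) ^ (E + 1) := by
        refine Finset.sum_le_sum fun e _ => ?_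
        have hE : 0 < E := e.pos
        have hCa := hS.Ca_nonneg hE
        refine (norm_adjoint_apply_le (hS.jac2_le e e.2 _ _) _).trans ?_
        rw [pow_succ']
        exact mul_le_mul (by linarith) (hS.norm_backprop_le' hdE hE _ _ _ _ (by omega))
          (norm_nonneg _) (by linarith)
    _ = _ := by simp

theorem norm_paramGrad_sub_le (hdE : d E = 1) (ys ys' : ∀ e, Act d e) (h0 : ys 0 = ys' 0)
    (w w' : Weights E dw) :
    ‖paramGrad a ys w - paramGrad a ys' w'‖
      ≤ E * ((E + 1) * (1 + Ca) ^ (E + 1) * |Lg|) * actDist ys ys' w w' := by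
  refine (norm_weights_le_sum _).trans ?_
  have hD := actDist_nonneg ys ys' w w'
  calc ∑ e : Fin E, ‖(paramGrad a ys w - paramGrad a ys' w') e‖
      ≤ ∑ _e : Fin E, (E + 1) * (1 + Ca) ^ (E + 1) * |Lg| * actDist ys ys' w w' := by
        refine Finset.sum_le_sum fun e _ => ?_
        have hE : 0 < E := e.pos
        have hCa := hS.Ca_nonneg hE
        have h1 := hS.norm_backprop_sub_le' hdE w w' ys ys' (E - (e + 1)) (e + 1) (by omega)
          (by omega)
        have h2 := hS.norm_backprop_le' hdE hE w' ys' (E - (e + 1)) (e + 1) (by omega)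
        refine (norm_adjoint_sub_le (hS.jac2_le e e.2 _ _)
          (hS.norm_jac2_sub_le e.2 ys ys' h0 w w') _ _).trans ?_
        have hA : 0 ≤ (1 + Ca) ^ E := by positivity
        have hX : 0 ≤ |Lg| * actDist ys ys' w w' := by positivity
        calc _ ≤ Ca * (E * (1 + Ca) ^ E * |Lg| * actDist ys ys' w w')
              + |Lg| * actDist ys ys' w w' * (1 + Ca) ^ E := by gcongr
          _ ≤ (1 + Ca) * (E * (1 + Ca) ^ E * |Lg| * actDist ys ys' w w')
              + (1 + Ca) * (|Lg| * actDist ys ys' w w' * (1 + Ca) ^ E) := by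
              have h4 : 0 ≤ E * (1 + Ca) ^ E * |Lg| * actDist ys ys' w w' := by positivity
              have h5 : 0 ≤ |Lg| * actDist ys ys' w w' * (1 + Ca) ^ E := by positivity
              nlinarith [mul_nonneg hCa h5]
          _ = _ := by ring
    _ = _ := by simp; ring

theorem norm_layer_sub_le {e : ℕ} (h : e + 1 < E) (y y' : Act d e) (w w' : Weights E dw) :
    ‖a e y (block w e) - a e y' (block w' e)‖ ≤ |La| * (‖y - y'‖ + ‖w - w'‖) :=
  (le_abs_mul_add_of_sq_le (norm_nonneg _) (norm_nonneg _) (hS.lipschitz_layer e h _ _ _ _)).trans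
    (mul_le_mul_of_nonneg_left (add_le_add le_rfl (norm_block_sub_le w w' e)) (abs_nonneg _))

theorem norm_act_sub_le (x : Act d 0) (w w' : Weights E dw) (e : ℕ) (he : e < E) :
    ‖act a x w e - act a x w' e‖ ≤ e * (1 + |La|) ^ e * ‖w - w'‖ := by
  induction e with
  | zero => simp [act]
  | succ e ih =>
    rw [act, act]
    refine (hS.norm_layer_sub_le he _ _ w w').trans ?_
    have h1 := ih (by omega)
    have hL := abs_nonneg La
    have hw := norm_nonneg (w - w')
    have h2 : (1 : ℝ) ≤ (1 + |La|) ^ e := one_le_pow₀ (by linarith)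
    calc |La| * (‖act a x w e - act a x w' e‖ + ‖w - w'‖)
        ≤ (1 + |La|) * (e * (1 + |La|) ^ e * ‖w - w'‖ + (1 + |La|) ^ e * ‖w - w'‖) := by
          gcongr
          · linarith
          · nlinarith
      _ = _ := by push_cast; ring

theorem actDist_act_le (x : Act d 0) (w w' : Weights E dw) :
    actDist (fun e => act a x w e) (fun e => act a x w' e) w w'
      ≤ (E * (E * (1 + |La|) ^ E) + 1) * ‖w - w'‖ := by
  unfold actDist
  rw [add_mul, one_mul]
  gcongr
  calc ∑ i ∈ Finset.Ico 1 E, ‖act a x w i - act a x w' i‖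
      ≤ ∑ _i ∈ Finset.Ico 1 E, E * (1 + |La|) ^ E * ‖w - w'‖ := by
        refine Finset.sum_le_sum fun i hi => ?_
        rw [Finset.mem_Ico] at hi
        refine (hS.norm_act_sub_le x w w' i hi.2).trans ?_
        have : (i : ℝ) ≤ E := by exact_mod_cast hi.2.le
        have : (1 + |La|) ^ i ≤ (1 + |La|) ^ E :=
          pow_le_pow_right₀ (by linarith [abs_nonneg La]) hi.2.le
        gcongr
    _ ≤ _ := by
        rw [Finset.sum_const, nsmul_eq_mul, Nat.card_Ico, ← mul_assoc]
        have : ((E - 1 : ℕ) : ℝ) ≤ E := by exact_mod_cast Nat.sub_le E 1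
        gcongr

/-- Approximate activations whose one-layer errors are small are close to the exact ones. -/
theorem norm_sub_act_le (ys : ∀ e, Act d e) (w : Weights E dw) (e : ℕ) (he : e < E) :
    ‖ys e - act a (ys 0) w e‖ ≤
      (1 + |La|) ^ e * ∑ i ∈ Finset.range e, ‖ys (i + 1) - a i (ys i) (block w i)‖ := by
  induction e with
  | zero => simp [act]
  | succ e ih =>
    rw [act, Finset.sum_range_succ]
    have h1 := ih (by omega)
    have hL := abs_nonneg La
    have h2 := hS.norm_layer_sub_le he (ys e) (act a (ys 0) w e) w w
    rw [sub_self, norm_zero, add_zero] at h2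
    have h3 : (1 : ℝ) ≤ (1 + |La|) ^ (e + 1) := one_le_pow₀ (by linarith)
    have h4 := norm_sub_le_norm_sub_add_norm_sub (ys (e + 1)) (a e (ys e) (block w e))
      (a e (act a (ys 0) w e) (block w e))
    refine h4.trans ?_
    rw [mul_add, add_comm]
    refine add_le_add (h2.trans ?_) (le_mul_of_one_le_left (norm_nonneg _) h3)
    rw [pow_succ', mul_assoc]
    exact mul_le_mul (by linarith) h1 (norm_nonneg _) (by linarith)

end Smooth

/-- Coordinate projection to a parameter block. -/
def blockL (E : ℕ) (dw : ℕ → ℕ) (e : ℕ) : Weights E dw →L[ℝ] EuclideanSpace ℝ (Fin (dw e)) :=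
  if h : e < E then PiLp.proj 2 (fun e : Fin E => EuclideanSpace ℝ (Fin (dw e))) ⟨e, h⟩ else 0

theorem blockL_apply (w : Weights E dw) (e : ℕ) : blockL E dw e w = block w e := by
  unfold blockL block
  split_ifs <;> simp

/-- The derivative of the exact activations in the parameters. -/
def actDeriv (a : Layers d dw) (x : Act d 0) (w : Weights E dw) :
    ∀ e, Weights E dw →L[ℝ] Act d e
  | 0 => 0
  | e + 1 => (jac1 a e (act a x w e) (block w e)).comp (actDeriv a x w e)
      + (jac2 a e (act a x w e) (block w e)).comp (blockL E dw e)

theorem Smooth.hasFDerivAt_act (hS : Smooth E a D Lℓ Ca Lg La) (x : Act d 0) (w : Weights E dw)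
    (e : ℕ) (he : e ≤ E) : HasFDerivAt (fun w => act a x w e) (actDeriv a x w e) w := by
  induction e with
  | zero => exact hasFDerivAt_const x w
  | succ e ih =>
    have h1 := ih (by omega)
    have h2 : HasFDerivAt (fun w : Weights E dw => block w e) (blockL E dw e) w := by
      have : (fun w : Weights E dw => block w e) = blockL E dw e :=
        funext fun w => (blockL_apply w e).symm
      rw [this]; exact (blockL E dw e).hasFDerivAt
    have h3 := (hS.differentiable_layer e (by omega) (act a x w e, block w e)).hasFDerivAt
    have h4 := h3.comp w (h1.prodMk h2)
    have j1 : jac1 a e (act a x w e) (block w e) =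
        (fderiv ℝ (fun q : Act d e × EuclideanSpace ℝ (Fin (dw e)) => a e q.1 q.2)
          (act a x w e, block w e)).comp (ContinuousLinearMap.inl ℝ _ _) :=
      (HasFDerivAt.comp (f := fun y => (y, block w e)) (act a x w e) h3
        (hasFDerivAt_prodMk_left (act a x w e) (block w e))).fderiv
    have j2 : jac2 a e (act a x w e) (block w e) =
        (fderiv ℝ (fun q : Act d e × EuclideanSpace ℝ (Fin (dw e)) => a e q.1 q.2)
          (act a x w e, block w e)).comp (ContinuousLinearMap.inr ℝ _ _) :=
      (HasFDerivAt.comp (f := fun v => (act a x w e, v)) (block w e) h3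
        (hasFDerivAt_prodMk_right (act a x w e) (block w e))).fderiv
    refine h4.congr_fderiv ?_
    ext1 h
    change _ = (jac1 a e (act a x w e) (block w e)).comp (actDeriv a x w e) h
      + (jac2 a e (act a x w e) (block w e)).comp (blockL E dw e) h
    rw [j1, j2]
    simp only [ContinuousLinearMap.comp_apply,
      ContinuousLinearMap.inl_apply, ContinuousLinearMap.inr_apply,
      ContinuousLinearMap.prod_apply, ← map_add, Prod.mk_add_mk, add_zero, zero_add]

/-- Adjoint form of the chain rule: moving the gradient across one layer passes the derivative of
the activations on to the previous layer and leaves one contribution of a parameter block. At `e =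
E` this is the derivative of the loss. -/
theorem inner_backprop_actDeriv (a : Layers d dw) (x : Act d 0) (w h : Weights E dw) (e : ℕ)
    (he : e ≤ E) :
    inner ℝ (backprop a w (act a x w) (E - e) e) (actDeriv a x w e h) =
      ∑ i ∈ Finset.range e, inner ℝ (backprop a w (act a x w) (E - (i + 1)) (i + 1))
        (jac2 a i (act a x w i) (block w i) (block h i)) := by
  induction e with
  | zero => simp [actDeriv]
  | succ e ih =>
    rw [Finset.sum_range_succ, ← ih (by omega), actDeriv,
      show E - e = (E - (e + 1)) + 1 by omega, backprop]
    simp only [add_apply, ContinuousLinearMap.comp_apply, inner_add_right,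
      ContinuousLinearMap.adjoint_inner_left, blockL_apply]

/-- Back-propagation computes the gradient of the loss. -/
theorem Smooth.hasGradientAt_loss (hS : Smooth E a D Lℓ Ca Lg La) (x : Act d 0)
    (w : Weights E dw) :
    HasGradientAt (fun w => loss a x w) (paramGrad a (act a x w) w) w := by
  rw [hasGradientAt_iff_hasFDerivAt]
  have h1 : HasFDerivAt (fun w : Weights E dw =>
      innerSL ℝ (WithLp.toLp 2 fun _ => (1 : ℝ) : Act d E) (act a x w E))
      ((innerSL ℝ (WithLp.toLp 2 fun _ => (1 : ℝ) : Act d E)).comp (actDeriv a x w E)) w :=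
    (innerSL ℝ (WithLp.toLp 2 fun _ => (1 : ℝ) : Act d E)).hasFDerivAt.comp w
      (hS.hasFDerivAt_act x w E le_rfl)
  have h3 : (fun w : Weights E dw => loss a x w) = fun w : Weights E dw =>
      innerSL ℝ (WithLp.toLp 2 fun _ => (1 : ℝ) : Act d E) (act a x w E) := by
    funext w
    simp [loss, PiLp.inner_apply]
  rw [h3]
  refine h1.congr_fderiv ?_
  · ext1 h
    have h2 := inner_backprop_actDeriv a x w h E le_rfl
    rw [Nat.sub_self, backprop] at h2
    simp only [InnerProductSpace.toDual_apply_apply, ContinuousLinearMap.comp_apply,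
      innerSL_apply_apply]
    rw [h2]
    refine Eq.trans ?_ (PiLp.inner_apply _ _).symm
    rw [Finset.sum_range]
    refine Finset.sum_congr rfl fun e _ => ?_
    simp only [paramGrad, ContinuousLinearMap.adjoint_inner_left]
    simp [block]

theorem Smooth.gradient_loss (hS : Smooth E a D Lℓ Ca Lg La) (x : Act d 0) (w : Weights E dw) :
    gradient (fun w => loss a x w) w = paramGrad a (act a x w) w :=
  (hS.hasGradientAt_loss x w).gradient

/-- A Lipschitz constant for the gradients of the loss. -/
def lossLip (E : ℕ) (Ca Lg La : ℝ) : ℝ :=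
  E * ((E + 1) * (1 + Ca) ^ (E + 1) * |Lg|) * (E * (E * (1 + |La|) ^ E) + 1)

theorem lossLip_nonneg {E : ℕ} {Ca Lg La : ℝ} (h : 0 ≤ Ca) : 0 ≤ lossLip E Ca Lg La := by
  unfold lossLip; positivity

theorem Smooth.norm_gradient_loss_sub_le (hS : Smooth E a D Lℓ Ca Lg La) (hE : 0 < E)
    (hdE : d E = 1) (x : Act d 0) (w w' : Weights E dw) :
    ‖paramGrad a (act a x w) w - paramGrad a (act a x w') w'‖
      ≤ lossLip E Ca Lg La * ‖w - w'‖ := by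
  have hCa := hS.Ca_nonneg hE
  refine (hS.norm_paramGrad_sub_le hdE _ _ (by simp [act]) w w').trans ?_
  rw [lossLip, mul_assoc _ _ ‖w - w'‖]
  exact mul_le_mul_of_nonneg_left (hS.actDist_act_le x w w') (by positivity)

end Backprop

/-! ### Measurability of the run, and its dependence on the seeds -/

section Measurability

variable {E B : ℕ} {d dw : ℕ → ℕ} {Ξ Ω : Type*} [MeasurableSpace Ξ] [MeasurableSpace Ω]

theorem measurable_block (e : ℕ) : Measurable (fun w : Weights E dw => block w e) := by
  have : (fun w : Weights E dw => block w e) = blockL E dw e :=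
    funext fun w => (blockL_apply w e).symm
  rw [this]; exact (blockL E dw e).continuous.measurable

theorem measurable_euclidean {n : ℕ} {f : Ω → EuclideanSpace ℝ (Fin n)}
    (h : ∀ i, Measurable fun ω => f ω i) : Measurable f :=
  (WithLp.measurable_toLp 2 (Fin n → ℝ)).comp (measurable_pi_lambda (fun ω i => f ω i) h)

/-- The coordinates of the adjoint are inner products with the images of basis vectors, so
measurability of each `A ω h` suffices. -/
theorem measurable_adjoint_apply {n k : ℕ}
    {A : Ω → EuclideanSpace ℝ (Fin n) →L[ℝ] EuclideanSpace ℝ (Fin k)}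
    {x : Ω → EuclideanSpace ℝ (Fin k)} (hA : ∀ h, Measurable fun ω => A ω h)
    (hx : Measurable x) : Measurable fun ω => ContinuousLinearMap.adjoint (A ω) (x ω) := by
  refine measurable_euclidean fun i => ?_
  have : (fun ω => ContinuousLinearMap.adjoint (A ω) (x ω) i) =
      fun ω => inner ℝ (A ω (EuclideanSpace.single i 1)) (x ω) := by
    funext ω
    rw [← ContinuousLinearMap.adjoint_inner_right, EuclideanSpace.inner_single_left]
    simp
  rw [this]
  exact (hA _).inner hx

variable {a : Layers d dw} {D : Measure (Act d 0)} {Lℓ Ca Lg La : ℝ}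

namespace Smooth

variable (hS : Smooth E a D Lℓ Ca Lg La)
include hS

theorem measurable_layer {e : ℕ} (he : e < E) {y : Ω → Act d e} {w : Ω → Weights E dw}
    (hy : Measurable y) (hw : Measurable w) : Measurable fun ω => a e (y ω) (block (w ω) e) :=
  (hS.differentiable_layer e he).continuous.measurable.comp
    (hy.prodMk ((measurable_block e).comp hw))

theorem measurable_jac1 {e : ℕ} (he : e < E) {y : Ω → Act d e} {w : Ω → Weights E dw}
    (hy : Measurable y) (hw : Measurable w) (h : Act d e) :
    Measurable fun ω => jac1 a e (y ω) (block (w ω) e) h := by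
  have hc : Continuous (Function.uncurry fun (v : EuclideanSpace ℝ (Fin (dw e))) (y : Act d e) =>
      a e y v) := (hS.differentiable_layer e he).continuous.comp continuous_swap
  exact (measurable_fderiv_apply_const_with_param ℝ hc h).comp
    (((measurable_block e).comp hw).prodMk hy)

theorem measurable_jac2 {e : ℕ} (he : e < E) {y : Ω → Act d e} {w : Ω → Weights E dw}
    (hy : Measurable y) (hw : Measurable w) (h : EuclideanSpace ℝ (Fin (dw e))) :
    Measurable fun ω => jac2 a e (y ω) (block (w ω) e) h := by
  have hc : Continuous (Function.uncurry fun (y : Act d e) (v : EuclideanSpace ℝ (Fin (dw e))) =>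
      a e y v) := (hS.differentiable_layer e he).continuous
  exact (measurable_fderiv_apply_const_with_param ℝ hc h).comp
    (hy.prodMk ((measurable_block e).comp hw))

theorem measurable_act {x : Ω → Act d 0} {w : Ω → Weights E dw} (hx : Measurable x)
    (hw : Measurable w) (e : ℕ) (he : e ≤ E) : Measurable fun ω => act a (x ω) (w ω) e := by
  induction e with
  | zero => exact hx
  | succ e ih => exact hS.measurable_layer (by omega) (ih (by omega)) hw

theorem measurable_backprop {ys : Ω → ∀ e, Act d e} {w : Ω → Weights E dw}
    (hy : ∀ e < E, Measurable fun ω => ys ω e) (hw : Measurable w) (k e : ℕ) (h : e + k = E) :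
    Measurable fun ω => backprop a (w ω) (ys ω) k e := by
  induction k generalizing e with
  | zero => exact measurable_const
  | succ k ih =>
    exact measurable_adjoint_apply (hS.measurable_jac1 (by omega) (hy e (by omega)) hw)
      (ih (e + 1) (by omega))

omit [MeasurableSpace Ω] hS in
theorem _root_.Clapping.measurable_weights [MeasurableSpace Ω] {f : Ω → Weights E dw}
    (h : ∀ e, Measurable fun ω => f ω e) : Measurable f :=
  (WithLp.measurable_toLp 2 (∀ e : Fin E, EuclideanSpace ℝ (Fin (dw e)))).comp
    (measurable_pi_lambda (fun ω e => f ω e) h)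

theorem measurable_paramGrad {ys : Ω → ∀ e, Act d e} {w : Ω → Weights E dw}
    (hy : ∀ e < E, Measurable fun ω => ys ω e) (hw : Measurable w) :
    Measurable fun ω => paramGrad a (ys ω) (w ω) :=
  measurable_weights fun e => measurable_adjoint_apply
    (hS.measurable_jac2 e.2 (hy e e.2) hw) (hS.measurable_backprop hy hw _ _ (by omega))

end Smooth

theorem measurable_send {V : Type*} [NormedAddCommGroup V] [MeasurableSpace V] [BorelSpace V]
    [SecondCountableTopology V] {P : Ω → Prop} (hP : MeasurableSet {ω | P ω}) {C : V → Ξ → V}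
    (hC : Measurable (Function.uncurry C)) {ξ : Ω → Ξ} (hξ : Measurable ξ) {prev z : Ω → V}
    (hprev : Measurable prev) (hz : Measurable z) :
    Measurable fun ω => send (P ω) C (ξ ω) (prev ω) (z ω) := by
  have : Measurable fun ω => C (z ω - prev ω) (ξ ω) := hC.comp ((hz.sub hprev).prodMk hξ)
  exact Measurable.ite hP hz (hprev.add this)

/-- The used components of a random state are measurable. -/
structure MeasurableState (S : Ω → State E B d dw) : Prop where
  w : Measurable fun ω => (S ω).w
  u : Measurable fun ω => (S ω).u
  x : ∀ b, Measurable fun ω => (S ω).x b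
  y : ∀ b, ∀ e < E, Measurable fun ω => (S ω).y b e
  v : ∀ b e, 1 ≤ e → e ≤ E → Measurable fun ω => (S ω).v b e

variable {ν : Measure Ξ} {cfg : Config d Ξ} {ωF ωB : ℝ}

theorem measurableSet_fresh (cfg : Config d Ξ) (t : ℕ) {s : Ω → IterSeed B d Ξ}
    (hs : Measurable s) (b : Fin B) : MeasurableSet {ω | Fresh cfg t (s ω) b} := by
  unfold Fresh
  refine MeasurableSet.union (.const _) ?_
  cases cfg.rule
  · exact measurableSet_le (by fun_prop) measurable_const
  · exact measurableSet_le (by fun_prop) measurable_const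

theorem measurableSet_exact (cfg : Config d Ξ) (t : ℕ) {s : Ω → IterSeed B d Ξ}
    (hs : Measurable s) (b : Fin B) : MeasurableSet {ω | Exact cfg t (s ω) b} :=
  MeasurableSet.inter (.const _) (measurableSet_fresh cfg t hs b)

section Step

variable (hS : Smooth E a D Lℓ Ca Lg La) (hC : Contractive E ν cfg.Cf cfg.Cb ωF ωB)
  {S : Ω → State E B d dw} (hSt : MeasurableState S) {s : Ω → IterSeed B d Ξ} (hs : Measurable s)
include hSt hs

theorem MeasurableState.newSample (cfg : Config d Ξ) (t : ℕ) (b : Fin B) :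
    Measurable fun ω => newSample cfg t (S ω) (s ω) b :=
  Measurable.ite (measurableSet_fresh cfg t hs b) (by fun_prop) (hSt.x b)

include hS hC

theorem MeasurableState.forward (t : ℕ) (b : Fin B) (e : ℕ) (he : e < E) :
    Measurable fun ω => forward a cfg t (S ω) (s ω) b e := by
  induction e with
  | zero => exact hSt.newSample hs cfg t b
  | succ e ih =>
    exact measurable_send (measurableSet_exact cfg t hs b)
      (hC.forward (e + 1) (by omega) he).measurable (by fun_prop) (hSt.y b _ he)
      (hS.measurable_layer (by omega) (ih (by omega)) hSt.w)

theorem MeasurableState.backwardAux (t : ℕ) (b : Fin B) (k e : ℕ) (h1 : 1 ≤ e) (h : e + k = E) :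
    Measurable fun ω => backwardAux a cfg t (S ω) (s ω) b k e := by
  induction k generalizing e with
  | zero => exact measurable_const
  | succ k ih =>
    exact measurable_send (measurableSet_exact cfg t hs b)
      (hC.backward e h1 (by omega)).measurable (by fun_prop) (hSt.v b e h1 (by omega))
      (measurable_adjoint_apply (hS.measurable_jac1 (by omega)
        (MeasurableState.forward hS hC hSt hs t b e (by omega)) hSt.w) (ih (e + 1) (by omega) (by omega)))

theorem MeasurableState.gradEstimate (t : ℕ) (b : Fin B) :
    Measurable fun ω => gradEstimate a cfg t (S ω) (s ω) b :=
  measurable_weights fun e => measurable_adjoint_apply (hS.measurable_jac2 e.2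
    (MeasurableState.forward hS hC hSt hs t b e e.2) hSt.w)
    (MeasurableState.backwardAux hS hC hSt hs t b _ _ (by omega) (by omega))

theorem MeasurableState.step (t : ℕ) :
    MeasurableState fun ω => step a cfg t (S ω) (s ω) := by
  have hu : Measurable fun ω => newMomentum a cfg t (S ω) (s ω) := by
    have h := fun b => MeasurableState.gradEstimate hS hC hSt hs t b
    simp only [newMomentum]
    have h1 : Measurable fun ω => ∑ b, Clapping.gradEstimate a cfg t (S ω) (s ω) b :=
      Finset.measurable_fun_sum _ fun b _ => h b
    have h2 := hSt.u
    fun_prop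
  have hw : Measurable fun ω => (S ω).w - cfg.γ • newMomentum a cfg t (S ω) (s ω) := by
    have h2 := hSt.w
    fun_prop
  exact { w := hw
          u := hu
          x := hSt.newSample hs cfg t
          y := MeasurableState.forward hS hC hSt hs t
          v := fun b e h1 h2 => MeasurableState.backwardAux hS hC hSt hs t b _ e h1 (by omega) }

end Step

theorem measurableState_run (hS : Smooth E a D Lℓ Ca Lg La)
    (hC : Contractive E ν cfg.Cf cfg.Cb ωF ωB) (w₁ : Weights E dw) (n : ℕ) :
    MeasurableState fun ω : ℕ → IterSeed B d Ξ => run a cfg w₁ ω n := by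
  induction n with
  | zero =>
    exact ⟨measurable_const, measurable_const, fun _ => measurable_const,
      fun _ _ _ => measurable_const, fun _ _ _ _ => measurable_const⟩
  | succ n ih => exact MeasurableState.step hS hC ih (measurable_pi_apply (n + 1)) (n + 1)

end Measurability

/-! ### The seeds on which a message depends. -/

section Dependence

variable {E B : ℕ} {d dw : ℕ → ℕ} {Ξ : Type*} {a : Layers d dw} {cfg : Config d Ξ}

theorem run_congr (w₁ : Weights E dw) {s s' : ℕ → IterSeed B d Ξ} (n : ℕ)
    (h : ∀ i, i ≤ n → s i = s' i) : run a cfg w₁ s n = run a cfg w₁ s' n := by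
  induction n with
  | zero => rfl
  | succ n ih => rw [run, run, ih fun i hi => h i (by omega), h (n + 1) le_rfl]

/-- Replace the randomness of the forward compressor number `e` for the batch entry `b`. -/
def setForward (b : Fin B) (e : ℕ) (s : IterSeed B d Ξ) (ξ : Ξ) : IterSeed B d Ξ :=
  (s.1, Function.update s.2 b
    ((s.2 b).1, (s.2 b).2.1, Function.update (s.2 b).2.2.1 e ξ, (s.2 b).2.2.2))

/-- Replace the randomness of the backward compressor number `e` for the batch entry `b`. -/
def setBackward (b : Fin B) (e : ℕ) (s : IterSeed B d Ξ) (ξ : Ξ) : IterSeed B d Ξ :=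
  (s.1, Function.update s.2 b
    ((s.2 b).1, (s.2 b).2.1, (s.2 b).2.2.1, Function.update (s.2 b).2.2.2 e ξ))

variable (t : ℕ) (S : State E B d dw) (s : IterSeed B d Ξ) (b : Fin B)

theorem fresh_setForward (e : ℕ) (ξ : Ξ) :
    Fresh cfg t (setForward b e s ξ) b ↔ Fresh cfg t s b := by
  unfold Fresh setForward; cases cfg.rule <;> simp

theorem fresh_setBackward (e : ℕ) (ξ : Ξ) :
    Fresh cfg t (setBackward b e s ξ) b ↔ Fresh cfg t s b := by
  unfold Fresh setBackward; cases cfg.rule <;> simp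

/-- Activations before link `e` are computed before its compressor is called. Hence a message is
independent of the randomness with which it is compressed. -/
theorem forward_setForward {e e' : ℕ} (h : e' < e) (ξ : Ξ) :
    forward a cfg t S (setForward b e s ξ) b e' = forward a cfg t S s b e' := by
  induction e' with
  | zero =>
    have h2 : ((setForward b e s ξ).2 b).1 = (s.2 b).1 := by simp [setForward]
    simp only [forward, newSample, h2]
    have h3 := fresh_setForward (cfg := cfg) t s b e ξ
    by_cases hf : Fresh cfg t s b
    · rw [if_pos hf, if_pos (h3.2 hf)]
    · rw [if_neg hf, if_neg (mt h3.1 hf)]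
  | succ e' ih =>
    rw [forward, forward, ih (by omega)]
    simp only [Exact, fresh_setForward]
    simp [setForward, Function.update_of_ne (show e' + 1 ≠ e by omega)]

theorem forward_setBackward (e e' : ℕ) (ξ : Ξ) :
    forward a cfg t S (setBackward b e s ξ) b e' = forward a cfg t S s b e' := by
  induction e' with
  | zero =>
    have h2 : ((setBackward b e s ξ).2 b).1 = (s.2 b).1 := by simp [setBackward]
    simp only [forward, newSample, h2]
    have h3 := fresh_setBackward (cfg := cfg) t s b e ξ
    by_cases hf : Fresh cfg t s b
    · rw [if_pos hf, if_pos (h3.2 hf)]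
    · rw [if_neg hf, if_neg (mt h3.1 hf)]
  | succ e' ih =>
    rw [forward, forward, ih]
    simp only [Exact, fresh_setBackward]
    simp [setBackward]

/-- The backward pass runs downwards: gradients of index above `e` are computed before compressor
`e` is called. -/
theorem backwardAux_setBackward {e : ℕ} (k e' : ℕ) (h : e < e') (ξ : Ξ) :
    backwardAux a cfg t S (setBackward b e s ξ) b k e' = backwardAux a cfg t S s b k e' := by
  induction k generalizing e' with
  | zero => rfl
  | succ k ih =>
    rw [backwardAux, backwardAux, ih (e' + 1) (by omega)]
    simp only [Exact, fresh_setBackward, forward_setBackward]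
    simp [setBackward, Function.update_of_ne (show e' ≠ e by omega)]

end Dependence

/-! ### Resampling one compressor seed of an iteration. -/

section Resample

variable {B : ℕ} {d : ℕ → ℕ} {Ξ : Type*} [MeasurableSpace Ξ]
  (D : Measure (Act d 0)) [IsProbabilityMeasure D] (ν : Measure Ξ) [IsProbabilityMeasure ν]

theorem measurePreserving_setForward (b : Fin B) (e : ℕ) :
    MeasurePreserving (fun p : IterSeed B d Ξ × Ξ => setForward b e p.1 p.2)
      ((iterLaw B D ν).prod ν) (iterLaw B D ν) := by
  have h0 := measurePreserving_update (fun _ : ℕ => ν) e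
  have h1 := MeasurePreserving.fst_resample _ (Measure.infinitePi fun _ : ℕ => ν) h0
  have h2 := MeasurePreserving.snd_resample (volume : Measure unitInterval) _ h1
  have h3 := MeasurePreserving.snd_resample D _ h2
  have h4 := MeasurePreserving.update_resample_pi (fun _ : Fin B => sampleLaw D ν) b h3
  exact MeasurePreserving.snd_resample (volume : Measure unitInterval) _ h4

theorem measurePreserving_setBackward (b : Fin B) (e : ℕ) :
    MeasurePreserving (fun p : IterSeed B d Ξ × Ξ => setBackward b e p.1 p.2)
      ((iterLaw B D ν).prod ν) (iterLaw B D ν) := by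
  have h0 := measurePreserving_update (fun _ : ℕ => ν) e
  have h1 := MeasurePreserving.snd_resample (Measure.infinitePi fun _ : ℕ => ν) _ h0
  have h2 := MeasurePreserving.snd_resample (volume : Measure unitInterval) _ h1
  have h3 := MeasurePreserving.snd_resample D _ h2
  have h4 := MeasurePreserving.update_resample_pi (fun _ : Fin B => sampleLaw D ν) b h3
  exact MeasurePreserving.snd_resample (volume : Measure unitInterval) _ h4

end Resample

/-! ### Bounds in mean square -/

section MeanSquare

variable {Ω : Type*} [MeasurableSpace Ω] {μ : Measure Ω}

/-- The `L²` norm of `f` is at most `c`. -/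
structure L2Le (μ : Measure Ω) (f : Ω → ℝ) (c : ℝ) : Prop where
  nonneg : 0 ≤ c
  meas : AEStronglyMeasurable f μ
  le : eLpNorm f 2 μ ≤ ENNReal.ofReal c

theorem lintegral_enorm_sq_eq {V : Type*} [NormedAddCommGroup V] (f : Ω → V) :
    ∫⁻ a, ‖f a‖ₑ ^ 2 ∂μ = eLpNorm f 2 μ ^ 2 := by
  have h := eLpNorm_nnreal_pow_eq_lintegral (f := f) (μ := μ) (p := 2) (by norm_num)
  simpa using h.symm

namespace L2Le

variable {f g : Ω → ℝ} {c c' : ℝ}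

theorem mono_bound (h : L2Le μ f c) (hc : c ≤ c') : L2Le μ f c' :=
  ⟨h.nonneg.trans hc, h.meas, h.le.trans (ENNReal.ofReal_le_ofReal hc)⟩

theorem mono (h : L2Le μ g c) (hf : AEStronglyMeasurable f μ) (hfg : ∀ ω, |f ω| ≤ g ω) :
    L2Le μ f c :=
  ⟨h.nonneg, hf, (eLpNorm_mono_real hfg).trans h.le⟩

theorem const [IsProbabilityMeasure μ] (hc : 0 ≤ c) : L2Le μ (fun _ => c) c := by
  refine ⟨hc, aestronglyMeasurable_const, ?_⟩
  rw [eLpNorm_const _ (by norm_num) (NeZero.ne μ)]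
  simp [Real.enorm_eq_ofReal hc]

/-- Minkowski's inequality. Working with `L²` norms instead of second moments keeps the factor `ω`
of an error recursion exact, with no loss from Young's inequality. -/
theorem add (hf : L2Le μ f c) (hg : L2Le μ g c') : L2Le μ (fun ω => f ω + g ω) (c + c') := by
  refine ⟨add_nonneg hf.nonneg hg.nonneg, hf.meas.add hg.meas, ?_⟩
  rw [ENNReal.ofReal_add hf.nonneg hg.nonneg]
  exact (eLpNorm_add_le hf.meas hg.meas (by norm_num)).trans (add_le_add hf.le hg.le)

theorem const_mul (hf : L2Le μ f c) {k : ℝ} (hk : 0 ≤ k) : L2Le μ (fun ω => k * f ω) (k * c) := by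
  refine ⟨mul_nonneg hk hf.nonneg, hf.meas.const_mul k, ?_⟩
  have := eLpNorm_const_smul k f 2 μ
  rw [ENNReal.ofReal_mul hk, ← Real.enorm_eq_ofReal hk]
  exact this.le.trans (mul_le_mul_right hf.le _)

theorem sum {ι : Type*} (s : Finset ι) {f : ι → Ω → ℝ} {c : ι → ℝ}
    (h : ∀ i ∈ s, L2Le μ (f i) (c i)) : L2Le μ (fun ω => ∑ i ∈ s, f i ω) (∑ i ∈ s, c i) := by
  classical
  induction s using Finset.induction_on with
  | empty =>
    refine ⟨by simp, by simpa using aestronglyMeasurable_const, ?_⟩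
    have : (fun ω : Ω => ∑ i ∈ (∅ : Finset ι), f i ω) = 0 := by funext; simp
    rw [this]; simp
  | insert i s hi ih =>
    simp only [Finset.sum_insert hi]
    exact (h i (by simp)).add (ih fun j hj => h j (by simp [hj]))

theorem lintegral_le (h : L2Le μ f c) : ∫⁻ ω, ‖f ω‖ₑ ^ 2 ∂μ ≤ ENNReal.ofReal (c ^ 2) := by
  rw [lintegral_enorm_sq_eq, ENNReal.ofReal_pow h.nonneg]
  exact pow_le_pow_left₀ zero_le h.le 2

theorem of_lintegral (hc : 0 ≤ c) (hf : AEStronglyMeasurable f μ)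
    (h : ∫⁻ ω, ‖f ω‖ₑ ^ 2 ∂μ ≤ ENNReal.ofReal (c ^ 2)) : L2Le μ f c := by
  refine ⟨hc, hf, ?_⟩
  rw [lintegral_enorm_sq_eq, ENNReal.ofReal_pow hc] at h
  exact le_of_not_gt fun hlt => absurd h (not_le.2 (ENNReal.pow_lt_pow_left two_ne_zero hlt))

theorem memLp (h : L2Le μ f c) : MemLp f 2 μ := ⟨h.meas, h.le.trans_lt ENNReal.ofReal_lt_top⟩

theorem integrable_sq (h : L2Le μ f c) : Integrable (fun ω => f ω ^ 2) μ := h.memLp.integrable_sq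

theorem integral_sq_le (h : L2Le μ f c) : ∫ ω, f ω ^ 2 ∂μ ≤ c ^ 2 := by
  rw [integral_eq_lintegral_of_nonneg_ae (.of_forall fun _ => sq_nonneg _)
    h.integrable_sq.aestronglyMeasurable]
  refine ENNReal.toReal_le_of_le_ofReal (sq_nonneg _) (le_trans (le_of_eq ?_) h.lintegral_le)
  refine lintegral_congr fun ω => ?_
  rw [← enorm_pow, Real.enorm_eq_ofReal (sq_nonneg _)]

theorem of_integrable (hf : AEStronglyMeasurable f μ) (h : Integrable (fun ω => f ω ^ 2) μ) :
    L2Le μ f (√(∫ ω, f ω ^ 2 ∂μ)) := by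
  have h0 : 0 ≤ ∫ ω, f ω ^ 2 ∂μ := integral_nonneg fun _ => sq_nonneg _
  refine of_lintegral (Real.sqrt_nonneg _) hf ?_
  rw [Real.sq_sqrt h0, ofReal_integral_eq_lintegral_ofReal h (.of_forall fun _ => sq_nonneg _)]
  refine le_of_eq (lintegral_congr fun ω => ?_)
  rw [← enorm_pow, Real.enorm_eq_ofReal (sq_nonneg _)]

end L2Le

/-- The compression error of a message, in mean square. -/
theorem IsCompressor.l2Le {Ξ V : Type*} [MeasurableSpace Ξ] [NormedAddCommGroup V]
    [MeasurableSpace V] [BorelSpace V] [SecondCountableTopology V] {ν : Measure Ξ}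
    [IsProbabilityMeasure ν] {C : V → Ξ → V} {κ : ℝ} (hκ : 0 ≤ κ) (hC : IsCompressor ν C κ)
    [IsProbabilityMeasure μ] {R : Ω × Ξ → Ω} (hR : MeasurePreserving R (μ.prod ν) μ)
    {ξ : Ω → Ξ} (hξ : Measurable ξ) (hξR : ∀ a x, ξ (R (a, x)) = x) {z : Ω → V}
    (hz : Measurable z) (hzR : ∀ a x, z (R (a, x)) = z a) {c : ℝ}
    (hc : L2Le μ (fun ω => ‖z ω‖) c) : L2Le μ (fun ω => ‖z ω - C (z ω) (ξ ω)‖) (κ * c) := by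
  have hm : Measurable fun ω => C (z ω) (ξ ω) := hC.measurable.comp (hz.prodMk hξ)
  refine L2Le.of_lintegral (mul_nonneg hκ hc.nonneg)
    (hz.sub hm).norm.aestronglyMeasurable ?_
  have h1 := hC.lintegral_le hR hξ hξR hz hzR
  have h2 := hc.lintegral_le
  simp only [enorm_norm] at h2 ⊢
  rw [mul_pow, ENNReal.ofReal_mul (sq_nonneg _)]
  exact h1.trans (mul_le_mul_right h2 _)

end MeanSquare

/-! ### Geometric filters of sequences -/

section Filter

/-- The solution of `f (n + 1) = ω f n + s (n + 1)`. -/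
def geomFilter (ω : ℝ) (s : ℕ → ℝ) : ℕ → ℝ
  | 0 => s 0
  | n + 1 => ω * geomFilter ω s n + s (n + 1)

variable {ω : ℝ} {s s' s'' : ℕ → ℝ}

theorem geomFilter_nonneg (hω : 0 ≤ ω) (hs : ∀ n, 0 ≤ s n) (n : ℕ) : 0 ≤ geomFilter ω s n := by
  induction n with
  | zero => exact hs 0
  | succ n ih => exact add_nonneg (mul_nonneg hω ih) (hs _)

theorem le_geomFilter {f : ℕ → ℝ} (hω : 0 ≤ ω) {T : ℕ} (h0 : f 0 ≤ s 0)
    (h : ∀ n, n + 1 < T → f (n + 1) ≤ ω * f n + s (n + 1)) (n : ℕ) (hn : n < T) :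
    f n ≤ geomFilter ω s n := by
  induction n with
  | zero => exact h0
  | succ n ih =>
    exact (h n hn).trans (add_le_add (mul_le_mul_of_nonneg_left (ih (by omega)) hω) le_rfl)

theorem geomFilter_add (ω : ℝ) (s s' : ℕ → ℝ) (n : ℕ) :
    geomFilter ω (fun n => s n + s' n) n = geomFilter ω s n + geomFilter ω s' n := by
  induction n with
  | zero => rfl
  | succ n ih => simp only [geomFilter, ih]; ring

theorem geomFilter_mono (hω : 0 ≤ ω) (h : ∀ n, s n ≤ s' n) (n : ℕ) :
    geomFilter ω s n ≤ geomFilter ω s' n := by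
  induction n with
  | zero => exact h 0
  | succ n ih => exact add_le_add (mul_le_mul_of_nonneg_left ih hω) (h _)

theorem sum_geomFilter_eq (ω : ℝ) (s : ℕ → ℝ) (T : ℕ) :
    (1 - ω) * ∑ n ∈ Finset.range (T + 1), geomFilter ω s n + ω * geomFilter ω s T =
      ∑ n ∈ Finset.range (T + 1), s n := by
  induction T with
  | zero => simp [geomFilter]; ring
  | succ T ih =>
    rw [Finset.sum_range_succ, Finset.sum_range_succ s, ← ih, geomFilter]; ring

theorem sum_geomFilter_le (hω : 0 ≤ ω) (hω1 : ω < 1) (hs : ∀ n, 0 ≤ s n) (T : ℕ) :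
    ∑ n ∈ Finset.range T, geomFilter ω s n ≤ (∑ n ∈ Finset.range T, s n) / (1 - ω) := by
  rcases T with _ | T
  · simp
  · rw [le_div_iff₀ (by linarith), ← sum_geomFilter_eq ω s T]
    nlinarith [mul_nonneg hω (geomFilter_nonneg hω hs T)]

/-- Convexity of the square with weights `ω` and `1 - ω`, the new term being read as `(1 - ω) * (s /
(1 - ω))`. -/
theorem geomFilter_sq_le (hω : 0 ≤ ω) (hω1 : ω < 1) (s : ℕ → ℝ) (n : ℕ) :
    geomFilter ω s n ^ 2 ≤ geomFilter ω (fun n => s n ^ 2 / (1 - ω)) n := by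
  have h1 : 0 < 1 - ω := by linarith
  refine le_geomFilter (f := fun n => geomFilter ω s n ^ 2) (T := n + 1) hω ?_ (fun k _ => ?_) n
    (by omega)
  · simp only [geomFilter]
    rw [le_div_iff₀ h1]; nlinarith [sq_nonneg (s 0)]
  · simp only [geomFilter]
    have : (ω * geomFilter ω s k + s (k + 1)) ^ 2 =
        ω * geomFilter ω s k ^ 2 + s (k + 1) ^ 2 / (1 - ω)
          - ω / (1 - ω) * ((1 - ω) * geomFilter ω s k - s (k + 1)) ^ 2 := by
      field_simp; ring
    rw [this]
    have : 0 ≤ ω / (1 - ω) * ((1 - ω) * geomFilter ω s k - s (k + 1)) ^ 2 := by positivity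
    linarith

/-- Young's convolution inequality `ℓ¹ * ℓ² → ℓ²`: the kernel of the filter has mass `1 / (1 - ω)`.
-/
theorem sum_sq_geomFilter_le (hω : 0 ≤ ω) (hω1 : ω < 1) (s : ℕ → ℝ) (T : ℕ) :
    ∑ n ∈ Finset.range T, geomFilter ω s n ^ 2 ≤
      (∑ n ∈ Finset.range T, s n ^ 2) / (1 - ω) ^ 2 := by
  have h1 : 0 < 1 - ω := by linarith
  refine (Finset.sum_le_sum fun n _ => geomFilter_sq_le hω hω1 s n).trans ?_
  refine (sum_geomFilter_le hω hω1 (fun n => by positivity) T).trans (le_of_eq ?_)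
  rw [← Finset.sum_div, div_div, sq]

theorem geomFilter_le_sum (hω : 0 ≤ ω) (hω1 : ω < 1) (hs : ∀ n, 0 ≤ s n) (n : ℕ) :
    geomFilter ω s n ≤ ∑ i ∈ Finset.range (n + 1), s i := by
  induction n with
  | zero => simp [geomFilter]
  | succ n ih =>
    rw [geomFilter, Finset.sum_range_succ]
    have := geomFilter_nonneg hω hs n
    nlinarith

/-- A filtered summable sequence: its square sum is controlled by the square of the sum. -/
theorem sum_sq_geomFilter_le_sq_sum (hω : 0 ≤ ω) (hω1 : ω < 1) (hs : ∀ n, 0 ≤ s n) (T : ℕ) :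
    ∑ n ∈ Finset.range T, geomFilter ω s n ^ 2 ≤ (∑ n ∈ Finset.range T, s n) ^ 2 / (1 - ω) := by
  have hA : 0 ≤ ∑ n ∈ Finset.range T, s n := Finset.sum_nonneg fun _ _ => hs _
  -- The square is at most the supremum times the sequence, and the supremum is at most the total
  -- sum; so only one factor `1 / (1 - ω)` is lost.
  calc ∑ n ∈ Finset.range T, geomFilter ω s n ^ 2
      ≤ ∑ n ∈ Finset.range T, (∑ n ∈ Finset.range T, s n) * geomFilter ω s n := by
        refine Finset.sum_le_sum fun n hn => ?_
        rw [sq]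
        refine mul_le_mul_of_nonneg_right ((geomFilter_le_sum hω hω1 hs n).trans ?_)
          (geomFilter_nonneg hω hs n)
        exact Finset.sum_le_sum_of_subset_of_nonneg
          (Finset.range_subset_range.2 (Finset.mem_range.1 hn)) fun _ _ _ => hs _
    _ ≤ _ := by
        rw [← Finset.mul_sum, sq, mul_div_assoc]
        exact mul_le_mul_of_nonneg_left (sum_geomFilter_le hω hω1 hs T) hA

/-- Up to time `T`, the sequence `b` is the sum of a part with sum at most `C J` and a part with
square sum at most `C² Q`. -/
def Dom (T : ℕ) (J Q C : ℝ) (b : ℕ → ℝ) : Prop :=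
  0 ≤ C ∧ ∃ b' b'' : ℕ → ℝ, (∀ n, 0 ≤ b' n) ∧ (∀ n, 0 ≤ b'' n) ∧ (∀ n, b n ≤ b' n + b'' n) ∧
    ∑ n ∈ Finset.range T, b' n ≤ C * J ∧ ∑ n ∈ Finset.range T, b'' n ^ 2 ≤ C ^ 2 * Q

namespace Dom

variable {T : ℕ} {J Q C C' : ℝ} {b c : ℕ → ℝ}

theorem mono_const (h : Dom T J Q C b) (hJ : 0 ≤ J) (hQ : 0 ≤ Q) (hC' : C ≤ C') :
    Dom T J Q C' b := by
  obtain ⟨hC, b', b'', h1, h2, h3, h4, h5⟩ := h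
  refine ⟨hC.trans hC', b', b'', h1, h2, h3, h4.trans ?_, h5.trans ?_⟩ <;> gcongr

theorem zero (hJ : 0 ≤ J) (hQ : 0 ≤ Q) (hC : 0 ≤ C) : Dom T J Q C (fun _ => 0) :=
  ⟨hC, fun _ => 0, fun _ => 0, by simp, by simp, by simp, by simp; positivity,
    by simp; positivity⟩

theorem add (hQ : 0 ≤ Q) (h : Dom T J Q C b) (h' : Dom T J Q C' c) :
    Dom T J Q (C + C') (fun n => b n + c n) := by
  obtain ⟨hC, b', b'', h1, h2, h3, h4, h5⟩ := h
  obtain ⟨hC', c', c'', k1, k2, k3, k4, k5⟩ := h'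
  refine ⟨add_nonneg hC hC', fun n => b' n + c' n, fun n => b'' n + c'' n,
    fun n => add_nonneg (h1 n) (k1 n), fun n => add_nonneg (h2 n) (k2 n),
    fun n => by linarith [h3 n, k3 n], ?_, ?_⟩
  · rw [Finset.sum_add_distrib, add_mul]; exact add_le_add h4 k4
  · have e : ∑ n ∈ Finset.range T, (b'' n + c'' n) ^ 2 = ∑ n ∈ Finset.range T, b'' n ^ 2
        + 2 * ∑ n ∈ Finset.range T, b'' n * c'' n + ∑ n ∈ Finset.range T, c'' n ^ 2 := by
      rw [Finset.mul_sum, ← Finset.sum_add_distrib, ← Finset.sum_add_distrib]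
      exact Finset.sum_congr rfl fun _ _ => by ring
    -- Minkowski in `ℓ²`, written out through Cauchy–Schwarz for the cross term.
    have cs := Finset.sum_mul_sq_le_sq_mul_sq (Finset.range T) b'' c''
    have : ∑ n ∈ Finset.range T, b'' n * c'' n ≤ C * C' * Q := by
      refine le_abs_mul_add_of_sq_le.le_of_sq_le_sq (cs.trans ?_) (by positivity)
      calc _ ≤ (C ^ 2 * Q) * (C' ^ 2 * Q) :=
            mul_le_mul h5 k5 (Finset.sum_nonneg fun _ _ => sq_nonneg _) (by positivity)
        _ = _ := by ring
    rw [e]; nlinarith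

theorem const_mul (h : Dom T J Q C b) {k : ℝ} (hk : 0 ≤ k) :
    Dom T J Q (k * C) (fun n => k * b n) := by
  obtain ⟨hC, b', b'', h1, h2, h3, h4, h5⟩ := h
  refine ⟨mul_nonneg hk hC, fun n => k * b' n, fun n => k * b'' n,
    fun n => mul_nonneg hk (h1 n), fun n => mul_nonneg hk (h2 n),
    fun n => by rw [← mul_add]; exact mul_le_mul_of_nonneg_left (h3 n) hk, ?_, ?_⟩
  · rw [← Finset.mul_sum, mul_assoc]; exact mul_le_mul_of_nonneg_left h4 hk
  · simp only [mul_pow]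
    rw [← Finset.mul_sum, mul_assoc]; exact mul_le_mul_of_nonneg_left h5 (sq_nonneg k)

theorem sum (hJ : 0 ≤ J) (hQ : 0 ≤ Q) {ι : Type*} (s : Finset ι) {b : ι → ℕ → ℝ} {C : ι → ℝ}
    (h : ∀ i ∈ s, Dom T J Q (C i) (b i)) :
    Dom T J Q (∑ i ∈ s, C i) (fun n => ∑ i ∈ s, b i n) := by
  classical
  induction s using Finset.induction_on with
  | empty => simpa using zero (T := T) hJ hQ le_rfl
  | insert i s hi ih =>
    simp only [Finset.sum_insert hi]
    exact (h i (by simp)).add hQ (ih fun j hj => h j (by simp [hj]))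

/-- Delaying a sequence by one. -/
def delay (b : ℕ → ℝ) : ℕ → ℝ
  | 0 => 0
  | n + 1 => b n

theorem sum_delay_le {b : ℕ → ℝ} (hb : ∀ n, 0 ≤ b n) (T : ℕ) :
    ∑ n ∈ Finset.range T, delay b n ≤ ∑ n ∈ Finset.range T, b n := by
  rcases T with _ | T
  · simp
  · rw [Finset.sum_range_succ', Finset.sum_range_succ]
    simp only [delay, add_zero]
    linarith [hb T]

theorem delayed (h : Dom T J Q C b) : Dom T J Q C (delay b) := by
  obtain ⟨hC, b', b'', h1, h2, h3, h4, h5⟩ := h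
  refine ⟨hC, delay b', delay b'', ?_, ?_, ?_, (sum_delay_le h1 T).trans h4, ?_⟩
  · rintro (_ | n); exacts [le_rfl, h1 n]
  · rintro (_ | n); exacts [le_rfl, h2 n]
  · rintro (_ | n); exacts [by simp [delay], h3 n]
  · refine le_trans (le_of_eq ?_) ((sum_delay_le (fun n => sq_nonneg (b'' n)) T).trans h5)
    exact Finset.sum_congr rfl fun n _ => by cases n <;> simp [delay]

/-- Filtering has the same norm on `ℓ¹` and on `ℓ²`, so both parts of the decomposition lose the
same factor. Hence a link of the pipeline costs exactly one `1 / (1 - ω)`. -/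
theorem filtered (h : Dom T J Q C b) (hω : 0 ≤ ω) (hω1 : ω < 1) :
    Dom T J Q (C / (1 - ω)) (geomFilter ω b) := by
  obtain ⟨hC, b', b'', h1, h2, h3, h4, h5⟩ := h
  have hp : 0 < 1 - ω := by linarith
  refine ⟨by positivity, geomFilter ω b', geomFilter ω b'', geomFilter_nonneg hω h1,
    geomFilter_nonneg hω h2, fun n => ?_, ?_, ?_⟩
  · rw [← geomFilter_add]; exact geomFilter_mono hω h3 n
  · refine (sum_geomFilter_le hω hω1 h1 T).trans ?_
    rw [div_mul_eq_mul_div]; gcongr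
  · refine (sum_sq_geomFilter_le hω hω1 b'' T).trans ?_
    rw [div_pow, div_mul_eq_mul_div]; gcongr

/-- A sequence supported at `0`. -/
theorem impulse (hJ : 0 ≤ J) (hQ : 0 ≤ Q) (hC : 0 ≤ C) :
    Dom T J Q C (fun n => if n = 0 then C * J else 0) := by
  refine ⟨hC, fun n => if n = 0 then C * J else 0, fun _ => 0, fun n => ?_, by simp, by simp, ?_,
    by simp; positivity⟩
  · dsimp only; split_ifs; exacts [mul_nonneg hC hJ, le_rfl]
  · rw [Finset.sum_ite_eq']; split_ifs; exacts [le_rfl, mul_nonneg hC hJ]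

end Dom

end Filter

/-! ### Compression errors -/

instance (B : ℕ) {d : ℕ → ℕ} {Ξ : Type*} [MeasurableSpace Ξ] (D : Measure (Act d 0))
    [IsProbabilityMeasure D] (ν : Measure Ξ) [IsProbabilityMeasure ν] :
    IsProbabilityMeasure (runLaw B D ν) := by
  unfold runLaw; infer_instance

section Errors

variable {E B : ℕ} {d dw : ℕ → ℕ} {Ξ : Type*}

open Classical in
/-- `0` if the communication for the entry `b` is uncompressed in iteration `n + 1`, else `1`. -/
def inexact (cfg : Config d Ξ) (b : Fin B) (n : ℕ) (s : ℕ → IterSeed B d Ξ) : ℝ :=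
  if Exact cfg (n + 1) (s (n + 1)) b then 0 else 1

variable (a : Layers d dw) (cfg : Config d Ξ) (w₁ : Weights E dw) (b : Fin B)

/-- The error of the forward link `e + 1` in iteration `n + 1`. -/
def fwdErr (n e : ℕ) (s : ℕ → IterSeed B d Ξ) : ℝ :=
  ‖(run a cfg w₁ s (n + 1)).y b (e + 1)
    - a e ((run a cfg w₁ s (n + 1)).y b e) (block (run a cfg w₁ s n).w e)‖

/-- The compressed message on the forward link `e + 1` in iteration `n + 1`. -/
def fwdMsg (n e : ℕ) (s : ℕ → IterSeed B d Ξ) : ℝ :=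
  inexact cfg b n s * ‖a e ((run a cfg w₁ s (n + 1)).y b e) (block (run a cfg w₁ s n).w e)
    - (run a cfg w₁ s n).y b (e + 1)‖

/-- The change of a communicated activation in iteration `n + 1`. -/
def fwdMove (n e : ℕ) (s : ℕ → IterSeed B d Ξ) : ℝ :=
  inexact cfg b n s * ‖(run a cfg w₁ s (n + 1)).y b e - (run a cfg w₁ s n).y b e‖

/-- The change of the parameters before iteration `n + 1`. -/
def wMove (n : ℕ) (s : ℕ → IterSeed B d Ξ) : ℝ :=
  ‖(run a cfg w₁ s n).w - (run a cfg w₁ s (n - 1)).w‖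

/-- The error of the backward link `e` in iteration `n + 1`. -/
def bwdErr (n e : ℕ) (s : ℕ → IterSeed B d Ξ) : ℝ :=
  ‖(run a cfg w₁ s (n + 1)).v b e
    - ContinuousLinearMap.adjoint (jac1 a e ((run a cfg w₁ s (n + 1)).y b e)
      (block (run a cfg w₁ s n).w e)) ((run a cfg w₁ s (n + 1)).v b (e + 1))‖

/-- The compressed message on the backward link `e` in iteration `n + 1`. -/
def bwdMsg (n e : ℕ) (s : ℕ → IterSeed B d Ξ) : ℝ :=
  inexact cfg b n s * ‖ContinuousLinearMap.adjoint (jac1 a e ((run a cfg w₁ s (n + 1)).y b e)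
      (block (run a cfg w₁ s n).w e)) ((run a cfg w₁ s (n + 1)).v b (e + 1))
    - (run a cfg w₁ s n).v b e‖

/-- The deviation of the communicated gradients from exact back-propagation at the communicated
activations. -/
def bwdDev (n e : ℕ) (s : ℕ → IterSeed B d Ξ) : ℝ :=
  ‖(run a cfg w₁ s (n + 1)).v b e
    - backprop a (run a cfg w₁ s n).w ((run a cfg w₁ s (n + 1)).y b) (E - e) e‖

theorem inexact_nonneg (n : ℕ) (s : ℕ → IterSeed B d Ξ) : 0 ≤ inexact cfg b n s := by
  unfold inexact; split_ifs <;> norm_num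

theorem inexact_le_one (n : ℕ) (s : ℕ → IterSeed B d Ξ) : inexact cfg b n s ≤ 1 := by
  unfold inexact; split_ifs <;> norm_num

theorem run_succ_y (n e : ℕ) (s : ℕ → IterSeed B d Ξ) :
    (run a cfg w₁ s (n + 1)).y b e
      = forward a cfg (n + 1) (run a cfg w₁ s n) (s (n + 1)) b e := rfl

theorem run_succ_v (n e : ℕ) (s : ℕ → IterSeed B d Ξ) :
    (run a cfg w₁ s (n + 1)).v b e
      = backwardAux a cfg (n + 1) (run a cfg w₁ s n) (s (n + 1)) b (E - e) e := rfl

/-- The conditionals put the message in the form used for the mean square contraction, where it is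
set to zero in exact iterations so as to be defined everywhere. -/
theorem norm_send_sub {V : Type*} [NormedAddCommGroup V] (P : Prop) [Decidable P]
    (C : V → Ξ → V) (ξ : Ξ) (prev z : V) (hP : ¬ P) :
    ‖send P C ξ prev z - z‖ = ‖(if P then 0 else z - prev) - C (if P then 0 else z - prev) ξ‖ := by
  unfold send
  rw [if_neg hP, if_neg hP, ← norm_neg]
  congr 1; abel

theorem send_of_exact {V : Type*} [NormedAddCommGroup V] {P : Prop}
    (C : V → Ξ → V) (ξ : Ξ) (prev z : V) (hP : P) : send P C ξ prev z = z := if_pos hP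

variable [MeasurableSpace Ξ] {a cfg w₁ b} {D : Measure (Act d 0)} {ν : Measure Ξ}
  {Lℓ Ca Lg La ωF ωB : ℝ}
  (hS : Smooth E a D Lℓ Ca Lg La) (hC : Contractive E ν cfg.Cf cfg.Cb ωF ωB)

theorem measurable_inexact (n : ℕ) : Measurable (inexact cfg b n) := by
  classical
  exact Measurable.ite (measurableSet_exact cfg (n + 1) (measurable_pi_apply (n + 1)) b)
    measurable_const measurable_const

include hS hC

theorem measurable_fwdTarget (n e : ℕ) (he : e < E) :
    Measurable fun s : ℕ → IterSeed B d Ξ =>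
      a e ((run a cfg w₁ s (n + 1)).y b e) (block (run a cfg w₁ s n).w e) :=
  hS.measurable_layer he ((measurableState_run hS hC w₁ (n + 1)).y b e he)
    (measurableState_run hS hC w₁ n).w

theorem measurable_bwdTarget (n e : ℕ) (he : e < E) :
    Measurable fun s : ℕ → IterSeed B d Ξ =>
      ContinuousLinearMap.adjoint (jac1 a e ((run a cfg w₁ s (n + 1)).y b e)
        (block (run a cfg w₁ s n).w e)) ((run a cfg w₁ s (n + 1)).v b (e + 1)) :=
  measurable_adjoint_apply (hS.measurable_jac1 he
    ((measurableState_run hS hC w₁ (n + 1)).y b e he) (measurableState_run hS hC w₁ n).w)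
    ((measurableState_run hS hC w₁ (n + 1)).v b (e + 1) (by omega) (by omega))

theorem measurable_fwdErr (n e : ℕ) (he : e + 1 < E) : Measurable (fwdErr a cfg w₁ b n e) :=
  (((measurableState_run hS hC w₁ (n + 1)).y b (e + 1) he).sub
    (measurable_fwdTarget hS hC n e (by omega))).norm

theorem measurable_fwdMsg (n e : ℕ) (he : e + 1 < E) : Measurable (fwdMsg a cfg w₁ b n e) :=
  (measurable_inexact n).mul ((measurable_fwdTarget hS hC n e (by omega)).sub
    ((measurableState_run hS hC w₁ n).y b (e + 1) he)).norm

theorem measurable_fwdMove (n e : ℕ) (he : e < E) : Measurable (fwdMove a cfg w₁ b n e) :=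
  (measurable_inexact n).mul (((measurableState_run hS hC w₁ (n + 1)).y b e he).sub
    ((measurableState_run hS hC w₁ n).y b e he)).norm

theorem measurable_bwdErr (n e : ℕ) (h1 : 1 ≤ e) (he : e < E) :
    Measurable (bwdErr a cfg w₁ b n e) :=
  (((measurableState_run hS hC w₁ (n + 1)).v b e h1 he.le).sub
    (measurable_bwdTarget hS hC n e he)).norm

theorem measurable_bwdMsg (n e : ℕ) (h1 : 1 ≤ e) (he : e < E) :
    Measurable (bwdMsg a cfg w₁ b n e) :=
  (measurable_inexact n).mul ((measurable_bwdTarget hS hC n e he).sub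
    ((measurableState_run hS hC w₁ n).v b e h1 he.le)).norm

theorem measurable_bwdDev (n e : ℕ) (h1 : 1 ≤ e) (he : e ≤ E) :
    Measurable (bwdDev a cfg w₁ b n e) :=
  (((measurableState_run hS hC w₁ (n + 1)).v b e h1 he).sub
    (hS.measurable_backprop (ys := fun s => (run a cfg w₁ s (n + 1)).y b)
      (fun e he => (measurableState_run hS hC w₁ (n + 1)).y b e he)
      (measurableState_run hS hC w₁ n).w (E - e) e (by omega))).norm

variable [IsProbabilityMeasure D] [IsProbabilityMeasure ν]

/-- The message is unchanged when the seed of its own compressor is resampled, so the contraction at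
a fixed message integrates to a contraction in mean square. -/
theorem l2Le_fwdErr {n e : ℕ} (he : e + 1 < E) {c : ℝ}
    (hc : L2Le (runLaw B D ν) (fwdMsg a cfg w₁ b n e) c) :
    L2Le (runLaw B D ν) (fwdErr a cfg w₁ b n e) (ωF * c) := by
  classical
  -- In an exact iteration the error is zero, so any message would do there; zero makes its norm
  -- equal to `fwdMsg`.
  let z : (ℕ → IterSeed B d Ξ) → Act d (e + 1) := fun s =>
    if Exact cfg (n + 1) (s (n + 1)) b then 0 else
      a e ((run a cfg w₁ s (n + 1)).y b e) (block (run a cfg w₁ s n).w e)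
        - (run a cfg w₁ s n).y b (e + 1)
  have hz : Measurable z :=
    Measurable.ite (measurableSet_exact cfg (n + 1) (measurable_pi_apply (n + 1)) b)
      measurable_const ((measurable_fwdTarget hS hC n e (by omega)).sub
        ((measurableState_run hS hC w₁ n).y b (e + 1) he))
  have hR := MeasurePreserving.update_resample (fun _ : ℕ => iterLaw B D ν) (n + 1)
    (measurePreserving_setForward D ν b (e + 1))
  have hzc : L2Le (runLaw B D ν) (fun s => ‖z s‖) c := by
    convert hc using 2 with s
    simp only [z, fwdMsg, inexact]
    split_ifs <;> simp
  have key := IsCompressor.l2Le (μ := runLaw B D ν) hC.ωF_mem.1 (hC.forward (e + 1) (by omega) he)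
    hR (ξ := fun s => ((s (n + 1)).2 b).2.2.1 (e + 1)) (by fun_prop)
    (fun s x => by simp [setForward]) hz (fun s x => ?_) hzc
  · refine key.mono (measurable_fwdErr hS hC n e he).aestronglyMeasurable fun s => ?_
    rw [abs_of_nonneg (by unfold fwdErr; positivity), fwdErr, run_succ_y, forward]
    by_cases hP : Exact cfg (n + 1) (s (n + 1)) b
    · rw [send_of_exact _ _ _ _ hP]; simp [run_succ_y]
    · rw [← run_succ_y a cfg w₁ b n e s]
      exact (norm_send_sub _ _ _ _ _ hP).le
  · have h1 : run a cfg w₁ (Function.update s (n + 1) (setForward b (e + 1) (s (n + 1)) x)) n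
        = run a cfg w₁ s n :=
      run_congr w₁ n fun i hi => Function.update_of_ne (by omega) _ _
    simp only [z, run_succ_y, h1, Function.update_self,
      forward_setForward (n + 1) _ _ b (Nat.lt_succ_self e)]
    have h2 : Exact cfg (n + 1) (setForward b (e + 1) (s (n + 1)) x) b ↔
        Exact cfg (n + 1) (s (n + 1)) b := and_congr_right fun _ => fresh_setForward _ _ _ _ _
    simp only [h2]

theorem l2Le_bwdErr {n e : ℕ} (h1 : 1 ≤ e) (he : e < E) {c : ℝ}
    (hc : L2Le (runLaw B D ν) (bwdMsg a cfg w₁ b n e) c) :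
    L2Le (runLaw B D ν) (bwdErr a cfg w₁ b n e) (ωB * c) := by
  classical
  let z : (ℕ → IterSeed B d Ξ) → Act d e := fun s =>
    if Exact cfg (n + 1) (s (n + 1)) b then 0 else
      ContinuousLinearMap.adjoint (jac1 a e ((run a cfg w₁ s (n + 1)).y b e)
        (block (run a cfg w₁ s n).w e)) ((run a cfg w₁ s (n + 1)).v b (e + 1))
        - (run a cfg w₁ s n).v b e
  have hz : Measurable z :=
    Measurable.ite (measurableSet_exact cfg (n + 1) (measurable_pi_apply (n + 1)) b)
      measurable_const ((measurable_bwdTarget hS hC n e he).sub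
        ((measurableState_run hS hC w₁ n).v b e h1 he.le))
  have hR := MeasurePreserving.update_resample (fun _ : ℕ => iterLaw B D ν) (n + 1)
    (measurePreserving_setBackward D ν b e)
  have hzc : L2Le (runLaw B D ν) (fun s => ‖z s‖) c := by
    convert hc using 2 with s
    simp only [z, bwdMsg, inexact]
    split_ifs <;> simp
  have key := IsCompressor.l2Le (μ := runLaw B D ν) hC.ωB_mem.1 (hC.backward e h1 he)
    hR (ξ := fun s => ((s (n + 1)).2 b).2.2.2 e) (by fun_prop)
    (fun s x => by simp [setBackward]) hz (fun s x => ?_) hzc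
  · refine key.mono (measurable_bwdErr hS hC n e h1 he).aestronglyMeasurable fun s => ?_
    rw [abs_of_nonneg (by unfold bwdErr; positivity), bwdErr, run_succ_v, run_succ_v,
      show E - e = (E - (e + 1)) + 1 by omega, backwardAux, run_succ_y]
    by_cases hP : Exact cfg (n + 1) (s (n + 1)) b
    · rw [send_of_exact _ _ _ _ hP]; simp
    · rw [← run_succ_y a cfg w₁ b n e s]
      exact (norm_send_sub _ _ _ _ _ hP).le
  · have h1 : run a cfg w₁ (Function.update s (n + 1) (setBackward b e (s (n + 1)) x)) n
        = run a cfg w₁ s n :=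
      run_congr w₁ n fun i hi => Function.update_of_ne (by omega) _ _
    simp only [z, run_succ_y, run_succ_v, h1, Function.update_self,
      forward_setBackward (n + 1) _ _ b, backwardAux_setBackward (n + 1) _ _ b _ _
        (Nat.lt_succ_self e)]
    have h2 : Exact cfg (n + 1) (setBackward b e (s (n + 1)) x) b ↔
        Exact cfg (n + 1) (s (n + 1)) b := and_congr_right fun _ => fresh_setBackward _ _ _ _ _
    simp only [h2]

end Errors

/-! ### Recursions and bounds for the forward errors. -/

section ErrorBounds

variable {E B : ℕ} {d dw : ℕ → ℕ} {Ξ : Type*}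
  {a : Layers d dw} {cfg : Config d Ξ} {w₁ : Weights E dw} {b : Fin B}
  {D : Measure (Act d 0)} {Lℓ Ca Lg La ωF ωB : ℝ}

theorem fwdErr_nonneg (n e : ℕ) (s : ℕ → IterSeed B d Ξ) : 0 ≤ fwdErr a cfg w₁ b n e s :=
  norm_nonneg _

theorem fwdMsg_nonneg (n e : ℕ) (s : ℕ → IterSeed B d Ξ) : 0 ≤ fwdMsg a cfg w₁ b n e s :=
  mul_nonneg (inexact_nonneg ..) (norm_nonneg _)

theorem fwdMove_nonneg (n e : ℕ) (s : ℕ → IterSeed B d Ξ) : 0 ≤ fwdMove a cfg w₁ b n e s :=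
  mul_nonneg (inexact_nonneg ..) (norm_nonneg _)

theorem bwdErr_nonneg (n e : ℕ) (s : ℕ → IterSeed B d Ξ) : 0 ≤ bwdErr a cfg w₁ b n e s :=
  norm_nonneg _

theorem bwdMsg_nonneg (n e : ℕ) (s : ℕ → IterSeed B d Ξ) : 0 ≤ bwdMsg a cfg w₁ b n e s :=
  mul_nonneg (inexact_nonneg ..) (norm_nonneg _)

theorem bwdDev_nonneg (n e : ℕ) (s : ℕ → IterSeed B d Ξ) : 0 ≤ bwdDev a cfg w₁ b n e s :=
  norm_nonneg _

theorem norm_le_add_three {V : Type*} [NormedAddCommGroup V] (x y z t : V) :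
    ‖x - t‖ ≤ ‖x - y‖ + ‖y - z‖ + ‖z - t‖ := by
  have h1 := norm_sub_le_norm_sub_add_norm_sub x z t
  have h2 := norm_sub_le_norm_sub_add_norm_sub x y z
  linarith

theorem mul_le_of_le_add {i x y z : ℝ} (h0 : 0 ≤ i) (h1 : i ≤ 1) (hy : 0 ≤ y)
    (h : x ≤ z + y) : i * x ≤ i * z + y := by nlinarith

/-- Error feedback: the receiver holds the previous target up to the previous error, so a message is
the change of the target plus that error. Only the change keeps the factor `inexact`, which is what
removes the jumps of fresh samples in the variant FU. -/
theorem fwdMsg_succ_le (hS : Smooth E a D Lℓ Ca Lg La) (n : ℕ) {e : ℕ} (he : e + 1 < E)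
    (s : ℕ → IterSeed B d Ξ) :
    fwdMsg a cfg w₁ b (n + 1) e s ≤
      |La| * (fwdMove a cfg w₁ b (n + 1) e s + wMove a cfg w₁ (n + 1) s)
        + fwdErr a cfg w₁ b n e s := by
  have h0 := inexact_nonneg cfg b (n + 1) s
  have h1 := inexact_le_one cfg b (n + 1) s
  have h2 := hS.norm_layer_sub_le he ((run a cfg w₁ s (n + 2)).y b e)
    ((run a cfg w₁ s (n + 1)).y b e) (run a cfg w₁ s (n + 1)).w (run a cfg w₁ s n).w
  have h3 := norm_sub_le_norm_sub_add_norm_sub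
    (a e ((run a cfg w₁ s (n + 2)).y b e) (block (run a cfg w₁ s (n + 1)).w e))
    (a e ((run a cfg w₁ s (n + 1)).y b e) (block (run a cfg w₁ s n).w e))
    ((run a cfg w₁ s (n + 1)).y b (e + 1))
  have h4 := fwdErr_nonneg (a := a) (cfg := cfg) (w₁ := w₁) (b := b) n e s
  rw [norm_sub_rev (a e ((run a cfg w₁ s (n + 1)).y b e) (block (run a cfg w₁ s n).w e))] at h3
  refine (mul_le_of_le_add h0 h1 h4 (z := |La| *
    (‖(run a cfg w₁ s (n + 2)).y b e - (run a cfg w₁ s (n + 1)).y b e‖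
      + ‖(run a cfg w₁ s (n + 1)).w - (run a cfg w₁ s n).w‖))
      (h3.trans (add_le_add h2 le_rfl))).trans ?_
  refine add_le_add_left ?_ _
  rw [mul_left_comm, mul_add]
  refine mul_le_mul_of_nonneg_left (add_le_add le_rfl ?_) (abs_nonneg _)
  exact mul_le_of_le_one_left (norm_nonneg _) h1

/-- A received activation follows its target up to the errors of two consecutive iterations. This
feeds the motion of one activation into the target of the next link. -/
theorem fwdMove_succ_le (hS : Smooth E a D Lℓ Ca Lg La) (n : ℕ) {e : ℕ} (he : e + 1 < E)
    (s : ℕ → IterSeed B d Ξ) :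
    fwdMove a cfg w₁ b (n + 1) (e + 1) s ≤
      |La| * (fwdMove a cfg w₁ b (n + 1) e s + wMove a cfg w₁ (n + 1) s)
        + (fwdErr a cfg w₁ b (n + 1) e s + fwdErr a cfg w₁ b n e s) := by
  have h0 := inexact_nonneg cfg b (n + 1) s
  have h1 := inexact_le_one cfg b (n + 1) s
  have h2 := hS.norm_layer_sub_le he ((run a cfg w₁ s (n + 2)).y b e)
    ((run a cfg w₁ s (n + 1)).y b e) (run a cfg w₁ s (n + 1)).w (run a cfg w₁ s n).w
  have h3 := norm_le_add_three ((run a cfg w₁ s (n + 2)).y b (e + 1))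
    (a e ((run a cfg w₁ s (n + 2)).y b e) (block (run a cfg w₁ s (n + 1)).w e))
    (a e ((run a cfg w₁ s (n + 1)).y b e) (block (run a cfg w₁ s n).w e))
    ((run a cfg w₁ s (n + 1)).y b (e + 1))
  have h4 := fwdErr_nonneg (a := a) (cfg := cfg) (w₁ := w₁) (b := b) n e s
  have h5 := fwdErr_nonneg (a := a) (cfg := cfg) (w₁ := w₁) (b := b) (n + 1) e s
  rw [norm_sub_rev (a e ((run a cfg w₁ s (n + 1)).y b e) (block (run a cfg w₁ s n).w e))] at h3
  refine (mul_le_of_le_add h0 h1 (add_nonneg h5 h4) (z := |La| *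
    (‖(run a cfg w₁ s (n + 2)).y b e - (run a cfg w₁ s (n + 1)).y b e‖
      + ‖(run a cfg w₁ s (n + 1)).w - (run a cfg w₁ s n).w‖)) ?_).trans ?_
  · refine h3.trans ?_
    unfold fwdErr
    linarith
  · refine add_le_add_left ?_ _
    rw [mul_left_comm, mul_add]
    refine mul_le_mul_of_nonneg_left (add_le_add le_rfl ?_) (abs_nonneg _)
    exact mul_le_of_le_one_left (norm_nonneg _) h1

/-- The deviation of the first communicated activations from the exact ones. -/
def initDev (a : Layers d dw) (cfg : Config d Ξ) (w₁ : Weights E dw) (b : Fin B) (e : ℕ)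
    (s : ℕ → IterSeed B d Ξ) : ℝ :=
  inexact cfg b 0 s * ‖(run a cfg w₁ s 1).y b e - act a ((run a cfg w₁ s 1).x b) w₁ e‖

theorem initDev_nonneg (e : ℕ) (s : ℕ → IterSeed B d Ξ) : 0 ≤ initDev a cfg w₁ b e s :=
  mul_nonneg (inexact_nonneg ..) (norm_nonneg _)

/-- The size of the first exact activations. -/
def initAct (a : Layers d dw) (cfg : Config d Ξ) (w₁ : Weights E dw) (b : Fin B) (e : ℕ)
    (s : ℕ → IterSeed B d Ξ) : ℝ :=
  inexact cfg b 0 s * ‖act a ((run a cfg w₁ s 1).x b) w₁ e‖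

/-- The buffers start at zero, so the first message is a whole activation and not an increment. It
is the impulse that the filters then spread over time. -/
theorem fwdMsg_zero_le (hS : Smooth E a D Lℓ Ca Lg La) {e : ℕ} (he : e + 1 < E)
    (s : ℕ → IterSeed B d Ξ) :
    fwdMsg a cfg w₁ b 0 e s ≤ initAct a cfg w₁ b (e + 1) s + |La| * initDev a cfg w₁ b e s := by
  have h0 := inexact_nonneg cfg b 0 s
  have h2 := hS.norm_layer_sub_le he ((run a cfg w₁ s 1).y b e)
    (act a ((run a cfg w₁ s 1).x b) w₁ e) w₁ w₁
  rw [sub_self, norm_zero, add_zero] at h2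
  have h3 : ‖a e ((run a cfg w₁ s 1).y b e) (block w₁ e)‖ ≤
      ‖act a ((run a cfg w₁ s 1).x b) w₁ (e + 1)‖
        + |La| * ‖(run a cfg w₁ s 1).y b e - act a ((run a cfg w₁ s 1).x b) w₁ e‖ := by
    have := norm_sub_norm_le (a e ((run a cfg w₁ s 1).y b e) (block w₁ e))
      (act a ((run a cfg w₁ s 1).x b) w₁ (e + 1))
    have h4 := h2
    rw [act] at this ⊢
    linarith
  have h4 : fwdMsg a cfg w₁ b 0 e s =
      inexact cfg b 0 s * ‖a e ((run a cfg w₁ s 1).y b e) (block w₁ e)‖ := by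
    simp [fwdMsg, run, State.init]
  rw [h4, initAct, initDev, mul_left_comm, ← mul_add]
  exact mul_le_mul_of_nonneg_left h3 h0

theorem initDev_succ_le (hS : Smooth E a D Lℓ Ca Lg La) {e : ℕ} (he : e + 1 < E)
    (s : ℕ → IterSeed B d Ξ) :
    initDev a cfg w₁ b (e + 1) s ≤ |La| * initDev a cfg w₁ b e s + fwdErr a cfg w₁ b 0 e s := by
  have h0 := inexact_nonneg cfg b 0 s
  have h1 := inexact_le_one cfg b 0 s
  have h2 := hS.norm_layer_sub_le he ((run a cfg w₁ s 1).y b e)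
    (act a ((run a cfg w₁ s 1).x b) w₁ e) w₁ w₁
  rw [sub_self, norm_zero, add_zero] at h2
  have h3 := norm_sub_le_norm_sub_add_norm_sub ((run a cfg w₁ s 1).y b (e + 1))
    (a e ((run a cfg w₁ s 1).y b e) (block w₁ e)) (act a ((run a cfg w₁ s 1).x b) w₁ (e + 1))
  have h4 := fwdErr_nonneg (a := a) (cfg := cfg) (w₁ := w₁) (b := b) 0 e s
  unfold initDev
  rw [mul_left_comm]
  refine mul_le_of_le_add h0 h1 h4 (h3.trans ?_)
  rw [add_comm]
  exact add_le_add h2 le_rfl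

variable [MeasurableSpace Ξ] {ν : Measure Ξ}

theorem measurable_initDev (hS : Smooth E a D Lℓ Ca Lg La)
    (hC : Contractive E ν cfg.Cf cfg.Cb ωF ωB) {e : ℕ} (he : e < E) :
    Measurable (initDev a cfg w₁ b e) :=
  (measurable_inexact 0).mul (((measurableState_run hS hC w₁ 1).y b e he).sub
    (hS.measurable_act ((measurableState_run hS hC w₁ 1).x b) measurable_const e he.le)).norm

variable [IsProbabilityMeasure D] [IsProbabilityMeasure ν]

/-- Mean square bounds for what drives the compression errors: the motion `η` of the samples, the
motion `δ` of the parameters, and the first messages. -/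
structure Inputs (a : Layers d dw) (cfg : Config d Ξ) (w₁ : Weights E dw) (b : Fin B)
    (D : Measure (Act d 0)) [IsProbabilityMeasure D] (ν : Measure Ξ) [IsProbabilityMeasure ν]
    (T : ℕ) (J Q M c : ℝ) (η δ : ℕ → ℝ) : Prop where
  J_nonneg : 0 ≤ J
  Q_nonneg : 0 ≤ Q
  M_nonneg : 0 ≤ M
  move_nonneg : ∀ n, 0 ≤ η n
  move : ∀ n, n + 1 < T → L2Le (runLaw B D ν) (fwdMove a cfg w₁ b (n + 1) 0) (η (n + 1))
  move_dom : Dom T J Q c η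
  w_nonneg : ∀ n, 0 ≤ δ n
  w : ∀ n, n + 1 < T → L2Le (runLaw B D ν) (wMove a cfg w₁ (n + 1)) (δ (n + 1))
  w_dom : Dom T J Q 1 δ
  initAct : ∀ e, 1 ≤ e → e < E → L2Le (runLaw B D ν) (initAct a cfg w₁ b e) (M * J)
  init : L2Le (runLaw B D ν) (inexact cfg b 0) J

/-- The constants of the forward error bounds. -/
def fwdConst (La M c : ℝ) : ℕ → ℝ
  | 0 => c
  | e + 1 => 3 * (M + 2 * (|La| * (fwdConst La M c e + 1)))

theorem fwdConst_nonneg {La M c : ℝ} (hM : 0 ≤ M) (hc : 0 ≤ c) (e : ℕ) :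
    0 ≤ fwdConst La M c e := by
  induction e with
  | zero => exact hc
  | succ e ih => rw [fwdConst]; positivity

variable {T : ℕ} {J Q M c : ℝ} {η δ : ℕ → ℝ}

/-- The bounds for activation number `e`. -/
structure FwdBound (a : Layers d dw) (cfg : Config d Ξ) (w₁ : Weights E dw) (b : Fin B)
    (D : Measure (Act d 0)) [IsProbabilityMeasure D] (ν : Measure Ξ) [IsProbabilityMeasure ν]
    (T : ℕ) (J Q K : ℝ) (e : ℕ) (C : ℝ) (η : ℕ → ℝ) : Prop where
  nonneg : ∀ n, 0 ≤ η n
  move : ∀ n, n + 1 < T → L2Le (runLaw B D ν) (fwdMove a cfg w₁ b (n + 1) e) (η (n + 1))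
  dom : Dom T J Q C η
  init : L2Le (runLaw B D ν) (initDev a cfg w₁ b e) (K * J)

/-- The bounds for the errors of the forward link number `e + 1`. -/
structure FwdErrBound (a : Layers d dw) (cfg : Config d Ξ) (w₁ : Weights E dw) (b : Fin B)
    (D : Measure (Act d 0)) [IsProbabilityMeasure D] (ν : Measure Ξ) [IsProbabilityMeasure ν]
    (T : ℕ) (J Q : ℝ) (e : ℕ) (C : ℝ) (α : ℕ → ℝ) : Prop where
  nonneg : ∀ n, 0 ≤ α n
  err : ∀ n, n < T → L2Le (runLaw B D ν) (fwdErr a cfg w₁ b n e) (α n)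
  dom : Dom T J Q C α

theorem le_div_pow {x p : ℝ} (hx : 0 ≤ x) (hp : 0 < p) (hp1 : p ≤ 1) (e : ℕ) : x ≤ x / p ^ e := by
  rw [le_div_iff₀ (by positivity)]
  exact mul_le_of_le_one_right hx (pow_le_one₀ hp.le hp1)

/-- One link: its error is the filter, of ratio `ωF`, of the first message and of the changes of the
target, and this costs one factor `1 / (1 - ωF)`. The next activation moves with the target and with
two consecutive errors. -/
theorem fwd_step (hS : Smooth E a D Lℓ Ca Lg La) (hC : Contractive E ν cfg.Cf cfg.Cb ωF ωB)
    (hI : Inputs a cfg w₁ b D ν T J Q M c η δ) {e : ℕ} (he : e + 1 < E) {K A : ℝ}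
    (hK : 0 ≤ K) (hA : A = M + 2 * (|La| * (K + 1))) {θ : ℕ → ℝ}
    (h : FwdBound a cfg w₁ b D ν T J Q K e (K / (1 - ωF) ^ e) θ) :
    ∃ α θ', FwdErrBound a cfg w₁ b D ν T J Q e (A / (1 - ωF) ^ (e + 1)) α ∧
      FwdBound a cfg w₁ b D ν T J Q (3 * A) (e + 1) (3 * A / (1 - ωF) ^ (e + 1)) θ' := by
  obtain ⟨hω0, hω1⟩ := hC.ωF_mem
  have hJ := hI.J_nonneg
  have hQ := hI.Q_nonneg
  have hM := hI.M_nonneg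
  have hL := abs_nonneg La
  have hp : 0 < 1 - ωF := by linarith
  have hp1 : 1 - ωF ≤ 1 := by linarith
  have hA0 : 0 ≤ A := by rw [hA]; positivity
  have hLK : 0 ≤ |La| * K := mul_nonneg hL hK
  -- The input of the filter: the first message as an impulse at `0`, and the Lipschitz bound for
  -- the change of the target at the other times.
  set g : ℕ → ℝ := fun n => (if n = 0 then (M + |La| * K) * J else 0)
    + |La| * (θ n + δ n) with hg
  have hg0 : ∀ n, 0 ≤ g n := fun n => by
    have := h.nonneg n; have := hI.w_nonneg n
    simp only [hg]; split_ifs <;> positivity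
  have hθδ : Dom T J Q (|La| * (K + 1) / (1 - ωF) ^ e) (fun n => |La| * (θ n + δ n)) := by
    refine ((h.dom.add hQ hI.w_dom).const_mul hL).mono_const hJ hQ ?_
    rw [mul_div_assoc, add_div]
    have := le_div_pow zero_le_one hp hp1 e
    gcongr
  have hgdom : Dom T J Q (A / (1 - ωF) ^ e) g := by
    have h1 : Dom T J Q (M + |La| * K) fun n => if n = 0 then (M + |La| * K) * J else 0 :=
      Dom.impulse hJ hQ (by positivity)
    refine (h1.add hQ hθδ).mono_const hJ hQ ?_
    have := le_div_pow (x := M + |La| * K) (by positivity) hp hp1 e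
    calc _ ≤ (M + |La| * K) / (1 - ωF) ^ e + |La| * (K + 1) / (1 - ωF) ^ e :=
          add_le_add_left this _
      _ = (M + |La| * K + |La| * (K + 1)) / (1 - ωF) ^ e := by rw [add_div _ (|La| * (K + 1))]
      _ ≤ _ := div_le_div_of_nonneg_right (by rw [hA]; nlinarith) (by positivity)
  have hα0 := geomFilter_nonneg hω0 hg0
  have hmsg0 : L2Le (runLaw B D ν) (fwdMsg a cfg w₁ b 0 e) (M * J + |La| * (K * J)) :=
    ((hI.initAct (e + 1) (by omega) he).add (h.init.const_mul hL)).mono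
      (measurable_fwdMsg hS hC 0 e he).aestronglyMeasurable fun s => by
        rw [abs_of_nonneg (fwdMsg_nonneg ..)]; exact fwdMsg_zero_le hS he s
  have herr0 : L2Le (runLaw B D ν) (fwdErr a cfg w₁ b 0 e) (M * J + |La| * (K * J)) :=
    (l2Le_fwdErr hS hC he hmsg0).mono_bound (mul_le_of_le_one_left hmsg0.nonneg hω1.le)
  have herr : ∀ n, n < T → L2Le (runLaw B D ν) (fwdErr a cfg w₁ b n e) (geomFilter ωF g n) := by
    intro n hn
    induction n with
    | zero =>
      refine herr0.mono_bound ?_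
      have := mul_nonneg hL (add_nonneg (h.nonneg 0) (hI.w_nonneg 0))
      simp only [geomFilter, hg, if_true]
      linarith
    | succ n ih =>
      have h1 : L2Le (runLaw B D ν) (fwdMsg a cfg w₁ b (n + 1) e)
          (|La| * (θ (n + 1) + δ (n + 1)) + geomFilter ωF g n) :=
        ((((h.move n hn).add (hI.w n hn)).const_mul hL).add (ih (by omega))).mono
          (measurable_fwdMsg hS hC (n + 1) e he).aestronglyMeasurable fun s => by
            rw [abs_of_nonneg (fwdMsg_nonneg ..)]; exact fwdMsg_succ_le hS n he s
      refine (l2Le_fwdErr hS hC he h1).mono_bound ?_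
      have h2 := mul_nonneg hL (add_nonneg (h.nonneg (n + 1)) (hI.w_nonneg (n + 1)))
      have h3 : g (n + 1) = |La| * (θ (n + 1) + δ (n + 1)) := by simp [hg]
      rw [geomFilter, h3]
      nlinarith
  have hαdom : Dom T J Q (A / (1 - ωF) ^ (e + 1)) (geomFilter ωF g) := by
    have := hgdom.filtered hω0 hω1
    rwa [div_div, ← pow_succ] at this
  have hdα0 : ∀ n, 0 ≤ Dom.delay (geomFilter ωF g) n := by
    rintro (_ | n); exacts [le_rfl, hα0 n]
  refine ⟨geomFilter ωF g, fun n => |La| * (θ n + δ n)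
    + (geomFilter ωF g n + Dom.delay (geomFilter ωF g) n), ⟨hα0, herr, hαdom⟩, ?_⟩
  constructor
  · intro n
    have := mul_nonneg hL (add_nonneg (h.nonneg n) (hI.w_nonneg n))
    have := hα0 n; have := hdα0 n; positivity
  · intro n hn
    exact ((((h.move n hn).add (hI.w n hn)).const_mul hL).add
      ((herr (n + 1) hn).add (herr n (by omega)))).mono
        (measurable_fwdMove hS hC (n + 1) (e + 1) he).aestronglyMeasurable fun s => by
          rw [abs_of_nonneg (fwdMove_nonneg ..)]; exact fwdMove_succ_le hS n he s
  · refine (hθδ.add hQ (hαdom.add hQ hαdom.delayed)).mono_const hJ hQ ?_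
    have h1 : |La| * (K + 1) / (1 - ωF) ^ e ≤ A / (1 - ωF) ^ (e + 1) := by
      rw [pow_succ]
      have : |La| * (K + 1) ≤ A := by rw [hA]; nlinarith
      refine div_le_div₀ hA0 this (by positivity) ?_
      exact mul_le_of_le_one_right (by positivity) hp1
    -- The factor `3` counts the change of the target, the current error and the delayed error.
    have h2 : 3 * A / (1 - ωF) ^ (e + 1) = A / (1 - ωF) ^ (e + 1) + (A / (1 - ωF) ^ (e + 1)
      + A / (1 - ωF) ^ (e + 1)) := by ring
    rw [h2]; gcongr
  · refine (((h.init.const_mul hL).add herr0).mono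
      (measurable_initDev hS hC he).aestronglyMeasurable (fun s => ?_)).mono_bound ?_
    · rw [abs_of_nonneg (initDev_nonneg _ s)]
      exact initDev_succ_le hS he s
    · have : (|La| * K + (M + |La| * K)) * J ≤ 3 * A * J := by
        refine mul_le_mul_of_nonneg_right ?_ hJ
        rw [hA]; nlinarith
      linarith

theorem exists_fwdBound (hS : Smooth E a D Lℓ Ca Lg La)
    (hC : Contractive E ν cfg.Cf cfg.Cb ωF ωB) (hI : Inputs a cfg w₁ b D ν T J Q M c η δ) (e : ℕ)
    (he : e < E) : ∃ θ, FwdBound a cfg w₁ b D ν T J Q (fwdConst La M c e) e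
      (fwdConst La M c e / (1 - ωF) ^ e) θ := by
  induction e with
  | zero =>
    refine ⟨η, hI.move_nonneg, hI.move, by simpa [fwdConst] using hI.move_dom, ?_⟩
    have h0 : initDev a cfg w₁ b 0 = fun _ => 0 * 0 := by
      funext s
      have : (run a cfg w₁ s 1).y b 0 = (run a cfg w₁ s 1).x b := rfl
      simp [initDev, act, this]
    rw [h0]
    have := (L2Le.const (μ := runLaw B D ν) le_rfl (c := 0)).const_mul (le_refl 0)
    exact this.mono_bound (by simpa [fwdConst] using mul_nonneg hI.move_dom.1 hI.J_nonneg)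
  | succ e ih =>
    obtain ⟨θ, hθ⟩ := ih (by omega)
    obtain ⟨α, θ', -, h⟩ := fwd_step hS hC hI he
      (fwdConst_nonneg hI.M_nonneg hI.move_dom.1 e) rfl hθ
    exact ⟨θ', h⟩

theorem exists_fwdErrBound (hS : Smooth E a D Lℓ Ca Lg La)
    (hC : Contractive E ν cfg.Cf cfg.Cb ωF ωB) (hI : Inputs a cfg w₁ b D ν T J Q M c η δ) (e : ℕ)
    (he : e + 1 < E) : ∃ α, FwdErrBound a cfg w₁ b D ν T J Q e
      (fwdConst La M c (e + 1) / (1 - ωF) ^ (e + 1)) α := by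
  obtain ⟨θ, hθ⟩ := exists_fwdBound hS hC hI e (by omega)
  have hK := fwdConst_nonneg (La := La) hI.M_nonneg hI.move_dom.1 e
  obtain ⟨α, θ', h, -⟩ := fwd_step hS hC hI he hK rfl hθ
  refine ⟨α, h.nonneg, h.err, h.dom.mono_const hI.J_nonneg hI.Q_nonneg ?_⟩
  have hp : 0 < 1 - ωF := by linarith [hC.ωF_mem.2]
  rw [fwdConst]
  gcongr
  have : 0 ≤ M + 2 * (|La| * (fwdConst La M c e + 1)) := by
    have := hI.M_nonneg; positivity
  linarith

end ErrorBounds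

/-! ### Backward errors, and the error of a gradient estimate. -/

section BackwardErrors

variable {E B : ℕ} {d dw : ℕ → ℕ} {Ξ : Type*}
  {a : Layers d dw} {cfg : Config d Ξ} {w₁ : Weights E dw} {b : Fin B}
  {D : Measure (Act d 0)} {Lℓ Ca Lg La ωF ωB : ℝ}

/-- The change of everything that exact back-propagation depends on, in iteration `n + 1`. -/
def backMove (a : Layers d dw) (cfg : Config d Ξ) (w₁ : Weights E dw) (b : Fin B) (n : ℕ)
    (s : ℕ → IterSeed B d Ξ) : ℝ :=
  ∑ i ∈ Finset.Ico 1 E, fwdMove a cfg w₁ b n i s + wMove a cfg w₁ n s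

theorem inexact_mul_actDist_le (n : ℕ) (s : ℕ → IterSeed B d Ξ) :
    inexact cfg b (n + 1) s * actDist ((run a cfg w₁ s (n + 2)).y b)
      ((run a cfg w₁ s (n + 1)).y b) (run a cfg w₁ s (n + 1)).w (run a cfg w₁ s n).w
      ≤ backMove a cfg w₁ b (n + 1) s := by
  rw [actDist, mul_add, Finset.mul_sum]
  exact add_le_add le_rfl (mul_le_of_le_one_left (norm_nonneg _) (inexact_le_one ..))

/-- The exact part of a backward message. -/
theorem adjoint_jac1_backprop (n e : ℕ) (he : e < E) (s : ℕ → IterSeed B d Ξ) :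
    backprop a (run a cfg w₁ s n).w ((run a cfg w₁ s (n + 1)).y b) (E - e) e =
      ContinuousLinearMap.adjoint (jac1 a e ((run a cfg w₁ s (n + 1)).y b e)
        (block (run a cfg w₁ s n).w e))
        (backprop a (run a cfg w₁ s n).w ((run a cfg w₁ s (n + 1)).y b) (E - (e + 1)) (e + 1)) := by
  rw [show E - e = (E - (e + 1)) + 1 by omega, backprop]

theorem norm_target_sub_le (hS : Smooth E a D Lℓ Ca Lg La) (n e : ℕ) (he : e < E)
    (s : ℕ → IterSeed B d Ξ) :
    ‖ContinuousLinearMap.adjoint (jac1 a e ((run a cfg w₁ s (n + 1)).y b e)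
        (block (run a cfg w₁ s n).w e)) ((run a cfg w₁ s (n + 1)).v b (e + 1))
      - backprop a (run a cfg w₁ s n).w ((run a cfg w₁ s (n + 1)).y b) (E - e) e‖
      ≤ Ca * bwdDev a cfg w₁ b n (e + 1) s := by
  rw [adjoint_jac1_backprop n e he, ← map_sub]
  exact norm_adjoint_apply_le (hS.jac1_le e he _ _) _

theorem bwdDev_le (hS : Smooth E a D Lℓ Ca Lg La) (n : ℕ) {e : ℕ} (he : e < E)
    (s : ℕ → IterSeed B d Ξ) :
    bwdDev a cfg w₁ b n e s ≤ bwdErr a cfg w₁ b n e s + Ca * bwdDev a cfg w₁ b n (e + 1) s :=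
  (norm_sub_le_norm_sub_add_norm_sub _ _ _).trans
    (add_le_add le_rfl (norm_target_sub_le hS n e he s))

theorem bwdDev_last (n : ℕ) (s : ℕ → IterSeed B d Ξ) : bwdDev a cfg w₁ b n E s = 0 := by
  rw [bwdDev, run_succ_v, Nat.sub_self]; simp [backwardAux, backprop]

/-- The comparison goes through exact back-propagation `Z`, `Z'` at the communicated activations. A
change of Jacobian multiplies a gradient, and a product of two quantities known only in mean square
would not be controlled; `Z'` is bounded by a constant, whereas the communicated gradients are only
controlled in mean square. The deviations from `Z` and `Z'` just pass through a bounded Jacobian. -/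
theorem bwdMsg_succ_le (hS : Smooth E a D Lℓ Ca Lg La) (hdE : d E = 1) (n : ℕ) {e : ℕ}
    (h1 : 1 ≤ e) (he : e < E) (s : ℕ → IterSeed B d Ξ) :
    bwdMsg a cfg w₁ b (n + 1) e s ≤
      Ca * (bwdDev a cfg w₁ b (n + 1) (e + 1) s + bwdDev a cfg w₁ b n (e + 1) s)
        + E * (1 + Ca) ^ E * |Lg| * backMove a cfg w₁ b (n + 1) s
        + bwdErr a cfg w₁ b n e s := by
  have h0 := inexact_nonneg cfg b (n + 1) s
  have hi1 := inexact_le_one cfg b (n + 1) s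
  have hCa := hS.Ca_nonneg (by omega)
  set A := ContinuousLinearMap.adjoint (jac1 a e ((run a cfg w₁ s (n + 2)).y b e)
        (block (run a cfg w₁ s (n + 1)).w e)) ((run a cfg w₁ s (n + 2)).v b (e + 1))
  set A' := ContinuousLinearMap.adjoint (jac1 a e ((run a cfg w₁ s (n + 1)).y b e)
        (block (run a cfg w₁ s n).w e)) ((run a cfg w₁ s (n + 1)).v b (e + 1))
  set Z := backprop a (run a cfg w₁ s (n + 1)).w ((run a cfg w₁ s (n + 2)).y b) (E - e) e
  set Z' := backprop a (run a cfg w₁ s n).w ((run a cfg w₁ s (n + 1)).y b) (E - e) e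
  have h2 : ‖A - Z‖ ≤ Ca * bwdDev a cfg w₁ b (n + 1) (e + 1) s :=
    norm_target_sub_le hS (n + 1) e he s
  have h3 : ‖A' - Z'‖ ≤ Ca * bwdDev a cfg w₁ b n (e + 1) s := norm_target_sub_le hS n e he s
  have h4 : ‖Z - Z'‖ ≤ E * (1 + Ca) ^ E * |Lg| * actDist ((run a cfg w₁ s (n + 2)).y b)
      ((run a cfg w₁ s (n + 1)).y b) (run a cfg w₁ s (n + 1)).w (run a cfg w₁ s n).w :=
    hS.norm_backprop_sub_le' hdE _ _ _ _ (E - e) e h1 (by omega)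
  have h5 := norm_le_add_three A Z Z' ((run a cfg w₁ s (n + 1)).v b e)
  have h6 := norm_sub_le_norm_sub_add_norm_sub Z' A' ((run a cfg w₁ s (n + 1)).v b e)
  rw [norm_sub_rev Z' A', norm_sub_rev A' ((run a cfg w₁ s (n + 1)).v b e)] at h6
  have h7 : ‖(run a cfg w₁ s (n + 1)).v b e - A'‖ = bwdErr a cfg w₁ b n e s := rfl
  have h8 := inexact_mul_actDist_le (a := a) (cfg := cfg) (w₁ := w₁) (b := b) n s
  have h9 := bwdErr_nonneg (a := a) (cfg := cfg) (w₁ := w₁) (b := b) n e s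
  have h10 := bwdDev_nonneg (a := a) (cfg := cfg) (w₁ := w₁) (b := b) n (e + 1) s
  have h11 := bwdDev_nonneg (a := a) (cfg := cfg) (w₁ := w₁) (b := b) (n + 1) (e + 1) s
  have h12 : 0 ≤ E * (1 + Ca) ^ E * |Lg| := by positivity
  have h13 : 0 ≤ Ca * (bwdDev a cfg w₁ b (n + 1) (e + 1) s + bwdDev a cfg w₁ b n (e + 1) s)
      + bwdErr a cfg w₁ b n e s := by positivity
  change inexact cfg b (n + 1) s * ‖A - (run a cfg w₁ s (n + 1)).v b e‖ ≤ _
  refine (mul_le_of_le_add h0 hi1 h13 (z := E * (1 + Ca) ^ E * |Lg| *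
    actDist ((run a cfg w₁ s (n + 2)).y b) ((run a cfg w₁ s (n + 1)).y b)
      (run a cfg w₁ s (n + 1)).w (run a cfg w₁ s n).w) (by linarith)).trans ?_
  rw [mul_left_comm]
  have := mul_le_mul_of_nonneg_left h8 h12
  linarith

theorem bwdMsg_zero_le (hS : Smooth E a D Lℓ Ca Lg La) (hdE : d E = 1) {e : ℕ} (he : e < E)
    (s : ℕ → IterSeed B d Ξ) :
    bwdMsg a cfg w₁ b 0 e s ≤
      Ca * bwdDev a cfg w₁ b 0 (e + 1) s + (1 + Ca) ^ E * inexact cfg b 0 s := by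
  have h0 := inexact_nonneg cfg b 0 s
  have hi1 := inexact_le_one cfg b 0 s
  have hCa := hS.Ca_nonneg (by omega)
  have h3 := norm_target_sub_le (cfg := cfg) (w₁ := w₁) (b := b) hS 0 e he s
  have h4 := hS.norm_backprop_le' hdE (by omega) (run a cfg w₁ s 0).w ((run a cfg w₁ s 1).y b)
    (E - e) e (by omega)
  have h5 := norm_le_norm_sub_add (ContinuousLinearMap.adjoint
    (jac1 a e ((run a cfg w₁ s 1).y b e) (block (run a cfg w₁ s 0).w e))
      ((run a cfg w₁ s 1).v b (e + 1)))
    (backprop a (run a cfg w₁ s 0).w ((run a cfg w₁ s 1).y b) (E - e) e)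
  have h6 : (run a cfg w₁ s 0).v b e = 0 := rfl
  have h10 := bwdDev_nonneg (a := a) (cfg := cfg) (w₁ := w₁) (b := b) 0 (e + 1) s
  rw [bwdMsg, h6, sub_zero, mul_comm ((1 + Ca) ^ E), add_comm (Ca * _)]
  exact mul_le_of_le_add h0 hi1 (by positivity) (by linarith)

variable [MeasurableSpace Ξ] {ν : Measure Ξ} [IsProbabilityMeasure D] [IsProbabilityMeasure ν]
  {T : ℕ} {J Q M c : ℝ} {η δ : ℕ → ℝ}

/-- A constant for `backMove`. -/
def moveConst (E : ℕ) (La M c : ℝ) : ℝ := ∑ i ∈ Finset.Ico 1 E, fwdConst La M c i + 1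

theorem exists_backMove (hS : Smooth E a D Lℓ Ca Lg La)
    (hC : Contractive E ν cfg.Cf cfg.Cb ωF ωB) (hI : Inputs a cfg w₁ b D ν T J Q M c η δ) :
    ∃ θ : ℕ → ℝ, (∀ n, 0 ≤ θ n) ∧
      (∀ n, n + 1 < T → L2Le (runLaw B D ν) (backMove a cfg w₁ b (n + 1)) (θ (n + 1))) ∧
      Dom T J Q (moveConst E La M c / (1 - ωF) ^ (E - 1)) θ := by
  have hp : 0 < 1 - ωF := by linarith [hC.ωF_mem.2]
  have hp1 : 1 - ωF ≤ 1 := by linarith [hC.ωF_mem.1]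
  have hK := fwdConst_nonneg (La := La) hI.M_nonneg hI.move_dom.1
  choose! θ hθ using fun e he => exists_fwdBound hS hC hI e he
  refine ⟨fun n => ∑ i ∈ Finset.Ico 1 E, θ i n + δ n, fun n => ?_, fun n hn => ?_, ?_⟩
  · exact add_nonneg (Finset.sum_nonneg fun i hi => (hθ i (Finset.mem_Ico.1 hi).2).nonneg n)
      (hI.w_nonneg n)
  · exact (L2Le.sum _ fun i hi => (hθ i (Finset.mem_Ico.1 hi).2).move n hn).add (hI.w n hn)
  · refine ((Dom.sum hI.J_nonneg hI.Q_nonneg (Finset.Ico 1 E) fun i hi =>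
      (hθ i (Finset.mem_Ico.1 hi).2).dom).add hI.Q_nonneg hI.w_dom).mono_const
        hI.J_nonneg hI.Q_nonneg ?_
    rw [moveConst, add_div, Finset.sum_div]
    refine add_le_add (Finset.sum_le_sum fun i hi => ?_) (le_div_pow zero_le_one hp hp1 _)
    refine div_le_div_of_nonneg_left (hK i) (by positivity) ?_
    exact pow_le_pow_of_le_one hp.le hp1 (by have := (Finset.mem_Ico.1 hi).2; omega)

/-- The bounds for the deviation of the communicated gradients. -/
structure BwdBound (a : Layers d dw) (cfg : Config d Ξ) (w₁ : Weights E dw) (b : Fin B)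
    (D : Measure (Act d 0)) [IsProbabilityMeasure D] (ν : Measure Ξ) [IsProbabilityMeasure ν]
    (T : ℕ) (J Q : ℝ) (e : ℕ) (C : ℝ) (β : ℕ → ℝ) : Prop where
  nonneg : ∀ n, 0 ≤ β n
  dev : ∀ n, n < T → L2Le (runLaw B D ν) (bwdDev a cfg w₁ b n e) (β n)
  dom : Dom T J Q C β

/-- The constants of the backward error bounds, after `k` links. -/
def bwdConst (E : ℕ) (Ca Lg La M c : ℝ) : ℕ → ℝ
  | 0 => 0
  | k + 1 => 3 * Ca * bwdConst E Ca Lg La M c k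
      + (E * (1 + Ca) ^ E * |Lg| * moveConst E La M c + (1 + Ca) ^ E)

theorem moveConst_nonneg {La M c : ℝ} (hM : 0 ≤ M) (hc : 0 ≤ c) : 0 ≤ moveConst E La M c :=
  add_nonneg (Finset.sum_nonneg fun i _ => fwdConst_nonneg hM hc i) zero_le_one

theorem bwdConst_nonneg (hCa : 0 ≤ Ca) {Lg La M c : ℝ} (hM : 0 ≤ M) (hc : 0 ≤ c) (k : ℕ) :
    0 ≤ bwdConst E Ca Lg La M c k := by
  have := moveConst_nonneg (E := E) (La := La) hM hc
  induction k with
  | zero => exact le_rfl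
  | succ k ih => rw [bwdConst]; positivity

/-- Induction from the last activation, whose gradient is exactly `1`. Each link filters with ratio
`ωB`. The motion of activations enters with its complete forward factor `(1 - ωF) ^ (E - 1)` already
paid, so that this factor is common to all links and does not accumulate. -/
theorem exists_bwdBound (hS : Smooth E a D Lℓ Ca Lg La) (hdE : d E = 1)
    (hC : Contractive E ν cfg.Cf cfg.Cb ωF ωB) (hI : Inputs a cfg w₁ b D ν T J Q M c η δ)
    (hE : 0 < E) (k e : ℕ) (h1 : 1 ≤ e) (hk : e + k = E) :
    ∃ β, BwdBound a cfg w₁ b D ν T J Q e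
      (bwdConst E Ca Lg La M c k / (1 - ωF) ^ (E - 1) / (1 - ωB) ^ k) β := by
  have hJ := hI.J_nonneg
  have hQ := hI.Q_nonneg
  have hM := hI.M_nonneg
  have hCa := hS.Ca_nonneg hE
  have hKm := moveConst_nonneg (E := E) (La := La) hM hI.move_dom.1
  have hpF : 0 < 1 - ωF := by linarith [hC.ωF_mem.2]
  have hpF1 : 1 - ωF ≤ 1 := by linarith [hC.ωF_mem.1]
  obtain ⟨hω0, hω1⟩ := hC.ωB_mem
  have hp : 0 < 1 - ωB := by linarith
  have hp1 : 1 - ωB ≤ 1 := by linarith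
  induction k generalizing e with
  | zero =>
    obtain rfl : e = E := by omega
    refine ⟨fun _ => 0, fun _ => le_rfl, fun n _ => ?_, Dom.zero hJ hQ (by simp [bwdConst])⟩
    have h0 : bwdDev a cfg w₁ b n e = fun _ => 0 := by funext s; exact bwdDev_last n s
    rw [h0]
    exact L2Le.const le_rfl
  | succ k ih =>
    obtain ⟨β, hβ⟩ := ih (e + 1) (by omega) (by omega)
    obtain ⟨θ, hθ0, hθ, hθd⟩ := exists_backMove hS hC hI
    set Kb := E * (1 + Ca) ^ E * |Lg| with hKb
    have hKb0 : 0 ≤ Kb := by positivity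
    set K := bwdConst E Ca Lg La M c k with hKdef
    have hK0 : 0 ≤ K := bwdConst_nonneg hCa hM hI.move_dom.1 k
    set P := (1 - ωF) ^ (E - 1) with hP
    have hP0 : 0 < P := by positivity
    have hP1 : P ≤ 1 := pow_le_one₀ hpF.le hpF1
    -- A message compares two consecutive iterations, so the deviation of the next link enters both
    -- now and with a delay.
    set g : ℕ → ℝ := fun n => (if n = 0 then (1 + Ca) ^ E * J else 0)
      + (Ca * (β n + Dom.delay β n) + Kb * θ n) with hg
    have hdβ0 : ∀ n, 0 ≤ Dom.delay β n := by
      rintro (_ | n); exacts [le_rfl, hβ.nonneg n]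
    have hg1 : ∀ n, 0 ≤ Ca * (β n + Dom.delay β n) + Kb * θ n := fun n => by
      have := hβ.nonneg n; have := hdβ0 n; have := hθ0 n; positivity
    have hg0 : ∀ n, 0 ≤ g n := fun n => by
      have := hg1 n
      simp only [hg]; split_ifs <;> positivity
    have hgd : Dom T J Q ((2 * Ca * K + (Kb * moveConst E La M c + (1 + Ca) ^ E))
        / P / (1 - ωB) ^ k) g := by
      have h1 : Dom T J Q ((1 + Ca) ^ E) fun n => if n = 0 then (1 + Ca) ^ E * J else 0 :=
        Dom.impulse hJ hQ (by positivity)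
      refine (h1.add hQ (((hβ.dom.add hQ hβ.dom.delayed).const_mul hCa).add hQ
        (hθd.const_mul hKb0))).mono_const hJ hQ ?_
      have e1 : (1 + Ca) ^ E ≤ (1 + Ca) ^ E / P / (1 - ωB) ^ k :=
        (le_div_pow (by positivity) hpF hpF1 (E - 1)).trans (le_div_pow (by positivity) hp hp1 k)
      have e2 : moveConst E La M c / P ≤ moveConst E La M c / P / (1 - ωB) ^ k :=
        le_div_pow (by positivity) hp hp1 k
      have e3 := mul_le_mul_of_nonneg_left e2 hKb0
      calc _ ≤ (1 + Ca) ^ E / P / (1 - ωB) ^ k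
            + (Ca * (K / P / (1 - ωB) ^ k + K / P / (1 - ωB) ^ k)
            + Kb * (moveConst E La M c / P / (1 - ωB) ^ k)) := by
            gcongr
        _ = _ := by ring
    have hα0 := geomFilter_nonneg hω0 hg0
    have herr : ∀ n, n < T → L2Le (runLaw B D ν) (bwdErr a cfg w₁ b n e) (geomFilter ωB g n) := by
      intro n hn
      induction n with
      | zero =>
        have h2 : L2Le (runLaw B D ν) (bwdMsg a cfg w₁ b 0 e) (Ca * β 0 + (1 + Ca) ^ E * J) :=
          (((hβ.dev 0 hn).const_mul hCa).add (hI.init.const_mul (by positivity))).mono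
            (measurable_bwdMsg hS hC 0 e h1 (by omega)).aestronglyMeasurable fun s => by
              rw [abs_of_nonneg (bwdMsg_nonneg ..)]; exact bwdMsg_zero_le hS hdE (by omega) s
        refine (l2Le_bwdErr hS hC h1 (by omega) h2).mono_bound
          ((mul_le_of_le_one_left h2.nonneg hω1.le).trans ?_)
        have := mul_nonneg hKb0 (hθ0 0)
        simp only [geomFilter, hg, if_true, Dom.delay]
        linarith
      | succ n ih2 =>
        have h2 : L2Le (runLaw B D ν) (bwdMsg a cfg w₁ b (n + 1) e)
            (Ca * (β (n + 1) + β n) + Kb * θ (n + 1) + geomFilter ωB g n) :=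
          (((((hβ.dev (n + 1) hn).add (hβ.dev n (by omega))).const_mul hCa).add
            ((hθ n hn).const_mul hKb0)).add (ih2 (by omega))).mono
            (measurable_bwdMsg hS hC (n + 1) e h1 (by omega)).aestronglyMeasurable fun s => by
              rw [abs_of_nonneg (bwdMsg_nonneg ..)]
              exact bwdMsg_succ_le hS hdE n h1 (by omega) s
        refine (l2Le_bwdErr hS hC h1 (by omega) h2).mono_bound ?_
        have h4 := hg1 (n + 1)
        have h3 : g (n + 1) = Ca * (β (n + 1) + β n) + Kb * θ (n + 1) := by simp [hg, Dom.delay]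
        rw [geomFilter, h3]
        simp only [Dom.delay] at h4
        nlinarith
    refine ⟨fun n => geomFilter ωB g n + Ca * β n, fun n => ?_, fun n hn => ?_, ?_⟩
    · have := hα0 n; have := hβ.nonneg n; positivity
    · exact ((herr n hn).add ((hβ.dev n hn).const_mul hCa)).mono
        (measurable_bwdDev hS hC n e h1 (by omega)).aestronglyMeasurable fun s => by
          rw [abs_of_nonneg (bwdDev_nonneg ..)]; exact bwdDev_le hS n (by omega) s
    · refine ((hgd.filtered hω0 hω1).add hQ (hβ.dom.const_mul hCa)).mono_const hJ hQ ?_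
      have e1 : K / P / (1 - ωB) ^ k ≤ K / P / (1 - ωB) ^ (k + 1) := by
        refine div_le_div_of_nonneg_left (by positivity) (by positivity) ?_
        exact pow_le_pow_of_le_one hp.le hp1 (by omega)
      have e2 := mul_le_mul_of_nonneg_left e1 hCa
      -- In the factor `3 * Ca`, two units come from the message and one from the deviation that
      -- passes through the layer directly.
      rw [div_div _ _ (1 - ωB), ← pow_succ, bwdConst]
      refine (add_le_add_right e2 _).trans (le_of_eq ?_)
      ring

/-- The deviation of the gradient estimate from the gradient of the loss of the sample. -/
def gradDev (a : Layers d dw) (cfg : Config d Ξ) (w₁ : Weights E dw) (b : Fin B) (n : ℕ)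
    (s : ℕ → IterSeed B d Ξ) : ℝ :=
  ‖gradEstimate a cfg (n + 1) (run a cfg w₁ s n) (s (n + 1)) b
    - paramGrad a (act a ((run a cfg w₁ s (n + 1)).x b) (run a cfg w₁ s n).w)
      (run a cfg w₁ s n).w‖

-- The intermediate point is `paramGrad` at the communicated activations. On one side the deviations
-- of the communicated gradients remain; on the other, the forward errors, through Lipschitz
-- continuity of back-propagation.
omit [MeasurableSpace Ξ] [IsProbabilityMeasure D] in
theorem gradDev_le (hS : Smooth E a D Lℓ Ca Lg La) (hdE : d E = 1) (hE : 0 < E) (n : ℕ)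
    (s : ℕ → IterSeed B d Ξ) :
    gradDev a cfg w₁ b n s ≤ ∑ e : Fin E, Ca * bwdDev a cfg w₁ b n (e + 1) s
      + E * ((E + 1) * (1 + Ca) ^ (E + 1) * |Lg|) * (E * (1 + |La|) ^ E)
        * ∑ i ∈ Finset.range (E - 1), fwdErr a cfg w₁ b n i s := by
  have hCa := hS.Ca_nonneg hE
  have hL := abs_nonneg La
  set ys := (run a cfg w₁ s (n + 1)).y b with hys
  set w := (run a cfg w₁ s n).w with hw
  set x := (run a cfg w₁ s (n + 1)).x b with hx
  have hF : 0 ≤ ∑ i ∈ Finset.range (E - 1), fwdErr a cfg w₁ b n i s :=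
    Finset.sum_nonneg fun i _ => fwdErr_nonneg n i s
  have h1 : ‖gradEstimate a cfg (n + 1) (run a cfg w₁ s n) (s (n + 1)) b - paramGrad a ys w‖
      ≤ ∑ e : Fin E, Ca * bwdDev a cfg w₁ b n (e + 1) s := by
    refine (norm_weights_le_sum _).trans (Finset.sum_le_sum fun e _ => ?_)
    have : (gradEstimate a cfg (n + 1) (run a cfg w₁ s n) (s (n + 1)) b - paramGrad a ys w) e =
        ContinuousLinearMap.adjoint (jac2 a e (ys e) (block w e))
          ((run a cfg w₁ s (n + 1)).v b (e + 1)
            - backprop a w ys (E - (e + 1)) (e + 1)) := by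
      rw [map_sub]; rfl
    rw [this]
    exact norm_adjoint_apply_le (hS.jac2_le e e.2 _ _) _
  -- `rfl` works because the communicated activation number `0` is the sample itself.
  have h2 := hS.norm_paramGrad_sub_le hdE ys (act a x w) rfl w w
  have h3 : actDist ys (act a x w) w w ≤ E * (1 + |La|) ^ E
      * ∑ i ∈ Finset.range (E - 1), fwdErr a cfg w₁ b n i s := by
    rw [actDist, sub_self, norm_zero, add_zero, mul_assoc]
    calc ∑ i ∈ Finset.Ico 1 E, ‖ys i - act a x w i‖
        ≤ ∑ _i ∈ Finset.Ico 1 E, (1 + |La|) ^ E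
          * ∑ i ∈ Finset.range (E - 1), fwdErr a cfg w₁ b n i s := by
          refine Finset.sum_le_sum fun i hi => ?_
          have hi' := (Finset.mem_Ico.1 hi).2
          refine (hS.norm_sub_act_le ys w i hi').trans ?_
          refine mul_le_mul (pow_le_pow_right₀ (by linarith) hi'.le) ?_
            (Finset.sum_nonneg fun _ _ => norm_nonneg _) (by positivity)
          exact Finset.sum_le_sum_of_subset_of_nonneg
            (Finset.range_subset_range.2 (by omega)) fun _ _ _ => fwdErr_nonneg ..
      _ ≤ _ := by
          rw [Finset.sum_const, nsmul_eq_mul, Nat.card_Ico]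
          have : ((E - 1 : ℕ) : ℝ) ≤ E := by exact_mod_cast Nat.sub_le E 1
          gcongr
  refine (norm_sub_le_norm_sub_add_norm_sub _ (paramGrad a ys w) _).trans (add_le_add h1 ?_)
  rw [mul_assoc (_ * _)]
  exact h2.trans (mul_le_mul_of_nonneg_left h3 (by positivity))

omit [IsProbabilityMeasure D] [IsProbabilityMeasure ν] in
theorem measurable_gradDev (hS : Smooth E a D Lℓ Ca Lg La)
    (hC : Contractive E ν cfg.Cf cfg.Cb ωF ωB) (n : ℕ) :
    Measurable (gradDev a cfg w₁ b n) :=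
  ((MeasurableState.gradEstimate hS hC (measurableState_run hS hC w₁ n)
    (measurable_pi_apply (n + 1)) (n + 1) b).sub (hS.measurable_paramGrad
      (fun e he => hS.measurable_act ((measurableState_run hS hC w₁ (n + 1)).x b)
        (measurableState_run hS hC w₁ n).w e he.le)
      (measurableState_run hS hC w₁ n).w)).norm

/-- The constant of the bound for `gradDev`. -/
def gradConst (E : ℕ) (Ca Lg La M c : ℝ) : ℝ :=
  ∑ e : Fin E, Ca * bwdConst E Ca Lg La M c (E - (e + 1))
    + E * ((E + 1) * (1 + Ca) ^ (E + 1) * |Lg|) * (E * (1 + |La|) ^ E)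
      * ∑ i ∈ Finset.range (E - 1), fwdConst La M c (i + 1)

/-- The contraction of the whole pipeline. -/
def pipeRate (E : ℕ) (ωF ωB : ℝ) : ℝ := (1 - ωF) ^ (E - 1) * (1 - ωB) ^ (E - 1)

/-- The links carry various powers of `1 - ωF` and `1 - ωB`; all are at least the full product
`pipeRate`, which becomes the common denominator. -/
theorem exists_gradBound (hS : Smooth E a D Lℓ Ca Lg La) (hdE : d E = 1)
    (hC : Contractive E ν cfg.Cf cfg.Cb ωF ωB) (hI : Inputs a cfg w₁ b D ν T J Q M c η δ)
    (hE : 0 < E) :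
    ∃ β : ℕ → ℝ, (∀ n, 0 ≤ β n) ∧
      (∀ n, n < T → L2Le (runLaw B D ν) (gradDev a cfg w₁ b n) (β n)) ∧
      Dom T J Q (gradConst E Ca Lg La M c / pipeRate E ωF ωB) β := by
  have hJ := hI.J_nonneg
  have hQ := hI.Q_nonneg
  have hCa := hS.Ca_nonneg hE
  have hF0 : 0 < 1 - ωF := by linarith [hC.ωF_mem.2]
  have hF1 : 1 - ωF ≤ 1 := by linarith [hC.ωF_mem.1]
  have hB0 : 0 < 1 - ωB := by linarith [hC.ωB_mem.2]
  have hB1 : 1 - ωB ≤ 1 := by linarith [hC.ωB_mem.1]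
  have hκ : 0 < pipeRate E ωF ωB := by unfold pipeRate; positivity
  choose α hα using fun i : Fin (E - 1) => exists_fwdErrBound hS hC hI i (by omega)
  choose β hβ using fun e : Fin E =>
    exists_bwdBound hS hdE hC hI hE (E - (e + 1)) (e + 1) (by omega) (by omega)
  set K := E * ((E + 1) * (1 + Ca) ^ (E + 1) * |Lg|) * (E * (1 + |La|) ^ E) with hK
  have hK0 : 0 ≤ K := by positivity
  refine ⟨fun n => ∑ e, Ca * β e n + K * ∑ i, α i n, fun n => ?_, fun n hn => ?_, ?_⟩
  · exact add_nonneg (Finset.sum_nonneg fun e _ => mul_nonneg hCa ((hβ e).nonneg n))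
      (mul_nonneg hK0 (Finset.sum_nonneg fun i _ => (hα i).nonneg n))
  · refine ((L2Le.sum _ fun e _ => ((hβ e).dev n hn).const_mul hCa).add
      ((L2Le.sum Finset.univ fun i _ => (hα i).err n hn).const_mul hK0)).mono
      (measurable_gradDev hS hC n).aestronglyMeasurable fun s => ?_
    rw [abs_of_nonneg (show 0 ≤ gradDev a cfg w₁ b n s from norm_nonneg _)]
    refine (gradDev_le hS hdE hE n s).trans (le_of_eq ?_)
    rw [Finset.sum_range]
  · refine ((Dom.sum hJ hQ _ fun e _ => (hβ e).dom.const_mul hCa).add hQ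
      ((Dom.sum hJ hQ Finset.univ fun i _ => (hα i).dom).const_mul hK0)).mono_const hJ hQ ?_
    rw [gradConst, add_div, Finset.sum_div, mul_div_assoc, Finset.sum_div, Finset.sum_range]
    refine add_le_add (Finset.sum_le_sum fun e _ => ?_)
      (mul_le_mul_of_nonneg_left (Finset.sum_le_sum fun i _ => ?_) hK0)
    · rw [mul_div_assoc, div_div]
      refine mul_le_mul_of_nonneg_left (div_le_div_of_nonneg_left
        (bwdConst_nonneg hCa hI.M_nonneg hI.move_dom.1 _) hκ ?_) hCa
      exact mul_le_mul_of_nonneg_left (pow_le_pow_of_le_one hB0.le hB1 (by omega)) (by positivity)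
    · refine div_le_div_of_nonneg_left (fwdConst_nonneg hI.M_nonneg hI.move_dom.1 _) hκ ?_
      exact (mul_le_of_le_one_right (by positivity) (pow_le_one₀ hB0.le hB1)).trans
        (pow_le_pow_of_le_one hF0.le hF1 (by omega))

end BackwardErrors

/-! ### Lazy sampling -/

section Sampling

variable {E B : ℕ} {d dw : ℕ → ℕ} {Ξ : Type*}

/-- The uniform variable which decides whether the entry `b` is drawn afresh. -/
def coin (rule : SamplingRule) (b : Fin B) (σ : IterSeed B d Ξ) : unitInterval :=
  match rule with
  | .sampleWise => (σ.2 b).2.1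
  | .batchWise => σ.1

/-- The probability of a fresh sample in iteration `t`. -/
def freshRate (p : ℝ) (t : ℕ) : ℝ := if t = 1 then 1 else lazyRate p t

theorem freshRate_le_two {p : ℝ} {t : ℕ} (h1 : 1 ≤ t) (h2 : t ≤ 2) : freshRate p t = 1 := by
  interval_cases t <;> simp [freshRate, lazyRate]

theorem freshRate_of_three_le {p : ℝ} {t : ℕ} (h : 3 ≤ t) : freshRate p t = p := by
  rw [freshRate, if_neg (by omega), lazyRate, if_neg (by omega)]

theorem freshRate_mem {p : ℝ} (h0 : 0 ≤ p) (h1 : p ≤ 1) (t : ℕ) :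
    freshRate p t ∈ Set.Icc (0 : ℝ) 1 := by
  unfold freshRate lazyRate
  split_ifs <;> simp [h0, h1]

theorem fresh_iff (cfg : Config d Ξ) (t : ℕ) (σ : IterSeed B d Ξ) (b : Fin B) :
    Fresh cfg t σ b ↔ (coin cfg.rule b σ : ℝ) ≤ freshRate cfg.p t := by
  unfold Fresh coin freshRate
  by_cases ht : t = 1
  · simp only [ht, true_or, if_true, true_iff]
    exact (coin cfg.rule b σ).2.2
  · simp only [ht, false_or, if_false]
    cases cfg.rule <;> rfl

open Classical in
/-- The batch of iteration `t`, given the previous one. -/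
def selectBatch (cfg : Config d Ξ) (t : ℕ) (X : Fin B → Act d 0) (σ : IterSeed B d Ξ) :
    Fin B → Act d 0 :=
  fun b => if Fresh cfg t σ b then (σ.2 b).1 else X b

theorem run_succ_x (a : Layers d dw) (cfg : Config d Ξ) (w₁ : Weights E dw) (n : ℕ)
    (s : ℕ → IterSeed B d Ξ) :
    (run a cfg w₁ s (n + 1)).x = selectBatch cfg (n + 1) (run a cfg w₁ s n).x (s (n + 1)) := rfl

theorem volume_coin_le {r : ℝ} (hr : r ∈ Set.Icc (0 : ℝ) 1) :
    volume {c : unitInterval | (c : ℝ) ≤ r} = ENNReal.ofReal r := by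
  have : {c : unitInterval | (c : ℝ) ≤ r} = Set.Iic ⟨r, hr⟩ := rfl
  rw [this, unitInterval.volume_Iic]

variable [MeasurableSpace Ξ]

theorem measurable_coin (rule : SamplingRule) (b : Fin B) :
    Measurable (coin rule b : IterSeed B d Ξ → unitInterval) := by
  cases rule
  · exact ((measurable_pi_apply b).comp measurable_snd).snd.fst
  · exact measurable_fst

theorem measurable_selectBatch (cfg : Config d Ξ) (t : ℕ) :
    Measurable fun p : (Fin B → Act d 0) × IterSeed B d Ξ => selectBatch cfg t p.1 p.2 :=
  measurable_pi_iff.2 fun b => Measurable.ite (measurableSet_fresh cfg t measurable_snd b)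
    (by fun_prop) (by fun_prop)

variable (D : Measure (Act d 0)) (ν : Measure Ξ) [IsProbabilityMeasure D] [IsProbabilityMeasure ν]

theorem measurePreserving_coin_sample (rule : SamplingRule) (b : Fin B) :
    MeasurePreserving (fun σ : IterSeed B d Ξ => (coin rule b σ, (σ.2 b).1)) (iterLaw B D ν)
      (volume.prod D) := by
  have h1 : MeasurePreserving (fun σ : IterSeed B d Ξ => (σ.1, σ.2 b)) (iterLaw B D ν)
      (volume.prod (sampleLaw D ν)) :=
    (MeasurePreserving.id _).prod (measurePreserving_eval (fun _ : Fin B => sampleLaw D ν) b)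
  cases rule
  · have h2 : MeasurePreserving (fun z : SampleSeed d Ξ => (z.2.1, z.1)) (sampleLaw D ν)
        (volume.prod D) :=
      Measure.measurePreserving_swap.comp
        ((MeasurePreserving.id D).prod measurePreserving_fst)
    exact h2.comp (measurePreserving_snd.comp h1)
  · exact ((MeasurePreserving.id _).prod measurePreserving_fst).comp h1

/-- The variables which decide the batch: the coins and the candidate samples. -/
theorem measurePreserving_coins_samples :
    MeasurePreserving (fun σ : IterSeed B d Ξ => ((σ.1, fun b => (σ.2 b).2.1), fun b => (σ.2 b).1))
      (iterLaw B D ν)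
      (((volume : Measure unitInterval).prod (Measure.pi fun _ : Fin B => volume)).prod
        (Measure.pi fun _ : Fin B => D)) := by
  have h2 : MeasurePreserving (fun z : SampleSeed d Ξ => (z.2.1, z.1)) (sampleLaw D ν)
      (volume.prod D) :=
    Measure.measurePreserving_swap.comp
      ((MeasurePreserving.id D).prod measurePreserving_fst)
  have h3 := (measurePreserving_arrowProdEquivProdArrow unitInterval (Act d 0) (Fin B)
    (fun _ => volume) (fun _ => D)).comp
    (measurePreserving_pi (fun _ : Fin B => sampleLaw D ν) _ fun _ => h2)
  exact (MeasurePreserving.symm MeasurableEquiv.prodAssoc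
    (measurePreserving_prodAssoc _ _ _)).comp ((MeasurePreserving.id _).prod h3)

/-- Given the coins, the new batch is a splice of two independent batches with independent entries,
hence again of the same law. Since coins and samples are independent, this covers both sampling
rules. -/
theorem measurePreserving_selectBatch (cfg : Config d Ξ) (t : ℕ) :
    MeasurePreserving (fun p : (Fin B → Act d 0) × IterSeed B d Ξ => selectBatch cfg t p.1 p.2)
      ((Measure.pi fun _ => D).prod (iterLaw B D ν)) (Measure.pi fun _ => D) := by
  classical
  set C := (volume : Measure unitInterval).prod
    (Measure.pi fun _ : Fin B => (volume : Measure unitInterval)) with hC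
  set P := Measure.pi fun _ : Fin B => D with hP
  let A : unitInterval × (Fin B → unitInterval) → Set (Fin B) := fun c =>
    {b | ((match cfg.rule with | .sampleWise => c.2 b | .batchWise => c.1 : unitInterval) : ℝ)
      ≤ freshRate cfg.p t}
  let g : unitInterval × (Fin B → unitInterval) → (Fin B → Act d 0) × (Fin B → Act d 0) →
    (Fin B → Act d 0) := fun c q => (A c).piecewise q.1 q.2
  have hgm : Measurable (Function.uncurry g) := by
    refine measurable_pi_iff.2 fun b => ?_
    refine Measurable.ite (p := fun q : (unitInterval × (Fin B → unitInterval)) ×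
      (Fin B → Act d 0) × (Fin B → Act d 0) => b ∈ A q.1) ?_ (by fun_prop) (by fun_prop)
    simp only [A]
    cases cfg.rule
    · exact measurableSet_le (f := fun q : (unitInterval × (Fin B → unitInterval)) ×
        (Fin B → Act d 0) × (Fin B → Act d 0) => (q.1.2 b : ℝ)) (by fun_prop) measurable_const
    · exact measurableSet_le (f := fun q : (unitInterval × (Fin B → unitInterval)) ×
        (Fin B → Act d 0) × (Fin B → Act d 0) => (q.1.1 : ℝ)) (by fun_prop) measurable_const
  have hg : ∀ c, MeasurePreserving (g c) (P.prod P) P := fun c => by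
    have := measurePreserving_piecewise (fun _ : Fin B => D) (A c)
    rwa [Measure.infinitePi_eq_pi] at this
  have h1 : MeasurePreserving (fun q : (unitInterval × (Fin B → unitInterval)) ×
      (Fin B → Act d 0) × (Fin B → Act d 0) => g q.1 q.2) (C.prod (P.prod P)) P :=
    measurePreserving_snd.comp
      (MeasurePreserving.skew_product (MeasurePreserving.id C) hgm (.of_forall fun c => (hg c).map_eq))
  have h2 : MeasurePreserving (fun p : (Fin B → Act d 0) × IterSeed B d Ξ =>
      (((p.2.1, fun b => (p.2.2 b).2.1), (fun b => (p.2.2 b).1), p.1) :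
        (unitInterval × (Fin B → unitInterval)) × (Fin B → Act d 0) × (Fin B → Act d 0)))
      (P.prod (iterLaw B D ν)) (C.prod (P.prod P)) :=
    (measurePreserving_prodAssoc C P P).comp (Measure.measurePreserving_swap.comp
      ((MeasurePreserving.id P).prod (measurePreserving_coins_samples D ν)))
  convert h1.comp h2 using 1
  funext p b
  simp only [selectBatch, fresh_iff, g, Function.comp, Set.piecewise, A, Set.mem_ofPred_eq, coin]

variable {D ν}

/-- The seed of an iteration is independent of the others. -/
theorem lintegral_seed (n : ℕ) {F : (ℕ → IterSeed B d Ξ) × IterSeed B d Ξ → ENNReal}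
    (hF : Measurable F) (hF' : ∀ s σ σ', F (Function.update s n σ', σ) = F (s, σ)) :
    ∫⁻ s, F (s, s n) ∂runLaw B D ν = ∫⁻ s, ∫⁻ σ, F (s, σ) ∂iterLaw B D ν ∂runLaw B D ν := by
  have h := measurePreserving_update (fun _ : ℕ => iterLaw B D ν) n
  have hm : Measurable fun s : ℕ → IterSeed B d Ξ => F (s, s n) :=
    hF.comp (measurable_id.prodMk (measurable_pi_apply n))
  change ∫⁻ s, F (s, s n) ∂(Measure.infinitePi fun _ : ℕ => iterLaw B D ν) = _
  rw [← h.lintegral_comp hm]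
  simp only [Function.update_self, hF']
  exact lintegral_prod _ hF.aemeasurable

open Classical in
/-- Conditionally on the past, the entry `b` is fresh with probability `freshRate`. -/
theorem lintegral_fresh (cfg : Config d Ξ) (hp0 : 0 ≤ cfg.p) (hp1 : cfg.p ≤ 1) (t : ℕ) (b : Fin B)
    {g : Act d 0 → ENNReal} (hg : Measurable g) (h : ENNReal) :
    ∫⁻ σ, (if Fresh cfg t σ b then g (σ.2 b).1 else h) ∂iterLaw B D ν =
      ENNReal.ofReal (freshRate cfg.p t) * ∫⁻ x, g x ∂D
        + ENNReal.ofReal (1 - freshRate cfg.p t) * h := by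
  have hr := freshRate_mem hp0 hp1 t
  set r := freshRate cfg.p t
  have hA : MeasurableSet {c : unitInterval | (c : ℝ) ≤ r} :=
    measurableSet_le (by fun_prop) measurable_const
  have hm : Measurable fun q : unitInterval × Act d 0 => if (q.1 : ℝ) ≤ r then g q.2 else h :=
    Measurable.ite (measurableSet_le (by fun_prop) measurable_const) (by fun_prop)
      measurable_const
  simp only [fresh_iff]
  rw [(measurePreserving_coin_sample D ν cfg.rule b).lintegral_comp hm,
    lintegral_prod _ hm.aemeasurable]
  have : ∀ c : unitInterval, ∫⁻ x, (if (c : ℝ) ≤ r then g x else h) ∂D =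
      {c : unitInterval | (c : ℝ) ≤ r}.indicator (fun _ => ∫⁻ x, g x ∂D) c
        + {c : unitInterval | (c : ℝ) ≤ r}ᶜ.indicator (fun _ => h) c := fun c => by
    by_cases hc : (c : ℝ) ≤ r <;> simp [hc]
  simp only [this]
  rw [lintegral_add_left (measurable_const.indicator hA), lintegral_indicator_const hA,
    lintegral_indicator_const hA.compl, prob_compl_eq_one_sub hA, volume_coin_le hr,
    ENNReal.ofReal_sub _ hr.1, ENNReal.ofReal_one, mul_comm, mul_comm h]

variable {a : Layers d dw} {cfg : Config d Ξ} {w₁ : Weights E dw} {Lℓ Ca Lg La ωF ωB : ℝ}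
  (hS : Smooth E a D Lℓ Ca Lg La) (hC : Contractive E ν cfg.Cf cfg.Cb ωF ωB)

omit [MeasurableSpace Ξ] in
theorem run_update (n : ℕ) (s : ℕ → IterSeed B d Ξ) (σ : IterSeed B d Ξ) :
    run a cfg w₁ (Function.update s (n + 1) σ) n = run a cfg w₁ s n :=
  run_congr w₁ n fun _ _ => Function.update_of_ne (by omega) _ _

include hS hC

/-- The samples of an iteration are independent, with law `D`. -/
theorem measurePreserving_batch (n : ℕ) :
    MeasurePreserving (fun s => (run a cfg w₁ s (n + 1)).x) (runLaw B D ν)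
      (Measure.pi fun _ => D) := by
  induction n with
  | zero =>
    have h1 : MeasurePreserving (fun σ : IterSeed B d Ξ => fun b => (σ.2 b).1) (iterLaw B D ν)
        (Measure.pi fun _ => D) :=
      measurePreserving_snd.comp (measurePreserving_coins_samples D ν)
    convert h1.comp (measurePreserving_eval_infinitePi (fun _ : ℕ => iterLaw B D ν) 1) using 1
    · funext s b
      rw [run_succ_x, selectBatch]
      exact if_pos (Or.inl rfl)
    · rfl
  | succ n ih =>
    have h1 := measurePreserving_update (fun _ : ℕ => iterLaw B D ν) (n + 2)
    refine MeasurePreserving.of_comp ?_ h1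
      (measurable_pi_iff.2 (measurableState_run hS hC w₁ (n + 2)).x)
    convert (measurePreserving_selectBatch D ν cfg (n + 2)).comp
      (ih.prod (MeasurePreserving.id (iterLaw B D ν))) using 1
    · funext p
      simp only [Function.comp, run_succ_x _ _ _ (n + 1), Function.update_self]
      rw [run_update (n + 1)]
      rfl
    · rfl

theorem measurePreserving_sample (n : ℕ) (b : Fin B) :
    MeasurePreserving (fun s => (run a cfg w₁ s (n + 1)).x b) (runLaw B D ν) D :=
  (measurePreserving_eval (fun _ : Fin B => D) b).comp (measurePreserving_batch hS hC n)

/-- The change of a sample, in mean square. -/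
theorem l2Le_fwdMove_zero (hp0 : 0 ≤ cfg.p) (hp1 : cfg.p ≤ 1) {φ : ℝ} (hφ : SampleSpread D φ)
    (hE : 0 < E) (n : ℕ) (b : Fin B) :
    L2Le (runLaw B D ν) (fwdMove a cfg w₁ b (n + 1) 0) (√(freshRate cfg.p (n + 2)) * |φ|) := by
  classical
  have hr := freshRate_mem hp0 hp1 (n + 2)
  set r := freshRate cfg.p (n + 2) with hrdef
  have hx := (measurableState_run (B := B) hS hC w₁ (n + 1)).x b
  refine L2Le.of_lintegral (by positivity) (measurable_fwdMove hS hC (n + 1) 0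
    hE).aestronglyMeasurable ?_
  let F : (ℕ → IterSeed B d Ξ) × IterSeed B d Ξ → ENNReal := fun q =>
    if Fresh cfg (n + 2) q.2 b then ‖(q.2.2 b).1 - (run a cfg w₁ q.1 (n + 1)).x b‖ₑ ^ 2 else 0
  have hF : Measurable F := by
    refine Measurable.ite (measurableSet_fresh cfg (n + 2) measurable_snd b) ?_ measurable_const
    have : Measurable fun q : (ℕ → IterSeed B d Ξ) × IterSeed B d Ξ =>
      (run a cfg w₁ q.1 (n + 1)).x b := hx.comp measurable_fst
    fun_prop
  have hF' : ∀ s σ σ', F (Function.update s (n + 2) σ', σ) = F (s, σ) := fun s σ σ' => by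
    simp only [F, run_update (n + 1)]
  calc ∫⁻ s, ‖fwdMove a cfg w₁ b (n + 1) 0 s‖ₑ ^ 2 ∂runLaw B D ν
      ≤ ∫⁻ s, F (s, s (n + 2)) ∂runLaw B D ν := by
        refine lintegral_mono fun s => ?_
        have h1 : (run a cfg w₁ s (n + 2)).y b 0 - (run a cfg w₁ s (n + 1)).y b 0 =
            if Fresh cfg (n + 2) (s (n + 2)) b then
              ((s (n + 2)).2 b).1 - (run a cfg w₁ s (n + 1)).x b else 0 := by
          change (run a cfg w₁ s (n + 2)).x b - (run a cfg w₁ s (n + 1)).x b = _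
          rw [run_succ_x _ _ _ (n + 1)]
          unfold selectBatch
          split_ifs <;> simp
        have h2 : ‖fwdMove a cfg w₁ b (n + 1) 0 s‖ₑ ≤
            ‖(run a cfg w₁ s (n + 2)).y b 0 - (run a cfg w₁ s (n + 1)).y b 0‖ₑ := by
          rw [fwdMove, enorm_mul, enorm_norm]
          refine mul_le_of_le_one_left zero_le ?_
          rw [Real.enorm_eq_ofReal (inexact_nonneg ..)]
          exact ENNReal.ofReal_le_one.2 (inexact_le_one ..)
        refine (pow_le_pow_left₀ zero_le h2 2).trans (le_of_eq ?_)
        rw [h1]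
        simp only [F]
        split_ifs <;> simp
    _ = ∫⁻ s, ∫⁻ σ, F (s, σ) ∂iterLaw B D ν ∂runLaw B D ν := lintegral_seed (n + 2) hF hF'
    _ = ∫⁻ s, ENNReal.ofReal r * ∫⁻ x, ‖x - (run a cfg w₁ s (n + 1)).x b‖ₑ ^ 2 ∂D
          ∂runLaw B D ν := by
        refine lintegral_congr fun s => ?_
        simp only [F]
        rw [lintegral_fresh cfg hp0 hp1 (n + 2) b
          (g := fun x => ‖x - (run a cfg w₁ s (n + 1)).x b‖ₑ ^ 2) (by fun_prop) 0]
        simp [hrdef]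
    _ = ∫⁻ x₁, ENNReal.ofReal r * ∫⁻ x, ‖x - x₁‖ₑ ^ 2 ∂D ∂D := by
        have hm : Measurable fun x₁ : Act d 0 =>
            ENNReal.ofReal r * ∫⁻ x, ‖x - x₁‖ₑ ^ 2 ∂D := by
          refine Measurable.const_mul (Measurable.lintegral_prod_right'
            (f := fun q : Act d 0 × Act d 0 => ‖q.2 - q.1‖ₑ ^ 2) (by fun_prop)) _
        exact (measurePreserving_sample hS hC n b).lintegral_comp hm
    _ = ENNReal.ofReal r * ∫⁻ x₁, ∫⁻ x, ‖x₁ - x‖ₑ ^ 2 ∂D ∂D := by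
        rw [lintegral_const_mul _ (Measurable.lintegral_prod_right'
            (f := fun q : Act d 0 × Act d 0 => ‖q.2 - q.1‖ₑ ^ 2) (by fun_prop))]
        simp only [enorm_sub_rev]
    _ ≤ ENNReal.ofReal ((√r * |φ|) ^ 2) := by
        rw [mul_pow, Real.sq_sqrt hr.1, sq_abs, ENNReal.ofReal_mul hr.1]
        exact mul_le_mul_right hφ _

end Sampling

/-! ### The inputs of the two variants, and the error of the averaged gradient estimate. -/

section Momentum

variable {E B : ℕ} {d dw : ℕ → ℕ} {Ξ : Type*} [MeasurableSpace Ξ]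
  {a : Layers d dw} {cfg : Config d Ξ} {w₁ : Weights E dw} {b : Fin B}
  {D : Measure (Act d 0)} {ν : Measure Ξ} [IsProbabilityMeasure D] [IsProbabilityMeasure ν]
  {Lℓ Ca Lg La ωF ωB J q M c : ℝ} {η : ℕ → ℝ}

/-- The part of `Inputs` that does not involve the motion of the parameters. -/
structure SampleInputs (a : Layers d dw) (cfg : Config d Ξ) (w₁ : Weights E dw) (b : Fin B)
    (D : Measure (Act d 0)) [IsProbabilityMeasure D] (ν : Measure Ξ) [IsProbabilityMeasure ν]
    (J q M c : ℝ) (η : ℕ → ℝ) : Prop where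
  J_nonneg : 0 ≤ J
  q_nonneg : 0 ≤ q
  M_nonneg : 0 ≤ M
  move_nonneg : ∀ n, 0 ≤ η n
  move : ∀ n, L2Le (runLaw B D ν) (fwdMove a cfg w₁ b (n + 1) 0) (η (n + 1))
  move_dom : ∀ T : ℕ, Dom T J (T * q) c η
  initAct : ∀ e, 1 ≤ e → e < E → L2Le (runLaw B D ν) (initAct a cfg w₁ b e) (M * J)
  init : L2Le (runLaw B D ν) (inexact cfg b 0) J

/-- A compressed iteration of FU keeps its sample, so there is neither a move of the sample nor a
compressed first message, and all constants are zero. -/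
theorem SampleInputs.of_FU (hv : cfg.variant = .FU) :
    SampleInputs a cfg w₁ b D ν 0 0 0 0 (fun _ => 0) := by
  have h0 : inexact cfg b 0 = fun _ : ℕ → IterSeed B d Ξ => (0 : ℝ) := by
    funext s
    exact if_pos ⟨hv, Or.inl rfl⟩
  refine ⟨le_rfl, le_rfl, le_rfl, fun _ => le_rfl, fun n => ?_,
    fun T => Dom.zero le_rfl (by simp) le_rfl, fun e _ _ => ?_, ?_⟩
  · have : fwdMove a cfg w₁ b (n + 1) 0 = fun _ => (0 : ℝ) := by
      funext s
      by_cases h : Fresh cfg (n + 2) (s (n + 2)) b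
      · have : inexact cfg b (n + 1) s = 0 := if_pos ⟨hv, h⟩
        rw [fwdMove, this, zero_mul]
      · have h1 : (run a cfg w₁ s (n + 2)).y b 0 = (run a cfg w₁ s (n + 1)).y b 0 := by
          change selectBatch cfg (n + 2) (run a cfg w₁ s (n + 1)).x (s (n + 2)) b = _
          rw [selectBatch]
          exact if_neg h
        rw [fwdMove, h1, sub_self, norm_zero, mul_zero]
    rw [this]
    exact L2Le.const le_rfl
  · have : Clapping.initAct a cfg w₁ b e = fun _ => (0 : ℝ) := by
      funext s
      rw [Clapping.initAct, h0, zero_mul]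
    rw [this]
    exact (L2Le.const le_rfl).mono_bound (by simp)
  · rw [h0]
    exact L2Le.const le_rfl

/-- The first two iterations are fresh with certainty and form the `ℓ¹` part, whence `2 * φ`. Later
moves have mean square `p * φ ^ 2` and form the `ℓ²` part. -/
theorem Dom.sample_moves {p φ : ℝ} (hp0 : 0 ≤ p) (hφ : 0 ≤ φ) (T : ℕ) :
    Dom T 1 (T * p) (2 * φ) (fun n => √(freshRate p (n + 1)) * φ) := by
  refine ⟨by positivity, fun n => (if n = 0 then φ else 0) + (if n = 1 then φ else 0),
    fun _ => √p * φ, fun n => ?_, fun n => by positivity, fun n => ?_, ?_, ?_⟩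
  · dsimp only; split_ifs <;> linarith
  · dsimp only
    rcases n with _ | _ | n
    · rw [freshRate_le_two le_rfl (by norm_num)]
      simp; positivity
    · rw [freshRate_le_two (t := 0 + 1 + 1) (by norm_num) (by norm_num)]
      simp; positivity
    · rw [freshRate_of_three_le (t := n + 1 + 1 + 1) (by omega)]
      simp
  · rw [Finset.sum_add_distrib, Finset.sum_ite_eq', Finset.sum_ite_eq']
    split_ifs <;> linarith
  · simp only [Finset.sum_const, Finset.card_range, nsmul_eq_mul, mul_pow, Real.sq_sqrt hp0]
    have : 0 ≤ T * p * φ ^ 2 := by positivity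
    nlinarith

theorem SampleInputs.of_FC (hS : Smooth E a D Lℓ Ca Lg La)
    (hC : Contractive E ν cfg.Cf cfg.Cb ωF ωB) (hE : 0 < E) (hp0 : 0 ≤ cfg.p) (hp1 : cfg.p ≤ 1)
    {φ M : ℝ} (hφ : SampleSpread D φ)
    (hM : ∀ e, 1 ≤ e → e < E → ∫⁻ x, ‖act a x w₁ e‖ₑ ^ 2 ∂D ≤ ENNReal.ofReal (M ^ 2)) :
    SampleInputs a cfg w₁ b D ν 1 cfg.p |M| (2 * |φ|)
      (fun n => √(freshRate cfg.p (n + 1)) * |φ|) := by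
  refine ⟨zero_le_one, hp0, abs_nonneg _, fun n => by positivity,
    fun n => l2Le_fwdMove_zero hS hC hp0 hp1 hφ hE n b,
    Dom.sample_moves hp0 (abs_nonneg φ), fun e h1 he => ?_, ?_⟩
  · have hx := (measurableState_run (B := B) hS hC w₁ 1).x b
    have hact := hS.measurable_act (w := fun _ => w₁) measurable_id measurable_const e he.le
    have h2 : L2Le (runLaw B D ν) (fun s => ‖act a ((run a cfg w₁ s 1).x b) w₁ e‖) |M| := by
      refine L2Le.of_lintegral (abs_nonneg M) (hact.comp hx).norm.aestronglyMeasurable ?_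
      rw [sq_abs]
      refine le_trans (le_of_eq ?_) (hM e h1 he)
      simp only [enorm_norm]
      exact (measurePreserving_sample hS hC 0 b).lintegral_comp (hact.enorm.pow_const 2)
    rw [mul_one]
    refine h2.mono ((measurable_inexact 0).mul (hact.comp hx).norm).aestronglyMeasurable
      fun s => ?_
    rw [Clapping.initAct, abs_of_nonneg (mul_nonneg (inexact_nonneg ..) (norm_nonneg _))]
    exact mul_le_of_le_one_left (norm_nonneg _) (inexact_le_one ..)
  · refine (L2Le.const zero_le_one).mono (measurable_inexact 0).aestronglyMeasurable fun s => ?_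
    rw [abs_of_nonneg (inexact_nonneg ..)]
    exact inexact_le_one ..

theorem Dom.mono_sq {T : ℕ} {J Q Q' C : ℝ} {b : ℕ → ℝ} (h : Dom T J Q C b) (hQ : Q ≤ Q') :
    Dom T J Q' C b := by
  obtain ⟨hC, b', b'', h1, h2, h3, h4, h5⟩ := h
  exact ⟨hC, b', b'', h1, h2, h3, h4, h5.trans (by gcongr)⟩

/-- The moves of the parameters are measured by their true `L²` norms, and their square sum becomes
part of `Q`. The resulting bounds refer back to the run itself; the descent inequality closes the
circle later. -/
theorem SampleInputs.inputs (h : SampleInputs a cfg w₁ b D ν J q M c η) {T : ℕ}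
    (hw : ∀ n, n + 1 < T → ∃ k, L2Le (runLaw B D ν) (wMove a cfg w₁ (n + 1)) k) :
    Inputs a cfg w₁ b D ν T J
      (T * q + ∑ n ∈ Finset.range T, ∫ s, wMove (B := B) a cfg w₁ n s ^ 2 ∂runLaw B D ν) M c η
      (fun n => √(∫ s, wMove (B := B) a cfg w₁ n s ^ 2 ∂runLaw B D ν)) := by
  have h0 : ∀ n, 0 ≤ ∫ s, wMove (B := B) a cfg w₁ n s ^ 2 ∂runLaw B D ν := fun n =>
    integral_nonneg fun _ => sq_nonneg _
  have hq := h.q_nonneg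
  have hs : 0 ≤ ∑ n ∈ Finset.range T, ∫ s, wMove (B := B) a cfg w₁ n s ^ 2 ∂runLaw B D ν :=
    Finset.sum_nonneg fun n _ => h0 n
  refine ⟨h.J_nonneg, by positivity, h.M_nonneg, h.move_nonneg, fun n _ => h.move n,
    (h.move_dom T).mono_sq (by linarith), fun n => Real.sqrt_nonneg _, fun n hn => ?_, ?_,
    h.initAct, h.init⟩
  · obtain ⟨k, hk⟩ := hw n hn
    exact L2Le.of_integrable hk.meas hk.integrable_sq
  · refine ⟨zero_le_one, fun _ => 0, _, fun _ => le_rfl, fun n => Real.sqrt_nonneg _,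
      fun n => (zero_add _).ge, by simpa using h.J_nonneg, ?_⟩
    simp only [Real.sq_sqrt (h0 _)]
    have : 0 ≤ T * q := by positivity
    linarith

variable (a cfg w₁) in
/-- The average of the gradient estimates of iteration `n + 1`. -/
def avgEstimate (n : ℕ) (s : ℕ → IterSeed B d Ξ) : Weights E dw :=
  (B : ℝ)⁻¹ • ∑ b, gradEstimate a cfg (n + 1) (run a cfg w₁ s n) (s (n + 1)) b

variable (a) in
/-- The average of the gradients of the loss over a batch. -/
def batchGrad (X : Fin B → Act d 0) (w : Weights E dw) : Weights E dw :=
  (B : ℝ)⁻¹ • ∑ b, paramGrad a (act a (X b) w) w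

variable (a cfg w₁) in
/-- The error of the average of the gradient estimates of iteration `n + 1`. -/
def meanDev (n : ℕ) (s : ℕ → IterSeed B d Ξ) : ℝ :=
  ‖avgEstimate a cfg w₁ n s - batchGrad a (run a cfg w₁ s (n + 1)).x (run a cfg w₁ s n).w‖

omit [MeasurableSpace Ξ] in
theorem run_succ_u (n : ℕ) (s : ℕ → IterSeed B d Ξ) :
    (run a cfg w₁ s (n + 1)).u = (1 - cfg.m) • (run a cfg w₁ s n).u
      + cfg.m • avgEstimate a cfg w₁ n s := by
  rw [avgEstimate, smul_smul, ← div_eq_mul_inv]; rfl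

omit [MeasurableSpace Ξ] in
theorem run_succ_w (n : ℕ) (s : ℕ → IterSeed B d Ξ) :
    (run a cfg w₁ s (n + 1)).w = (run a cfg w₁ s n).w - cfg.γ • (run a cfg w₁ s (n + 1)).u := rfl

omit [MeasurableSpace Ξ] in
theorem wMove_succ (n : ℕ) (s : ℕ → IterSeed B d Ξ) :
    wMove a cfg w₁ (n + 1) s = |cfg.γ| * ‖(run a cfg w₁ s (n + 1)).u‖ := by
  rw [wMove, Nat.add_sub_cancel, run_succ_w, sub_sub_cancel_left, norm_neg, norm_smul,
    Real.norm_eq_abs]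

omit [MeasurableSpace Ξ] in
theorem meanDev_le (n : ℕ) (s : ℕ → IterSeed B d Ξ) :
    meanDev a cfg w₁ n s ≤ (B : ℝ)⁻¹ * ∑ b, gradDev a cfg w₁ b n s := by
  rw [meanDev, avgEstimate, batchGrad, ← smul_sub, ← Finset.sum_sub_distrib, norm_smul,
    Real.norm_eq_abs, abs_of_nonneg (by positivity)]
  exact mul_le_mul_of_nonneg_left (norm_sum_le _ _) (by positivity)

omit [IsProbabilityMeasure D] in
theorem norm_batchGrad_le (hS : Smooth E a D Lℓ Ca Lg La) (hdE : d E = 1) (hE : 0 < E)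
    (X : Fin B → Act d 0) (w : Weights E dw) :
    ‖batchGrad a X w‖ ≤ E * (1 + Ca) ^ (E + 1) := by
  have hCa := hS.Ca_nonneg hE
  rw [batchGrad, norm_smul, Real.norm_eq_abs, abs_of_nonneg (by positivity)]
  have h1 : ‖∑ b, paramGrad a (act a (X b) w) w‖ ≤ B * (E * (1 + Ca) ^ (E + 1)) := by
    refine (norm_sum_le _ _).trans ((Finset.sum_le_card_nsmul _ _ _ fun b _ =>
      hS.norm_paramGrad_le hdE (act a (X b) w) w).trans (le_of_eq ?_))
    simp
  rcases Nat.eq_zero_or_pos B with rfl | hB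
  · simp; positivity
  · rw [inv_mul_le_iff₀ (by exact_mod_cast hB)]
    exact h1

omit [IsProbabilityMeasure D] in
theorem measurable_batchGrad (hS : Smooth E a D Lℓ Ca Lg La) {Ω : Type*} [MeasurableSpace Ω] {X : Ω → Fin B → Act d 0}
    {w : Ω → Weights E dw} (hX : ∀ b, Measurable fun ω => X ω b) (hw : Measurable w) :
    Measurable fun ω => batchGrad a (X ω) (w ω) :=
  (Finset.measurable_fun_sum _ fun b _ => hS.measurable_paramGrad
    (fun e he => hS.measurable_act (hX b) hw e he.le) hw).const_smul ((B : ℝ)⁻¹)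

section

variable (hS : Smooth E a D Lℓ Ca Lg La) (hC : Contractive E ν cfg.Cf cfg.Cb ωF ωB)
include hS hC

omit [IsProbabilityMeasure D] [IsProbabilityMeasure ν] in
theorem measurable_avgEstimate (n : ℕ) : Measurable (avgEstimate (B := B) a cfg w₁ n) :=
  (Finset.measurable_fun_sum _ fun b _ => MeasurableState.gradEstimate hS hC
    (measurableState_run hS hC w₁ n) (measurable_pi_apply (n + 1)) (n + 1) b).const_smul
      ((B : ℝ)⁻¹)

omit [IsProbabilityMeasure D] [IsProbabilityMeasure ν] in
theorem measurable_meanDev (n : ℕ) : Measurable (meanDev (B := B) a cfg w₁ n) :=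
  ((measurable_avgEstimate hS hC n).sub (measurable_batchGrad hS
    (measurableState_run hS hC w₁ (n + 1)).x (measurableState_run hS hC w₁ n).w)).norm

/-- Only finiteness matters here: second moments of the moves must exist before their integrals can
serve as bounds. Finite moments up to iteration `n` bound the error of iteration `n + 1`, hence its
momentum. -/
theorem l2Le_momentum (hdE : d E = 1) (hE : 0 < E)
    (hI : ∀ b : Fin B, SampleInputs a cfg w₁ b D ν J q M c η) (n : ℕ) :
    ∃ k, L2Le (runLaw B D ν) (fun s => ‖(run a cfg w₁ s n).u‖) k := by
  induction n using Nat.strong_induction_on with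
  | _ n ih =>
  rcases n with _ | n
  · have : (fun s : ℕ → IterSeed B d Ξ => ‖(run a cfg w₁ s 0).u‖) = fun _ => 0 := by
      funext s; simp [run, State.init]
    rw [this]; exact ⟨0, L2Le.const le_rfl⟩
  -- With horizon `n + 1` only moves made up to iteration `n` are needed, which is what the strong
  -- induction provides.
  · have hw : ∀ i, i + 1 < n + 1 → ∃ k, L2Le (runLaw B D ν) (wMove a cfg w₁ (i + 1)) k := by
      intro i hi
      obtain ⟨k, hk⟩ := ih (i + 1) hi
      refine ⟨|cfg.γ| * k, ?_⟩
      simp only [funext (wMove_succ (a := a) (cfg := cfg) (w₁ := w₁) i)]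
      exact hk.const_mul (abs_nonneg _)
    choose β hβ0 hβ _ using fun b =>
      exists_gradBound hS hdE hC ((hI b).inputs hw) hE
    obtain ⟨k, hk⟩ := ih n (Nat.lt_succ_self n)
    have h1 := (L2Le.sum Finset.univ fun b _ => hβ b n (Nat.lt_succ_self n)).const_mul
      (k := (B : ℝ)⁻¹) (by positivity)
    have hG : 0 ≤ E * (1 + Ca) ^ (E + 1) := by have := hS.Ca_nonneg hE; positivity
    have h2 := (hk.const_mul (abs_nonneg (1 - cfg.m))).add
      ((h1.add (L2Le.const hG)).const_mul (abs_nonneg cfg.m))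
    refine ⟨_, h2.mono (measurableState_run hS hC w₁ (n + 1)).u.norm.aestronglyMeasurable
      fun s => ?_⟩
    rw [abs_norm, run_succ_u]
    refine (norm_add_le _ _).trans (add_le_add (norm_smul_le _ _) ?_)
    refine (norm_smul_le _ _).trans (mul_le_mul_of_nonneg_left ?_ (abs_nonneg _))
    have h3 := norm_le_norm_sub_add (avgEstimate a cfg w₁ n s)
      (batchGrad a (run a cfg w₁ s (n + 1)).x (run a cfg w₁ s n).w)
    exact h3.trans (add_le_add (meanDev_le n s) (norm_batchGrad_le hS hdE hE _ _))

theorem l2Le_wMove (hdE : d E = 1) (hE : 0 < E)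
    (hI : ∀ b : Fin B, SampleInputs a cfg w₁ b D ν J q M c η) (n : ℕ) :
    ∃ k, L2Le (runLaw B D ν) (wMove (B := B) a cfg w₁ (n + 1)) k := by
  obtain ⟨k, hk⟩ := l2Le_momentum hS hC hdE hE hI (n + 1)
  refine ⟨|cfg.γ| * k, ?_⟩
  simp only [funext (wMove_succ (a := a) (cfg := cfg) (w₁ := w₁) n)]
  exact hk.const_mul (abs_nonneg _)

/-- The errors of the entries are averaged by the triangle inequality alone. Compression gains
nothing from the size of the batch, and the rates do not ask for it. -/
theorem exists_meanDev_bound (hdE : d E = 1) (hE : 0 < E) (hB : 0 < B)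
    (hI : ∀ b : Fin B, SampleInputs a cfg w₁ b D ν J q M c η) (T : ℕ) :
    ∃ β : ℕ → ℝ, (∀ n, 0 ≤ β n) ∧
      (∀ n, n < T → L2Le (runLaw B D ν) (meanDev (B := B) a cfg w₁ n) (β n)) ∧
      Dom T J (T * q + ∑ n ∈ Finset.range T, ∫ s, wMove (B := B) a cfg w₁ n s ^ 2 ∂runLaw B D ν)
        (gradConst E Ca Lg La M c / pipeRate E ωF ωB) β := by
  have hJ := (hI ⟨0, hB⟩).J_nonneg
  have hB' : (B : ℝ) ≠ 0 := by exact_mod_cast hB.ne'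
  have hin := fun b => (hI b).inputs (T := T) fun n _ => l2Le_wMove hS hC hdE hE hI n
  have hQ := (hin ⟨0, hB⟩).Q_nonneg
  choose β hβ0 hβ hd using fun b => exists_gradBound hS hdE hC (hin b) hE
  refine ⟨fun n => (B : ℝ)⁻¹ * ∑ b, β b n, fun n => ?_, fun n hn => ?_, ?_⟩
  · exact mul_nonneg (by positivity) (Finset.sum_nonneg fun b _ => hβ0 b n)
  · refine ((L2Le.sum Finset.univ fun b _ => hβ b n hn).const_mul (by positivity)).mono
      (measurable_meanDev hS hC n).aestronglyMeasurable fun s => ?_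
    rw [abs_of_nonneg (show 0 ≤ meanDev a cfg w₁ n s from norm_nonneg _)]
    exact meanDev_le n s
  · refine ((Dom.sum hJ hQ Finset.univ fun b _ => hd b).const_mul (by positivity)).mono_const
      hJ hQ (le_of_eq ?_)
    rw [Finset.sum_const, Finset.card_univ, Fintype.card_fin, nsmul_eq_mul]
    field_simp

end

end Momentum

/-! ### Bounded measurable functions -/

section Bounded

variable {Ω Ω' V : Type*} [MeasurableSpace Ω] [MeasurableSpace Ω'] [NormedAddCommGroup V]
  [MeasurableSpace V] [BorelSpace V] [SecondCountableTopology V]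

/-- A bounded measurable function. -/
structure BddMeas (f : Ω → V) : Prop where
  meas : Measurable f
  bdd : ∃ C, ∀ ω, ‖f ω‖ ≤ C

namespace BddMeas

variable {f g : Ω → V}

omit [BorelSpace V] [SecondCountableTopology V] in
theorem const (v : V) : BddMeas fun _ : Ω => v := ⟨measurable_const, ‖v‖, fun _ => le_rfl⟩

theorem add (hf : BddMeas f) (hg : BddMeas g) : BddMeas fun ω => f ω + g ω := by
  obtain ⟨C, hC⟩ := hf.bdd
  obtain ⟨C', hC'⟩ := hg.bdd
  exact ⟨hf.meas.add hg.meas, C + C', fun ω => (norm_add_le _ _).trans (add_le_add (hC ω) (hC' ω))⟩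

theorem sub (hf : BddMeas f) (hg : BddMeas g) : BddMeas fun ω => f ω - g ω := by
  obtain ⟨C, hC⟩ := hf.bdd
  obtain ⟨C', hC'⟩ := hg.bdd
  exact ⟨hf.meas.sub hg.meas, C + C', fun ω => (norm_sub_le _ _).trans (add_le_add (hC ω) (hC' ω))⟩

omit [SecondCountableTopology V] in
theorem smul [NormedSpace ℝ V] (hf : BddMeas f) (k : ℝ) : BddMeas fun ω => k • f ω := by
  obtain ⟨C, hC⟩ := hf.bdd
  refine ⟨hf.meas.const_smul k, |k| * C, fun ω => ?_⟩
  rw [norm_smul, Real.norm_eq_abs]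
  exact mul_le_mul_of_nonneg_left (hC ω) (abs_nonneg k)

theorem mul {f g : Ω → ℝ} (hf : BddMeas f) (hg : BddMeas g) : BddMeas fun ω => f ω * g ω := by
  obtain ⟨C, hC⟩ := hf.bdd
  obtain ⟨C', hC'⟩ := hg.bdd
  refine ⟨hf.meas.mul hg.meas, C * C', fun ω => ?_⟩
  rw [norm_mul]
  exact mul_le_mul (hC ω) (hC' ω) (norm_nonneg _) ((norm_nonneg _).trans (hC ω))

omit [SecondCountableTopology V] in
theorem norm (hf : BddMeas f) : BddMeas fun ω => ‖f ω‖ := by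
  obtain ⟨C, hC⟩ := hf.bdd
  exact ⟨hf.meas.norm, C, fun ω => by rw [norm_norm]; exact hC ω⟩

omit [SecondCountableTopology V] in
theorem norm_sq (hf : BddMeas f) : BddMeas fun ω => ‖f ω‖ ^ 2 := by
  simp only [sq]
  exact hf.norm.mul hf.norm

theorem sum {ι : Type*} (s : Finset ι) {f : ι → Ω → V} (h : ∀ i ∈ s, BddMeas (f i)) :
    BddMeas fun ω => ∑ i ∈ s, f i ω := by
  classical
  induction s using Finset.induction_on with
  | empty => simpa using const (0 : V)
  | insert i s hi ih =>
    simp only [Finset.sum_insert hi]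
    exact (h i (by simp)).add (ih fun j hj => h j (by simp [hj]))

omit [BorelSpace V] [SecondCountableTopology V] in
theorem comp (hf : BddMeas f) {φ : Ω' → Ω} (hφ : Measurable φ) : BddMeas fun ω => f (φ ω) :=
  ⟨hf.meas.comp hφ, hf.bdd.imp fun _ h _ => h _⟩

omit [BorelSpace V] [SecondCountableTopology V] in
theorem ite (hf : BddMeas f) (hg : BddMeas g) {P : Ω → Prop} [DecidablePred P]
    (hP : MeasurableSet {ω | P ω}) : BddMeas fun ω => if P ω then f ω else g ω := by
  obtain ⟨C, hC⟩ := hf.bdd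
  obtain ⟨C', hC'⟩ := hg.bdd
  refine ⟨Measurable.ite hP hf.meas hg.meas, max C C', fun ω => ?_⟩
  split_ifs
  exacts [(hC ω).trans (le_max_left ..), (hC' ω).trans (le_max_right ..)]

theorem integrable (hf : BddMeas f) {μ : Measure Ω} [IsFiniteMeasure μ] : Integrable f μ := by
  obtain ⟨C, hC⟩ := hf.bdd
  exact Integrable.of_bound hf.meas.aestronglyMeasurable C (.of_forall hC)

end BddMeas

end Bounded

/-! ### Independent sums -/

section IndependentSums

variable {Ω V : Type*} [MeasurableSpace Ω] [NormedAddCommGroup V] [InnerProductSpace ℝ V]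
  [CompleteSpace V] [SecondCountableTopology V] [MeasurableSpace V] [BorelSpace V]

theorem integral_norm_add_sq {μ : Measure Ω} [IsProbabilityMeasure μ] {f : Ω → V} (hf : BddMeas f)
    (A : V) : ∫ ω, ‖A + f ω‖ ^ 2 ∂μ =
      ‖A‖ ^ 2 + 2 * inner ℝ A (∫ ω, f ω ∂μ) + ∫ ω, ‖f ω‖ ^ 2 ∂μ := by
  have h1 : Integrable (fun ω => 2 * inner ℝ A (f ω)) μ :=
    (hf.integrable.const_inner A).const_mul 2
  simp only [norm_add_sq_real]
  rw [integral_add (by fun_prop) hf.norm_sq.integrable, integral_add (by fun_prop) h1,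
    integral_const_mul, integral_inner hf.integrable]
  simp

omit [InnerProductSpace ℝ V] [CompleteSpace V] [SecondCountableTopology V] [MeasurableSpace V]
  [BorelSpace V] in
theorem integral_eval_pi [NormedSpace ℝ V] {B : ℕ} {ρ : Measure Ω} [IsProbabilityMeasure ρ]
    (b : Fin B) {f : Ω → V} (hf : AEStronglyMeasurable f ρ) :
    ∫ ω, f (ω b) ∂(Measure.pi fun _ : Fin B => ρ) = ∫ ω, f ω ∂ρ := by
  have hev := measurePreserving_eval (fun _ : Fin B => ρ) b
  have h := integral_map (μ := Measure.pi fun _ : Fin B => ρ) (φ := Function.eval b)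
    (measurable_pi_apply b).aemeasurable (f := f) (by rw [hev.map_eq]; exact hf)
  rw [hev.map_eq] at h
  exact h.symm

theorem integral_norm_sum_sq_pi {B : ℕ} {ρ : Measure Ω} [IsProbabilityMeasure ρ]
    {g : Fin B → Ω → V} (hg : ∀ b, BddMeas (g b)) (h0 : ∀ b, ∫ ω, g b ω ∂ρ = 0) :
    ∫ ω, ‖∑ b, g b (ω b)‖ ^ 2 ∂(Measure.pi fun _ : Fin B => ρ) = ∑ b, ∫ ω, ‖g b ω‖ ^ 2 ∂ρ := by
  classical
  set P := Measure.pi fun _ : Fin B => ρ with hP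
  have hG : ∀ b, BddMeas fun ω : Fin B → Ω => g b (ω b) := fun b =>
    (hg b).comp (measurable_pi_apply b)
  have hmul : ∀ b b', Integrable (fun ω => inner ℝ (g b (ω b)) (g b' (ω b'))) P := by
    intro b b'
    obtain ⟨C, hC⟩ := (hg b).bdd
    obtain ⟨C', hC'⟩ := (hg b').bdd
    refine Integrable.of_bound ((hG b).meas.inner (hG b').meas).aestronglyMeasurable (C * C')
      (.of_forall fun ω => ?_)
    exact (norm_inner_le_norm _ _).trans (mul_le_mul (hC _) (hC' _) (norm_nonneg _)
      ((norm_nonneg _).trans (hC (ω b))))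
  have hind : ∀ b b', b ≠ b' → ∫ ω, inner ℝ (g b (ω b)) (g b' (ω b')) ∂P = 0 := by
    intro b b' hb
    have h1 := (ProbabilityTheory.iIndepFun_pi (μ := fun _ : Fin B => ρ) (X := g)
      fun i => (hg i).meas.aemeasurable).indepFun hb
    have h2 : ∫ ω, inner ℝ (g b (ω b)) (g b' (ω b')) ∂P =
        inner ℝ (∫ ω, g b (ω b) ∂P) (∫ ω, g b' (ω b') ∂P) :=
      h1.integral_bilin (hG b).integrable (hG b').integrable (innerSL ℝ)
    rw [h2, integral_eval_pi b (hg b).meas.aestronglyMeasurable, h0, inner_zero_left]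
  simp only [← real_inner_self_eq_norm_sq, sum_inner, inner_sum]
  rw [integral_finsetSum _ fun b _ => integrable_finsetSum _ fun b' _ => hmul b' b]
  refine Finset.sum_congr rfl fun b _ => ?_
  rw [integral_finsetSum _ fun b' _ => hmul b' b, Finset.sum_eq_single b
    (fun b' _ hb' => hind b' b hb') (by simp)]
  simp only [real_inner_self_eq_norm_sq]
  exact integral_eval_pi b (f := fun ω => ‖g b ω‖ ^ 2) (hg b).norm_sq.meas.aestronglyMeasurable

/-- The second moment of an independent sum. -/
theorem integral_norm_add_sum_sq_pi {B : ℕ} {ρ : Measure Ω} [IsProbabilityMeasure ρ]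
    {g : Fin B → Ω → V} (hg : ∀ b, BddMeas (g b)) (A : V) :
    ∫ ω, ‖A + ∑ b, g b (ω b)‖ ^ 2 ∂(Measure.pi fun _ : Fin B => ρ) =
      ‖A + ∑ b, ∫ ω, g b ω ∂ρ‖ ^ 2
        + ∑ b, (∫ ω, ‖g b ω‖ ^ 2 ∂ρ - ‖∫ ω, g b ω ∂ρ‖ ^ 2) := by
  set m : Fin B → V := fun b => ∫ ω, g b ω ∂ρ with hm
  have hc : ∀ b, BddMeas fun ω => g b ω - m b := fun b => (hg b).sub (.const _)
  have hc0 : ∀ b, ∫ ω, (g b ω - m b) ∂ρ = 0 := fun b => by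
    rw [integral_sub (hg b).integrable (integrable_const _)]; simp [hm]
  have hsum : BddMeas fun ω : Fin B → Ω => ∑ b, (g b (ω b) - m b) :=
    BddMeas.sum _ fun b _ => (hc b).comp (measurable_pi_apply b)
  have e1 : ∀ ω : Fin B → Ω, A + ∑ b, g b (ω b) = (A + ∑ b, m b) + ∑ b, (g b (ω b) - m b) :=
    fun ω => by rw [Finset.sum_sub_distrib]; abel
  simp only [e1]
  rw [integral_norm_add_sq hsum, integral_norm_sum_sq_pi hc hc0]
  have e2 : ∫ ω : Fin B → Ω, ∑ b, (g b (ω b) - m b) ∂(Measure.pi fun _ : Fin B => ρ) = 0 := by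
    rw [integral_finsetSum _ fun b _ => ((hc b).comp (measurable_pi_apply b)).integrable]
    refine Finset.sum_eq_zero fun b _ => ?_
    rw [← hc0 b]
    exact integral_eval_pi b (hc b).meas.aestronglyMeasurable
  rw [e2, inner_zero_right, mul_zero, add_zero]
  congr 1
  refine Finset.sum_congr rfl fun b _ => ?_
  have h := integral_norm_add_sq (μ := ρ) (hg b) (-(m b))
  have e3 : ∀ ω, -(m b) + g b ω = g b ω - m b := fun ω => by abel
  simp only [e3] at h
  rw [h, norm_neg, inner_neg_left]
  change _ + 2 * -inner ℝ (m b) (m b) + _ = _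
  rw [real_inner_self_eq_norm_sq]
  ring

end IndependentSums

/-! ### One step of lazy sampling -/

section OneStep

theorem MeasurePreserving.integral_comp_meas {α β V : Type*} [MeasurableSpace α]
    [MeasurableSpace β] [NormedAddCommGroup V] [NormedSpace ℝ V] {μ : Measure α} {ν : Measure β}
    {f : α → β} (hf : MeasurePreserving f μ ν) {g : β → V} (hg : AEStronglyMeasurable g ν) :
    ∫ x, g (f x) ∂μ = ∫ y, g y ∂ν := by
  rw [← hf.map_eq] at hg ⊢
  exact (integral_map hf.measurable.aemeasurable hg).symm

variable {V : Type*} [NormedAddCommGroup V]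

/-- The average over a batch. -/
def avg [NormedSpace ℝ V] {B : ℕ} (c : Fin B → V) : V := (B : ℝ)⁻¹ • ∑ b, c b

theorem norm_avg_le [NormedSpace ℝ V] {B : ℕ} {c : Fin B → V} {C : ℝ} (hC : 0 ≤ C)
    (h : ∀ b, ‖c b‖ ≤ C) : ‖avg c‖ ≤ C := by
  rw [avg, norm_smul, Real.norm_eq_abs, abs_of_nonneg (by positivity)]
  have h1 : ‖∑ b, c b‖ ≤ B * C :=
    (norm_sum_le _ _).trans ((Finset.sum_le_card_nsmul _ _ _ fun b _ => h b).trans (by simp))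
  rcases Nat.eq_zero_or_pos B with rfl | hB
  · simpa using hC
  · rw [inv_mul_le_iff₀ (by exact_mod_cast hB)]
    exact h1

theorem avg_sub [NormedSpace ℝ V] {B : ℕ} (c c' : Fin B → V) :
    avg (fun b => c b - c' b) = avg c - avg c' := by
  simp only [avg, Finset.sum_sub_distrib, smul_sub]

/-- The part of the size of the noise which a resampling step contracts. -/
def spread [NormedSpace ℝ V] (rule : SamplingRule) {B : ℕ} (c : Fin B → V) : ℝ :=
  match rule with
  | .sampleWise => (B : ℝ)⁻¹ ^ 2 * ∑ b, ‖c b‖ ^ 2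
  | .batchWise => ‖avg c‖ ^ 2

theorem spread_nonneg [NormedSpace ℝ V] (rule : SamplingRule) {B : ℕ} (c : Fin B → V) :
    0 ≤ spread rule c := by
  cases rule <;> unfold spread <;> positivity

theorem norm_add_sq_le_young {x y : V} {θ : ℝ} (hθ : 0 < θ) :
    ‖x + y‖ ^ 2 ≤ (1 + θ) * ‖x‖ ^ 2 + (1 + 1 / θ) * ‖y‖ ^ 2 := by
  have h1 : ‖x + y‖ ^ 2 ≤ (‖x‖ + ‖y‖) ^ 2 := pow_le_pow_left₀ (norm_nonneg _) (norm_add_le _ _) 2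
  have h2 : (1 + θ) * ‖x‖ ^ 2 + (1 + 1 / θ) * ‖y‖ ^ 2 - (‖x‖ + ‖y‖) ^ 2 =
      (θ * ‖x‖ - ‖y‖) ^ 2 / θ := by field_simp; ring
  have : 0 ≤ (θ * ‖x‖ - ‖y‖) ^ 2 / θ := by positivity
  linarith

theorem spread_le_young [NormedSpace ℝ V] (rule : SamplingRule) {B : ℕ} {c c' : Fin B → V}
    {θ e : ℝ} (hθ : 0 < θ) (he : 0 ≤ e) (h : ∀ b, ‖c b - c' b‖ ≤ e) :
    spread rule c ≤ (1 + θ) * spread rule c' + (1 + 1 / θ) * e ^ 2 := by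
  have hb : ∀ b, ‖c b‖ ^ 2 ≤ (1 + θ) * ‖c' b‖ ^ 2 + (1 + 1 / θ) * e ^ 2 := fun b => by
    have h1 := norm_add_sq_le_young (x := c' b) (y := c b - c' b) hθ
    rw [add_sub_cancel] at h1
    have h2 : ‖c b - c' b‖ ^ 2 ≤ e ^ 2 := pow_le_pow_left₀ (norm_nonneg _) (h b) 2
    have : (1 + 1 / θ) * ‖c b - c' b‖ ^ 2 ≤ (1 + 1 / θ) * e ^ 2 := by gcongr
    linarith
  cases rule with
  | batchWise =>
    have h1 := norm_add_sq_le_young (x := avg c') (y := avg c - avg c') hθ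
    rw [add_sub_cancel] at h1
    have h2 : ‖avg c - avg c'‖ ^ 2 ≤ e ^ 2 := by
      rw [← avg_sub]; exact pow_le_pow_left₀ (norm_nonneg _) (norm_avg_le he h) 2
    have : (1 + 1 / θ) * ‖avg c - avg c'‖ ^ 2 ≤ (1 + 1 / θ) * e ^ 2 := by gcongr
    simp only [spread]
    linarith
  | sampleWise =>
    simp only [spread]
    have h1 : ∑ b, ‖c b‖ ^ 2 ≤ (1 + θ) * ∑ b, ‖c' b‖ ^ 2 + B * ((1 + 1 / θ) * e ^ 2) := by
      refine (Finset.sum_le_sum fun b _ => hb b).trans (le_of_eq ?_)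
      rw [Finset.sum_add_distrib, ← Finset.mul_sum]; simp
    have h2 : (B : ℝ)⁻¹ ^ 2 * B ≤ 1 := by
      rcases Nat.eq_zero_or_pos B with rfl | hB
      · simp
      · have : (1 : ℝ) ≤ B := by exact_mod_cast hB
        have h3 : (B : ℝ)⁻¹ ^ 2 * B = (B : ℝ)⁻¹ := by field_simp
        rw [h3]; exact inv_le_one_of_one_le₀ this
    have h3 : 0 ≤ (1 + 1 / θ) * e ^ 2 := by positivity
    calc _ ≤ (B : ℝ)⁻¹ ^ 2 * ((1 + θ) * ∑ b, ‖c' b‖ ^ 2 + B * ((1 + 1 / θ) * e ^ 2)) := by gcongr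
      _ = (1 + θ) * ((B : ℝ)⁻¹ ^ 2 * ∑ b, ‖c' b‖ ^ 2)
          + (B : ℝ)⁻¹ ^ 2 * B * ((1 + 1 / θ) * e ^ 2) := by ring
      _ ≤ _ := by nlinarith

variable [InnerProductSpace ℝ V] [CompleteSpace V] [SecondCountableTopology V] [MeasurableSpace V]
  [BorelSpace V] {B : ℕ} {d : ℕ → ℕ} {Ξ : Type*} [MeasurableSpace Ξ]

theorem integral_coin_prod {α : Type*} [MeasurableSpace α] {P : Measure α} [IsProbabilityMeasure P]
    {r : ℝ} (hr : r ∈ Set.Icc (0 : ℝ) 1) {f : α → V} (hf : BddMeas f) (v : V) :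
    ∫ q : unitInterval × α, (if (q.1 : ℝ) ≤ r then f q.2 else v) ∂(volume.prod P) =
      r • ∫ x, f x ∂P + (1 - r) • v := by
  have hm : MeasurableSet {q : unitInterval × α | (q.1 : ℝ) ≤ r} :=
    measurableSet_le (by fun_prop) measurable_const
  have hA : MeasurableSet {c : unitInterval | (c : ℝ) ≤ r} :=
    measurableSet_le (by fun_prop) measurable_const
  rw [integral_prod _ ((hf.comp measurable_snd).ite (.const v) hm).integrable]
  have : ∀ c : unitInterval, ∫ x, (if (c : ℝ) ≤ r then f x else v) ∂P =
      {c : unitInterval | (c : ℝ) ≤ r}.indicator (fun _ => ∫ x, f x ∂P) c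
        + {c : unitInterval | (c : ℝ) ≤ r}ᶜ.indicator (fun _ => v) c := fun c => by
    by_cases hc : (c : ℝ) ≤ r <;> simp [hc]
  simp only [this]
  rw [integral_add ((integrable_const _).indicator hA) ((integrable_const _).indicator hA.compl),
    integral_indicator_const _ hA, integral_indicator_const _ hA.compl,
    measureReal_compl hA, measureReal_def, volume_coin_le hr]
  simp [ENNReal.toReal_ofReal hr.1]

/-- A bounded centered function of a sample. -/
structure Centered (D : Measure (Act d 0)) (N : Act d 0 → V) (σ : ℝ) : Prop where
  bdd : BddMeas N
  mean : ∫ x, N x ∂D = 0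
  var : ∫ x, ‖N x‖ ^ 2 ∂D ≤ σ ^ 2

variable {D : Measure (Act d 0)} [IsProbabilityMeasure D] {ν : Measure Ξ} [IsProbabilityMeasure ν]
  {N : Act d 0 → V} {σ : ℝ}

theorem Centered.integral_batch_le (hN : Centered D N σ) (hB : 0 < B) (A : V) (k : ℝ) :
    ∫ Y, ‖A + k • avg (fun b => N (Y b))‖ ^ 2 ∂(Measure.pi fun _ : Fin B => D) ≤
      ‖A‖ ^ 2 + k ^ 2 * (σ ^ 2 / B) := by
  have h := integral_norm_add_sum_sq_pi (ρ := D) (B := B) (g := fun _ x => (k * (B : ℝ)⁻¹) • N x)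
    (fun _ => hN.bdd.smul _) A
  simp only [integral_smul, hN.mean, smul_zero, Finset.sum_const_zero, add_zero, norm_zero,
    norm_smul, mul_pow, integral_const_mul, ← Finset.smul_sum] at h
  simp only [avg, smul_smul]
  rw [h]
  simp only [Finset.sum_const, Finset.card_univ, Fintype.card_fin, nsmul_eq_mul,
    Real.norm_eq_abs, sq_abs]
  have hB' : (0 : ℝ) < B := by exact_mod_cast hB
  have e1 : (B : ℝ) * (((k * (B : ℝ)⁻¹) ^ 2 * ∫ x, ‖N x‖ ^ 2 ∂D) - 0 ^ 2) =
      k ^ 2 * ((∫ x, ‖N x‖ ^ 2 ∂D) / B) := by field_simp; ring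
  rw [e1]
  have := hN.var
  gcongr

variable (cfg : Config d Ξ) (t : ℕ)

omit [MeasurableSpace Ξ] in
theorem selectBatch_apply {W : Type*} (X : Fin B → Act d 0) (s : IterSeed B d Ξ) (b : Fin B)
    (N : Act d 0 → W) : N (selectBatch cfg t X s b) =
      if (coin cfg.rule b s : ℝ) ≤ freshRate cfg.p t then N (s.2 b).1 else N (X b) := by
  unfold selectBatch
  by_cases h : Fresh cfg t s b
  · rw [if_pos h, if_pos ((fresh_iff ..).1 h)]
  · rw [if_neg h, if_neg (mt (fresh_iff ..).2 h)]

omit [MeasurableSpace Ξ] in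
theorem selectBatch_batchWise {W : Type*} (hr : cfg.rule = .batchWise) (X : Fin B → Act d 0)
    (s : IterSeed B d Ξ) (b : Fin B) (N : Act d 0 → W) : N (selectBatch cfg t X s b) =
      if (s.1 : ℝ) ≤ freshRate cfg.p t then N (s.2 b).1 else N (X b) := by
  rw [selectBatch_apply cfg t X s b N, hr]; rfl

omit [MeasurableSpace Ξ] in
theorem selectBatch_sampleWise {W : Type*} (hr : cfg.rule = .sampleWise) (X : Fin B → Act d 0)
    (s : IterSeed B d Ξ) (b : Fin B) (N : Act d 0 → W) : N (selectBatch cfg t X s b) =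
      if ((s.2 b).2.1 : ℝ) ≤ freshRate cfg.p t then N (s.2 b).1 else N (X b) := by
  rw [selectBatch_apply cfg t X s b N, hr]; rfl

variable (D ν) in
theorem measurePreserving_coin_batch :
    MeasurePreserving (fun s : IterSeed B d Ξ => (s.1, fun b => (s.2 b).1)) (iterLaw B D ν)
      (volume.prod (Measure.pi fun _ : Fin B => D)) :=
  (MeasurePreserving.id _).prod
    (measurePreserving_pi (fun _ : Fin B => sampleLaw D ν) _ fun _ => measurePreserving_fst)

/-- Bias and variance. The conditional mean of the new noise is `1 - r` times the noise of the old
batch. Under the sample-wise rule the entries are conditionally independent and their variances add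
up; under the batch-wise rule one coin mixes a new average with the old one. `spread` is chosen so
that both cases give the same formula. -/
theorem Centered.integral_step_le (hN : Centered D N σ) (hB : 0 < B) (hp0 : 0 ≤ cfg.p)
    (hp1 : cfg.p ≤ 1) (X : Fin B → Act d 0) (A : V) (k : ℝ) :
    ∫ s, ‖A + k • avg (fun b => N (selectBatch cfg t X s b))‖ ^ 2 ∂iterLaw B D ν ≤
      ‖A + (k * (1 - freshRate cfg.p t)) • avg (fun b => N (X b))‖ ^ 2
        + k ^ 2 * freshRate cfg.p t *
          (σ ^ 2 / B + (1 - freshRate cfg.p t) * spread cfg.rule fun b => N (X b)) := by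
  have hr := freshRate_mem hp0 hp1 t
  set r := freshRate cfg.p t with hrdef
  obtain ⟨hr0, hr1⟩ := hr
  have hB' : (0 : ℝ) < B := by exact_mod_cast hB
  have hσ := hN.var
  cases hrule : cfg.rule with
  | batchWise =>
    simp only [selectBatch_batchWise cfg t hrule X _ _ N, ← hrdef, spread]
    set c := avg fun b => N (X b) with hc
    set F : (Fin B → Act d 0) → ℝ := fun Y => ‖A + k • avg (fun b => N (Y b))‖ ^ 2 with hF
    have hFb : BddMeas F := ((BddMeas.const A).add (((BddMeas.sum Finset.univ fun b _ =>
      hN.bdd.comp (measurable_pi_apply b)).smul ((B : ℝ)⁻¹)).smul k)).norm_sq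
    have e1 : ∀ s : IterSeed B d Ξ, ‖A + k • avg (fun b => if (s.1 : ℝ) ≤ r then N (s.2 b).1
        else N (X b))‖ ^ 2 = if (s.1 : ℝ) ≤ r then F (fun b => (s.2 b).1)
        else ‖A + k • c‖ ^ 2 := fun s => by split_ifs <;> rfl
    simp only [e1]
    have hm : MeasurableSet {q : unitInterval × (Fin B → Act d 0) | (q.1 : ℝ) ≤ r} :=
      measurableSet_le (by fun_prop) measurable_const
    rw [MeasurePreserving.integral_comp_meas (measurePreserving_coin_batch D ν)
      (g := fun q => if (q.1 : ℝ) ≤ r then F q.2 else ‖A + k • c‖ ^ 2)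
      ((hFb.comp measurable_snd).ite (.const _) hm).meas.aestronglyMeasurable,
      integral_coin_prod ⟨hr0, hr1⟩ hFb]
    have h1 := hN.integral_batch_le hB A k
    -- Mean and variance of a variable equal to `A` with probability `r` and to `A + k • c`
    -- otherwise.
    have h2 : ‖A + (k * (1 - r)) • c‖ ^ 2 + k ^ 2 * r * ((1 - r) * ‖c‖ ^ 2) =
        r * ‖A‖ ^ 2 + (1 - r) * ‖A + k • c‖ ^ 2 := by
      simp only [norm_add_sq_real, inner_smul_right, norm_smul, mul_pow, Real.norm_eq_abs, sq_abs]
      ring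
    have h4 := mul_le_mul_of_nonneg_left h1 hr0
    simp only [smul_eq_mul]
    simp only [hF] at h4 ⊢
    linarith
  | sampleWise =>
    simp only [selectBatch_sampleWise cfg t hrule X _ _ N, ← hrdef, spread]
    let g : Fin B → SampleSeed d Ξ → V := fun b z =>
      (k * (B : ℝ)⁻¹) • (if (z.2.1 : ℝ) ≤ r then N z.1 else N (X b))
    have hm : MeasurableSet {z : SampleSeed d Ξ | (z.2.1 : ℝ) ≤ r} :=
      measurableSet_le (by fun_prop) measurable_const
    have hg : ∀ b, BddMeas (g b) := fun b =>
      ((hN.bdd.comp measurable_fst).ite (.const _) hm).smul _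
    have e1 : ∀ s : IterSeed B d Ξ, A + k • avg (fun b => if ((s.2 b).2.1 : ℝ) ≤ r then
        N (s.2 b).1 else N (X b)) = A + ∑ b, g b (s.2 b) := fun s => by
      simp only [avg, g, smul_smul, Finset.smul_sum]
    simp only [e1]
    have hsum : BddMeas fun z : Fin B → SampleSeed d Ξ => ‖A + ∑ b, g b (z b)‖ ^ 2 :=
      ((BddMeas.const A).add (BddMeas.sum Finset.univ fun b _ =>
        (hg b).comp (measurable_pi_apply b))).norm_sq
    rw [MeasurePreserving.integral_comp_meas (μ := iterLaw B D ν) measurePreserving_snd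
      (g := fun z => ‖A + ∑ b, g b (z b)‖ ^ 2) hsum.meas.aestronglyMeasurable,
      integral_norm_add_sum_sq_pi hg A]
    have hsw : MeasurePreserving (fun z : SampleSeed d Ξ => (z.2.1, z.1)) (sampleLaw D ν)
        (volume.prod D) :=
      Measure.measurePreserving_swap.comp ((MeasurePreserving.id D).prod measurePreserving_fst)
    have hm2 : MeasurableSet {q : unitInterval × Act d 0 | (q.1 : ℝ) ≤ r} :=
      measurableSet_le (by fun_prop) measurable_const
    have mean : ∀ b, ∫ z, g b z ∂sampleLaw D ν = (k * (B : ℝ)⁻¹ * (1 - r)) • N (X b) := fun b => by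
      simp only [g]
      rw [integral_smul, MeasurePreserving.integral_comp_meas hsw
        (g := fun q => if (q.1 : ℝ) ≤ r then N q.2 else N (X b))
        ((hN.bdd.comp measurable_snd).ite (.const _) hm2).meas.aestronglyMeasurable,
        integral_coin_prod ⟨hr0, hr1⟩ hN.bdd, hN.mean, smul_zero, zero_add, smul_smul]
    have var : ∀ b, ∫ z, ‖g b z‖ ^ 2 ∂sampleLaw D ν =
        (k * (B : ℝ)⁻¹) ^ 2 * (r * ∫ x, ‖N x‖ ^ 2 ∂D + (1 - r) * ‖N (X b)‖ ^ 2) := fun b => by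
      have e2 : ∀ z : SampleSeed d Ξ, ‖g b z‖ ^ 2 = (k * (B : ℝ)⁻¹) ^ 2 *
          (if (z.2.1 : ℝ) ≤ r then ‖N z.1‖ ^ 2 else ‖N (X b)‖ ^ 2) := fun z => by
        simp only [g]
        rw [norm_smul, mul_pow, Real.norm_eq_abs, sq_abs]
        split_ifs <;> rfl
      simp only [e2]
      rw [integral_const_mul, MeasurePreserving.integral_comp_meas hsw
        (g := fun q => if (q.1 : ℝ) ≤ r then ‖N q.2‖ ^ 2 else ‖N (X b)‖ ^ 2)
        ((hN.bdd.norm_sq.comp measurable_snd).ite (.const _) hm2).meas.aestronglyMeasurable,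
        integral_coin_prod ⟨hr0, hr1⟩ hN.bdd.norm_sq]
      rfl
    simp only [mean, var]
    have e3 : ∑ b, (k * (B : ℝ)⁻¹ * (1 - r)) • N (X b) = (k * (1 - r)) • avg fun b => N (X b) := by
      rw [avg, smul_smul, Finset.smul_sum]
      exact Finset.sum_congr rfl fun b _ => by congr 1; ring
    rw [e3]
    refine add_le_add le_rfl ?_
    calc ∑ b, ((k * (B : ℝ)⁻¹) ^ 2 * (r * ∫ x, ‖N x‖ ^ 2 ∂D + (1 - r) * ‖N (X b)‖ ^ 2)
          - ‖(k * (B : ℝ)⁻¹ * (1 - r)) • N (X b)‖ ^ 2)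
        ≤ ∑ b, (k * (B : ℝ)⁻¹) ^ 2 * r * (σ ^ 2 + (1 - r) * ‖N (X b)‖ ^ 2) := by
          refine Finset.sum_le_sum fun b _ => ?_
          rw [norm_smul, mul_pow ‖_‖, Real.norm_eq_abs, sq_abs]
          have h1 : 0 ≤ (k * (B : ℝ)⁻¹) ^ 2 := sq_nonneg _
          have h2 : r * ∫ x, ‖N x‖ ^ 2 ∂D ≤ r * σ ^ 2 := mul_le_mul_of_nonneg_left hσ hr0
          have h4 := mul_le_mul_of_nonneg_left h2 h1
          linarith
      _ = _ := by
          rw [← Finset.mul_sum, Finset.sum_add_distrib, ← Finset.mul_sum]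
          simp only [Finset.sum_const, Finset.card_univ, Fintype.card_fin, nsmul_eq_mul]
          field_simp

theorem Centered.integral_spread_le (hN : Centered D N σ) (hB : 0 < B) (hp0 : 0 ≤ cfg.p)
    (hp1 : cfg.p ≤ 1) (X : Fin B → Act d 0) :
    ∫ s, spread cfg.rule (fun b => N (selectBatch cfg t X s b)) ∂iterLaw B D ν ≤
      freshRate cfg.p t * (σ ^ 2 / B)
        + (1 - freshRate cfg.p t) * spread cfg.rule fun b => N (X b) := by
  have hr := freshRate_mem hp0 hp1 t
  set r := freshRate cfg.p t with hrdef
  have hB' : (0 : ℝ) < B := by exact_mod_cast hB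
  have hσ := hN.var
  cases hrule : cfg.rule with
  | batchWise =>
    simp only [selectBatch_batchWise cfg t hrule X _ _ N, ← hrdef, spread]
    set c := avg fun b => N (X b) with hc
    set F : (Fin B → Act d 0) → ℝ := fun Y => ‖avg (fun b => N (Y b))‖ ^ 2 with hF
    have hFb : BddMeas F := ((BddMeas.sum Finset.univ fun b _ =>
      hN.bdd.comp (measurable_pi_apply b)).smul ((B : ℝ)⁻¹)).norm_sq
    have e1 : ∀ s : IterSeed B d Ξ, ‖avg (fun b => if (s.1 : ℝ) ≤ r then N (s.2 b).1
        else N (X b))‖ ^ 2 = if (s.1 : ℝ) ≤ r then F (fun b => (s.2 b).1)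
        else ‖c‖ ^ 2 := fun s => by split_ifs <;> rfl
    simp only [e1]
    have hm : MeasurableSet {q : unitInterval × (Fin B → Act d 0) | (q.1 : ℝ) ≤ r} :=
      measurableSet_le (by fun_prop) measurable_const
    rw [MeasurePreserving.integral_comp_meas (measurePreserving_coin_batch D ν)
      (g := fun q => if (q.1 : ℝ) ≤ r then F q.2 else ‖c‖ ^ 2)
      ((hFb.comp measurable_snd).ite (.const _) hm).meas.aestronglyMeasurable,
      integral_coin_prod hr hFb]
    have h1 := hN.integral_batch_le hB 0 1
    simp only [zero_add, one_smul, norm_zero, one_pow, one_mul] at h1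
    have h4 := mul_le_mul_of_nonneg_left h1 hr.1
    simp only [smul_eq_mul]
    simp only [hF] at h4 ⊢
    simp only [ne_eq, OfNat.ofNat_ne_zero, not_false_eq_true, zero_pow, zero_add] at h4
    linarith
  | sampleWise =>
    simp only [spread]
    have hm2 : MeasurableSet {q : unitInterval × Act d 0 | (q.1 : ℝ) ≤ r} :=
      measurableSet_le (by fun_prop) measurable_const
    have e2 : ∀ (s : IterSeed B d Ξ) (b : Fin B), ‖N (selectBatch cfg t X s b)‖ ^ 2 =
        if (coin cfg.rule b s : ℝ) ≤ r then ‖N (s.2 b).1‖ ^ 2 else ‖N (X b)‖ ^ 2 := fun s b =>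
      selectBatch_apply cfg t X s b fun x => ‖N x‖ ^ 2
    have hb : ∀ b : Fin B, BddMeas fun q : unitInterval × Act d 0 =>
        if (q.1 : ℝ) ≤ r then ‖N q.2‖ ^ 2 else ‖N (X b)‖ ^ 2 := fun b =>
      (hN.bdd.norm_sq.comp measurable_snd).ite (.const _) hm2
    have hmp := fun b : Fin B => measurePreserving_coin_sample D ν cfg.rule b
    simp only [e2]
    rw [integral_const_mul, integral_finsetSum _ fun b _ =>
      ((hb b).comp (hmp b).measurable).integrable]
    have e3 : ∀ b : Fin B, ∫ s, (if (coin cfg.rule b s : ℝ) ≤ r then ‖N (s.2 b).1‖ ^ 2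
        else ‖N (X b)‖ ^ 2) ∂iterLaw B D ν =
        r * ∫ x, ‖N x‖ ^ 2 ∂D + (1 - r) * ‖N (X b)‖ ^ 2 := fun b => by
      rw [MeasurePreserving.integral_comp_meas (hmp b)
        (g := fun q => if (q.1 : ℝ) ≤ r then ‖N q.2‖ ^ 2 else ‖N (X b)‖ ^ 2)
        (hb b).meas.aestronglyMeasurable, integral_coin_prod hr hN.bdd.norm_sq]
      rfl
    simp only [e3]
    rw [Finset.sum_add_distrib, ← Finset.mul_sum]
    simp only [Finset.sum_const, Finset.card_univ, Fintype.card_fin, nsmul_eq_mul]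
    have h2 : r * ∫ x, ‖N x‖ ^ 2 ∂D ≤ r * σ ^ 2 := mul_le_mul_of_nonneg_left hσ hr.1
    rw [← Finset.mul_sum]
    calc _ ≤ (B : ℝ)⁻¹ ^ 2 * (B * (r * σ ^ 2) + (1 - r) * ∑ b, ‖N (X b)‖ ^ 2) := by
          refine mul_le_mul_of_nonneg_left (add_le_add ?_ le_rfl) (by positivity)
          nlinarith
      _ = _ := by field_simp

end OneStep

/-! ### The sampling noise -/

section Noise

variable {E B : ℕ} {d dw : ℕ → ℕ} {Ξ : Type*} [MeasurableSpace Ξ]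
  {a : Layers d dw} {cfg : Config d Ξ} {w₁ : Weights E dw}
  {D : Measure (Act d 0)} {ν : Measure Ξ} [IsProbabilityMeasure D] [IsProbabilityMeasure ν]
  {Lℓ Ca Lg La ωF ωB σ : ℝ}

variable (a D) in
/-- The deviation of the gradient of the loss of a sample from the gradient of the risk. -/
def sampleNoise (x : Act d 0) (w : Weights E dw) : Weights E dw :=
  paramGrad a (act a x w) w - gradient (risk a D) w

/-- A bound for gradients. -/
def gradBound (E : ℕ) (Ca : ℝ) : ℝ := E * (1 + Ca) ^ (E + 1)

theorem gradBound_nonneg (hCa : 0 ≤ Ca) : 0 ≤ gradBound E Ca := by unfold gradBound; positivity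

section

variable (hS : Smooth E a D Lℓ Ca Lg La) (hdE : d E = 1) (hE : 0 < E)
  (hG : StochasticGradient E a D σ)
include hS hG

omit [IsProbabilityMeasure D] in
theorem gradient_risk_eq (w : Weights E dw) :
    gradient (risk a D) w = ∫ x, paramGrad a (act a x w) w ∂D := by
  rw [← hG.unbiased w]
  simp only [hS.gradient_loss]

omit [IsProbabilityMeasure D] in
theorem integrable_paramGrad (w : Weights E dw) :
    Integrable (fun x => paramGrad a (act a x w) w) D := by
  have := hG.integrable w
  simpa only [hS.gradient_loss] using this

include hdE

theorem norm_gradient_risk_le (w : Weights E dw) :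
    ‖gradient (risk a D) w‖ ≤ gradBound E Ca := by
  rw [gradient_risk_eq hS hG]
  refine (norm_integral_le_of_norm_le_const (.of_forall fun x =>
    hS.norm_paramGrad_le hdE (act a x w) w)).trans (by simp [gradBound])

include hE

/-- Inherited from the gradients of single samples. The constant `lossLip` then serves both in the
descent inequality and for the dependence of the noise on the parameters. -/
theorem norm_gradient_risk_sub_le (w w' : Weights E dw) :
    ‖gradient (risk a D) w - gradient (risk a D) w'‖ ≤ lossLip E Ca Lg La * ‖w - w'‖ := by
  rw [gradient_risk_eq hS hG, gradient_risk_eq hS hG,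
    ← integral_sub (integrable_paramGrad hS hG w) (integrable_paramGrad hS hG w')]
  refine (norm_integral_le_of_norm_le_const (.of_forall fun x =>
    hS.norm_gradient_loss_sub_le hE hdE x w w')).trans (by simp)

theorem continuous_gradient_risk : Continuous (gradient (risk (E := E) a D)) :=
  (LipschitzWith.of_dist_le_mul (K := (lossLip E Ca Lg La).toNNReal) fun w w' => by
    rw [dist_eq_norm, dist_eq_norm,
      Real.coe_toNNReal _ (lossLip_nonneg (hS.Ca_nonneg hE))]
    exact norm_gradient_risk_sub_le hS hdE hE hG w w').continuous

theorem norm_sampleNoise_le (x : Act d 0) (w : Weights E dw) :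
    ‖sampleNoise a D x w‖ ≤ 2 * gradBound E Ca := by
  have h1 := hS.norm_paramGrad_le hdE (act a x w) w
  have h2 := norm_gradient_risk_le hS hdE hG w
  refine (norm_sub_le _ _).trans ?_
  unfold gradBound at h2 ⊢
  linarith

theorem norm_sampleNoise_sub_le (x : Act d 0) (w w' : Weights E dw) :
    ‖sampleNoise a D x w - sampleNoise a D x w'‖ ≤ 2 * lossLip E Ca Lg La * ‖w - w'‖ := by
  have h1 := hS.norm_gradient_loss_sub_le hE hdE x w w'
  have h2 := norm_gradient_risk_sub_le hS hdE hE hG w w'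
  unfold sampleNoise
  rw [sub_sub_sub_comm]
  refine (norm_sub_le _ _).trans ?_
  linarith

theorem measurable_sampleNoise {Ω : Type*} [MeasurableSpace Ω] {x : Ω → Act d 0}
    {w : Ω → Weights E dw} (hx : Measurable x) (hw : Measurable w) :
    Measurable fun ω => sampleNoise a D (x ω) (w ω) :=
  (hS.measurable_paramGrad (fun e he => hS.measurable_act hx hw e he.le) hw).sub
    ((continuous_gradient_risk hS hdE hE hG).measurable.comp hw)

theorem bddMeas_sampleNoise {Ω : Type*} [MeasurableSpace Ω] {x : Ω → Act d 0}
    {w : Ω → Weights E dw} (hx : Measurable x) (hw : Measurable w) :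
    BddMeas fun ω => sampleNoise a D (x ω) (w ω) :=
  ⟨measurable_sampleNoise hS hdE hE hG hx hw, _, fun _ => norm_sampleNoise_le hS hdE hE hG _ _⟩

theorem centered_sampleNoise (w : Weights E dw) :
    Centered D (fun x => sampleNoise a D x w) σ := by
  have hb : BddMeas fun x => sampleNoise a D x w :=
    bddMeas_sampleNoise hS hdE hE hG measurable_id measurable_const
  refine ⟨hb, ?_, ?_⟩
  · unfold sampleNoise
    rw [integral_sub (integrable_paramGrad hS hG w) (integrable_const _),
      ← gradient_risk_eq hS hG]
    simp
  · have h := hG.variance_le w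
    simp only [hS.gradient_loss] at h
    rw [integral_eq_lintegral_of_nonneg_ae (.of_forall fun _ => sq_nonneg _)
      hb.norm_sq.meas.aestronglyMeasurable]
    refine ENNReal.toReal_le_of_le_ofReal (sq_nonneg _) (le_trans (le_of_eq ?_) h)
    refine lintegral_congr fun x => ?_
    rw [ENNReal.ofReal_pow (norm_nonneg _), ofReal_norm]
    rfl

end

variable (a cfg w₁ D) in
/-- The noise of iteration `n + 1`. -/
def noise (n : ℕ) (s : ℕ → IterSeed B d Ξ) : Weights E dw :=
  avg fun b => sampleNoise a D ((run a cfg w₁ s (n + 1)).x b) (run a cfg w₁ s n).w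

variable (a cfg w₁ D) in
/-- The noise of the batch of iteration `n` at the parameters of iteration `n + 1`. -/
def staleNoise (n : ℕ) (s : ℕ → IterSeed B d Ξ) : Weights E dw :=
  avg fun b => sampleNoise a D ((run a cfg w₁ s n).x b) (run a cfg w₁ s n).w

variable (a cfg w₁ D) in
/-- The spread of the noise of iteration `n + 1`. -/
def noiseSpread (n : ℕ) (s : ℕ → IterSeed B d Ξ) : ℝ :=
  spread cfg.rule fun b : Fin B =>
    sampleNoise a D ((run a cfg w₁ s (n + 1)).x b) (run a cfg w₁ s n).w

variable (a cfg w₁ D) in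
/-- The spread of the noise of the batch of iteration `n` at the parameters of iteration `n + 1`. -/
def staleSpread (n : ℕ) (s : ℕ → IterSeed B d Ξ) : ℝ :=
  spread cfg.rule fun b : Fin B => sampleNoise a D ((run a cfg w₁ s n).x b) (run a cfg w₁ s n).w

variable (a cfg w₁ D) in
/-- The noise of the momentum of iteration `n + 1`. -/
def momentumNoise : ℕ → (ℕ → IterSeed B d Ξ) → Weights E dw
  | 0, s => cfg.m • noise a cfg w₁ D 0 s
  | n + 1, s => (1 - cfg.m) • momentumNoise n s + cfg.m • noise a cfg w₁ D (n + 1) s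

theorem BddMeas.avg {Ω V : Type*} [MeasurableSpace Ω] [NormedAddCommGroup V] [NormedSpace ℝ V]
    [MeasurableSpace V] [BorelSpace V] [SecondCountableTopology V] {c : Fin B → Ω → V}
    (h : ∀ b, BddMeas (c b)) : BddMeas fun ω => Clapping.avg fun b => c b ω :=
  (BddMeas.sum Finset.univ fun b _ => h b).smul ((B : ℝ)⁻¹)

theorem BddMeas.spread {Ω V : Type*} [MeasurableSpace Ω] [NormedAddCommGroup V] [NormedSpace ℝ V]
    [MeasurableSpace V] [BorelSpace V] [SecondCountableTopology V] (rule : SamplingRule)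
    {c : Fin B → Ω → V} (h : ∀ b, BddMeas (c b)) :
    BddMeas fun ω => Clapping.spread rule fun b => c b ω := by
  cases rule
  · exact (BddMeas.sum Finset.univ fun b _ => (h b).norm_sq).smul ((B : ℝ)⁻¹ ^ 2)
  · exact (BddMeas.avg h).norm_sq

/-- `F` ignores coordinate `n` of its first argument, so the actual seed `s n` may be treated as an
independent variable. This is conditioning on the past without conditional expectations. -/
theorem integral_seed_le (n : ℕ) {F : (ℕ → IterSeed B d Ξ) × IterSeed B d Ξ → ℝ} (hF : BddMeas F)
    (hF' : ∀ s τ τ', F (Function.update s n τ', τ) = F (s, τ)) {H : (ℕ → IterSeed B d Ξ) → ℝ}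
    (hH : Integrable H (runLaw B D ν)) (h : ∀ s, ∫ τ, F (s, τ) ∂iterLaw B D ν ≤ H s) :
    ∫ s, F (s, s n) ∂runLaw B D ν ≤ ∫ s, H s ∂runLaw B D ν := by
  have hm : BddMeas fun s : ℕ → IterSeed B d Ξ => F (s, s n) :=
    hF.comp (measurable_id.prodMk (measurable_pi_apply n))
  have h1 := MeasurePreserving.integral_comp_meas
    (measurePreserving_update (fun _ : ℕ => iterLaw B D ν) n)
    (g := fun s => F (s, s n)) hm.meas.aestronglyMeasurable
  simp only [Function.update_self, hF'] at h1
  have h2 : ∫ q : (ℕ → IterSeed B d Ξ) × IterSeed B d Ξ, F q ∂((runLaw B D ν).prod (iterLaw B D ν))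
      = ∫ s, ∫ τ, F (s, τ) ∂iterLaw B D ν ∂runLaw B D ν := integral_prod _ hF.integrable
  refine (h1.symm.trans h2).le.trans ?_
  exact integral_mono hF.integrable.integral_prod_left hH h

section

variable (hS : Smooth E a D Lℓ Ca Lg La) (hC : Contractive E ν cfg.Cf cfg.Cb ωF ωB)
  (hdE : d E = 1) (hE : 0 < E) (hG : StochasticGradient E a D σ)
include hS hC hdE hE hG

omit [IsProbabilityMeasure ν]

theorem bddMeas_sampleNoise_run (n k : ℕ) (b : Fin B) :
    BddMeas fun s => sampleNoise a D ((run a cfg w₁ s n).x b) (run a cfg w₁ s k).w :=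
  bddMeas_sampleNoise hS hdE hE hG ((measurableState_run hS hC w₁ n).x b)
    (measurableState_run hS hC w₁ k).w

theorem bddMeas_noise (n : ℕ) : BddMeas (noise (B := B) a cfg w₁ D n) :=
  BddMeas.avg fun b => bddMeas_sampleNoise_run hS hC hdE hE hG (n + 1) n b

theorem bddMeas_staleNoise (n : ℕ) : BddMeas (staleNoise (B := B) a cfg w₁ D n) :=
  BddMeas.avg fun b => bddMeas_sampleNoise_run hS hC hdE hE hG n n b

theorem bddMeas_noiseSpread (n : ℕ) : BddMeas (noiseSpread (B := B) a cfg w₁ D n) :=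
  BddMeas.spread _ fun b => bddMeas_sampleNoise_run hS hC hdE hE hG (n + 1) n b

theorem bddMeas_staleSpread (n : ℕ) : BddMeas (staleSpread (B := B) a cfg w₁ D n) :=
  BddMeas.spread _ fun b => bddMeas_sampleNoise_run hS hC hdE hE hG n n b

theorem bddMeas_momentumNoise (n : ℕ) : BddMeas (momentumNoise (B := B) a cfg w₁ D n) := by
  induction n with
  | zero => exact (bddMeas_noise hS hC hdE hE hG 0).smul cfg.m
  | succ n ih => exact (ih.smul _).add ((bddMeas_noise hS hC hdE hE hG (n + 1)).smul _)

omit [MeasurableSpace Ξ] hC in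
theorem norm_staleNoise_sub_le (n : ℕ) (s : ℕ → IterSeed B d Ξ) :
    ‖staleNoise a cfg w₁ D (n + 1) s - noise a cfg w₁ D n s‖ ≤
      2 * lossLip E Ca Lg La * wMove a cfg w₁ (n + 1) s := by
  unfold staleNoise noise
  rw [← avg_sub]
  have := lossLip_nonneg (E := E) (Lg := Lg) (La := La) (hS.Ca_nonneg hE)
  exact norm_avg_le (mul_nonneg (by positivity) (norm_nonneg _)) fun b =>
    norm_sampleNoise_sub_le hS hdE hE hG _ _ _

omit [MeasurableSpace Ξ] hC in
theorem staleSpread_le {θ : ℝ} (hθ : 0 < θ) (n : ℕ) (s : ℕ → IterSeed B d Ξ) :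
    staleSpread a cfg w₁ D (n + 1) s ≤ (1 + θ) * noiseSpread a cfg w₁ D n s
      + (1 + 1 / θ) * (2 * lossLip E Ca Lg La * wMove a cfg w₁ (n + 1) s) ^ 2 := by
  have := lossLip_nonneg (E := E) (Lg := Lg) (La := La) (hS.Ca_nonneg hE)
  exact spread_le_young _ hθ (mul_nonneg (by positivity) (norm_nonneg _)) fun b =>
    norm_sampleNoise_sub_le hS hdE hE hG _ _ _

variable [IsProbabilityMeasure ν]

theorem integral_noiseSpread_le (hB : 0 < B) (hp0 : 0 ≤ cfg.p) (hp1 : cfg.p ≤ 1) (n : ℕ) :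
    ∫ s, noiseSpread (B := B) a cfg w₁ D n s ∂runLaw B D ν ≤
      freshRate cfg.p (n + 1) * (σ ^ 2 / B)
        + (1 - freshRate cfg.p (n + 1)) * ∫ s, staleSpread (B := B) a cfg w₁ D n s ∂runLaw B D ν := by
  have hst := bddMeas_staleSpread (B := B) (w₁ := w₁) hS hC hdE hE hG n
  let F : (ℕ → IterSeed B d Ξ) × IterSeed B d Ξ → ℝ := fun q => spread cfg.rule fun b : Fin B =>
    sampleNoise a D (selectBatch cfg (n + 1) (run a cfg w₁ q.1 n).x q.2 b) (run a cfg w₁ q.1 n).w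
  have hF : BddMeas F := BddMeas.spread _ fun b => bddMeas_sampleNoise hS hdE hE hG
    ((measurable_pi_apply b).comp ((measurable_selectBatch cfg (n + 1)).comp
      (((measurable_pi_iff.2 (measurableState_run hS hC w₁ n).x).comp measurable_fst).prodMk
        measurable_snd))) ((measurableState_run hS hC w₁ n).w.comp measurable_fst)
  have key : ∀ s, ∫ τ, F (s, τ) ∂iterLaw B D ν ≤ freshRate cfg.p (n + 1) * (σ ^ 2 / B)
      + (1 - freshRate cfg.p (n + 1)) * staleSpread a cfg w₁ D n s := by
    intro s
    have h := (centered_sampleNoise hS hdE hE hG (run a cfg w₁ s n).w).integral_spread_le (ν := ν)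
      cfg (n + 1) hB hp0 hp1 (run a cfg w₁ s n).x
    simp only [F, staleSpread]
    exact h
  have h := integral_seed_le (D := D) (ν := ν) (n + 1) hF
    (fun s τ τ' => by simp only [F, run_update])
    (H := fun s => freshRate cfg.p (n + 1) * (σ ^ 2 / B)
      + (1 - freshRate cfg.p (n + 1)) * staleSpread a cfg w₁ D n s)
    ((integrable_const _).add (hst.integrable.const_mul _)) key
  refine h.trans (le_of_eq ?_)
  rw [integral_add (integrable_const _) (hst.integrable.const_mul _)]
  simp [integral_const_mul]

/-- `A` stands for a quantity determined before the seed of iteration `n + 1` is drawn; given the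
other seeds, one step of lazy sampling acts on it as on a constant. -/
theorem integral_add_noise_le (hB : 0 < B) (hp0 : 0 ≤ cfg.p) (hp1 : cfg.p ≤ 1) (n : ℕ)
    {A : (ℕ → IterSeed B d Ξ) → Weights E dw} (hA : BddMeas A)
    (hA' : ∀ s τ, A (Function.update s (n + 1) τ) = A s) (k : ℝ) :
    ∫ s, ‖A s + k • noise a cfg w₁ D n s‖ ^ 2 ∂runLaw B D ν ≤
      ∫ s, ‖A s + (k * (1 - freshRate cfg.p (n + 1))) • staleNoise a cfg w₁ D n s‖ ^ 2
          ∂runLaw B D ν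
        + k ^ 2 * freshRate cfg.p (n + 1) * (σ ^ 2 / B + (1 - freshRate cfg.p (n + 1))
          * ∫ s, staleSpread (B := B) a cfg w₁ D n s ∂runLaw B D ν) := by
  have hst := bddMeas_staleSpread (B := B) (w₁ := w₁) hS hC hdE hE hG n
  have hsn := bddMeas_staleNoise (B := B) (w₁ := w₁) hS hC hdE hE hG n
  set r := freshRate cfg.p (n + 1) with hr
  let F : (ℕ → IterSeed B d Ξ) × IterSeed B d Ξ → ℝ := fun q => ‖A q.1 + k • avg fun b : Fin B =>
    sampleNoise a D (selectBatch cfg (n + 1) (run a cfg w₁ q.1 n).x q.2 b)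
      (run a cfg w₁ q.1 n).w‖ ^ 2
  have hF : BddMeas F := ((hA.comp measurable_fst).add ((BddMeas.avg fun b =>
    bddMeas_sampleNoise hS hdE hE hG
    ((measurable_pi_apply b).comp ((measurable_selectBatch cfg (n + 1)).comp
      (((measurable_pi_iff.2 (measurableState_run hS hC w₁ n).x).comp measurable_fst).prodMk
        measurable_snd))) ((measurableState_run hS hC w₁ n).w.comp measurable_fst)).smul k)).norm_sq
  have h1 : Integrable (fun s => ‖A s + (k * (1 - r)) • staleNoise a cfg w₁ D n s‖ ^ 2)
      (runLaw B D ν) := (hA.add (hsn.smul _)).norm_sq.integrable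
  have h2 : Integrable (fun s => k ^ 2 * r * (σ ^ 2 / B
      + (1 - r) * staleSpread (B := B) a cfg w₁ D n s)) (runLaw B D ν) :=
    ((integrable_const _).add (hst.integrable.const_mul _)).const_mul _
  have key : ∀ s, ∫ τ, F (s, τ) ∂iterLaw B D ν ≤
      ‖A s + (k * (1 - r)) • staleNoise a cfg w₁ D n s‖ ^ 2
        + k ^ 2 * r * (σ ^ 2 / B + (1 - r) * staleSpread (B := B) a cfg w₁ D n s) := by
    intro s
    have h := (centered_sampleNoise hS hdE hE hG (run a cfg w₁ s n).w).integral_step_le (ν := ν)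
      cfg (n + 1) hB hp0 hp1 (run a cfg w₁ s n).x (A s) k
    simp only [F, staleSpread, staleNoise, r]
    exact h
  have h := integral_seed_le (D := D) (ν := ν) (n + 1) hF
    (fun s τ τ' => by simp only [F, run_update, hA']) (h1.add h2) key
  refine h.trans (le_of_eq ?_)
  simp only [Pi.add_apply]
  rw [integral_add h1 h2, integral_const_mul,
    integral_add (integrable_const _) (hst.integrable.const_mul _)]
  simp [integral_const_mul]

end

end Noise

/-! ### The noise of the momentum, for small momentum coefficients -/

/-- The recursions of the noise, in real numbers: `U` is the spread, `W` the spread of the stale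
noise, `z` the shifted momentum noise and `S` the momentum noise. -/
theorem sum_momentum_recursion_le {m p s₀ K2 : ℝ} {U W z S δ : ℕ → ℝ} (hm : 0 < m)
    (hmp : m ≤ p / 2) (hp1 : p ≤ 1) (hs₀ : 0 ≤ s₀) (hK2 : 0 ≤ K2) (hδ : ∀ n, 0 ≤ δ n)
    (hU0 : U 0 ≤ s₀) (hU1 : U 1 ≤ s₀) (hU : ∀ n, U (n + 2) ≤ p * s₀ + (1 - p) * W (n + 2))
    (hW : ∀ θ, 0 < θ → ∀ n, W (n + 1) ≤ (1 + θ) * U n + (1 + 1 / θ) * (K2 * δ (n + 1)))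
    (hz1 : z 1 ≤ 8 * (m ^ 2 / p ^ 2) * s₀)
    (hz : ∀ n, z (n + 2) ≤ (1 - m) * z (n + 1) + 4 * m / p ^ 2 * (K2 * δ (n + 2))
      + 4 * m ^ 2 / p ^ 2 * p * (s₀ + W (n + 2)))
    (hS0 : S 0 ≤ m ^ 2 * s₀) (hSn : ∀ n, 0 ≤ S n) (hS : ∀ n, S (n + 1) ≤ (1 - p) * S n + p * z (n + 1)) (T : ℕ) :
    ∑ n ∈ Finset.range T, S n ≤ m / p * (20 * T + 9 / p) * s₀
      + 28 / p ^ 2 * K2 * ∑ n ∈ Finset.range T, δ n := by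
  have hp : 0 < p := by linarith
  -- With `θ = p / 2` the spread contracts by `(1 - p) * (1 + p / 2) ≤ 1 - p / 2`, and `2 * s₀` is
  -- the fixed point of `x ↦ (1 - p / 2) * x + p * s₀`. The filter collects the effect of the
  -- parameter moves.
  have hUD : ∀ n, U n ≤ 2 * s₀ + geomFilter (1 - p / 2) (fun i => 2 / p * (K2 * δ i)) n := by
    have hD : ∀ n, 0 ≤ geomFilter (1 - p / 2) (fun i => 2 / p * (K2 * δ i)) n :=
      geomFilter_nonneg (by linarith) fun i => by have := hδ i; positivity
    intro n
    induction n with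
    | zero => linarith [hD 0]
    | succ n ih =>
      rcases n with _ | n
      · linarith [hD 1]
      · have h1 := hU n
        have h2 := hW (p / 2) (by linarith) (n + 1)
        have h3 : (1 - p) * W (n + 2) ≤ (1 - p) * ((1 + p / 2) * U (n + 1)
            + (1 + 1 / (p / 2)) * (K2 * δ (n + 2))) :=
          mul_le_mul_of_nonneg_left h2 (by linarith)
        have h4 : (1 - p) * (1 + p / 2) * U (n + 1) ≤ (1 - p) * (1 + p / 2)
            * (2 * s₀ + geomFilter (1 - p / 2) (fun i => 2 / p * (K2 * δ i)) (n + 1)) :=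
          mul_le_mul_of_nonneg_left ih (by nlinarith)
        have h5 : (1 - p) * (1 + p / 2)
            * (2 * s₀ + geomFilter (1 - p / 2) (fun i => 2 / p * (K2 * δ i)) (n + 1))
            ≤ (1 - p / 2)
            * (2 * s₀ + geomFilter (1 - p / 2) (fun i => 2 / p * (K2 * δ i)) (n + 1)) :=
          mul_le_mul_of_nonneg_right (by nlinarith) (by linarith [hD (n + 1)])
        have h6 : (1 - p) * (1 + 1 / (p / 2)) ≤ 2 / p := by
          rw [show (1 - p) * (1 + 1 / (p / 2)) = 2 / p - 1 - p by field_simp; ring]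
          linarith
        have h7 : (1 - p) * (1 + 1 / (p / 2)) * (K2 * δ (n + 2)) ≤ 2 / p * (K2 * δ (n + 2)) :=
          mul_le_mul_of_nonneg_right h6 (mul_nonneg hK2 (hδ _))
        simp only [geomFilter] at h5 h4 ⊢
        linarith
  have hD : ∀ n, 0 ≤ geomFilter (1 - p / 2) (fun i => 2 / p * (K2 * δ i)) n :=
    geomFilter_nonneg (by linarith) fun i => by have := hδ i; positivity
  generalize hDdef : geomFilter (1 - p / 2) (fun i => 2 / p * (K2 * δ i)) = D at *
  -- The input of the recursion of `z`, shifted by one: entry `n` belongs to `z (n + 1)`, since the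
  -- recursion only starts after the two fresh iterations.
  let g : ℕ → ℝ := fun n => n.casesOn (8 * (m ^ 2 / p ^ 2) * s₀) fun n =>
    12 * m / p ^ 2 * (K2 * δ (n + 2)) + 20 * (m ^ 2 / p) * s₀ + 8 * (m ^ 2 / p) * D (n + 1)
  have hg : ∀ n, 0 ≤ g n := by
    rintro (_ | n)
    · exact mul_nonneg (by positivity) hs₀
    · have h1 := mul_nonneg hK2 (hδ (n + 2))
      have h2 := hD (n + 1)
      dsimp only [g]
      refine add_nonneg (add_nonneg (mul_nonneg (by positivity) h1) (by positivity))
        (mul_nonneg (by positivity) h2)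
  have hzg : ∀ n, z (n + 1) ≤ geomFilter (1 - m) g n := fun n => by
    refine le_geomFilter (f := fun n => z (n + 1)) (T := n + 1) (by linarith) hz1 (fun k _ => ?_)
      n n.lt_succ_self
    refine (hz k).trans ?_
    -- No contraction is needed at this point, so `θ = 1` is enough.
    have h1 := hW 1 one_pos (k + 1)
    have h2 := hUD (k + 1)
    have h3 : 4 * m ^ 2 / p ^ 2 * p * (s₀ + W (k + 2)) ≤ 4 * m ^ 2 / p ^ 2 * p *
        (5 * s₀ + 2 * D (k + 1) + 2 * (K2 * δ (k + 2))) :=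
      mul_le_mul_of_nonneg_left (by linarith) (by positivity)
    have h4 : 8 * m ^ 2 / p ≤ 8 * m / p ^ 2 := by
      rw [div_le_div_iff₀ hp (by positivity)]
      have : m * p ≤ 1 := by nlinarith
      nlinarith [mul_pos hm hp]
    have h5 := mul_le_mul_of_nonneg_right h4 (mul_nonneg hK2 (hδ (k + 2)))
    have h6 : 4 * m ^ 2 / p ^ 2 * p * (5 * s₀ + 2 * D (k + 1) + 2 * (K2 * δ (k + 2))) =
        20 * (m ^ 2 / p) * s₀ + 8 * (m ^ 2 / p) * D (k + 1)
          + 8 * m ^ 2 / p * (K2 * δ (k + 2)) := by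
      field_simp; ring
    have h7 : 12 * m / p ^ 2 * (K2 * δ (k + 2)) = 4 * m / p ^ 2 * (K2 * δ (k + 2))
        + 8 * m / p ^ 2 * (K2 * δ (k + 2)) := by ring
    dsimp only [g]
    linarith
  rcases T with _ | T
  · simp only [Finset.range_zero, Finset.sum_empty, CharP.cast_eq_zero]
    positivity
  have hT : 0 ≤ ∑ n ∈ Finset.range (T + 1), δ n := Finset.sum_nonneg fun n _ => hδ n
  have hDs : ∑ n ∈ Finset.range T, D n ≤ 4 / p ^ 2 * (K2 * ∑ n ∈ Finset.range T, δ n) := by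
    rw [← hDdef]
    refine (sum_geomFilter_le (by linarith) (by linarith)
      (fun i => by have := hδ i; positivity) T).trans (le_of_eq ?_)
    rw [← Finset.mul_sum, ← Finset.mul_sum, sub_sub_cancel]
    field_simp; ring
  have hDs' : ∑ n ∈ Finset.range (T - 1), D (n + 1) ≤ ∑ n ∈ Finset.range T, D n := by
    rcases T with _ | T
    · simp
    · rw [Finset.sum_range_succ' _ T]
      simpa using hD 0
  have hδs : ∑ n ∈ Finset.range (T - 1), δ (n + 2) ≤ ∑ n ∈ Finset.range (T + 1), δ n := by
    rcases T with _ | T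
    · simpa using hδ 0
    · rw [Finset.sum_range_succ' _ (T + 1), Finset.sum_range_succ' _ T]
      have := hδ 0
      have := hδ (0 + 1)
      simp only [Nat.add_sub_cancel]
      linarith
  have hδs' : ∑ n ∈ Finset.range T, δ n ≤ ∑ n ∈ Finset.range (T + 1), δ n := by
    rw [Finset.sum_range_succ]; linarith [hδ T]
  have hgs : ∑ n ∈ Finset.range T, g n ≤ 8 * (m ^ 2 / p ^ 2) * s₀
      + (12 * m / p ^ 2 * (K2 * ∑ n ∈ Finset.range (T + 1), δ n) + 20 * (m ^ 2 / p) * s₀ * T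
      + 8 * (m ^ 2 / p) * (4 / p ^ 2 * (K2 * ∑ n ∈ Finset.range (T + 1), δ n))) := by
    rcases T with _ | T
    · simp only [Finset.range_zero, Finset.sum_empty]
      positivity
    · rw [Finset.sum_range_succ' g T, add_comm]
      refine add_le_add le_rfl ?_
      dsimp only [g]
      rw [Finset.sum_add_distrib, Finset.sum_add_distrib, ← Finset.mul_sum, ← Finset.mul_sum,
        ← Finset.mul_sum, ← Finset.mul_sum, Finset.sum_const, Finset.card_range, nsmul_eq_mul]
      simp only [Nat.add_sub_cancel] at hδs hDs'
      have h1 := hDs'.trans (hDs.trans (mul_le_mul_of_nonneg_left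
        (mul_le_mul_of_nonneg_left hδs' hK2) (by positivity)))
      have h2 := mul_le_mul_of_nonneg_left h1 (show 0 ≤ 8 * (m ^ 2 / p) by positivity)
      have h3 := mul_le_mul_of_nonneg_left (mul_le_mul_of_nonneg_left hδs hK2)
        (show 0 ≤ 12 * m / p ^ 2 by positivity)
      have h4 : (T : ℝ) * (20 * (m ^ 2 / p) * s₀) ≤ 20 * (m ^ 2 / p) * s₀ * ((T + 1 : ℕ) : ℝ) := by
        push_cast
        have : 0 ≤ 20 * (m ^ 2 / p) * s₀ := by positivity
        nlinarith
      linarith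
  have hzs : ∑ n ∈ Finset.range T, z (n + 1) ≤ (∑ n ∈ Finset.range T, g n) / m := by
    refine (Finset.sum_le_sum fun n _ => hzg n).trans ?_
    have := sum_geomFilter_le (ω := 1 - m) (by linarith) (by linarith) hg T
    simpa using this
  -- Summing the recursion of `S` telescopes: its contraction rate `p` equals the weight of `z`.
  have hSs : ∑ n ∈ Finset.range (T + 1), S n ≤ m ^ 2 * s₀ / p + ∑ n ∈ Finset.range T, z (n + 1) := by
    have h0 : ∀ T, p * ∑ n ∈ Finset.range (T + 1), S n + (1 - p) * S T ≤
        m ^ 2 * s₀ + p * ∑ n ∈ Finset.range T, z (n + 1) := by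
      intro T
      induction T with
      | zero => simp; linarith
      | succ T ih =>
        rw [Finset.sum_range_succ, Finset.sum_range_succ (fun n => z (n + 1))]
        linarith [hS T]
    have h1 := h0 T
    have h2 := mul_nonneg (show 0 ≤ 1 - p by linarith) (hSn T)
    have h3 : p * (m ^ 2 * s₀ / p + ∑ n ∈ Finset.range T, z (n + 1)) =
        m ^ 2 * s₀ + p * ∑ n ∈ Finset.range T, z (n + 1) := by field_simp
    exact le_of_mul_le_mul_left (by linarith) hp
  have h1 := div_le_div_of_nonneg_right hgs hm.le
  refine hSs.trans ((add_le_add le_rfl (hzs.trans h1)).trans ?_)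
  generalize (∑ n ∈ Finset.range (T + 1), δ n) = Q at hT ⊢
  -- The filter of ratio `1 - m` costs `1 / m`, which turns the variance input `m ^ 2 / p` into the
  -- reduced variance `m / p`.
  have e : (8 * (m ^ 2 / p ^ 2) * s₀ + (12 * m / p ^ 2 * (K2 * Q) + 20 * (m ^ 2 / p) * s₀ * T
      + 8 * (m ^ 2 / p) * (4 / p ^ 2 * (K2 * Q)))) / m = m / p * (20 * T + 8 / p) * s₀
      + (12 + 32 * (m / p)) / p ^ 2 * K2 * Q := by
    field_simp; ring
  rw [e]
  have h2 : m / p ≤ 1 / 2 := by rw [div_le_iff₀ hp]; linarith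
  have h3 : (12 + 32 * (m / p)) / p ^ 2 * K2 * Q ≤ 28 / p ^ 2 * K2 * Q := by gcongr; linarith
  have h4 : m ^ 2 * s₀ / p ≤ m / p * (1 / p) * s₀ := by
    rw [show m ^ 2 * s₀ / p = m / p * m * s₀ by ring]
    gcongr
    rw [le_div_iff₀ hp]; nlinarith
  have h5 : m / p * (20 * ((T + 1 : ℕ) : ℝ) + 9 / p) * s₀ = m / p * (20 * T + 8 / p) * s₀
      + m / p * (1 / p) * s₀ + 20 * (m / p * s₀) := by push_cast; ring
  have h6 : 0 ≤ m / p * s₀ := by positivity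
  rw [h5]
  linarith

/-- The momentum update is rewritten with the old momentum noise, at weight `1 - p`, and the shifted
process, at weight `(p - m) / (1 - m) ≤ p`. The squares then combine by convexity. -/
theorem norm_sq_combination_le {V : Type*} [NormedAddCommGroup V] [NormedSpace ℝ V] {m p k : ℝ}
    (hm : 0 < m) (hmp : m ≤ p / 2) (hp1 : p ≤ 1) (hk : k = m * (1 - m) / (p - m)) {x y : V} :
    ‖(1 - m) • x + m • y‖ ^ 2 ≤ (1 - p) * ‖x‖ ^ 2 + p * ‖(1 - m) • x + k • y‖ ^ 2 := by
  have hq : 0 < 1 - m := by linarith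
  have hpm : 0 < p - m := by linarith
  have e : (1 - m) • x + m • y = (1 - p) • x
      + ((p - m) / (1 - m)) • ((1 - m) • x + k • y) := by
    rw [smul_add, smul_smul, smul_smul, ← add_assoc, ← add_smul, hk]
    rw [show (1 - p) + (p - m) / (1 - m) * (1 - m) = 1 - m by field_simp; ring,
      show (p - m) / (1 - m) * (m * (1 - m) / (p - m)) = m by field_simp]
  rw [e]
  generalize (1 - m) • x + k • y = z
  have h1 : ‖(1 - p) • x + ((p - m) / (1 - m)) • z‖ ≤ (1 - p) * ‖x‖ + p * ‖z‖ := by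
    refine (norm_add_le _ _).trans (add_le_add ?_ ?_)
    · rw [norm_smul, Real.norm_eq_abs, abs_of_nonneg (by linarith)]
    · rw [norm_smul, Real.norm_eq_abs, abs_of_nonneg (by positivity)]
      refine mul_le_mul_of_nonneg_right ?_ (norm_nonneg _)
      rw [div_le_iff₀ hq]; nlinarith
  refine (pow_le_pow_left₀ (norm_nonneg _) h1 2).trans ?_
  have h2 : 0 ≤ (1 - p) * p * (‖x‖ - ‖z‖) ^ 2 :=
    mul_nonneg (mul_nonneg (by linarith) (by linarith)) (sq_nonneg _)
  nlinarith

section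

variable {E B : ℕ} {d dw : ℕ → ℕ} {Ξ : Type*} [MeasurableSpace Ξ]
  {a : Layers d dw} {cfg : Config d Ξ} {w₁ : Weights E dw}
  {D : Measure (Act d 0)} {ν : Measure Ξ} [IsProbabilityMeasure D]
  {Lℓ Ca Lg La ωF ωB σ : ℝ}

omit [MeasurableSpace Ξ] [IsProbabilityMeasure D] in
theorem momentumNoise_update {n k : ℕ} (h : n + 1 < k) (s : ℕ → IterSeed B d Ξ)
    (τ : IterSeed B d Ξ) :
    momentumNoise a cfg w₁ D n (Function.update s k τ) = momentumNoise a cfg w₁ D n s := by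
  have hr : ∀ j, j < k → run a cfg w₁ (Function.update s k τ) j = run a cfg w₁ s j :=
    fun j hj => run_congr w₁ j fun i hi => Function.update_of_ne (by omega) _ _
  have hn : ∀ j, j + 1 < k →
      noise a cfg w₁ D j (Function.update s k τ) = noise a cfg w₁ D j s := fun j hj => by
    simp only [noise, hr _ hj, hr j (by omega)]
  induction n with
  | zero => simp only [momentumNoise, hn 0 h]
  | succ n ih => simp only [momentumNoise, hn _ h, ih (by omega)]

variable [IsProbabilityMeasure ν]
  (hS : Smooth E a D Lℓ Ca Lg La) (hC : Contractive E ν cfg.Cf cfg.Cb ωF ωB)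
  (hdE : d E = 1) (hE : 0 < E) (hG : StochasticGradient E a D σ)
include hS hC hdE hE hG

/-- The momentum noise, for small momentum coefficients. -/
theorem sum_momentumNoise_le (hB : 0 < B) (hm : 0 < cfg.m) (hmp : cfg.m ≤ cfg.p / 2)
    (hp1 : cfg.p ≤ 1)
    (hw : ∀ n, Integrable (fun s => wMove (B := B) a cfg w₁ n s ^ 2) (runLaw B D ν)) (T : ℕ) :
    ∑ n ∈ Finset.range T, ∫ s, ‖momentumNoise (B := B) a cfg w₁ D n s‖ ^ 2 ∂runLaw B D ν ≤
      cfg.m / cfg.p * (20 * T + 9 / cfg.p) * (σ ^ 2 / B)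
        + 28 / cfg.p ^ 2 * (2 * lossLip E Ca Lg La) ^ 2
          * ∑ n ∈ Finset.range T, ∫ s, wMove (B := B) a cfg w₁ n s ^ 2 ∂runLaw B D ν := by
  have hp : 0 < cfg.p := by linarith
  set m := cfg.m with hm_def
  set p := cfg.p with hp_def
  set K := 2 * lossLip E Ca Lg La with hK_def
  set μ := runLaw B D ν with hμ
  have hK : 0 ≤ K := mul_nonneg zero_le_two (lossLip_nonneg (hS.Ca_nonneg hE))
  -- `c` solves `(m + c) * (1 - p) = (1 - m) * c`. Thus the conditional mean of the next shifted
  -- noise, momentum noise plus `c` times noise, is `1 - m` times the current one, up to the change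
  -- of parameters. The shift compensates the correlation of successive batches.
  set c := m * (1 - p) / (p - m) with hc_def
  have hpm : 0 < p - m := by linarith
  have hc0 : 0 ≤ c := by apply div_nonneg (mul_nonneg hm.le (by linarith)) hpm.le
  have hmc : m + c = m * (1 - m) / (p - m) := by rw [hc_def]; field_simp; ring
  have hmc0 : 0 < m + c := by linarith
  have hmc2 : m + c ≤ 2 * m / p := by
    rw [hmc, div_le_div_iff₀ hpm hp]; nlinarith [mul_pos hm hp, mul_pos hm hm]
  have hmc3 : (m + c) * (1 - p) = (1 - m) * c := by rw [hmc, hc_def]; ring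
  have hc2 : c ^ 2 ≤ 4 * m ^ 2 / p ^ 2 := by
    calc c ^ 2 ≤ (2 * m / p) ^ 2 := pow_le_pow_left₀ hc0 (by linarith) 2
      _ = _ := by ring
  have hmc4 : (m + c) ^ 2 ≤ 4 * m ^ 2 / p ^ 2 := by
    calc (m + c) ^ 2 ≤ (2 * m / p) ^ 2 := pow_le_pow_left₀ hmc0.le hmc2 2
      _ = _ := by ring
  have hN := fun n => bddMeas_noise (B := B) (w₁ := w₁) hS hC hdE hE hG n
  have hM := fun n => bddMeas_momentumNoise (B := B) (w₁ := w₁) hS hC hdE hE hG n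
  have hSt := fun n => bddMeas_staleNoise (B := B) (w₁ := w₁) hS hC hdE hE hG n
  have hNs := fun n => bddMeas_noiseSpread (B := B) (w₁ := w₁) hS hC hdE hE hG n
  have hSs := fun n => bddMeas_staleSpread (B := B) (w₁ := w₁) hS hC hdE hE hG n
  let Z : ℕ → (ℕ → IterSeed B d Ξ) → Weights E dw := fun n s =>
    momentumNoise a cfg w₁ D n s + c • noise a cfg w₁ D n s
  have hZ : ∀ n, BddMeas (Z n) := fun n => (hM n).add ((hN n).smul c)
  have hZs : ∀ n s, Z (n + 1) s = (1 - m) • momentumNoise a cfg w₁ D n s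
      + (m + c) • noise a cfg w₁ D (n + 1) s := fun n s => by
    simp only [Z, momentumNoise, ← hm_def, add_smul, add_assoc]
  have hstep := fun n => integral_add_noise_le (B := B) (w₁ := w₁) hS hC hdE hE hG hB hp.le hp1
    (n + 1) (A := fun s => (1 - m) • momentumNoise a cfg w₁ D n s) ((hM n).smul _)
    (fun s τ => by simp only [momentumNoise_update (show n + 1 < n + 1 + 1 by omega)]) (m + c)
  simp only [← hZs, ← hp_def, ← hμ] at hstep
  have hs₀ : 0 ≤ σ ^ 2 / (B : ℝ) := by positivity
  have hS0 : ∫ s, ‖momentumNoise (B := B) a cfg w₁ D 0 s‖ ^ 2 ∂μ ≤ m ^ 2 * (σ ^ 2 / B) := by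
    have h := integral_add_noise_le (B := B) (w₁ := w₁) hS hC hdE hE hG hB hp.le hp1 0
      (BddMeas.const 0) (fun _ _ => rfl) m
    simpa [freshRate_le_two, momentumNoise, ← hm_def] using h
  have hint : ∀ n, 0 ≤ ∫ s, wMove (B := B) a cfg w₁ n s ^ 2 ∂μ := fun n =>
    integral_nonneg fun _ => sq_nonneg _
  refine sum_momentum_recursion_le (m := m) (p := p) (s₀ := σ ^ 2 / B) (K2 := K ^ 2)
    (U := fun n => ∫ s, noiseSpread (B := B) a cfg w₁ D n s ∂μ)
    (W := fun n => ∫ s, staleSpread (B := B) a cfg w₁ D n s ∂μ)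
    (z := fun n => ∫ s, ‖Z n s‖ ^ 2 ∂μ) hm hmp hp1 hs₀ (sq_nonneg _) hint ?_ ?_ ?_ ?_ ?_ ?_ hS0
    (fun n => integral_nonneg fun _ => sq_nonneg _) ?_ T
  · have h := integral_noiseSpread_le (B := B) (w₁ := w₁) hS hC hdE hE hG hB hp.le hp1 0
    simpa [freshRate_le_two] using h
  · have h := integral_noiseSpread_le (B := B) (w₁ := w₁) hS hC hdE hE hG hB hp.le hp1 1
    simpa [freshRate_le_two] using h
  · intro n
    have h := integral_noiseSpread_le (B := B) (w₁ := w₁) hS hC hdE hE hG hB hp.le hp1 (n + 2)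
    rwa [freshRate_of_three_le (by omega)] at h
  · intro θ hθ n
    have hi : Integrable (fun s => (1 + 1 / θ) * (K * wMove (B := B) a cfg w₁ (n + 1) s) ^ 2) μ := by
      simp only [mul_pow]
      exact ((hw (n + 1)).const_mul _).const_mul _
    refine (integral_mono (hSs _).integrable (((hNs n).integrable.const_mul _).add hi) fun s =>
      staleSpread_le hS hdE hE hG hθ n s).trans (le_of_eq ?_)
    simp only [Pi.add_apply]
    rw [integral_add ((hNs n).integrable.const_mul _) hi, integral_const_mul, integral_const_mul]
    simp only [mul_pow, integral_const_mul]
  -- The second iteration is fresh with certainty, so the stale terms drop out.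
  · have h := hstep 0
    rw [freshRate_le_two (by omega) (by omega)] at h
    simp only [sub_self, mul_zero, zero_smul, add_zero, zero_mul, mul_one, norm_smul, mul_pow,
      integral_const_mul, Real.norm_eq_abs, sq_abs] at h
    refine h.trans ?_
    have h1 : (1 - m) ^ 2 ≤ 1 := by nlinarith
    have h2 : (1 - m) ^ 2 * ∫ s, ‖momentumNoise (B := B) a cfg w₁ D 0 s‖ ^ 2 ∂μ ≤
        1 * (m ^ 2 * (σ ^ 2 / B)) :=
      mul_le_mul h1 hS0 (integral_nonneg fun _ => sq_nonneg _) zero_le_one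
    have h3 : m ^ 2 ≤ 4 * m ^ 2 / p ^ 2 := le_trans (pow_le_pow_left₀ hm.le (by linarith) 2) hmc4
    have h4 := mul_le_mul_of_nonneg_right (add_le_add h3 hmc4) hs₀
    calc _ ≤ (m ^ 2 + (m + c) ^ 2) * (σ ^ 2 / B) := by linarith
      _ ≤ _ := h4.trans (le_of_eq (by ring))
  · intro n
    have h := hstep (n + 1)
    rw [freshRate_of_three_le (by omega), hmc3] at h
    refine h.trans ?_
    have hi : Integrable (fun s => c ^ 2 / m * (K * wMove (B := B) a cfg w₁ (n + 2) s) ^ 2) μ := by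
      simp only [mul_pow]
      exact ((hw (n + 2)).const_mul _).const_mul _
    have h1 : ∫ s, ‖(1 - m) • momentumNoise (B := B) a cfg w₁ D (n + 1) s
        + ((1 - m) * c) • staleNoise a cfg w₁ D (n + 2) s‖ ^ 2 ∂μ ≤
        (1 - m) * ∫ s, ‖Z (n + 1) s‖ ^ 2 ∂μ
          + 4 * m / p ^ 2 * (K ^ 2 * ∫ s, wMove (B := B) a cfg w₁ (n + 2) s ^ 2 ∂μ) := by
      calc _ ≤ ∫ s, ((1 - m) * ‖Z (n + 1) s‖ ^ 2
            + c ^ 2 / m * (K * wMove (B := B) a cfg w₁ (n + 2) s) ^ 2) ∂μ := by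
            refine integral_mono (((hM _).smul _).add ((hSt _).smul _)).norm_sq.integrable
              (((hZ _).norm_sq.integrable.const_mul _).add hi) fun s => ?_
            have e : (1 - m) • momentumNoise a cfg w₁ D (n + 1) s
                + ((1 - m) * c) • staleNoise a cfg w₁ D (n + 2) s =
                (1 - m) • (Z (n + 1) s + c • (staleNoise a cfg w₁ D (n + 2) s
                  - noise a cfg w₁ D (n + 1) s)) := by
              simp only [Z]; module
            have hk := norm_staleNoise_sub_le (cfg := cfg) (w₁ := w₁) hS hdE hE hG (n + 1) s
            -- Stale noise differs from the previous noise only by a move of the parameters. Young's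
            -- inequality with parameter `m` is affordable because `(1 - m) ^ 2 * (1 + m) ≤ 1 - m`.
            have hy := norm_add_sq_le_young (x := Z (n + 1) s)
              (y := c • (staleNoise a cfg w₁ D (n + 2) s - noise a cfg w₁ D (n + 1) s)) hm
            dsimp only
            rw [e, norm_smul, mul_pow, Real.norm_eq_abs, sq_abs]
            have hk2 : ‖c • (staleNoise a cfg w₁ D (n + 2) s - noise a cfg w₁ D (n + 1) s)‖ ^ 2 ≤
                c ^ 2 * (K * wMove a cfg w₁ (n + 2) s) ^ 2 := by
              rw [norm_smul, mul_pow, Real.norm_eq_abs, sq_abs]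
              exact mul_le_mul_of_nonneg_left (pow_le_pow_left₀ (norm_nonneg _) hk 2) (sq_nonneg _)
            have h1 := mul_le_mul_of_nonneg_left (hy.trans (add_le_add le_rfl
              (mul_le_mul_of_nonneg_left hk2 (show 0 ≤ 1 + 1 / m by positivity))))
              (sq_nonneg (1 - m))
            refine h1.trans ?_
            rw [mul_add, ← mul_assoc, ← mul_assoc]
            have h2 : (1 - m) ^ 2 * (1 + m) ≤ 1 - m := by
              have : 0 ≤ (1 - m) * m ^ 2 := mul_nonneg (by linarith) (sq_nonneg _)
              nlinarith
            have h3 : (1 - m) ^ 2 * (1 + 1 / m) ≤ 1 / m := by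
              rw [show (1 - m) ^ 2 * (1 + 1 / m) = (1 - m) ^ 2 * (1 + m) / m by field_simp; ring]
              gcongr; linarith
            refine add_le_add (mul_le_mul_of_nonneg_right h2 (sq_nonneg _)) ?_
            refine (mul_le_mul_of_nonneg_right h3 (by positivity)).trans (le_of_eq (by ring))
        _ = (1 - m) * ∫ s, ‖Z (n + 1) s‖ ^ 2 ∂μ
            + c ^ 2 / m * (K ^ 2 * ∫ s, wMove (B := B) a cfg w₁ (n + 2) s ^ 2 ∂μ) := by
            rw [integral_add ((hZ _).norm_sq.integrable.const_mul _) hi, integral_const_mul,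
              integral_const_mul]
            simp only [mul_pow, integral_const_mul]
        _ ≤ _ := by
            refine add_le_add le_rfl (mul_le_mul_of_nonneg_right ?_
              (mul_nonneg (sq_nonneg _) (hint _)))
            rw [div_le_iff₀ hm]
            exact hc2.trans (le_of_eq (by ring))
    refine add_le_add h1 ?_
    have hW0 : 0 ≤ ∫ s, staleSpread (B := B) a cfg w₁ D (n + 2) s ∂μ :=
      integral_nonneg fun _ => spread_nonneg _ _
    refine mul_le_mul (mul_le_mul_of_nonneg_right hmc4 hp.le) (add_le_add le_rfl ?_) ?_
      (by positivity)
    · nlinarith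
    · exact add_nonneg hs₀ (mul_nonneg (by linarith) hW0)
  · intro n
    have hle : ∀ s, ‖momentumNoise a cfg w₁ D (n + 1) s‖ ^ 2 ≤
        (1 - p) * ‖momentumNoise (B := B) a cfg w₁ D n s‖ ^ 2 + p * ‖Z (n + 1) s‖ ^ 2 := by
      intro s
      have hq : 0 < 1 - m := by linarith
      rw [hZs]
      have e : momentumNoise a cfg w₁ D (n + 1) s = (1 - m) • momentumNoise a cfg w₁ D n s
        + m • noise a cfg w₁ D (n + 1) s := rfl
      rw [e]
      exact norm_sq_combination_le hm hmp hp1 hmc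
    refine (integral_mono (hM _).norm_sq.integrable (((hM n).norm_sq.integrable.const_mul _).add
      ((hZ _).norm_sq.integrable.const_mul _)) hle).trans (le_of_eq ?_)
    simp only [Pi.add_apply]
    rw [integral_add ((hM n).norm_sq.integrable.const_mul _)
      ((hZ _).norm_sq.integrable.const_mul _), integral_const_mul, integral_const_mul]

end

/-! ### Stochastic gradient descent with momentum -/

/-- Mean value inequality on the segment. It gives the constant `L` where integration would give `L
/ 2`; the difference is harmless below. -/
theorem le_add_inner_gradient {V : Type*} [NormedAddCommGroup V] [InnerProductSpace ℝ V]
    [CompleteSpace V] {f : V → ℝ} (hf : Differentiable ℝ f) {L : ℝ}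
    (hL : ∀ x y, ‖gradient f x - gradient f y‖ ≤ L * ‖x - y‖) (x h : V) :
    f (x + h) ≤ f x + inner ℝ (gradient f x) h + L * ‖h‖ ^ 2 := by
  have hL0 : 0 ≤ L * ‖h‖ := by
    have := (norm_nonneg _).trans (hL (x + h) x)
    simpa using this
  have h1 : ∀ y ∈ segment ℝ x (x + h),
      HasFDerivWithinAt f (InnerProductSpace.toDual ℝ V (gradient f y)) (segment ℝ x (x + h)) y :=
    fun y _ => ((hf y).hasGradientAt.hasFDerivAt).hasFDerivWithinAt
  have h2 : ∀ y ∈ segment ℝ x (x + h), ‖InnerProductSpace.toDual ℝ V (gradient f y)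
      - InnerProductSpace.toDual ℝ V (gradient f x)‖ ≤ L * ‖h‖ := by
    intro y hy
    rw [← map_sub, LinearIsometryEquiv.norm_map]
    rcases eq_or_ne h 0 with rfl | hh
    · have : y = x := by simpa using hy
      simp [this]
    refine (hL y x).trans ?_
    have hL1 : 0 ≤ L := nonneg_of_mul_nonneg_left hL0 (norm_pos_iff.2 hh)
    refine mul_le_mul_of_nonneg_left ?_ hL1
    rw [segment_eq_image'] at hy
    obtain ⟨θ, ⟨hθ0, hθ1⟩, rfl⟩ := hy
    simp only [add_sub_cancel_left, norm_smul, Real.norm_eq_abs, abs_of_nonneg hθ0]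
    exact mul_le_of_le_one_left (norm_nonneg _) hθ1
  have h3 := (convex_segment x (x + h)).norm_image_sub_le_of_norm_hasFDerivWithin_le' h1 h2
    (left_mem_segment ℝ x (x + h)) (right_mem_segment ℝ x (x + h))
  rw [add_sub_cancel_left, InnerProductSpace.toDual_apply_apply, Real.norm_eq_abs] at h3
  have h4 := le_abs_self (f (x + h) - f x - inner ℝ (gradient f x) h)
  nlinarith

section

variable {E B : ℕ} {d dw : ℕ → ℕ} {Ξ : Type*} [MeasurableSpace Ξ]
  {a : Layers d dw} {cfg : Config d Ξ} {w₁ : Weights E dw}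
  {D : Measure (Act d 0)} {ν : Measure Ξ} [IsProbabilityMeasure D] [IsProbabilityMeasure ν]
  {Lℓ Ca Lg La ωF ωB σ J q M c Δ : ℝ} {η : ℕ → ℝ}

variable (a cfg w₁ D) in
/-- The error of the momentum of iteration `n + 1`, without the noise of the samples. -/
def driftError (n : ℕ) (s : ℕ → IterSeed B d Ξ) : Weights E dw :=
  (run a cfg w₁ s (n + 1)).u - gradient (risk a D) (run a cfg w₁ s n).w
    - momentumNoise a cfg w₁ D n s

omit [MeasurableSpace Ξ] [IsProbabilityMeasure D] in
theorem noise_eq (hB : 0 < B) (n : ℕ) (s : ℕ → IterSeed B d Ξ) :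
    noise a cfg w₁ D n s = batchGrad a (run a cfg w₁ s (n + 1)).x (run a cfg w₁ s n).w
      - gradient (risk a D) (run a cfg w₁ s n).w := by
  have hB' : (B : ℝ) ≠ 0 := by exact_mod_cast hB.ne'
  simp only [noise, avg, sampleNoise, Finset.sum_sub_distrib, smul_sub, batchGrad, Finset.sum_const,
    Finset.card_univ, Fintype.card_fin]
  rw [← Nat.cast_smul_eq_nsmul ℝ, smul_smul, inv_mul_cancel₀ hB', one_smul]

section

variable (hS : Smooth E a D Lℓ Ca Lg La) (hdE : d E = 1) (hE : 0 < E)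
  (hG : StochasticGradient E a D σ)
include hS hdE hG

omit [MeasurableSpace Ξ]

/-- The momentum starts at zero, so the first iteration misses `1 - m` times the gradient. This bias
is the impulse `gradBound`. -/
theorem norm_driftError_zero_le (hB : 0 < B) (hm : 0 ≤ cfg.m) (hm1 : cfg.m ≤ 1)
    (s : ℕ → IterSeed B d Ξ) :
    ‖driftError a cfg w₁ D 0 s‖ ≤ gradBound E Ca + cfg.m * meanDev a cfg w₁ 0 s := by
  have e : driftError a cfg w₁ D 0 s = cfg.m • (avgEstimate a cfg w₁ 0 s
      - batchGrad a (run a cfg w₁ s (0 + 1)).x (run a cfg w₁ s 0).w)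
      - (1 - cfg.m) • gradient (risk a D) (run a cfg w₁ s 0).w := by
    have hu : (run a cfg w₁ s 0).u = 0 := rfl
    rw [driftError, run_succ_u, momentumNoise, noise_eq hB, hu]
    module
  rw [e]
  refine (norm_sub_le _ _).trans ?_
  rw [norm_smul, norm_smul, Real.norm_eq_abs, Real.norm_eq_abs, abs_of_nonneg hm,
    abs_of_nonneg (by linarith), add_comm]
  refine add_le_add ?_ le_rfl
  have h1 := norm_gradient_risk_le hS hdE hG (run a cfg w₁ s 0).w
  exact (mul_le_of_le_one_left (norm_nonneg _) (by linarith)).trans h1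

include hE

theorem norm_driftError_succ_le (hB : 0 < B) (hm : 0 ≤ cfg.m) (hm1 : cfg.m ≤ 1) (n : ℕ)
    (s : ℕ → IterSeed B d Ξ) :
    ‖driftError a cfg w₁ D (n + 1) s‖ ≤ (1 - cfg.m) * ‖driftError a cfg w₁ D n s‖
      + (lossLip E Ca Lg La * wMove a cfg w₁ (n + 1) s + cfg.m * meanDev a cfg w₁ (n + 1) s) := by
  have e : driftError a cfg w₁ D (n + 1) s = (1 - cfg.m) • driftError a cfg w₁ D n s
      + ((1 - cfg.m) • (gradient (risk a D) (run a cfg w₁ s n).w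
        - gradient (risk a D) (run a cfg w₁ s (n + 1)).w)
      + cfg.m • (avgEstimate a cfg w₁ (n + 1) s
        - batchGrad a (run a cfg w₁ s (n + 1 + 1)).x (run a cfg w₁ s (n + 1)).w)) := by
    rw [driftError, run_succ_u, momentumNoise, noise_eq hB, driftError]
    module
  rw [e]
  refine (norm_add_le _ _).trans (add_le_add ?_ ((norm_add_le _ _).trans (add_le_add ?_ ?_)))
  · rw [norm_smul, Real.norm_eq_abs, abs_of_nonneg (by linarith)]
  · rw [norm_smul, Real.norm_eq_abs, abs_of_nonneg (by linarith)]
    refine (mul_le_of_le_one_left (norm_nonneg _) (by linarith)).trans ?_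
    rw [norm_sub_rev]
    exact norm_gradient_risk_sub_le hS hdE hE hG _ _
  · rw [norm_smul, Real.norm_eq_abs, abs_of_nonneg hm]
    rfl

/-- The sum of the squared gradients along a run. -/
theorem sum_norm_gradient_sq_le (hΔ : ∀ w : Weights E dw, risk a D w₁ - risk a D w ≤ Δ) (hγ : 0 < cfg.γ)
    (hγL : cfg.γ * lossLip E Ca Lg La ≤ 1 / 4) (T : ℕ) (s : ℕ → IterSeed B d Ξ) :
    ∑ n ∈ Finset.range T, ‖gradient (risk a D) (run a cfg w₁ s n).w‖ ^ 2
        + 1 / 2 * ∑ n ∈ Finset.range T, ‖(run a cfg w₁ s (n + 1)).u‖ ^ 2 ≤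
      2 * Δ / cfg.γ + ∑ n ∈ Finset.range T,
        ‖(run a cfg w₁ s (n + 1)).u - gradient (risk a D) (run a cfg w₁ s n).w‖ ^ 2 := by
  have key : ∀ T, cfg.γ / 2 * (∑ n ∈ Finset.range T,
      ‖gradient (risk a D) (run a cfg w₁ s n).w‖ ^ 2
        + 1 / 2 * ∑ n ∈ Finset.range T, ‖(run a cfg w₁ s (n + 1)).u‖ ^ 2
        - ∑ n ∈ Finset.range T,
        ‖(run a cfg w₁ s (n + 1)).u - gradient (risk a D) (run a cfg w₁ s n).w‖ ^ 2) ≤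
      risk a D w₁ - risk a D (run a cfg w₁ s T).w := by
    intro T
    induction T with
    | zero => simp [run, State.init]
    | succ T ih =>
      rw [Finset.sum_range_succ, Finset.sum_range_succ, Finset.sum_range_succ]
      -- The inner product of `u` and the gradient is expanded by polarisation. It yields `-γ/2`
      -- times `‖∇ℓ‖² + ‖u‖² - ‖u - ∇ℓ‖²`; since `γ * lossLip ≤ 1/4`, the quadratic term uses up
      -- only half of `‖u‖²`.
      have h1 := le_add_inner_gradient hS.differentiable_risk
        (norm_gradient_risk_sub_le hS hdE hE hG) (run a cfg w₁ s T).w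
        (-(cfg.γ • (run a cfg w₁ s (T + 1)).u))
      rw [← sub_eq_add_neg, ← run_succ_w, inner_neg_right, inner_smul_right, norm_neg, norm_smul,
        mul_pow, Real.norm_eq_abs, sq_abs] at h1
      have h2 := norm_sub_sq_real (run a cfg w₁ s (T + 1)).u
        (gradient (risk a D) (run a cfg w₁ s T).w)
      rw [real_inner_comm] at h2
      have h3 : cfg.γ * (cfg.γ * lossLip E Ca Lg La * ‖(run a cfg w₁ s (T + 1)).u‖ ^ 2) ≤
          cfg.γ * (1 / 4 * ‖(run a cfg w₁ s (T + 1)).u‖ ^ 2) := by gcongr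
      rw [h2]
      linarith
  have h := (key T).trans (hΔ _)
  have h4 : 2 * Δ / cfg.γ * (cfg.γ / 2) = Δ := by field_simp
  refine le_of_mul_le_mul_right ?_ (half_pos hγ)
  rw [add_mul (2 * Δ / cfg.γ), h4]
  linarith

end

variable (hS : Smooth E a D Lℓ Ca Lg La) (hC : Contractive E ν cfg.Cf cfg.Cb ωF ωB)
  (hdE : d E = 1) (hE : 0 < E) (hG : StochasticGradient E a D σ)
include hS hC hdE hE hG

theorem l2Le_driftError (hB : 0 < B) (hm : 0 < cfg.m) (hm1 : cfg.m < 1)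
    {δ β : ℕ → ℝ} {T : ℕ} (hδ : ∀ n, n < T → L2Le (runLaw B D ν) (wMove (B := B) a cfg w₁ n) (δ n))
    (hβ : ∀ n, n < T → L2Le (runLaw B D ν) (meanDev (B := B) a cfg w₁ n) (β n)) {n : ℕ}
    (hn : n < T) :
    L2Le (runLaw B D ν) (fun s => ‖driftError (B := B) a cfg w₁ D n s‖)
      (geomFilter (1 - cfg.m) (fun n => (if n = 0 then gradBound E Ca else 0)
        + (lossLip E Ca Lg La * δ n + cfg.m * β n)) n) := by
  have hCa := hS.Ca_nonneg hE
  have hL : 0 ≤ lossLip E Ca Lg La := lossLip_nonneg hCa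
  have hmeas : ∀ n, AEStronglyMeasurable (fun s => ‖driftError (B := B) a cfg w₁ D n s‖)
      (runLaw B D ν) := fun n =>
    (((measurableState_run hS hC w₁ (n + 1)).u.sub ((continuous_gradient_risk hS hdE hE
      hG).measurable.comp (measurableState_run hS hC w₁ n).w)).sub
      (bddMeas_momentumNoise hS hC hdE hE hG n).meas).norm.aestronglyMeasurable
  induction n with
  | zero =>
    refine (((L2Le.const (gradBound_nonneg (E := E) hCa)).add
      ((hβ 0 hn).const_mul hm.le)).mono (hmeas 0) fun s => ?_).mono_bound ?_
    · rw [abs_norm]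
      exact norm_driftError_zero_le hS hdE hG hB hm.le hm1.le s
    · have := mul_nonneg hL (hδ 0 hn).nonneg
      simp only [geomFilter, if_true]
      linarith
  | succ n ih =>
    refine (((ih (by omega)).const_mul (k := 1 - cfg.m) (by linarith)).add
      (((hδ _ hn).const_mul hL).add ((hβ _ hn).const_mul hm.le))).mono (hmeas _) (fun s => ?_)
      |>.mono_bound ?_
    · rw [abs_norm]
      exact norm_driftError_succ_le hS hdE hE hG hB hm.le hm1.le n s
    · simp [geomFilter]

-- The inputs are sorted by type. The initial bias and the `ℓ¹` part of the compression error pass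
-- through the filter at cost `1 / m`, the `ℓ²` inputs at cost `1 / m ^ 2`. Compression errors carry
-- a factor `m`, so `m * C ^ 2 * J ^ 2` and `C ^ 2 * Q` remain of them.
omit hS hC hdE hE hG in
theorem sum_sq_geomFilter_drift_le {m G L C Q S₂ J : ℝ} {δ β : ℕ → ℝ} (hm : 0 < m) (hm1 : m < 1)
    (hG : 0 ≤ G) (hL : 0 ≤ L) (hδ : ∀ n, 0 ≤ δ n) (hβ0 : ∀ n, 0 ≤ β n)
    {T : ℕ} (hδ2 : ∑ n ∈ Finset.range T, δ n ^ 2 ≤ S₂) (hβ : Dom T J Q C β) :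
    ∑ n ∈ Finset.range T, geomFilter (1 - m) (fun n => (if n = 0 then G else 0)
        + (L * δ n + m * β n)) n ^ 2 ≤
      4 * (G ^ 2 / m + m * C ^ 2 * J ^ 2 + L ^ 2 / m ^ 2 * S₂ + C ^ 2 * Q) := by
  obtain ⟨hC, b', b'', h1, h2, h3, h4, h5⟩ := hβ
  have hω : 0 ≤ 1 - m := by linarith
  have hω1 : 1 - m < 1 := by linarith
  let f₁ : ℕ → ℝ := fun n => (if n = 0 then G else 0) + m * b' n
  let f₂ : ℕ → ℝ := fun n => L * δ n + m * b'' n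
  have hf₁ : ∀ n, 0 ≤ f₁ n := fun n => by
    have := h1 n
    dsimp only [f₁]
    split_ifs <;> positivity
  have hf₂ : ∀ n, 0 ≤ f₂ n := fun n => add_nonneg (mul_nonneg hL (hδ n)) (mul_nonneg hm.le (h2 n))
  have hs₁ : ∑ n ∈ Finset.range T, f₁ n ≤ G + m * (C * J) := by
    simp only [f₁, Finset.sum_add_distrib, ← Finset.mul_sum, Finset.sum_ite_eq']
    refine add_le_add ?_ (mul_le_mul_of_nonneg_left h4 hm.le)
    split_ifs <;> linarith
  have hs₂ : ∑ n ∈ Finset.range T, f₂ n ^ 2 ≤ 2 * (L ^ 2 * S₂) + 2 * (m ^ 2 * (C ^ 2 * Q)) := by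
    calc ∑ n ∈ Finset.range T, f₂ n ^ 2
        ≤ ∑ n ∈ Finset.range T, (2 * (L ^ 2 * δ n ^ 2) + 2 * (m ^ 2 * b'' n ^ 2)) :=
          Finset.sum_le_sum fun n _ => by
            dsimp only [f₂]; nlinarith [sq_nonneg (L * δ n - m * b'' n)]
      _ ≤ _ := by
          rw [Finset.sum_add_distrib, ← Finset.mul_sum, ← Finset.mul_sum, ← Finset.mul_sum,
            ← Finset.mul_sum]
          gcongr
  calc _ ≤ ∑ n ∈ Finset.range T, (2 * geomFilter (1 - m) f₁ n ^ 2
        + 2 * geomFilter (1 - m) f₂ n ^ 2) := by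
        refine Finset.sum_le_sum fun n _ => ?_
        have h : geomFilter (1 - m) (fun n => (if n = 0 then G else 0)
            + (L * δ n + m * β n)) n ≤ geomFilter (1 - m) f₁ n + geomFilter (1 - m) f₂ n := by
          rw [← geomFilter_add]
          refine geomFilter_mono hω (fun n => ?_) n
          have := mul_le_mul_of_nonneg_left (h3 n) hm.le
          dsimp only [f₁, f₂]
          linarith
        have h0 : 0 ≤ geomFilter (1 - m) (fun n => (if n = 0 then G else 0)
            + (L * δ n + m * β n)) n := geomFilter_nonneg hω (fun n => by
          have := hδ n
          have := hβ0 n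
          split_ifs <;> positivity) n
        have := pow_le_pow_left₀ h0 h 2
        nlinarith [sq_nonneg (geomFilter (1 - m) f₁ n - geomFilter (1 - m) f₂ n)]
    _ ≤ 2 * ((G + m * (C * J)) ^ 2 / m)
        + 2 * ((2 * (L ^ 2 * S₂) + 2 * (m ^ 2 * (C ^ 2 * Q))) / m ^ 2) := by
        rw [Finset.sum_add_distrib, ← Finset.mul_sum, ← Finset.mul_sum]
        have e₁ := sum_sq_geomFilter_le_sq_sum hω hω1 hf₁ T
        have e₂ := sum_sq_geomFilter_le hω hω1 f₂ T
        rw [sub_sub_cancel] at e₁ e₂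
        have e₃ := Finset.sum_nonneg fun n (_ : n ∈ Finset.range T) => hf₁ n
        refine add_le_add (mul_le_mul_of_nonneg_left (e₁.trans ?_) zero_le_two)
          (mul_le_mul_of_nonneg_left (e₂.trans ?_) zero_le_two)
        · gcongr
        · gcongr
    _ ≤ 2 * ((2 * G ^ 2 + 2 * (m * (C * J)) ^ 2) / m)
        + 2 * ((2 * (L ^ 2 * S₂) + 2 * (m ^ 2 * (C ^ 2 * Q))) / m ^ 2) := by
        gcongr
        nlinarith [sq_nonneg (G - m * (C * J))]
    _ = _ := by field_simp; ring

/-- The convergence of the algorithm, given a bound for the noise of the momentum. -/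
theorem avgGradSqLE_of_noise (hB : 0 < B) (hΔ : ∀ w : Weights E dw, risk a D w₁ - risk a D w ≤ Δ)
    (hI : ∀ b : Fin B, SampleInputs a cfg w₁ b D ν J q M c η) (hγ : 0 < cfg.γ) (hm : 0 < cfg.m)
    (hm1 : cfg.m < 1) (hγL : cfg.γ * lossLip E Ca Lg La ≤ 1 / 4) {T : ℕ} (hT : 0 < T) {N k : ℝ}
    (hN : ∑ n ∈ Finset.range T, ∫ s, ‖momentumNoise (B := B) a cfg w₁ D n s‖ ^ 2 ∂runLaw B D ν ≤
      N + k * ∑ n ∈ Finset.range T, ∫ s, wMove (B := B) a cfg w₁ n s ^ 2 ∂runLaw B D ν) (hk : 0 ≤ k)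
    (hcoef : (8 * (lossLip E Ca Lg La ^ 2 / cfg.m ^ 2
      + (gradConst E Ca Lg La M c / pipeRate E ωF ωB) ^ 2) + 2 * k) * cfg.γ ^ 2 ≤ 1 / 2) {R : ℝ}
    (hR : 2 * Δ / cfg.γ + 8 * (gradBound E Ca ^ 2 / cfg.m
      + cfg.m * (gradConst E Ca Lg La M c / pipeRate E ωF ωB) ^ 2 * J ^ 2
      + (gradConst E Ca Lg La M c / pipeRate E ωF ωB) ^ 2 * (T * q)) + 2 * N ≤ T * R) :
    AvgGradSqLE a D ν cfg w₁ B T R := by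
  have hCa := hS.Ca_nonneg hE
  have hJ := (hI ⟨0, hB⟩).J_nonneg
  have hL : 0 ≤ lossLip E Ca Lg La := lossLip_nonneg hCa
  have hgrad : ∀ n, BddMeas fun s => gradient (risk a D) (run (B := B) a cfg w₁ s n).w := fun n =>
    ⟨(continuous_gradient_risk hS hdE hE hG).measurable.comp (measurableState_run hS hC w₁ n).w,
      _, fun s => norm_gradient_risk_le hS hdE hG _⟩
  have hmom := bddMeas_momentumNoise (B := B) (w₁ := w₁) hS hC hdE hE hG
  refine ⟨fun t _ => (hgrad (t - 1)).norm_sq.integrable, ?_⟩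
  have hsum : ∑ t ∈ Finset.Icc 1 T, ∫ s : ℕ → IterSeed B d Ξ,
      ‖gradient (risk a D) (iterate a cfg w₁ s t)‖ ^ 2 ∂runLaw B D ν =
      ∑ n ∈ Finset.range T, ∫ s : ℕ → IterSeed B d Ξ,
        ‖gradient (risk a D) (run a cfg w₁ s n).w‖ ^ 2 ∂runLaw B D ν := by
    rw [Finset.range_eq_Ico, Finset.sum_Ico_eq_sum_range, ← Finset.Ico_add_one_right_eq_Icc,
      Finset.sum_Ico_eq_sum_range]
    simp [iterate]
  rw [hsum, one_div, inv_mul_le_iff₀ (by exact_mod_cast hT)]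
  refine le_trans ?_ hR
  have hmove : ∀ n, ∃ k, L2Le (runLaw B D ν) (wMove (B := B) a cfg w₁ n) k := by
    rintro (_ | n)
    · have : wMove (B := B) a cfg w₁ 0 = fun _ => 0 := by funext s; simp [wMove]
      rw [this]; exact ⟨0, L2Le.const le_rfl⟩
    · exact l2Le_wMove hS hC hdE hE hI n
  have hδ : ∀ n, L2Le (runLaw B D ν) (wMove (B := B) a cfg w₁ n)
      (√(∫ s, wMove (B := B) a cfg w₁ n s ^ 2 ∂runLaw B D ν)) := fun n => by
    obtain ⟨k, hk⟩ := hmove n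
    exact L2Le.of_integrable hk.meas hk.integrable_sq
  have hδ0 : ∀ n, 0 ≤ ∫ s, wMove (B := B) a cfg w₁ n s ^ 2 ∂runLaw B D ν := fun n =>
    integral_nonneg fun _ => sq_nonneg _
  obtain ⟨β, hβ0, hβ, hβd⟩ := exists_meanDev_bound hS hC hdE hE hB hI T
  have hdrift := fun n (hn : n < T) => l2Le_driftError hS hC hdE hE hG hB hm hm1
    (fun n _ => hδ n) hβ hn
  have hdriftsum := sum_sq_geomFilter_drift_le hm hm1 (gradBound_nonneg (E := E) hCa) hL
    (fun n => Real.sqrt_nonneg _) hβ0 (le_of_eq (Finset.sum_congr rfl fun n _ => Real.sq_sqrt (hδ0 n)))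
    hβd
  have hu : ∀ n, Integrable (fun s => ‖(run (B := B) a cfg w₁ s n).u‖ ^ 2) (runLaw B D ν) :=
    fun n => (l2Le_momentum hS hC hdE hE hI n).choose_spec.integrable_sq
  have hpath := fun s => sum_norm_gradient_sq_le (B := B) hS hdE hE hG hΔ hγ hγL T s
  have hpath2 : ∀ s : ℕ → IterSeed B d Ξ,
      ∑ n ∈ Finset.range T, ‖gradient (risk a D) (run a cfg w₁ s n).w‖ ^ 2
        + 1 / 2 * ∑ n ∈ Finset.range T, ‖(run a cfg w₁ s (n + 1)).u‖ ^ 2 ≤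
      2 * Δ / cfg.γ + (2 * ∑ n ∈ Finset.range T, ‖driftError a cfg w₁ D n s‖ ^ 2
        + 2 * ∑ n ∈ Finset.range T, ‖momentumNoise a cfg w₁ D n s‖ ^ 2) := by
    intro s
    refine (hpath s).trans (add_le_add le_rfl ?_)
    rw [Finset.mul_sum, Finset.mul_sum, ← Finset.sum_add_distrib]
    refine Finset.sum_le_sum fun n _ => ?_
    have e : (run a cfg w₁ s (n + 1)).u - gradient (risk a D) (run a cfg w₁ s n).w =
        driftError a cfg w₁ D n s + momentumNoise a cfg w₁ D n s := by simp [driftError]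
    rw [e]
    have := pow_le_pow_left₀ (norm_nonneg _)
      (norm_add_le (driftError a cfg w₁ D n s) (momentumNoise a cfg w₁ D n s)) 2
    nlinarith [sq_nonneg (‖driftError a cfg w₁ D n s‖ - ‖momentumNoise a cfg w₁ D n s‖)]
  have hi₁ : ∀ n ∈ Finset.range T, Integrable (fun s =>
      ‖gradient (risk a D) (run (B := B) a cfg w₁ s n).w‖ ^ 2) (runLaw B D ν) := fun n _ =>
    (hgrad n).norm_sq.integrable
  have hi₂ : ∀ n ∈ Finset.range T, Integrable (fun s =>
      ‖(run (B := B) a cfg w₁ s (n + 1)).u‖ ^ 2) (runLaw B D ν) := fun n _ => hu (n + 1)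
  have hi₃ : ∀ n ∈ Finset.range T, Integrable (fun s =>
      ‖driftError (B := B) a cfg w₁ D n s‖ ^ 2) (runLaw B D ν) := fun n hn =>
    (hdrift n (Finset.mem_range.1 hn)).integrable_sq
  have hi₄ : ∀ n ∈ Finset.range T, Integrable (fun s =>
      ‖momentumNoise (B := B) a cfg w₁ D n s‖ ^ 2) (runLaw B D ν) := fun n _ =>
    (hmom n).norm_sq.integrable
  have hi₅ : Integrable (fun s : ℕ → IterSeed B d Ξ =>
      2 * ∑ n ∈ Finset.range T, ‖driftError a cfg w₁ D n s‖ ^ 2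
        + 2 * ∑ n ∈ Finset.range T, ‖momentumNoise a cfg w₁ D n s‖ ^ 2) (runLaw B D ν) :=
    ((integrable_finsetSum _ hi₃).const_mul 2).add ((integrable_finsetSum _ hi₄).const_mul 2)
  have hint := integral_mono ((integrable_finsetSum _ hi₁).add
      ((integrable_finsetSum _ hi₂).const_mul (1 / 2)))
    ((integrable_const (2 * Δ / cfg.γ)).add hi₅) hpath2
  simp only [Pi.add_apply] at hint
  rw [integral_add (integrable_finsetSum _ hi₁) ((integrable_finsetSum _ hi₂).const_mul (1 / 2)),
    integral_add (integrable_const (2 * Δ / cfg.γ)) hi₅,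
    integral_add ((integrable_finsetSum _ hi₃).const_mul 2)
      ((integrable_finsetSum _ hi₄).const_mul 2), integral_const_mul, integral_const_mul,
    integral_const_mul, integral_finsetSum _ hi₁, integral_finsetSum _ hi₂,
    integral_finsetSum _ hi₃, integral_finsetSum _ hi₄] at hint
  simp only [integral_const, probReal_univ, one_smul] at hint
  have hdr : ∑ n ∈ Finset.range T, ∫ s, ‖driftError (B := B) a cfg w₁ D n s‖ ^ 2 ∂runLaw B D ν ≤ _ :=
    (Finset.sum_le_sum fun n hn => (hdrift n (Finset.mem_range.1 hn)).integral_sq_le).trans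
      hdriftsum
  have hV : ∑ n ∈ Finset.range T, ∫ s, wMove (B := B) a cfg w₁ n s ^ 2 ∂runLaw B D ν ≤
      cfg.γ ^ 2 * ∑ n ∈ Finset.range T, ∫ s, ‖(run (B := B) a cfg w₁ s (n + 1)).u‖ ^ 2
        ∂runLaw B D ν := by
    have e : ∀ n, ∫ s, wMove (B := B) a cfg w₁ (n + 1) s ^ 2 ∂runLaw B D ν =
        cfg.γ ^ 2 * ∫ s, ‖(run (B := B) a cfg w₁ s (n + 1)).u‖ ^ 2 ∂runLaw B D ν := fun n => by
      rw [← integral_const_mul]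
      refine integral_congr_ae (.of_forall fun s => ?_)
      dsimp only
      rw [wMove_succ, mul_pow, sq_abs]
    obtain ⟨T, rfl⟩ := Nat.exists_eq_succ_of_ne_zero hT.ne'
    -- The subtraction in `wMove` is truncated, so the move with index `0` vanishes.
    have e0 : ∫ s, wMove (B := B) a cfg w₁ 0 s ^ 2 ∂runLaw B D ν = 0 := by simp [wMove]
    rw [Finset.sum_range_succ', e0, add_zero, Finset.sum_range_succ, mul_add, Finset.mul_sum]
    simp only [e]
    exact le_add_of_nonneg_right (mul_nonneg (sq_nonneg _) (integral_nonneg fun _ => sq_nonneg _))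
  have hV0 : 0 ≤ ∑ n ∈ Finset.range T, ∫ s, ‖(run (B := B) a cfg w₁ s (n + 1)).u‖ ^ 2
      ∂runLaw B D ν := Finset.sum_nonneg fun n _ => integral_nonneg fun _ => sq_nonneg _
  generalize (gradConst E Ca Lg La M c / pipeRate E ωF ωB) = K at *
  -- All occurrences of the squared moves, from drift, compression and noise, are collected; by
  -- `hcoef` they are at most half of the sum of `‖u‖²`, which the descent inequality left over.
  have h1 := mul_le_mul_of_nonneg_left hV (show 0 ≤ 8 * (lossLip E Ca Lg La ^ 2 / cfg.m ^ 2
      + K ^ 2) + 2 * k by positivity)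
  have h2 := mul_le_mul_of_nonneg_right hcoef hV0
  linarith

end

/-! ### Moments of averages -/

section Moments

variable {Ω : Type*} [MeasurableSpace Ω] {ρ : Measure Ω} [IsProbabilityMeasure ρ] {B : ℕ}

/-- Hoeffding's lemma for each entry; independence turns the exponential of the sum into a product.
-/
theorem integral_exp_avg_le {f : Ω → ℝ} (hf : Measurable f) {M : ℝ} (hM : 0 ≤ M)
    (hb : ∀ ω, |f ω| ≤ M) (h0 : ∫ ω, f ω ∂ρ = 0) (hB : 0 < B) (t : ℝ) :
    ∫ X : Fin B → Ω, Real.exp (t * ((B : ℝ)⁻¹ * ∑ b, f (X b))) ∂(Measure.pi fun _ => ρ) ≤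
      Real.exp (t ^ 2 * M ^ 2 / (2 * B)) := by
  have hB' : (B : ℝ) ≠ 0 := by exact_mod_cast hB.ne'
  have h := ProbabilityTheory.hasSubgaussianMGF_of_mem_Icc_of_integral_eq_zero (μ := ρ)
    hf.aemeasurable (.of_forall fun ω => Set.mem_Icc.2 (abs_le.1 (hb ω))) h0
  have e : ∀ X : Fin B → Ω, Real.exp (t * ((B : ℝ)⁻¹ * ∑ b, f (X b))) =
      ∏ b, Real.exp (t * (B : ℝ)⁻¹ * f (X b)) := fun X => by
    rw [← Real.exp_sum, ← Finset.mul_sum, mul_assoc]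
  simp only [e]
  rw [integral_fintype_prod_eq_pow (fun ω => Real.exp (t * (B : ℝ)⁻¹ * f ω)), Fintype.card_fin]
  refine (pow_le_pow_left₀ (integral_nonneg fun _ => (Real.exp_pos _).le)
    (h.mgf_le (t * (B : ℝ)⁻¹)) B).trans (le_of_eq ?_)
  rw [← Real.exp_nat_mul]
  congr 1
  have hc : ((‖M - -M‖₊ / 2 : NNReal) : ℝ) = M := by
    simp only [NNReal.coe_div, coe_nnnorm, Real.norm_eq_abs, NNReal.coe_ofNat]
    rw [abs_of_nonneg (by linarith)]; ring
  rw [NNReal.coe_pow, hc]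
  field_simp

/-- At the scale `θ = √B / M` the exponential moments are at most `e ^ (1/2) ≤ 2`, and a power is at
most a factorial times an exponential of the absolute value. The factor `4` counts both signs. -/
theorem integral_pow_avg_le {f : Ω → ℝ} (hf : Measurable f) {M : ℝ} (hM : 0 < M)
    (hb : ∀ ω, |f ω| ≤ M) (h0 : ∫ ω, f ω ∂ρ = 0) (hB : 0 < B) (k : ℕ) :
    ∫ X : Fin B → Ω, ((B : ℝ)⁻¹ * ∑ b, f (X b)) ^ (2 * k) ∂(Measure.pi fun _ => ρ) ≤
      4 * (2 * k).factorial * (M ^ 2 / B) ^ k := by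
  have hB' : (0 : ℝ) < B := by exact_mod_cast hB
  set P := Measure.pi fun _ : Fin B => ρ
  set z : (Fin B → Ω) → ℝ := fun X => (B : ℝ)⁻¹ * ∑ b, f (X b) with hz
  set θ := √B / M with hθ
  have hθ0 : 0 < θ := div_pos (Real.sqrt_pos.2 hB') hM
  have hθ2 : θ ^ 2 = B / M ^ 2 := by rw [hθ, div_pow, Real.sq_sqrt hB'.le]
  have hzm : Measurable z := (Finset.measurable_fun_sum _ fun b _ =>
    hf.comp (measurable_pi_apply b)).const_mul _
  have hzb : ∀ X, |z X| ≤ M := fun X =>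
    norm_avg_le (V := ℝ) hM.le fun b => hb (X b)
  have hexp : ∀ t : ℝ, Integrable (fun X => Real.exp (t * z X)) P := fun t =>
    BddMeas.integrable ⟨(hzm.const_mul t).exp, Real.exp (|t| * M), fun X => by
      rw [Real.norm_eq_abs, Real.abs_exp]
      refine Real.exp_le_exp.2 ((le_abs_self _).trans ?_)
      rw [abs_mul]
      exact mul_le_mul_of_nonneg_left (hzb X) (abs_nonneg t)⟩
  have hE : ∀ t : ℝ, t ^ 2 = θ ^ 2 → ∫ X, Real.exp (t * z X) ∂P ≤ 2 := fun t ht => by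
    refine (integral_exp_avg_le hf hM.le hb h0 hB t).trans ?_
    rw [ht, hθ2, show (B : ℝ) / M ^ 2 * M ^ 2 / (2 * B) = 1 / 2 by field_simp]
    have h1 := Real.exp_one_lt_d9
    have h2 : Real.exp (1 / 2) ^ 2 = Real.exp 1 := by rw [← Real.exp_nat_mul]; norm_num
    have := Real.exp_pos (1 / 2)
    nlinarith
  have hle : ∀ X, z X ^ (2 * k) ≤ (2 * k).factorial / θ ^ (2 * k)
      * (Real.exp (θ * z X) + Real.exp (-θ * z X)) := fun X => by
    have h1 := Real.pow_div_factorial_le_exp _ (abs_nonneg (θ * z X)) (2 * k)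
    rw [div_le_iff₀ (by positivity), (even_two_mul k).pow_abs, mul_pow] at h1
    rw [div_mul_eq_mul_div, le_div_iff₀ (by positivity), mul_comm]
    refine h1.trans ?_
    rw [mul_comm]
    refine mul_le_mul_of_nonneg_left ?_ (by positivity)
    rcases abs_cases (θ * z X) with ⟨h, -⟩ | ⟨h, -⟩ <;> rw [h]
    · exact le_add_of_nonneg_right (Real.exp_pos _).le
    · rw [← neg_mul]; exact le_add_of_nonneg_left (Real.exp_pos _).le
  have hint : Integrable (fun X => z X ^ (2 * k)) P :=
    BddMeas.integrable ⟨hzm.pow_const _, M ^ (2 * k), fun X => by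
      rw [norm_pow]; exact pow_le_pow_left₀ (norm_nonneg _) (hzb X) _⟩
  calc ∫ X, z X ^ (2 * k) ∂P ≤ ∫ X, (2 * k).factorial / θ ^ (2 * k)
        * (Real.exp (θ * z X) + Real.exp (-θ * z X)) ∂P :=
        integral_mono hint (((hexp θ).add (hexp (-θ))).const_mul _) hle
    _ = (2 * k).factorial / θ ^ (2 * k)
        * (∫ X, Real.exp (θ * z X) ∂P + ∫ X, Real.exp (-θ * z X) ∂P) := by
        rw [integral_const_mul, integral_add (hexp θ) (hexp (-θ))]
    _ ≤ (2 * k).factorial / θ ^ (2 * k) * (2 + 2) := by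
        refine mul_le_mul_of_nonneg_left (add_le_add (hE θ rfl) (hE (-θ) (by ring))) (by positivity)
    _ = _ := by rw [pow_mul, hθ2, div_pow, div_pow]; field_simp; ring

/-- The constant in the bound for the moments of averages. -/
def momentConst (n k : ℕ) : ℝ := n ^ (k + 1) * (4 * (2 * (k + 1)).factorial)

theorem momentConst_nonneg (n k : ℕ) : 0 ≤ momentConst n k := by unfold momentConst; positivity

variable {V : Type*} [NormedAddCommGroup V] [InnerProductSpace ℝ V] [FiniteDimensional ℝ V]
  [MeasurableSpace V] [BorelSpace V]

/-- The scalar bound in each coordinate of an orthonormal basis, combined by the power mean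
inequality; this produces the power of the dimension in `momentConst`. -/
theorem integral_norm_avg_pow_le {Y : Ω → V} (hY : Measurable Y) {M : ℝ} (hM : 0 < M)
    (hb : ∀ ω, ‖Y ω‖ ≤ M) (h0 : ∫ ω, Y ω ∂ρ = 0) (hB : 0 < B) (k : ℕ) :
    ∫ X : Fin B → Ω, ‖avg fun b => Y (X b)‖ ^ (2 * (k + 1)) ∂(Measure.pi fun _ => ρ) ≤
      momentConst (Module.finrank ℝ V) k * (M ^ 2 / B) ^ (k + 1) := by
  set n := Module.finrank ℝ V
  let e := stdOrthonormalBasis ℝ V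
  have hYi : Integrable Y ρ := BddMeas.integrable ⟨hY, M, hb⟩
  have hmeas : ∀ i, Measurable fun ω => inner ℝ (e i) (Y ω) := fun i => measurable_const.inner hY
  have hbi : ∀ i ω, |inner ℝ (e i) (Y ω)| ≤ M := fun i ω => by
    refine (abs_real_inner_le_norm _ _).trans ?_
    rw [e.orthonormal.1 i, one_mul]; exact hb ω
  have h0i : ∀ i, ∫ ω, inner ℝ (e i) (Y ω) ∂ρ = 0 := fun i => by
    rw [integral_inner hYi, h0, inner_zero_right]
  have hz : ∀ (X : Fin B → Ω) i, inner ℝ (e i) (avg fun b => Y (X b)) =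
      (B : ℝ)⁻¹ * ∑ b, inner ℝ (e i) (Y (X b)) := fun X i => by
    rw [avg, inner_smul_right, inner_sum]
  have hle : ∀ X : Fin B → Ω, ‖avg fun b => Y (X b)‖ ^ (2 * (k + 1)) ≤
      n ^ k * ∑ i, ((B : ℝ)⁻¹ * ∑ b, inner ℝ (e i) (Y (X b))) ^ (2 * (k + 1)) := fun X => by
    rw [pow_mul, ← e.sum_sq_norm_inner_right]
    have h := pow_sum_div_card_le_sum_pow (s := Finset.univ)
      (f := fun i => ‖inner ℝ (e i) (avg fun b => Y (X b))‖ ^ 2) (fun _ _ => sq_nonneg _) k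
    rcases Nat.eq_zero_or_pos n with hn | hn
    · have : IsEmpty (Fin n) := by rw [hn]; infer_instance
      simp
    · have hn' : (0 : ℝ) < n := by exact_mod_cast hn
      rw [Finset.card_univ, Fintype.card_fin, div_le_iff₀ (by positivity), mul_comm] at h
      refine h.trans (le_of_eq ?_)
      congr 1
      refine Finset.sum_congr rfl fun i _ => ?_
      rw [hz, Real.norm_eq_abs, ← pow_mul, (even_two_mul (k + 1)).pow_abs]
  have hi : ∀ i, Integrable (fun X : Fin B → Ω =>
      ((B : ℝ)⁻¹ * ∑ b, inner ℝ (e i) (Y (X b))) ^ (2 * (k + 1))) (Measure.pi fun _ => ρ) := fun i =>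
    BddMeas.integrable ⟨((Finset.measurable_fun_sum _ fun b _ =>
      (hmeas i).comp (measurable_pi_apply b)).const_mul _).pow_const _, M ^ (2 * (k + 1)),
      fun X => by
        rw [norm_pow]
        exact pow_le_pow_left₀ (norm_nonneg _)
          (norm_avg_le (V := ℝ) hM.le fun b => hbi i (X b)) _⟩
  have hl : Integrable (fun X : Fin B → Ω => ‖avg fun b => Y (X b)‖ ^ (2 * (k + 1)))
      (Measure.pi fun _ => ρ) :=
    BddMeas.integrable ⟨((Finset.measurable_fun_sum _ fun b _ =>
      hY.comp (measurable_pi_apply b)).const_smul ((B : ℝ)⁻¹)).norm.pow_const _, M ^ (2 * (k + 1)),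
      fun X => by
        rw [norm_pow, norm_norm]
        exact pow_le_pow_left₀ (norm_nonneg _) (norm_avg_le hM.le fun b => hb (X b)) _⟩
  refine (integral_mono hl ((integrable_finsetSum _ fun i _ => hi i).const_mul _) hle).trans ?_
  rw [integral_const_mul, integral_finsetSum _ fun i _ => hi i]
  refine (mul_le_mul_of_nonneg_left (Finset.sum_le_sum fun i _ =>
    integral_pow_avg_le (hmeas i) hM (hbi i) (h0i i) hB (k + 1)) (by positivity)).trans
    (le_of_eq ?_)
  rw [Finset.sum_const, Finset.card_univ, Fintype.card_fin, nsmul_eq_mul, momentConst]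
  ring

end Moments

/-! ### Suprema of Lipschitz functions through integrals -/

section BallAverage

variable {V : Type*} [NormedAddCommGroup V] [NormedSpace ℝ V] [FiniteDimensional ℝ V]
  [MeasurableSpace V] [BorelSpace V]

/-- The radius of a ball on which a function of Lipschitz constant `K` does not change much. -/
def smallRadius (K r lam : ℝ) : ℝ := √r / (2 * K + √lam + 1)

/-- The radius of the ball that contains all the relevant points. -/
def largeRadius (K M r lam : ℝ) : ℝ := M / √lam + smallRadius K r lam

/-- A moment of the relative size of `g`. -/
def ballMoment (μ : Measure V) (K M r lam : ℝ) (k : ℕ) (g : V → V) : ℝ :=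
  ∫ x in Metric.closedBall 0 (largeRadius K M r lam), (‖g x‖ ^ 2 / (r + lam * ‖x‖ ^ 2)) ^ k ∂μ

/-- Replaces a supremum over `h` by an integral, so that `h` may depend on `g`. If `‖g h‖²` exceeds
`r + lam ‖h‖²`, then by Lipschitz continuity the relative size of `g` is at least `1/16` on the
whole small ball around `h`. The moment is then at least `16 ^ (-k)` times the volume of that ball,
so the last factor is at least `1`, and the trivial bound `M ^ 2` finishes. -/
theorem norm_sq_le_ballMoment {μ : Measure V} [μ.IsAddHaarMeasure] {g : V → V} {K M r lam : ℝ}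
    (hK : 0 ≤ K) (hM : 0 ≤ M) (hr : 0 < r) (hlam : 0 < lam)
    (hg : ∀ x y, ‖g x - g y‖ ≤ K * ‖x - y‖) (hgM : ∀ x, ‖g x‖ ≤ M) (k : ℕ) (h : V) :
    ‖g h‖ ^ 2 ≤ r + lam * ‖h‖ ^ 2 + M ^ 2 * (16 ^ k
      / μ.real (Metric.ball 0 (smallRadius K r lam)) * ballMoment μ K M r lam k g) := by
  set ρ := smallRadius K r lam with hρdef
  have hsr : 0 < √r := Real.sqrt_pos.2 hr
  have hsl : 0 < √lam := Real.sqrt_pos.2 hlam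
  have hρ : 0 < ρ := by rw [hρdef, smallRadius]; positivity
  have hρ' : ρ * (2 * K + √lam + 1) = √r := by
    rw [hρdef, smallRadius, div_mul_cancel₀]; positivity
  have hcont : Continuous g := (LipschitzWith.of_dist_le_mul (K := K.toNNReal) fun x y => by
    rw [dist_eq_norm, dist_eq_norm, Real.coe_toNNReal _ hK]; exact hg x y).continuous
  have hden : ∀ x : V, 0 < r + lam * ‖x‖ ^ 2 := fun x => by positivity
  have hcontq : Continuous fun x : V => (‖g x‖ ^ 2 / (r + lam * ‖x‖ ^ 2)) ^ k :=
    ((hcont.norm.pow 2).div (by fun_prop) fun x => (hden x).ne').pow k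
  have hpos : 0 < μ.real (Metric.ball (0 : V) ρ) :=
    ENNReal.toReal_pos (Metric.measure_ball_pos μ _ hρ).ne' measure_ball_lt_top.ne
  have hint : IntegrableOn (fun x : V => (‖g x‖ ^ 2 / (r + lam * ‖x‖ ^ 2)) ^ k)
      (Metric.closedBall 0 (largeRadius K M r lam)) μ :=
    hcontq.continuousOn.integrableOn_compact (isCompact_closedBall _ _)
  have hnn : 0 ≤ ballMoment μ K M r lam k g :=
    integral_nonneg fun x => pow_nonneg (div_nonneg (sq_nonneg _) (hden x).le) k
  rcases le_or_gt (‖g h‖ ^ 2) (r + lam * ‖h‖ ^ 2) with hle | hlt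
  · refine hle.trans (le_add_of_nonneg_right ?_)
    positivity
  have hgh : ‖g h‖ ^ 2 ≤ M ^ 2 := pow_le_pow_left₀ (norm_nonneg _) (hgM h) 2
  -- An exceptional `h` satisfies `lam ‖h‖² ≤ M²`, which is why a ball of finite radius contains all
  -- the relevant points.
  have hhM : ‖h‖ ≤ M / √lam := by
    rw [le_div_iff₀ hsl]
    refine abs_le_of_sq_le_sq' ?_ hM |>.2
    rw [mul_pow, Real.sq_sqrt hlam.le]
    linarith
  have hsub : Metric.ball h ρ ⊆ Metric.closedBall 0 (largeRadius K M r lam) := by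
    intro x hx
    rw [mem_ball_iff_norm] at hx
    rw [mem_closedBall_zero_iff, largeRadius]
    have := norm_le_norm_sub_add x h
    linarith
  have hlow : ∀ x ∈ Metric.ball h ρ, (1 / 16 : ℝ) ^ k ≤ (‖g x‖ ^ 2 / (r + lam * ‖x‖ ^ 2)) ^ k := by
    intro x hx
    rw [mem_ball_iff_norm] at hx
    refine pow_le_pow_left₀ (by norm_num) ?_ k
    rw [le_div_iff₀ (hden x)]
    set A := √(r + lam * ‖h‖ ^ 2) with hA
    have hA2 : A ^ 2 = r + lam * ‖h‖ ^ 2 := Real.sq_sqrt (hden h).le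
    have hA0 : 0 ≤ A := Real.sqrt_nonneg _
    have hrA : √r ≤ A := Real.sqrt_le_sqrt (le_add_of_nonneg_right (by positivity))
    have h1 : A ≤ ‖g h‖ := by
      rw [hA, ← Real.sqrt_sq (norm_nonneg (g h))]
      exact Real.sqrt_le_sqrt hlt.le
    have h2 : ‖g h‖ ≤ ‖g x‖ + K * ρ := by
      have h3 := norm_le_norm_sub_add (g h) (g x)
      have h4 := hg h x
      rw [norm_sub_rev h x] at h4
      have h5 := mul_le_mul_of_nonneg_left hx.le hK
      linarith
    -- The denominator of `smallRadius` gives both `2Kρ ≤ √r` and `√lam ρ ≤ √r`: neither `g` nor the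
    -- reference size changes much on the ball.
    have h3 : 2 * (K * ρ) ≤ √r := by nlinarith
    have h4 : A / 2 ≤ ‖g x‖ := by linarith
    have h5 : (A / 2) ^ 2 ≤ ‖g x‖ ^ 2 := pow_le_pow_left₀ (by linarith) h4 2
    have h6 : lam * ρ ^ 2 ≤ r := by
      have h7 : √lam * ρ ≤ √r := by nlinarith [mul_nonneg hK hρ.le]
      have h8 := pow_le_pow_left₀ (by positivity) h7 2
      rwa [mul_pow, Real.sq_sqrt hlam.le, Real.sq_sqrt hr.le] at h8
    have h7 : ‖x‖ ^ 2 ≤ 2 * ‖h‖ ^ 2 + 2 * ρ ^ 2 := by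
      have h8 := norm_le_norm_sub_add x h
      have h9 : ‖x‖ ≤ ρ + ‖h‖ := by linarith
      have h10 := pow_le_pow_left₀ (norm_nonneg _) h9 2
      nlinarith [sq_nonneg (ρ - ‖h‖)]
    have h8 := mul_le_mul_of_nonneg_left h7 hlam.le
    have h9 : 0 ≤ lam * ‖h‖ ^ 2 := by positivity
    nlinarith
  have hvol : (1 / 16 : ℝ) ^ k * μ.real (Metric.ball 0 ρ) ≤ ballMoment μ K M r lam k g := by
    have e : μ.real (Metric.ball (0 : V) ρ) = μ.real (Metric.ball h ρ) := by
      rw [Measure.real, Measure.real, Measure.addHaar_ball_center μ h]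
    rw [e]
    refine (setIntegral_ge_of_const_le_real measurableSet_ball measure_ball_lt_top.ne hlow
      (hint.mono_set hsub)).trans ?_
    exact setIntegral_mono_set hint
      (.of_forall fun x => pow_nonneg (div_nonneg (sq_nonneg _) (hden x).le) k)
      (LE.le.eventuallyLE hsub)
  have h1 : 1 ≤ 16 ^ k / μ.real (Metric.ball 0 ρ) * ballMoment μ K M r lam k g := by
    rw [div_mul_eq_mul_div, le_div_iff₀ hpos, one_mul]
    calc μ.real (Metric.ball 0 ρ) = 16 ^ k * ((1 / 16 : ℝ) ^ k * μ.real (Metric.ball 0 ρ)) := by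
          rw [← mul_assoc, ← mul_pow]; norm_num
      _ ≤ _ := mul_le_mul_of_nonneg_left hvol (by positivity)
  have h2 := mul_le_mul_of_nonneg_left h1 (sq_nonneg M)
  have := hden h
  linarith

theorem bddMeas_ballMoment {𝒳 : Type*} [MeasurableSpace 𝒳] {μ : Measure V} [μ.IsAddHaarMeasure]
    {g : 𝒳 → V → V} {K M r lam : ℝ} (hr : 0 < r) (hlam : 0 < lam)
    (hg : Measurable (Function.uncurry g)) (hgM : ∀ X x, ‖g X x‖ ≤ M) (k : ℕ) :
    BddMeas fun X => ballMoment μ K M r lam k (g X) := by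
  have hm : Measurable (Function.uncurry fun X (x : V) =>
      (‖g X x‖ ^ 2 / (r + lam * ‖x‖ ^ 2)) ^ k) :=
    ((hg.norm.pow_const 2).div (by fun_prop)).pow_const k
  refine ⟨(hm.stronglyMeasurable.integral_prod_right
    (ν := μ.restrict (Metric.closedBall 0 (largeRadius K M r lam)))).measurable,
    (M ^ 2 / r) ^ k * μ.real (Metric.closedBall 0 (largeRadius K M r lam)), fun X => ?_⟩
  refine norm_setIntegral_le_of_norm_le_const (measure_closedBall_lt_top) fun x _ => ?_
  rw [norm_pow, norm_div, norm_pow, norm_norm, Real.norm_eq_abs,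
    abs_of_nonneg (by positivity : 0 ≤ r + lam * ‖x‖ ^ 2)]
  have h1 := hgM X x
  have h2 : r ≤ r + lam * ‖x‖ ^ 2 := le_add_of_nonneg_right (by positivity)
  gcongr

/-- Fubini applied to moment bounds at fixed points. The price of uniformity is the ratio of the
volumes of the two balls, a power of the ratio of the radii. -/
theorem integral_ballMoment_le {𝒳 : Type*} [MeasurableSpace 𝒳] {P : Measure 𝒳}
    [IsProbabilityMeasure P] {μ : Measure V} [μ.IsAddHaarMeasure] {g : 𝒳 → V → V}
    {K M r lam A : ℝ} (hK : 0 ≤ K) (hM : 0 ≤ M) (hr : 0 < r) (hlam : 0 < lam)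
    (hg : Measurable (Function.uncurry g)) (hgM : ∀ X x, ‖g X x‖ ≤ M) {k : ℕ}
    (hA : ∀ x, ∫ X, ‖g X x‖ ^ (2 * k) ∂P ≤ A * (r + lam * ‖x‖ ^ 2) ^ k) :
    16 ^ k / μ.real (Metric.ball 0 (smallRadius K r lam))
      * ∫ X, ballMoment μ K M r lam k (g X) ∂P ≤
      16 ^ k * A * (largeRadius K M r lam / smallRadius K r lam) ^ Module.finrank ℝ V := by
  have hsr : 0 < √r := Real.sqrt_pos.2 hr
  have hρ : 0 < smallRadius K r lam := by rw [smallRadius]; positivity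
  have hR : 0 ≤ largeRadius K M r lam := by
    have : 0 ≤ M / √lam := by positivity
    rw [largeRadius]; linarith
  have hden : ∀ x : V, 0 < r + lam * ‖x‖ ^ 2 := fun x => by positivity
  set S := Metric.closedBall (0 : V) (largeRadius K M r lam) with hS
  have hfin : IsFiniteMeasure (μ.restrict S) := ⟨by
    rw [Measure.restrict_apply_univ]; exact measure_closedBall_lt_top⟩
  have hm : Measurable (Function.uncurry fun X (x : V) =>
      (‖g X x‖ ^ 2 / (r + lam * ‖x‖ ^ 2)) ^ k) :=
    ((hg.norm.pow_const 2).div (by fun_prop)).pow_const k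
  have hint : Integrable (Function.uncurry fun X (x : V) =>
      (‖g X x‖ ^ 2 / (r + lam * ‖x‖ ^ 2)) ^ k) (P.prod (μ.restrict S)) := by
    refine BddMeas.integrable ⟨hm, (M ^ 2 / r) ^ k, fun ⟨X, x⟩ => ?_⟩
    simp only [Function.uncurry]
    rw [norm_pow, norm_div, norm_pow, norm_norm, Real.norm_eq_abs, abs_of_nonneg (hden x).le]
    have h1 := hgM X x
    have h2 : r ≤ r + lam * ‖x‖ ^ 2 := le_add_of_nonneg_right (by positivity)
    gcongr
  have h1 : ∫ X, ballMoment μ K M r lam k (g X) ∂P ≤ A * μ.real S := by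
    simp only [ballMoment]
    rw [integral_integral_swap hint]
    have h2 : ∀ x : V, ∫ X, (‖g X x‖ ^ 2 / (r + lam * ‖x‖ ^ 2)) ^ k ∂P ≤ A := fun x => by
      simp only [div_pow, ← pow_mul]
      rw [integral_div, div_le_iff₀ (pow_pos (hden x) k)]
      exact hA x
    refine (integral_mono hint.swap.integral_prod_left (integrable_const A) h2).trans
      (le_of_eq ?_)
    rw [integral_const, smul_eq_mul, mul_comm, measureReal_restrict_apply_univ]
  have hb1 : 0 < μ.real (Metric.ball (0 : V) 1) :=
    ENNReal.toReal_pos (Metric.measure_ball_pos μ _ one_pos).ne' measure_ball_lt_top.ne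
  have e1 : μ.real S = largeRadius K M r lam ^ Module.finrank ℝ V * μ.real (Metric.ball 0 1) :=
    Measure.addHaar_real_closedBall μ 0 hR
  have e2 : μ.real (Metric.ball 0 (smallRadius K r lam)) =
      smallRadius K r lam ^ Module.finrank ℝ V * μ.real (Metric.ball 0 1) := by
    rw [Measure.real, Measure.addHaar_ball_of_pos μ 0 hρ, ENNReal.toReal_mul,
      ENNReal.toReal_ofReal (by positivity), Measure.real]
  refine (mul_le_mul_of_nonneg_left h1 (by positivity)).trans (le_of_eq ?_)
  rw [e1, e2, div_pow]
  field_simp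

end BallAverage

/-! ### Batches that are refreshed at a given time -/

section Refresh

variable {E B : ℕ} {d dw : ℕ → ℕ} {Ξ : Type*} [MeasurableSpace Ξ]
  {a : Layers d dw} {cfg : Config d Ξ} {w₁ : Weights E dw}
  {D : Measure (Act d 0)} {ν : Measure Ξ} [IsProbabilityMeasure D] [IsProbabilityMeasure ν]
  {Lℓ Ca Lg La ωF ωB σ : ℝ}

variable (cfg) in
/-- The batch of iteration `t₀ + i + 1`, if all its entries were drawn afresh in iteration
`t₀ + 1`. -/
def refreshedBatch (t₀ : ℕ) (s : ℕ → IterSeed B d Ξ) : ℕ → Fin B → Act d 0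
  | 0 => fun b => ((s (t₀ + 1)).2 b).1
  | i + 1 => selectBatch cfg (t₀ + i + 2) (refreshedBatch t₀ s i) (s (t₀ + i + 2))

omit [MeasurableSpace Ξ] in
theorem refreshedBatch_update {t₀ i k : ℕ} (h : t₀ + i + 1 < k) (s : ℕ → IterSeed B d Ξ)
    (τ : IterSeed B d Ξ) :
    refreshedBatch cfg t₀ (Function.update s k τ) i = refreshedBatch cfg t₀ s i := by
  induction i with
  | zero => simp only [refreshedBatch, Function.update_of_ne (show t₀ + 1 ≠ k by omega)]
  | succ i ih =>
    simp only [refreshedBatch, Function.update_of_ne (show t₀ + i + 2 ≠ k by omega),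
      ih (by omega)]

theorem measurable_refreshedBatch (t₀ i : ℕ) :
    Measurable fun s : ℕ → IterSeed B d Ξ => refreshedBatch cfg t₀ s i := by
  induction i with
  | zero =>
    exact measurable_pi_iff.2 fun b => measurable_fst.comp
      ((measurable_pi_apply b).comp (measurable_snd.comp (measurable_pi_apply (t₀ + 1))))
  | succ i ih =>
    exact (measurable_selectBatch cfg (t₀ + i + 2)).comp (ih.prodMk (measurable_pi_apply _))

theorem measurePreserving_candidates :
    MeasurePreserving (fun τ : IterSeed B d Ξ => fun b => (τ.2 b).1) (iterLaw B D ν)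
      (Measure.pi fun _ => D) :=
  (measurePreserving_pi _ _ fun _ => measurePreserving_fst).comp measurePreserving_snd

/-- A refreshed batch is independent of the past. -/
theorem integral_refreshedBatch_le (t₀ i : ℕ)
    {F : (ℕ → IterSeed B d Ξ) × (Fin B → Act d 0) → ℝ} (hF : BddMeas F)
    (hF' : ∀ k, t₀ < k → ∀ s τ X, F (Function.update s k τ, X) = F (s, X))
    {H : (ℕ → IterSeed B d Ξ) → ℝ} (hH : Integrable H (runLaw B D ν))
    (h : ∀ s, ∫ X, F (s, X) ∂(Measure.pi fun _ => D) ≤ H s) :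
    ∫ s, F (s, refreshedBatch cfg t₀ s i) ∂runLaw B D ν ≤ ∫ s, H s ∂runLaw B D ν := by
  induction i generalizing F with
  | zero =>
    refine integral_seed_le (t₀ + 1)
      (F := fun q : (ℕ → IterSeed B d Ξ) × IterSeed B d Ξ => F (q.1, fun b => (q.2.2 b).1))
      (hF.comp (measurable_fst.prodMk
        ((measurePreserving_candidates (D := D) (ν := ν)).measurable.comp measurable_snd)))
      (fun s τ τ' => hF' _ (by omega) _ _ _) hH fun s => ?_
    refine le_trans (le_of_eq ?_) (h s)
    exact MeasurePreserving.integral_comp_meas (measurePreserving_candidates (D := D) (ν := ν))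
      (g := fun X => F (s, X)) (hF.meas.comp measurable_prodMk_left).aestronglyMeasurable
  | succ i ih =>
    set t := t₀ + i + 2 with ht
    let G : ((ℕ → IterSeed B d Ξ) × (Fin B → Act d 0)) × IterSeed B d Ξ → ℝ := fun q =>
      F (q.1.1, selectBatch cfg t q.1.2 q.2)
    have hsel := measurable_selectBatch (B := B) cfg t
    have hG : BddMeas G := hF.comp ((measurable_fst.comp measurable_fst).prodMk
      (hsel.comp ((measurable_snd.comp measurable_fst).prodMk measurable_snd)))
    have hFi : BddMeas fun q => ∫ τ, G (q, τ) ∂iterLaw B D ν := by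
      obtain ⟨C, hC⟩ := hG.bdd
      refine ⟨(hG.meas.stronglyMeasurable.integral_prod_right' (ν := iterLaw B D ν)).measurable,
        C, fun q => ?_⟩
      refine (norm_integral_le_of_norm_le_const (.of_forall fun τ => hC (q, τ))).trans
        (le_of_eq ?_)
      simp
    -- Averaging over the last seed gives a function of the preceding refreshed batch, and the
    -- hypothesis on `F` is inherited because the product law is invariant under `selectBatch`.
    have h1 := ih hFi (fun k hk s τ X => by simp only [G, hF' k hk]) fun s => by
      refine le_trans (le_of_eq ?_) (h s)
      have hGs : BddMeas fun p : (Fin B → Act d 0) × IterSeed B d Ξ => G ((s, p.1), p.2) :=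
        hG.comp ((measurable_const.prodMk measurable_fst).prodMk measurable_snd)
      have e := integral_prod (μ := Measure.pi fun _ : Fin B => D) (ν := iterLaw B D ν)
        (fun p : (Fin B → Act d 0) × IterSeed B d Ξ => G ((s, p.1), p.2)) hGs.integrable
      rw [← e]
      exact MeasurePreserving.integral_comp_meas (measurePreserving_selectBatch D ν cfg t)
        (g := fun X => F (s, X)) (hF.meas.comp measurable_prodMk_left).aestronglyMeasurable
    refine le_trans ?_ h1
    refine integral_seed_le t
      (F := fun q : (ℕ → IterSeed B d Ξ) × IterSeed B d Ξ => G ((q.1, refreshedBatch cfg t₀ q.1 i), q.2))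
      (hG.comp ((measurable_fst.prodMk
        ((measurable_refreshedBatch t₀ i).comp measurable_fst)).prodMk measurable_snd))
      (fun s τ τ' => ?_) ?_ fun s => le_rfl
    · simp only [G, refreshedBatch_update (show t₀ + i + 1 < t by omega), hF' t (by omega)]
    · exact (hFi.comp (measurable_id.prodMk (measurable_refreshedBatch t₀ i))).integrable

open Classical in
variable (a cfg w₁) in
/-- Whether an entry of the batch of iteration `t₀ + i + 1` differs from the refreshed batch. -/
def stale (t₀ i : ℕ) (b : Fin B) (s : ℕ → IterSeed B d Ξ) : ℝ :=
  if (run a cfg w₁ s (t₀ + i + 1)).x b = refreshedBatch cfg t₀ s i b then 0 else 1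

section

variable (hS : Smooth E a D Lℓ Ca Lg La) (hC : Contractive E ν cfg.Cf cfg.Cb ωF ωB)
include hS hC

omit [IsProbabilityMeasure D] [IsProbabilityMeasure ν] in
theorem bddMeas_stale (t₀ i : ℕ) (b : Fin B) : BddMeas (stale a cfg w₁ t₀ i b) := by
  classical
  exact BddMeas.ite (BddMeas.const 0) (BddMeas.const 1) (measurableSet_eq_fun
    ((measurableState_run hS hC w₁ (t₀ + i + 1)).x b)
    ((measurable_pi_apply b).comp (measurable_refreshedBatch t₀ i)))

/-- Both batches use the same seeds, so an entry agrees with the refreshed batch from its first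
fresh draw on. The bound is the probability of no draw in `i` iterations. -/
theorem integral_stale_le (hp0 : 0 ≤ cfg.p) (hp1 : cfg.p ≤ 1) (t₀ i : ℕ) (b : Fin B) :
    ∫ s, stale a cfg w₁ t₀ i b s ∂runLaw B D ν ≤ (1 - cfg.p) ^ i := by
  classical
  induction i with
  | zero =>
    refine (integral_mono (bddMeas_stale hS hC t₀ 0 b).integrable (integrable_const 1) fun s => ?_).trans
      (by simp)
    dsimp only [stale]; split_ifs <;> norm_num
  | succ i ih =>
    set t := t₀ + i + 2 with ht
    have hr := freshRate_mem hp0 hp1 t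
    have hrp : cfg.p ≤ freshRate cfg.p t := by
      rcases Nat.lt_or_ge t 3 with h | h
      · rw [freshRate_le_two (by omega) (by omega)]; exact hp1
      · rw [freshRate_of_three_le h]
    have hst := bddMeas_stale (w₁ := w₁) hS hC t₀ i b
    have h0 : ∀ s, 0 ≤ stale a cfg w₁ t₀ i b s := fun s => by
      dsimp only [stale]; split_ifs <;> norm_num
    have hfm : MeasurableSet {τ : IterSeed B d Ξ | Fresh cfg t τ b} := by
      simp only [fresh_iff]
      exact measurableSet_le ((measurable_subtype_coe).comp (measurable_coin _ _)) measurable_const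
    let F : (ℕ → IterSeed B d Ξ) × IterSeed B d Ξ → ℝ := fun q =>
      if Fresh cfg t q.2 b then 0 else stale a cfg w₁ t₀ i b q.1
    have hF : BddMeas F := BddMeas.ite (BddMeas.const 0) (hst.comp measurable_fst)
      (hfm.preimage measurable_snd)
    have h1 : ∀ s, stale a cfg w₁ t₀ (i + 1) b s ≤ F (s, s t) := fun s => by
      have e : (run a cfg w₁ s (t₀ + (i + 1) + 1)).x = selectBatch cfg t
        (run a cfg w₁ s (t₀ + i + 1)).x (s t) := run_succ_x a cfg w₁ (t₀ + i + 1) s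
      dsimp only [stale, F]
      rw [e, refreshedBatch]
      simp only [selectBatch]
      by_cases hf : Fresh cfg t (s t) b
      · simp [hf, ← ht]
      · simp [hf, ← ht]
    have h2 : ∫ s, F (s, s t) ∂runLaw B D ν ≤ ∫ s, (1 - cfg.p) * stale a cfg w₁ t₀ i b s
        ∂runLaw B D ν := by
      refine integral_seed_le t hF (fun s τ τ' => ?_) (hst.integrable.const_mul _) fun s => ?_
      · simp only [F, stale, refreshedBatch_update (show t₀ + i + 1 < t by omega)]
        rw [run_congr w₁ (s' := s) (t₀ + i + 1) fun j hj => Function.update_of_ne (by omega) _ _]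
      · have h3 := lintegral_fresh (D := D) (ν := ν) cfg hp0 hp1 t b (g := fun _ => 0)
          measurable_const (ENNReal.ofReal (stale a cfg w₁ t₀ i b s))
        have hFs : Measurable fun τ => F (s, τ) := hF.meas.comp measurable_prodMk_left
        have hF0 : ∀ τ, 0 ≤ F (s, τ) := fun τ => by
          dsimp only [F]; split_ifs; exacts [le_rfl, h0 s]
        rw [integral_eq_lintegral_of_nonneg_ae (.of_forall hF0) hFs.aestronglyMeasurable]
        refine ENNReal.toReal_le_of_le_ofReal (mul_nonneg (by linarith) (h0 s)) ?_
        have e : ∀ τ, ENNReal.ofReal (F (s, τ)) =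
            if Fresh cfg t τ b then 0 else ENNReal.ofReal (stale a cfg w₁ t₀ i b s) := fun τ => by
          dsimp only [F]; split_ifs <;> simp
        simp only [e]
        refine (le_of_eq h3).trans ?_
        rw [lintegral_zero, mul_zero, zero_add, ← ENNReal.ofReal_mul (by linarith [hr.2])]
        exact ENNReal.ofReal_le_ofReal (mul_le_mul_of_nonneg_right (by linarith) (h0 s))
    refine (integral_mono (bddMeas_stale hS hC t₀ (i + 1) b).integrable
      (hF.comp (measurable_id.prodMk (measurable_pi_apply t))).integrable h1).trans (h2.trans ?_)
    rw [integral_const_mul, pow_succ, mul_comm ((1 - cfg.p) ^ i)]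
    exact mul_le_mul_of_nonneg_left ih (by linarith)

-- Iteration `1` draws every entry, so a window reaching back to the start has no stale entry. This
-- covers the truncated subtraction `n - l`.
omit [MeasurableSpace Ξ] hS hC in
theorem stale_zero (i : ℕ) (b : Fin B) (s : ℕ → IterSeed B d Ξ) :
    stale a cfg w₁ 0 i b s = 0 := by
  classical
  have h : ∀ i, (run a cfg w₁ s (0 + i + 1)).x = refreshedBatch cfg 0 s i := by
    intro i
    induction i with
    | zero =>
      rw [run_succ_x]
      funext b
      exact if_pos (Or.inl rfl)
    | succ i ih =>
      rw [refreshedBatch, ← ih]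
      exact run_succ_x a cfg w₁ (0 + i + 1) s
  rw [stale, h]
  simp

theorem integral_stale_window_le (hp0 : 0 ≤ cfg.p) (hp1 : cfg.p ≤ 1) (n l : ℕ) (b : Fin B) :
    ∫ s, stale a cfg w₁ (n - l) (n - (n - l)) b s ∂runLaw B D ν ≤ (1 - cfg.p) ^ l := by
  rcases le_total n l with h | h
  · rw [Nat.sub_eq_zero_of_le h]
    simp only [stale_zero, integral_zero]
    exact pow_nonneg (by linarith) l
  · rw [Nat.sub_sub_self h]
    exact integral_stale_le hS hC hp0 hp1 _ _ b

/-- The change of the average noise of a batch when the parameters move. -/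
def noiseShift (a : Layers d dw) (D : Measure (Act d 0)) (w : Weights E dw) (X : Fin B → Act d 0)
    (h : Weights E dw) : Weights E dw :=
  avg fun b => sampleNoise a D (X b) (w + h) - sampleNoise a D (X b) w

/-- A bound for the noise and for its Lipschitz constant. -/
def noiseBound (E : ℕ) (Ca Lg La : ℝ) : ℝ := 4 * gradBound E Ca + 2 * lossLip E Ca Lg La + 1

omit hC
variable (hdE : d E = 1) (hE : 0 < E) (hG : StochasticGradient E a D σ)
include hdE hE hG

omit [MeasurableSpace Ξ] in
theorem norm_noiseShift_le (w : Weights E dw) (X : Fin B → Act d 0) (h : Weights E dw) :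
    ‖noiseShift a D w X h‖ ≤ noiseBound E Ca Lg La := by
  have hCa := hS.Ca_nonneg hE
  have h1 := gradBound_nonneg (E := E) hCa
  have h2 : 0 ≤ lossLip E Ca Lg La := lossLip_nonneg hCa
  refine norm_avg_le (by rw [noiseBound]; positivity) fun b => (norm_sub_le _ _).trans ?_
  have h3 := norm_sampleNoise_le hS hdE hE hG (X b) (w + h)
  have h4 := norm_sampleNoise_le hS hdE hE hG (X b) w
  rw [noiseBound]
  linarith

theorem norm_noiseShift_sub_le (w : Weights E dw) (X : Fin B → Act d 0) (h h' : Weights E dw) :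
    ‖noiseShift a D w X h - noiseShift a D w X h'‖ ≤ noiseBound E Ca Lg La * ‖h - h'‖ := by
  have hCa := hS.Ca_nonneg hE
  have h1 := gradBound_nonneg (E := E) hCa
  have h2 : 0 ≤ lossLip E Ca Lg La := lossLip_nonneg hCa
  rw [noiseShift, noiseShift, ← avg_sub]
  refine norm_avg_le (mul_nonneg (by rw [noiseBound]; positivity) (norm_nonneg _)) fun b => ?_
  rw [sub_sub_sub_cancel_right]
  have h3 := norm_sampleNoise_sub_le hS hdE hE hG (X b) (w + h) (w + h')
  rw [add_sub_add_left_eq_sub] at h3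
  refine h3.trans (mul_le_mul_of_nonneg_right ?_ (norm_nonneg _))
  rw [noiseBound]
  linarith

/-- The moments of the change of the average noise. -/
theorem integral_noiseShift_pow_le (hB : 0 < B) {r lam : ℝ} (hr : 0 < r) (hlam : 0 < lam)
    (w h : Weights E dw) (k : ℕ) :
    ∫ X : Fin B → Act d 0, ‖noiseShift a D w X h‖ ^ (2 * (k + 1)) ∂(Measure.pi fun _ => D) ≤
      momentConst (Module.finrank ℝ (Weights E dw)) k
        * (noiseBound E Ca Lg La ^ 2 / (B * (r + lam))) ^ (k + 1)
        * (r + lam * ‖h‖ ^ 2) ^ (k + 1) := by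
  have hCa := hS.Ca_nonneg hE
  have h1 := gradBound_nonneg (E := E) hCa
  have h2 : 0 ≤ lossLip E Ca Lg La := lossLip_nonneg hCa
  have hB' : (0 : ℝ) < B := by exact_mod_cast hB
  have hc := momentConst_nonneg (Module.finrank ℝ (Weights E dw)) k
  have hM : 0 < noiseBound E Ca Lg La := by rw [noiseBound]; positivity
  rcases eq_or_ne h 0 with rfl | hh
  · have e : ∀ X : Fin B → Act d 0, noiseShift a D w X 0 = 0 := fun X => by
      simp [noiseShift, avg]
    simp only [e, norm_zero]
    simp only [ne_eq, Nat.mul_eq_zero, OfNat.ofNat_ne_zero, Nat.add_eq_zero_iff, one_ne_zero,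
      and_false, or_self, not_false_eq_true, zero_pow, integral_zero]
    positivity
  have hh' : 0 < ‖h‖ := norm_pos_iff.2 hh
  -- The increment of the noise is bounded both by a constant and by a multiple of `‖h‖`. Since `t ^
  -- 2 * (r + lam) ≤ r + lam * ‖h‖ ^ 2`, the moment relative to `r + lam * ‖h‖ ^ 2` is bounded
  -- uniformly in `h`.
  set t := min 1 ‖h‖ with ht
  have ht0 : 0 < t := lt_min one_pos hh'
  have hY : Measurable fun x => sampleNoise a D x (w + h) - sampleNoise a D x w :=
    (measurable_sampleNoise hS hdE hE hG measurable_id measurable_const).sub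
      (measurable_sampleNoise hS hdE hE hG measurable_id measurable_const)
  have hYb : ∀ x, ‖sampleNoise a D x (w + h) - sampleNoise a D x w‖ ≤
      noiseBound E Ca Lg La * t := fun x => by
    rcases le_total 1 ‖h‖ with h1' | h1'
    · have h3 := norm_sampleNoise_le hS hdE hE hG x (w + h)
      have h4 := norm_sampleNoise_le hS hdE hE hG x w
      rw [ht, min_eq_left h1', mul_one]
      refine (norm_sub_le _ _).trans ?_
      rw [noiseBound]
      linarith
    · have h3 := norm_sampleNoise_sub_le hS hdE hE hG x (w + h) w
      rw [add_sub_cancel_left] at h3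
      rw [ht, min_eq_right h1']
      refine h3.trans (mul_le_mul_of_nonneg_right ?_ (norm_nonneg _))
      rw [noiseBound]
      linarith
  have h0 : ∫ x, (sampleNoise a D x (w + h) - sampleNoise a D x w) ∂D = 0 := by
    have c1 := centered_sampleNoise hS hdE hE hG (w + h)
    have c2 := centered_sampleNoise hS hdE hE hG w
    rw [integral_sub c1.bdd.integrable c2.bdd.integrable, c1.mean, c2.mean, sub_zero]
  refine (integral_norm_avg_pow_le hY (mul_pos hM ht0) hYb h0 hB k).trans ?_
  rw [mul_assoc, ← mul_pow]
  refine mul_le_mul_of_nonneg_left (pow_le_pow_left₀ (by positivity) ?_ _) hc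
  have h3 : t ^ 2 * (r + lam) ≤ r + lam * ‖h‖ ^ 2 := by
    have h4 : t ^ 2 ≤ 1 := pow_le_one₀ ht0.le (min_le_left _ _)
    have h5 : t ^ 2 ≤ ‖h‖ ^ 2 := pow_le_pow_left₀ ht0.le (min_le_right _ _) 2
    nlinarith
  rw [div_mul_eq_mul_div, div_le_div_iff₀ hB' (by positivity)]
  have h6 := mul_le_mul_of_nonneg_left h3 (show 0 ≤ noiseBound E Ca Lg La ^ 2 * B by positivity)
  linarith

omit [MeasurableSpace Ξ] in
theorem measurable_noiseShift {Ω : Type*} [MeasurableSpace Ω] {w h : Ω → Weights E dw}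
    {X : Ω → Fin B → Act d 0} (hw : Measurable w) (hh : Measurable h) (hX : Measurable X) :
    Measurable fun ω => noiseShift a D (w ω) (X ω) (h ω) :=
  (BddMeas.avg fun b => (bddMeas_sampleNoise hS hdE hE hG
    ((measurable_pi_apply b).comp hX) (hw.add hh)).sub
    (bddMeas_sampleNoise hS hdE hE hG ((measurable_pi_apply b).comp hX) hw)).meas

theorem integral_shiftMoment_le (hB : 0 < B) {r lam : ℝ} (hr : 0 < r) (hlam : 0 < lam)
    (w : Weights E dw) (k : ℕ) :
    16 ^ (k + 1) / (Measure.addHaar : Measure (Weights E dw)).real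
        (Metric.ball 0 (smallRadius (noiseBound E Ca Lg La) r lam))
      * ∫ X : Fin B → Act d 0, ballMoment Measure.addHaar (noiseBound E Ca Lg La)
        (noiseBound E Ca Lg La) r lam (k + 1) (noiseShift a D w X) ∂(Measure.pi fun _ => D) ≤
      16 ^ (k + 1) * (momentConst (Module.finrank ℝ (Weights E dw)) k
          * (noiseBound E Ca Lg La ^ 2 / (B * (r + lam))) ^ (k + 1))
        * (largeRadius (noiseBound E Ca Lg La) (noiseBound E Ca Lg La) r lam
          / smallRadius (noiseBound E Ca Lg La) r lam) ^ Module.finrank ℝ (Weights E dw) := by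
  have hM : 0 ≤ noiseBound E Ca Lg La := by
    have hCa := hS.Ca_nonneg hE
    have h1 := gradBound_nonneg (E := E) hCa
    have h2 : 0 ≤ lossLip E Ca Lg La := lossLip_nonneg hCa
    rw [noiseBound]; positivity
  refine integral_ballMoment_le hM hM hr hlam ?_ (fun X x => norm_noiseShift_le hS hdE hE hG _ _ _)
    fun x => integral_noiseShift_pow_le hS hdE hE hG hB hr hlam _ x k
  exact measurable_noiseShift hS hdE hE hG measurable_const measurable_snd measurable_fst

include hC

set_option maxHeartbeats 400000 in
/-- The second moment of the noise, when the parameters move slowly. -/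
theorem integral_noise_sq_le (hB : 0 < B) (hp0 : 0 ≤ cfg.p) (hp1 : cfg.p ≤ 1) {r lam : ℝ}
    (hr : 0 < r) (hlam : 0 < lam) (n l k : ℕ)
    (hw : Integrable (fun s => ‖(run (B := B) a cfg w₁ s n).w - (run a cfg w₁ s (n - l)).w‖ ^ 2)
      (runLaw B D ν)) :
    ∫ s, ‖noise (B := B) a cfg w₁ D n s‖ ^ 2 ∂runLaw B D ν ≤
      2 * noiseBound E Ca Lg La ^ 2 * (1 - cfg.p) ^ l + 4 * (σ ^ 2 / B)
      + 4 * (r + lam * ∫ s, ‖(run (B := B) a cfg w₁ s n).w - (run a cfg w₁ s (n - l)).w‖ ^ 2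
        ∂runLaw B D ν)
      + 4 * noiseBound E Ca Lg La ^ 2 * (16 ^ (k + 1)
        * (momentConst (Module.finrank ℝ (Weights E dw)) k
          * (noiseBound E Ca Lg La ^ 2 / (B * (r + lam))) ^ (k + 1))
        * (largeRadius (noiseBound E Ca Lg La) (noiseBound E Ca Lg La) r lam
          / smallRadius (noiseBound E Ca Lg La) r lam) ^ Module.finrank ℝ (Weights E dw)) := by
  have hCa := hS.Ca_nonneg hE
  have h1 := gradBound_nonneg (E := E) hCa
  have h2 : 0 ≤ lossLip E Ca Lg La := lossLip_nonneg hCa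
  have hM : 0 < noiseBound E Ca Lg La := by rw [noiseBound]; positivity
  have hMG : 4 * gradBound E Ca ≤ noiseBound E Ca Lg La := by rw [noiseBound]; linarith
  have hshift := norm_noiseShift_le (B := B) hS hdE hE hG
  have hlip := norm_noiseShift_sub_le (B := B) hS hdE hE hG
  set M := noiseBound E Ca Lg La with hM_def
  set N := Module.finrank ℝ (Weights E dw)
  set μ : Measure (Weights E dw) := Measure.addHaar
  set t₀ := n - l with ht₀
  set i := n - t₀ with hi
  have hti : t₀ + i = n := by omega
  set q := 16 ^ (k + 1) / μ.real (Metric.ball 0 (smallRadius M r lam)) with hq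
  set A := momentConst N k * (M ^ 2 / (B * (r + lam))) ^ (k + 1) with hA
  have hwm := fun j => (measurableState_run (B := B) hS hC w₁ j).w
  have hrunw : ∀ j, t₀ < j → ∀ (s : ℕ → IterSeed B d Ξ) τ,
      run a cfg w₁ (Function.update s j τ) t₀ = run a cfg w₁ s t₀ := fun j hj s τ =>
    run_congr w₁ t₀ fun _ _ => Function.update_of_ne (by omega) _ _
  -- the noise of the refreshed batch at the old parameters
  let F₁ : (ℕ → IterSeed B d Ξ) × (Fin B → Act d 0) → ℝ := fun q =>
    ‖avg fun b => sampleNoise a D (q.2 b) (run a cfg w₁ q.1 t₀).w‖ ^ 2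
  have hF₁ : BddMeas F₁ := (BddMeas.avg fun b => bddMeas_sampleNoise hS hdE hE hG
    ((measurable_pi_apply b).comp measurable_snd) ((hwm t₀).comp measurable_fst)).norm_sq
  have hI₁ : ∫ s, F₁ (s, refreshedBatch cfg t₀ s i) ∂runLaw B D ν ≤ σ ^ 2 / B := by
    refine (integral_refreshedBatch_le t₀ i hF₁ (fun j hj s τ X => ?_)
      (integrable_const (σ ^ 2 / B)) fun s => ?_).trans (by simp)
    · simp only [F₁, hrunw j hj]
    · have h := (centered_sampleNoise hS hdE hE hG (run a cfg w₁ s t₀).w).integral_batch_le hB 0 1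
      simpa [F₁] using h
  -- the moments of the change of the noise
  let F₂ : (ℕ → IterSeed B d Ξ) × (Fin B → Act d 0) → ℝ := fun p =>
    q * ballMoment μ M M r lam (k + 1) (noiseShift a D (run a cfg w₁ p.1 t₀).w p.2)
  have hgm : Measurable (Function.uncurry fun (p : (ℕ → IterSeed B d Ξ) × (Fin B → Act d 0)) =>
      noiseShift a D (run a cfg w₁ p.1 t₀).w p.2) :=
    measurable_noiseShift hS hdE hE hG ((hwm t₀).comp (measurable_fst.comp measurable_fst))
      measurable_snd (measurable_snd.comp measurable_fst)
  have hF₂ : BddMeas F₂ := (BddMeas.const q).mul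
    (bddMeas_ballMoment (μ := μ) (K := M) hr hlam hgm (fun p => hshift _ _) (k + 1))
  have hI₂ : ∫ s, F₂ (s, refreshedBatch cfg t₀ s i) ∂runLaw B D ν ≤
      16 ^ (k + 1) * A * (largeRadius M M r lam / smallRadius M r lam) ^ N := by
    refine (integral_refreshedBatch_le t₀ i hF₂ (fun j hj s τ X => ?_)
      (integrable_const (16 ^ (k + 1) * A * (largeRadius M M r lam / smallRadius M r lam) ^ N))
      fun s => ?_).trans (by simp)
    · simp only [F₂, hrunw j hj]
    · simp only [F₂]
      rw [integral_const_mul]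
      exact integral_shiftMoment_le hS hdE hE hG hB hr hlam (run a cfg w₁ s t₀).w k
  -- the entries that were not refreshed
  let F₃ : (ℕ → IterSeed B d Ξ) → ℝ := fun s => (B : ℝ)⁻¹ * ∑ b, stale a cfg w₁ t₀ i b s
  have hst := fun b => bddMeas_stale (w₁ := w₁) hS hC t₀ i (b : Fin B)
  have hF₃ : Integrable F₃ (runLaw B D ν) :=
    (integrable_finsetSum _ fun b _ => (hst b).integrable).const_mul _
  have hI₃ : ∫ s, F₃ s ∂runLaw B D ν ≤ (1 - cfg.p) ^ l := by
    simp only [F₃]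
    rw [integral_const_mul, integral_finsetSum _ fun b _ => (hst b).integrable,
      inv_mul_le_iff₀ (by exact_mod_cast hB)]
    refine (Finset.sum_le_card_nsmul _ _ _ fun b _ =>
      integral_stale_window_le hS hC hp0 hp1 n l b).trans (by simp)
  have hpath : ∀ s, ‖noise (B := B) a cfg w₁ D n s‖ ^ 2 ≤
      2 * M ^ 2 * F₃ s + 4 * F₁ (s, refreshedBatch cfg t₀ s i)
      + 4 * (r + lam * ‖(run a cfg w₁ s n).w - (run a cfg w₁ s t₀).w‖ ^ 2)
      + 4 * M ^ 2 * F₂ (s, refreshedBatch cfg t₀ s i) := by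
    intro s
    set X := refreshedBatch cfg t₀ s i
    set w := (run a cfg w₁ s n).w
    set w₀ := (run a cfg w₁ s t₀).w
    set e₁ := avg fun b => sampleNoise a D ((run a cfg w₁ s (n + 1)).x b) w - sampleNoise a D (X b) w
    -- Three parts: entries that were not redrawn, the noise at the old parameters, of which the
    -- refreshed batch is independent, and the effect of the shift of the parameters.
    have hdec : noise a cfg w₁ D n s = e₁ + ((avg fun b => sampleNoise a D (X b) w₀)
        + noiseShift a D w₀ X (w - w₀)) := by
      simp only [e₁, noiseShift, avg_sub, add_sub_cancel, noise]
      abel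
    have he₁ : ‖e₁‖ ^ 2 ≤ M ^ 2 * F₃ s := by
      have hle : ∀ b, ‖sampleNoise a D ((run a cfg w₁ s (n + 1)).x b) w
          - sampleNoise a D (X b) w‖ ≤ M * stale a cfg w₁ t₀ i b s := fun b => by
        classical
        rw [stale, hti]
        split_ifs with h
        · rw [h]; simp [X]
        · have h3 := norm_sampleNoise_le hS hdE hE hG ((run a cfg w₁ s (n + 1)).x b) w
          have h4 := norm_sampleNoise_le hS hdE hE hG (X b) w
          refine (norm_sub_le _ _).trans ?_
          linarith
      have h3 : ‖e₁‖ ≤ M * F₃ s := by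
        simp only [e₁, avg, F₃]
        rw [norm_smul, Real.norm_eq_abs, abs_of_nonneg (by positivity), mul_left_comm,
          Finset.mul_sum]
        exact mul_le_mul_of_nonneg_left ((norm_sum_le _ _).trans
          (Finset.sum_le_sum fun b _ => hle b)) (by positivity)
      -- One factor of the square is bounded by a constant, so that the mean square is linear in the
      -- fraction of stale entries.
      have h4 : ‖e₁‖ ≤ M := norm_avg_le hM.le fun b => (hle b).trans (by
        rw [stale]; split_ifs <;> simp [hM.le])
      calc ‖e₁‖ ^ 2 = ‖e₁‖ * ‖e₁‖ := sq _
        _ ≤ M * (M * F₃ s) := mul_le_mul h4 h3 (norm_nonneg _) hM.le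
        _ = _ := by ring
    -- The shift `w - w₀` depends on the batch, so a bound at a fixed shift would not suffice.
    have hball := norm_sq_le_ballMoment (μ := μ) hM.le hM.le hr hlam (hlip w₀ X) (hshift w₀ X)
      (k + 1) (w - w₀)
    have hadd : ∀ x y : Weights E dw, ‖x + y‖ ^ 2 ≤ 2 * ‖x‖ ^ 2 + 2 * ‖y‖ ^ 2 := fun x y => by
      have := pow_le_pow_left₀ (norm_nonneg _) (norm_add_le x y) 2
      nlinarith [sq_nonneg (‖x‖ - ‖y‖)]
    rw [hdec]
    refine (hadd _ _).trans ?_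
    have h5 := hadd (avg fun b => sampleNoise a D (X b) w₀) (noiseShift a D w₀ X (w - w₀))
    simp only [F₁, F₂]
    linarith
  have hj₁ : Integrable (fun s => F₁ (s, refreshedBatch cfg t₀ s i)) (runLaw B D ν) :=
    (hF₁.comp (measurable_id.prodMk (measurable_refreshedBatch t₀ i))).integrable
  have hj₂ : Integrable (fun s => F₂ (s, refreshedBatch cfg t₀ s i)) (runLaw B D ν) :=
    (hF₂.comp (measurable_id.prodMk (measurable_refreshedBatch t₀ i))).integrable
  have hj₄ : Integrable (fun s => r + lam * ‖(run (B := B) a cfg w₁ s n).w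
      - (run a cfg w₁ s t₀).w‖ ^ 2) (runLaw B D ν) := (integrable_const r).add (hw.const_mul lam)
  have hj₅ : Integrable (fun s => 2 * M ^ 2 * F₃ s + 4 * F₁ (s, refreshedBatch cfg t₀ s i))
      (runLaw B D ν) := (hF₃.const_mul (2 * M ^ 2)).add (hj₁.const_mul 4)
  have hj₆ : Integrable (fun s => 2 * M ^ 2 * F₃ s + 4 * F₁ (s, refreshedBatch cfg t₀ s i)
      + 4 * (r + lam * ‖(run (B := B) a cfg w₁ s n).w - (run a cfg w₁ s t₀).w‖ ^ 2))
      (runLaw B D ν) := hj₅.add (hj₄.const_mul 4)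
  have hint := integral_mono (bddMeas_noise (B := B) hS hC hdE hE hG n).norm_sq.integrable
    (hj₆.add (hj₂.const_mul (4 * M ^ 2))) hpath
  simp only [Pi.add_apply] at hint
  clear_value F₁ F₂ F₃
  rw [integral_add hj₆ (hj₂.const_mul (4 * M ^ 2)), integral_add hj₅ (hj₄.const_mul 4),
    integral_add (hF₃.const_mul (2 * M ^ 2)) (hj₁.const_mul 4),
    integral_const_mul, integral_const_mul, integral_const_mul, integral_const_mul,
    integral_add (integrable_const r) (hw.const_mul lam), integral_const_mul] at hint
  simp only [integral_const, probReal_univ, one_smul] at hint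
  refine hint.trans ?_
  gcongr

end

end Refresh

section

/-! ### The noise of the momentum, for large batches -/

theorem norm_sq_convex_combination_le {V : Type*} [NormedAddCommGroup V] [NormedSpace ℝ V] {m : ℝ}
    (h0 : 0 ≤ m) (h1 : m ≤ 1) (x y : V) :
    ‖(1 - m) • x + m • y‖ ^ 2 ≤ (1 - m) * ‖x‖ ^ 2 + m * ‖y‖ ^ 2 := by
  have h2 : 0 ≤ 1 - m := by linarith
  have h : ‖(1 - m) • x + m • y‖ ≤ (1 - m) * ‖x‖ + m * ‖y‖ := by
    refine (norm_add_le _ _).trans (le_of_eq ?_)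
    rw [norm_smul, norm_smul, Real.norm_of_nonneg h0, Real.norm_of_nonneg h2]
  refine (pow_le_pow_left₀ (norm_nonneg _) h 2).trans ?_
  nlinarith [mul_nonneg (mul_nonneg h0 h2) (sq_nonneg (‖x‖ - ‖y‖))]

/-- Indices below the delay are truncated to `0`, where the sequence vanishes. -/
theorem sum_sub_le {b : ℕ → ℝ} (hb : ∀ n, 0 ≤ b n) (h0 : b 0 = 0) (T j : ℕ) :
    ∑ n ∈ Finset.range T, b (n - j) ≤ ∑ n ∈ Finset.range T, b n := by
  induction j with
  | zero => simp
  | succ j ih =>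
    refine le_trans ?_ ih
    rcases T with _ | T
    · simp
    · rw [Finset.sum_range_succ', Finset.sum_range_succ (fun n => b (n - j))]
      simp only [Nat.zero_sub, h0, add_zero, Nat.add_sub_add_right]
      exact le_add_of_nonneg_right (hb _)

variable {E B : ℕ} {d dw : ℕ → ℕ} {Ξ : Type*} [MeasurableSpace Ξ]
  {a : Layers d dw} {cfg : Config d Ξ} {w₁ : Weights E dw}
  {D : Measure (Act d 0)} {ν : Measure Ξ} [IsProbabilityMeasure D] [IsProbabilityMeasure ν]
  {Lℓ Ca Lg La ωF ωB σ : ℝ}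

omit [MeasurableSpace Ξ] in
theorem norm_run_sub_sq_le (s : ℕ → IterSeed B d Ξ) (n l : ℕ) :
    ‖(run a cfg w₁ s n).w - (run a cfg w₁ s (n - l)).w‖ ^ 2 ≤
      l * ∑ j ∈ Finset.range l, wMove a cfg w₁ (n - j) s ^ 2 := by
  have h := Finset.sum_range_sub' (fun j => (run a cfg w₁ s (n - j)).w) l
  rw [Nat.sub_zero] at h
  rw [← h]
  have h2 : ‖∑ j ∈ Finset.range l, ((run a cfg w₁ s (n - j)).w - (run a cfg w₁ s (n - (j + 1))).w)‖
      ≤ ∑ j ∈ Finset.range l, wMove a cfg w₁ (n - j) s :=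
    (norm_sum_le _ _).trans (Finset.sum_le_sum fun j _ => by rw [wMove, Nat.sub_sub])
  refine (pow_le_pow_left₀ (norm_nonneg _) h2 2).trans ?_
  simpa using sq_sum_le_card_mul_sum_sq (s := Finset.range l) (f := fun j => wMove a cfg w₁ (n - j) s)

variable (hS : Smooth E a D Lℓ Ca Lg La) (hC : Contractive E ν cfg.Cf cfg.Cb ωF ωB)
include hS hC

theorem integrable_run_sub_sq
    (hw : ∀ n, Integrable (fun s => wMove (B := B) a cfg w₁ n s ^ 2) (runLaw B D ν)) (n l : ℕ) :
    Integrable (fun s => ‖(run (B := B) a cfg w₁ s n).w - (run a cfg w₁ s (n - l)).w‖ ^ 2)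
      (runLaw B D ν) := by
  have hm := fun j => (measurableState_run (B := B) hS hC w₁ j).w
  refine Integrable.mono' ((integrable_finsetSum (Finset.range l) fun j _ => hw (n - j)).const_mul (l : ℝ))
    (((hm n).sub (hm (n - l))).norm.pow_const 2).aestronglyMeasurable (ae_of_all _ fun s => ?_)
  rw [Real.norm_of_nonneg (by positivity)]
  exact norm_run_sub_sq_le s n l

theorem sum_integral_run_sub_sq_le
    (hw : ∀ n, Integrable (fun s => wMove (B := B) a cfg w₁ n s ^ 2) (runLaw B D ν)) (T l : ℕ) :
    ∑ n ∈ Finset.range T,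
        ∫ s, ‖(run (B := B) a cfg w₁ s n).w - (run a cfg w₁ s (n - l)).w‖ ^ 2 ∂runLaw B D ν ≤
      (l : ℝ) ^ 2 * ∑ n ∈ Finset.range T, ∫ s, wMove (B := B) a cfg w₁ n s ^ 2 ∂runLaw B D ν := by
  set δ : ℕ → ℝ := fun n => ∫ s, wMove (B := B) a cfg w₁ n s ^ 2 ∂runLaw B D ν
  have hδ : ∀ n, 0 ≤ δ n := fun n => integral_nonneg fun _ => sq_nonneg _
  have hδ0 : δ 0 = 0 := by simp [δ, wMove]
  calc _ ≤ ∑ n ∈ Finset.range T, (l : ℝ) * ∑ j ∈ Finset.range l, δ (n - j) := by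
        refine Finset.sum_le_sum fun n _ => ?_
        refine (integral_mono (integrable_run_sub_sq hS hC hw n l)
          ((integrable_finsetSum _ fun j _ => hw (n - j)).const_mul (l : ℝ))
          fun s => norm_run_sub_sq_le s n l).trans (le_of_eq ?_)
        rw [integral_const_mul, integral_finsetSum _ fun j _ => hw (n - j)]
    _ = (l : ℝ) * ∑ j ∈ Finset.range l, ∑ n ∈ Finset.range T, δ (n - j) := by
        rw [← Finset.mul_sum, Finset.sum_comm]
    _ ≤ (l : ℝ) * ∑ _j ∈ Finset.range l, ∑ n ∈ Finset.range T, δ n :=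
        mul_le_mul_of_nonneg_left (Finset.sum_le_sum fun j _ => sum_sub_le hδ hδ0 T j)
          (Nat.cast_nonneg l)
    _ = _ := by rw [Finset.sum_const, Finset.card_range, nsmul_eq_mul]; ring

variable (hdE : d E = 1) (hE : 0 < E) (hG : StochasticGradient E a D σ)
include hdE hE hG

/-- Jensen's inequality for the weights of the momentum. Nothing is gained from averaging over time:
for large batches each single noise is already small. -/
theorem sum_integral_momentumNoise_le_noise (hm : 0 < cfg.m) (hm1 : cfg.m ≤ 1) (T : ℕ) :
    ∑ n ∈ Finset.range T, ∫ s, ‖momentumNoise (B := B) a cfg w₁ D n s‖ ^ 2 ∂runLaw B D ν ≤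
      ∑ n ∈ Finset.range T, ∫ s, ‖noise (B := B) a cfg w₁ D n s‖ ^ 2 ∂runLaw B D ν := by
  have hN := fun n => (bddMeas_noise (B := B) (w₁ := w₁) hS hC hdE hE hG n).norm_sq.integrable
    (μ := runLaw B D ν)
  have hM := fun n => (bddMeas_momentumNoise (B := B) (w₁ := w₁) hS hC hdE hE hG n).norm_sq.integrable
    (μ := runLaw B D ν)
  set ζ : ℕ → ℝ := fun n => ∫ s, ‖noise (B := B) a cfg w₁ D n s‖ ^ 2 ∂runLaw B D ν
  have hζ : ∀ n, 0 ≤ ζ n := fun n => integral_nonneg fun _ => sq_nonneg _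
  have hle := fun n => le_geomFilter (ω := 1 - cfg.m) (s := fun n => cfg.m * ζ n) (T := n + 1)
    (f := fun n => ∫ s, ‖momentumNoise (B := B) a cfg w₁ D n s‖ ^ 2 ∂runLaw B D ν)
    (by linarith) (by
      simp only [momentumNoise, norm_smul, mul_pow, Real.norm_of_nonneg hm.le]
      rw [integral_const_mul]
      exact mul_le_mul_of_nonneg_right (by nlinarith) (hζ 0)) (fun k _ => by
      have h1 : ∀ s, ‖momentumNoise (B := B) a cfg w₁ D (k + 1) s‖ ^ 2 ≤
          (1 - cfg.m) * ‖momentumNoise a cfg w₁ D k s‖ ^ 2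
            + cfg.m * ‖noise a cfg w₁ D (k + 1) s‖ ^ 2 := fun s =>
        norm_sq_convex_combination_le hm.le hm1 _ _
      refine (integral_mono (hM (k + 1))
        (((hM k).const_mul (1 - cfg.m)).add ((hN (k + 1)).const_mul cfg.m)) h1).trans (le_of_eq ?_)
      simp only [Pi.add_apply]
      rw [integral_add ((hM k).const_mul (1 - cfg.m)) ((hN (k + 1)).const_mul cfg.m),
        integral_const_mul, integral_const_mul]) n (by omega)
  refine (Finset.sum_le_sum fun n _ => hle n).trans
    ((sum_geomFilter_le (by linarith) (by linarith) (fun n => by have := hζ n; positivity) T).trans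
      (le_of_eq ?_))
  rw [← Finset.mul_sum, sub_sub_cancel, mul_div_cancel_left₀ _ hm.ne']

/-- The momentum noise, from moments of the noise over windows of `l` iterations. -/
theorem sum_integral_momentumNoise_le_window (hB : 0 < B) (hm : 0 < cfg.m) (hm1 : cfg.m ≤ 1)
    (hp0 : 0 ≤ cfg.p) (hp1 : cfg.p ≤ 1) {r lam : ℝ} (hr : 0 < r) (hlam : 0 < lam)
    (hw : ∀ n, Integrable (fun s => wMove (B := B) a cfg w₁ n s ^ 2) (runLaw B D ν))
    (l k T : ℕ) :
    ∑ n ∈ Finset.range T, ∫ s, ‖momentumNoise (B := B) a cfg w₁ D n s‖ ^ 2 ∂runLaw B D ν ≤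
      T * (2 * noiseBound E Ca Lg La ^ 2 * (1 - cfg.p) ^ l + 4 * (σ ^ 2 / B) + 4 * r
        + 4 * noiseBound E Ca Lg La ^ 2 * (16 ^ (k + 1)
          * (momentConst (Module.finrank ℝ (Weights E dw)) k
            * (noiseBound E Ca Lg La ^ 2 / (B * (r + lam))) ^ (k + 1))
          * (largeRadius (noiseBound E Ca Lg La) (noiseBound E Ca Lg La) r lam
            / smallRadius (noiseBound E Ca Lg La) r lam) ^ Module.finrank ℝ (Weights E dw)))
      + 4 * lam * l ^ 2
        * ∑ n ∈ Finset.range T, ∫ s, wMove (B := B) a cfg w₁ n s ^ 2 ∂runLaw B D ν := by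
  refine (sum_integral_momentumNoise_le_noise hS hC hdE hE hG hm hm1 T).trans ?_
  refine (Finset.sum_le_sum fun n _ => integral_noise_sq_le hS hC hdE hE hG hB hp0 hp1 hr hlam n l k
    (integrable_run_sub_sq hS hC hw n l)).trans ?_
  have h := mul_le_mul_of_nonneg_left (sum_integral_run_sub_sq_le (B := B) (w₁ := w₁) hS hC hw T l)
    (show 0 ≤ 4 * lam by positivity)
  simp only [mul_add, Finset.sum_add_distrib, ← Finset.mul_sum, Finset.sum_const, Finset.card_range,
    nsmul_eq_mul] at h ⊢
  linarith

end

section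

/-! ### The parameters for large batches -/

/-- `(1 - p) ^ l` is at most `exp (-τ)`, which decays faster than any power of `τ`; this makes stale
entries negligible. -/
theorem one_sub_pow_le_div {p τ : ℝ} {l : ℕ} (hp1 : p ≤ 1) (hτ : 0 < τ) (h : τ ≤ p * l) (k : ℕ) :
    (1 - p) ^ l ≤ k.factorial / τ ^ k := by
  have h1 : (1 - p) ^ l ≤ Real.exp (-τ) := by
    calc (1 - p) ^ l ≤ Real.exp (-p) ^ l :=
          pow_le_pow_left₀ (by linarith) (by linarith [Real.add_one_le_exp (-p)]) l
      _ = Real.exp (-(p * l)) := by rw [← Real.exp_nat_mul]; congr 1; ring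
      _ ≤ _ := Real.exp_le_exp.mpr (by linarith)
  refine h1.trans ?_
  have h2 := Real.pow_div_factorial_le_exp τ hτ.le k
  have h3 : (0 : ℝ) < k.factorial := by exact_mod_cast k.factorial_pos
  rw [div_le_iff₀ h3] at h2
  rw [le_div_iff₀ (by positivity), Real.exp_neg, inv_mul_le_iff₀ (Real.exp_pos _)]
  exact h2

/-- Ensures that the base `K ^ 2 / (b * (r + lam))` of the moments decays like `θ ^ (-2)`. Either `r
* b` is at least `θ ^ 2`, or `r ^ 3 * b * θ ^ 24 ≥ 1` forces `r * θ ^ 13 ≥ 1`, and then `lam` is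
large enough. -/
theorem sq_le_mul_add_of_large {θ r lam b : ℝ} (hθ : 1 ≤ θ) (hr : 0 < r) (hb : 0 < b)
    (hlam : r ^ 4 * θ ^ 42 / 16 ≤ lam) (hrb : 1 ≤ r * b) (hrbt : 1 ≤ r ^ 3 * b * θ ^ 24) :
    θ ^ 2 / 16 ≤ b * (r + lam) := by
  have hθ0 : 0 < θ := by linarith
  have hl : 0 < lam := lt_of_lt_of_le (by positivity) hlam
  by_cases h : θ ^ 2 ≤ r * b
  · nlinarith [mul_pos hb hl, sq_nonneg θ]
  · push Not at h
    have h1 : 1 < (r * θ ^ 13) ^ 2 := by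
      calc 1 ≤ r ^ 3 * b * θ ^ 24 := hrbt
        _ = r * b * (r ^ 2 * θ ^ 24) := by ring
        _ < θ ^ 2 * (r ^ 2 * θ ^ 24) := mul_lt_mul_of_pos_right h (by positivity)
        _ = _ := by ring
    have h2 : 1 ≤ r * θ ^ 13 := by
      by_contra! h3
      nlinarith [show 0 < r * θ ^ 13 by positivity]
    have h3 : 1 ≤ (r * θ ^ 13) ^ 3 := one_le_pow₀ h2
    calc θ ^ 2 / 16 ≤ θ ^ 3 / 16 := by
          linarith [pow_le_pow_right₀ hθ (show 2 ≤ 3 by norm_num)]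
      _ ≤ 1 * (1 * (θ ^ 3 / 16)) := by linarith
      _ ≤ (r * b) * ((r * θ ^ 13) ^ 3 * (θ ^ 3 / 16)) := by gcongr
      _ = b * (r ^ 4 * θ ^ 42 / 16) := by ring
      _ ≤ b * (r + lam) := by gcongr; linarith

/-- The exponent is `39 = 12 + 27`, from the bounds `θ ^ 12` for `1 / √r` and `4 * θ ^ 27` for `1 /
√lam`. -/
theorem radius_ratio_le {θ r lam K : ℝ} (hθ : 1 ≤ θ) (hK : 0 ≤ K) (hr : 0 < r)
    (hlam : r ^ 4 * θ ^ 42 / 16 ≤ lam) (hrt : 1 ≤ r * θ ^ 24) :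
    largeRadius K K r lam / smallRadius K r lam ≤ (1 + K * (8 * K + 5)) * θ ^ 39 := by
  have hθ0 : 0 < θ := by linarith
  have hl : 0 < lam := lt_of_lt_of_le (by positivity) hlam
  have hs : 0 < √r := Real.sqrt_pos.mpr hr
  have hΛ : 0 < √lam := Real.sqrt_pos.mpr hl
  have h1 : 1 / √r ≤ θ ^ 12 := by
    rw [div_le_iff₀ hs]
    have : (1 : ℝ) ≤ √(r * (θ ^ 12) ^ 2) := Real.one_le_sqrt.mpr (by rw [← pow_mul]; exact hrt)
    rw [Real.sqrt_mul hr.le, Real.sqrt_sq (by positivity)] at this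
    linarith
  have h2 : 1 / √lam ≤ 4 * θ ^ 27 := by
    rw [div_le_iff₀ hΛ]
    have h3 : r ^ 2 * θ ^ 21 / 4 ≤ √lam := Real.le_sqrt_of_sq_le (by
      refine le_trans (le_of_eq ?_) hlam; ring)
    calc 1 ≤ (r * θ ^ 24) ^ 2 := one_le_pow₀ hrt
      _ = 4 * θ ^ 27 * (r ^ 2 * θ ^ 21 / 4) := by ring
      _ ≤ _ := by gcongr
  have e : largeRadius K K r lam / smallRadius K r lam =
      1 + K * ((2 * K + 1) * (1 / √lam) + 1) * (1 / √r) := by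
    unfold largeRadius smallRadius
    field_simp
    ring
  rw [e]
  have h4 : (1 : ℝ) ≤ θ ^ 27 := one_le_pow₀ hθ
  have h5 : (1 : ℝ) ≤ θ ^ 39 := one_le_pow₀ hθ
  calc 1 + K * ((2 * K + 1) * (1 / √lam) + 1) * (1 / √r)
      ≤ θ ^ 39 + K * ((2 * K + 1) * (4 * θ ^ 27) + θ ^ 27) * θ ^ 12 := by gcongr
    _ = _ := by ring

/-- The constant for the moments of the noise. -/
def tailConst (N : ℕ) (K : ℝ) : ℝ :=
  16 ^ (20 * N + 12) * (momentConst N (20 * N + 11) * (16 * K ^ 2) ^ (20 * N + 12))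
    * (1 + K * (8 * K + 5)) ^ N

/-- The moment of order `20 N + 12` decays like `θ ^ (-40 N - 24)` and beats the volume ratio `θ ^
(39 N)`. What is left is at most `θ ^ (-24) ≤ r`. -/
theorem tail_le {θ r lam b K : ℝ} (hθ : 1 ≤ θ) (hK : 0 ≤ K) (hr : 0 < r) (hb : 0 < b)
    (hlam : r ^ 4 * θ ^ 42 / 16 ≤ lam) (hrt : 1 ≤ r * θ ^ 24) (hrb : 1 ≤ r * b)
    (hrbt : 1 ≤ r ^ 3 * b * θ ^ 24) (N : ℕ) :
    16 ^ (20 * N + 11 + 1) * (momentConst N (20 * N + 11)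
      * (K ^ 2 / (b * (r + lam))) ^ (20 * N + 11 + 1))
      * (largeRadius K K r lam / smallRadius K r lam) ^ N ≤ tailConst N K * r := by
  have hθ0 : 0 < θ := by linarith
  have hl : 0 < lam := lt_of_lt_of_le (by positivity) hlam
  have h1 := sq_le_mul_add_of_large hθ hr hb hlam hrb hrbt
  have h2 := radius_ratio_le hθ hK hr hlam hrt
  have h3 : K ^ 2 / (b * (r + lam)) ≤ 16 * K ^ 2 * (1 / θ ^ 2) := by
    rw [div_le_iff₀ (by positivity)]
    calc K ^ 2 = 16 * K ^ 2 * (1 / θ ^ 2) * (θ ^ 2 / 16) := by field_simp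
      _ ≤ _ := by gcongr
  have h0 : 0 ≤ largeRadius K K r lam / smallRadius K r lam := by
    unfold largeRadius smallRadius; positivity
  have hm := momentConst_nonneg N (20 * N + 11)
  calc _ ≤ 16 ^ (20 * N + 12) * (momentConst N (20 * N + 11)
      * (16 * K ^ 2 * (1 / θ ^ 2)) ^ (20 * N + 12)) * ((1 + K * (8 * K + 5)) * θ ^ 39) ^ N := by
        gcongr
    _ = tailConst N K * ((1 / θ) ^ (N + 24)) := by
        have e : (1 / θ ^ 2) ^ (20 * N + 12) * (θ ^ 39) ^ N = (1 / θ) ^ (N + 24) := by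
          rw [one_div, one_div, inv_pow, inv_pow, ← pow_mul, ← pow_mul, inv_mul_eq_div,
            div_eq_iff (by positivity), ← div_eq_inv_mul, eq_div_iff (by positivity), ← pow_add]
          congr 1; ring
        rw [tailConst, mul_pow (16 * K ^ 2), mul_pow _ (θ ^ 39), ← e]
        ring
    _ ≤ tailConst N K * r := by
        have h4 : (1 / θ) ^ (N + 24) ≤ r := by
          calc (1 / θ) ^ (N + 24) ≤ (1 / θ) ^ 24 :=
                pow_le_pow_of_le_one (by positivity) (by rw [div_le_one hθ0]; exact hθ) (by omega)
            _ ≤ r := by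
              rw [div_pow, one_pow, div_le_iff₀ (by positivity)]; exact hrt
        have h5 : 0 ≤ tailConst N K := by unfold tailConst; positivity
        gcongr

/-- The constant for the momentum noise with large batches. -/
def noiseConst (N : ℕ) (K V : ℝ) : ℝ :=
  2 * K ^ 2 * (8 : ℕ).factorial + 4 * V ^ 2 + 4 + 4 * K ^ 2 * tailConst N K

variable {E B : ℕ} {d dw : ℕ → ℕ} {Ξ : Type*} [MeasurableSpace Ξ]
  {a : Layers d dw} {cfg : Config d Ξ} {w₁ : Weights E dw}
  {D : Measure (Act d 0)} {ν : Measure Ξ} [IsProbabilityMeasure D] [IsProbabilityMeasure ν]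
  {Lℓ Ca Lg La ωF ωB σ : ℝ}

/-- The momentum noise for large batches, with an arbitrarily small dependence on the moves. -/
theorem sum_integral_momentumNoise_le_large (hS : Smooth E a D Lℓ Ca Lg La)
    (hC : Contractive E ν cfg.Cf cfg.Cb ωF ωB) (hdE : d E = 1) (hE : 0 < E)
    (hG : StochasticGradient E a D σ) (hB : 0 < B) {T : ℕ} (hT : 0 < T) {κ r c₁ : ℝ}
    (hκ : 0 < κ) (hκ1 : κ ≤ 1) (hc : 0 < c₁) (hc1 : c₁ ≤ 1) (hr : 0 < r) (hr1 : r ≤ 1)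
    (hrt : 1 ≤ r * T) (hrb : 1 ≤ r * B) (hrbt : 1 ≤ r ^ 3 * (B * T)) (hp : cfg.p = κ * r / 2)
    (hm : cfg.m = κ / (8 * (r * T))) (hγ : cfg.γ = c₁ * cfg.m)
    (hw : ∀ n, Integrable (fun s => wMove (B := B) a cfg w₁ n s ^ 2) (runLaw B D ν)) :
    ∑ n ∈ Finset.range T, ∫ s, ‖momentumNoise (B := B) a cfg w₁ D n s‖ ^ 2 ∂runLaw B D ν ≤
      noiseConst (Module.finrank ℝ (Weights E dw)) (noiseBound E Ca Lg La) σ * (r * T)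
      + 1 / (16 * cfg.γ ^ 2)
        * ∑ n ∈ Finset.range T, ∫ s, wMove (B := B) a cfg w₁ n s ^ 2 ∂runLaw B D ν := by
  have hT' : (1 : ℝ) ≤ T := by exact_mod_cast hT
  have hB' : (0 : ℝ) < B := by exact_mod_cast hB
  -- The root makes all exponents below integers. The window exceeds the refresh time `1 / p` by the
  -- factor `θ ^ 3`, so the fraction of stale entries is at most `exp (-θ ^ 3) ≤ 8! / θ ^ 24 = 8! /
  -- T`.
  set θ : ℝ := (T : ℝ) ^ (1 / 24 : ℝ) with hθ_def
  have hθ : 1 ≤ θ := Real.one_le_rpow hT' (by norm_num)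
  have hθ0 : 0 < θ := by linarith
  have hθT : θ ^ 24 = T := by
    rw [hθ_def, ← Real.rpow_natCast, ← Real.rpow_mul (by linarith)]; norm_num
  have hK : 0 ≤ noiseBound E Ca Lg La := by
    have hCa := hS.Ca_nonneg hE
    have h1 := gradBound_nonneg (E := E) hCa
    have h2 : 0 ≤ lossLip E Ca Lg La := lossLip_nonneg hCa
    rw [noiseBound]; positivity
  have hp0 : 0 < cfg.p := by rw [hp]; positivity
  have hp1 : cfg.p ≤ 1 := by rw [hp]; nlinarith
  have hm0 : 0 < cfg.m := by rw [hm]; positivity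
  have hm1 : cfg.m ≤ 1 := by rw [hm, div_le_one (by positivity)]; linarith
  have hγ0 : 0 < cfg.γ := by rw [hγ]; positivity
  set l := ⌈θ ^ 3 / cfg.p⌉₊ with hl_def
  have hl : θ ^ 3 / cfg.p ≤ l := Nat.le_ceil _
  have hl' : (l : ℝ) ≤ θ ^ 3 / cfg.p + 1 := (Nat.ceil_lt_add_one (by positivity)).le
  have hl0 : (0 : ℝ) < l := lt_of_lt_of_le (by positivity) hl
  -- Chosen so that `4 * lam * l ^ 2 = 1 / (16 * γ ^ 2)`, a multiple of the squared moves which the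
  -- descent inequality can absorb.
  set lam := 1 / (64 * (cfg.γ * l) ^ 2) with hlam_def
  have hlam0 : 0 < lam := by positivity
  have hγl : cfg.γ * l ≤ θ ^ 3 / (2 * (r ^ 2 * T)) := by
    have h1 : (l : ℝ) ≤ 4 * θ ^ 3 / (κ * r) := by
      refine hl'.trans ?_
      have h2 : 1 ≤ θ ^ 3 / cfg.p := by
        rw [le_div_iff₀ hp0, one_mul]; exact hp1.trans (one_le_pow₀ hθ)
      calc θ ^ 3 / cfg.p + 1 ≤ θ ^ 3 / cfg.p + θ ^ 3 / cfg.p := by gcongr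
        _ = _ := by rw [hp]; field_simp; norm_num
    calc cfg.γ * l ≤ (1 * (κ / (8 * (r * T)))) * (4 * θ ^ 3 / (κ * r)) := by
          rw [hγ, hm]; gcongr
      _ = _ := by field_simp; norm_num
  have hlam : r ^ 4 * θ ^ 42 / 16 ≤ lam := by
    rw [hlam_def, le_div_iff₀ (by positivity)]
    calc r ^ 4 * θ ^ 42 / 16 * (64 * (cfg.γ * l) ^ 2)
        ≤ r ^ 4 * θ ^ 42 / 16 * (64 * (θ ^ 3 / (2 * (r ^ 2 * T))) ^ 2) := by gcongr
      _ = 1 := by rw [← hθT]; field_simp; norm_num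
  have h := sum_integral_momentumNoise_le_window (w₁ := w₁) hS hC hdE hE hG hB hm0 hm1 hp0.le hp1
    hr hlam0 hw l (20 * Module.finrank ℝ (Weights E dw) + 11) T
  have htail := tail_le hθ hK hr hB' hlam (by rwa [hθT]) hrb (by rw [hθT]; linarith)
    (Module.finrank ℝ (Weights E dw))
  have hpow : (1 - cfg.p) ^ l ≤ (8 : ℕ).factorial * r := by
    refine (one_sub_pow_le_div hp1 (show 0 < θ ^ 3 by positivity) ?_ 8).trans ?_
    · rwa [div_le_iff₀' hp0] at hl
    · rw [← pow_mul, hθT, div_le_iff₀ (by positivity), mul_assoc]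
      exact le_mul_of_one_le_right (by positivity) hrt
  have hvar : σ ^ 2 / B ≤ σ ^ 2 * r := by
    rw [div_le_iff₀ hB', mul_assoc]
    exact le_mul_of_one_le_right (sq_nonneg _) hrb
  have hcoef : 4 * lam * l ^ 2 = 1 / (16 * cfg.γ ^ 2) := by
    rw [hlam_def]; field_simp; norm_num
  rw [hcoef] at h
  refine h.trans (add_le_add_left ?_ _)
  calc _ ≤ (T : ℝ) * (2 * noiseBound E Ca Lg La ^ 2 * ((8 : ℕ).factorial * r) + 4 * (σ ^ 2 * r)
        + 4 * r + 4 * noiseBound E Ca Lg La ^ 2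
          * (tailConst (Module.finrank ℝ (Weights E dw)) (noiseBound E Ca Lg La) * r)) := by
        gcongr
    _ = _ := by rw [noiseConst]; ring

end

section

/-! ### Bounded and vanishing variance -/

variable {E B : ℕ} {d dw : ℕ → ℕ} {Ξ : Type*} [MeasurableSpace Ξ]
  {a : Layers d dw} {cfg : Config d Ξ} {w₁ : Weights E dw}
  {D : Measure (Act d 0)} {ν : Measure Ξ} [IsProbabilityMeasure D] [IsProbabilityMeasure ν]
  {Lℓ Ca Lg La ωF ωB σ : ℝ}

-- The Jacobian bounds already bound the noise. Replacing the variance by this structural bound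
-- keeps the constant of FC independent of `σ`.
omit [MeasurableSpace Ξ] in
theorem StochasticGradient.of_bound (hS : Smooth E a D Lℓ Ca Lg La) (hdE : d E = 1) (hE : 0 < E)
    (hG : StochasticGradient E a D σ) : StochasticGradient E a D (2 * gradBound E Ca) := by
  refine ⟨hG.integrable, hG.unbiased, fun w => ?_⟩
  have hb := gradBound_nonneg (E := E) (hS.Ca_nonneg hE)
  have h : ∀ x, ‖gradient (fun w' => loss a x w') w - gradient (risk a D) w‖ₑ ^ 2 ≤
      ENNReal.ofReal ((2 * gradBound E Ca) ^ 2) := fun x => by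
    have h1 := norm_sampleNoise_le hS hdE hE hG x w
    rw [sampleNoise, ← hS.gradient_loss x w] at h1
    rw [ENNReal.ofReal_pow (by positivity), ← ofReal_norm]
    gcongr
  exact (lintegral_mono h).trans (by simp)

variable (hS : Smooth E a D Lℓ Ca Lg La) (hC : Contractive E ν cfg.Cf cfg.Cb ωF ωB)
  (hdE : d E = 1) (hE : 0 < E) (hG : StochasticGradient E a D 0)
include hS hdE hE hG

-- The parameters depend on the samples, so a single null set must serve for all `w`. It is found on
-- a countable dense set and extended by continuity.
omit [MeasurableSpace Ξ] in
theorem ae_sampleNoise_eq_zero : ∀ᵐ x ∂D, ∀ w : Weights E dw, sampleNoise a D x w = 0 := by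
  have h1 : ∀ w : Weights E dw, ∀ᵐ x ∂D, sampleNoise a D x w = 0 := fun w => by
    have hc := centered_sampleNoise hS hdE hE hG w
    have h2 : ∫ x, ‖sampleNoise a D x w‖ ^ 2 ∂D = 0 :=
      le_antisymm (hc.var.trans (by simp)) (integral_nonneg fun _ => sq_nonneg _)
    rw [integral_eq_zero_iff_of_nonneg (fun _ => sq_nonneg _) hc.bdd.norm_sq.integrable] at h2
    filter_upwards [h2] with x hx
    simpa using hx
  obtain ⟨S, hSc, hSd⟩ := TopologicalSpace.exists_countable_dense (Weights E dw)
  filter_upwards [(ae_ball_iff hSc).mpr fun w _ => h1 w] with x hx w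
  have hlip : LipschitzWith (2 * lossLip E Ca Lg La).toNNReal (sampleNoise a D x) :=
    LipschitzWith.of_dist_le_mul fun w w' => by
      rw [dist_eq_norm, dist_eq_norm]
      exact (norm_sampleNoise_sub_le hS hdE hE hG x w w').trans
        (mul_le_mul_of_nonneg_right (Real.le_coe_toNNReal _) (norm_nonneg _))
  exact congrFun (hlip.continuous.ext_on hSd continuous_const hx) w

include hC

theorem integral_momentumNoise_eq_zero (n : ℕ) :
    ∫ s, ‖momentumNoise (B := B) a cfg w₁ D n s‖ ^ 2 ∂runLaw B D ν = 0 := by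
  have hnoise : ∀ n, ∀ᵐ s ∂runLaw B D ν, noise (B := B) a cfg w₁ D n s = 0 := fun n => by
    have h : ∀ b : Fin B, ∀ᵐ s ∂runLaw B D ν, ∀ w : Weights E dw,
        sampleNoise a D ((run a cfg w₁ s (n + 1)).x b) w = 0 := fun b =>
      (measurePreserving_sample hS hC n b).quasiMeasurePreserving.ae
        (ae_sampleNoise_eq_zero hS hdE hE hG)
    filter_upwards [ae_all_iff.mpr h] with s hs
    simp [noise, avg, hs]
  have hmom : ∀ᵐ s ∂runLaw B D ν, momentumNoise (B := B) a cfg w₁ D n s = 0 := by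
    induction n with
    | zero => filter_upwards [hnoise 0] with s hs; simp [momentumNoise, hs]
    | succ n ih => filter_upwards [ih, hnoise (n + 1)] with s h1 h2; simp [momentumNoise, h1, h2]
  refine integral_eq_zero_of_ae ?_
  filter_upwards [hmom] with s hs
  simp [hs]

end

section

/-! ### The choice of the parameters -/

/-- The ratio of the learning rate and the momentum coefficient. -/
def stepRatio (L A : ℝ) : ℝ := 1 / (22 * (1 + |L| + |A|))

theorem stepRatio_pos (L A : ℝ) : 0 < stepRatio L A := by unfold stepRatio; positivity

theorem stepRatio_le_one (L A : ℝ) : stepRatio L A ≤ 1 := by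
  rw [stepRatio, div_le_one (by positivity)]
  linarith [abs_nonneg L, abs_nonneg A]

theorem stepRatio_mul_left_le (L A : ℝ) : stepRatio L A * |L| ≤ 1 / 22 := by
  rw [stepRatio, div_mul_eq_mul_div, div_le_div_iff₀ (by positivity) (by norm_num)]
  linarith [abs_nonneg L, abs_nonneg A]

theorem stepRatio_mul_right_le (L A : ℝ) : stepRatio L A * |A| ≤ 1 / 22 := by
  rw [stepRatio, div_mul_eq_mul_div, div_le_div_iff₀ (by positivity) (by norm_num)]
  linarith [abs_nonneg L, abs_nonneg A]

theorem stepRatio_sq_mul_left_le (L A : ℝ) : stepRatio L A ^ 2 * L ^ 2 ≤ 1 / 484 := by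
  rw [← sq_abs L, ← mul_pow]
  calc _ ≤ (1 / 22 : ℝ) ^ 2 := pow_le_pow_left₀
        (mul_nonneg (stepRatio_pos L A).le (abs_nonneg L)) (stepRatio_mul_left_le L A) 2
    _ = _ := by norm_num

theorem stepRatio_sq_mul_right_le (L A : ℝ) : stepRatio L A ^ 2 * A ^ 2 ≤ 1 / 484 := by
  rw [← sq_abs A, ← mul_pow]
  calc _ ≤ (1 / 22 : ℝ) ^ 2 := pow_le_pow_left₀
        (mul_nonneg (stepRatio_pos L A).le (abs_nonneg A)) (stepRatio_mul_right_le L A) 2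
    _ = _ := by norm_num

theorem pipeRate_pos {E : ℕ} {ωF ωB : ℝ} (hF : ωF ∈ Set.Ico (0 : ℝ) 1) (hB : ωB ∈ Set.Ico (0 : ℝ) 1) :
    0 < pipeRate E ωF ωB := by
  have h1 : 0 < 1 - ωF := by linarith [hF.2]
  have h2 : 0 < 1 - ωB := by linarith [hB.2]
  unfold pipeRate; positivity

theorem pipeRate_le_one {E : ℕ} {ωF ωB : ℝ} (hF : ωF ∈ Set.Ico (0 : ℝ) 1)
    (hB : ωB ∈ Set.Ico (0 : ℝ) 1) : pipeRate E ωF ωB ≤ 1 :=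
  mul_le_one₀ (pow_le_one₀ (by linarith [hF.2]) (by linarith [hF.1]))
    (pow_nonneg (by linarith [hB.2]) _) (pow_le_one₀ (by linarith [hB.2]) (by linarith [hB.1]))

variable {E B : ℕ} {d dw : ℕ → ℕ} {Ξ : Type*} [MeasurableSpace Ξ]
  {a : Layers d dw} {cfg : Config d Ξ} {w₁ : Weights E dw}
  {D : Measure (Act d 0)} {ν : Measure Ξ} [IsProbabilityMeasure D] [IsProbabilityMeasure ν]
  {Lℓ Ca Lg La ωF ωB σ J q M c Δ : ℝ} {η : ℕ → ℝ}

theorem integrable_wMove_sq (hS : Smooth E a D Lℓ Ca Lg La)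
    (hC : Contractive E ν cfg.Cf cfg.Cb ωF ωB) (hdE : d E = 1) (hE : 0 < E)
    (hI : ∀ b : Fin B, SampleInputs a cfg w₁ b D ν J q M c η) (n : ℕ) :
    Integrable (fun s => wMove (B := B) a cfg w₁ n s ^ 2) (runLaw B D ν) := by
  rcases n with _ | n
  · simp [wMove]
  · obtain ⟨k, hk⟩ := l2Le_wMove hS hC hdE hE hI n
    exact hk.integrable_sq

/-- The convergence for a learning rate proportional to the momentum coefficient. -/
theorem avgGradSqLE_of_stepRatio (hS : Smooth E a D Lℓ Ca Lg La)
    (hC : Contractive E ν cfg.Cf cfg.Cb ωF ωB) (hdE : d E = 1) (hE : 0 < E)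
    (hG : StochasticGradient E a D σ) (hB : 0 < B)
    (hΔ : ∀ w : Weights E dw, risk a D w₁ - risk a D w ≤ Δ)
    (hI : ∀ b : Fin B, SampleInputs a cfg w₁ b D ν J q M c η) (hm : 0 < cfg.m) (hm1 : cfg.m < 1)
    (hmκ : cfg.m ≤ pipeRate E ωF ωB)
    (hγ : cfg.γ = stepRatio (lossLip E Ca Lg La) (gradConst E Ca Lg La M c) * cfg.m)
    {T : ℕ} (hT : 0 < T) {N k : ℝ}
    (hN : ∑ n ∈ Finset.range T, ∫ s, ‖momentumNoise (B := B) a cfg w₁ D n s‖ ^ 2 ∂runLaw B D ν ≤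
      N + k * ∑ n ∈ Finset.range T, ∫ s, wMove (B := B) a cfg w₁ n s ^ 2 ∂runLaw B D ν)
    (hk : 0 ≤ k) (hkγ : k * cfg.γ ^ 2 ≤ 1 / 8) {R : ℝ}
    (hR : 2 * |Δ| / cfg.γ + 8 * (gradBound E Ca ^ 2 / cfg.m
      + cfg.m * (gradConst E Ca Lg La M c / pipeRate E ωF ωB) ^ 2 * J ^ 2
      + (gradConst E Ca Lg La M c / pipeRate E ωF ωB) ^ 2 * (T * q)) + 2 * N ≤ T * R) :
    AvgGradSqLE a D ν cfg w₁ B T R := by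
  set L := lossLip E Ca Lg La
  set A := gradConst E Ca Lg La M c
  set κ := pipeRate E ωF ωB with hκ_def
  have hκ : 0 < κ := pipeRate_pos hC.ωF_mem hC.ωB_mem
  have hs := stepRatio_pos L A
  have hγ0 : 0 < cfg.γ := by rw [hγ]; positivity
  refine avgGradSqLE_of_noise hS hC hdE hE hG hB hΔ hI hγ0 hm hm1 ?_ hT hN hk ?_ (le_trans ?_ hR)
  · calc cfg.γ * L ≤ stepRatio L A * |L| * cfg.m := by
          rw [hγ, mul_right_comm]
          exact mul_le_mul_of_nonneg_right
            (mul_le_mul_of_nonneg_left (le_abs_self L) hs.le) hm.le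
      _ ≤ 1 / 22 * 1 := mul_le_mul (stepRatio_mul_left_le L A) hm1.le hm.le (by norm_num)
      _ ≤ 1 / 4 := by norm_num
  · have h2 : (cfg.m / κ) ^ 2 ≤ 1 :=
      pow_le_one₀ (by positivity) ((div_le_one hκ).mpr hmκ)
    -- The budget: drift and compression use `8/484` each and the noise `2/8`, together below `1/2`.
    have e : (8 * (L ^ 2 / cfg.m ^ 2 + (A / κ) ^ 2) + 2 * k) * cfg.γ ^ 2 =
        8 * (stepRatio L A ^ 2 * L ^ 2 + stepRatio L A ^ 2 * A ^ 2 * (cfg.m / κ) ^ 2)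
          + 2 * (k * cfg.γ ^ 2) := by
      rw [hγ]; field_simp
    have h3 := stepRatio_sq_mul_left_le L A
    have h4 : stepRatio L A ^ 2 * A ^ 2 * (cfg.m / κ) ^ 2 ≤ 1 / 484 * 1 :=
      mul_le_mul (stepRatio_sq_mul_right_le L A) h2 (by positivity) (by norm_num)
    rw [e]
    linarith
  · gcongr
    exact le_abs_self Δ

/-- The left side is the coefficient of the squared moves in `sum_momentumNoise_le` times `γ ^ 2`;
`m ≤ p / 2` makes it small independently of `p`. -/
theorem coef_mul_sq_le {p m L A : ℝ} (hp : 0 < p) (hm : 0 ≤ m) (hmp : m ≤ p / 2) :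
    28 / p ^ 2 * (2 * L) ^ 2 * (stepRatio L A * m) ^ 2 ≤ 1 / 8 := by
  have h1 : (m / p) ^ 2 ≤ (1 / 2) ^ 2 := by
    refine pow_le_pow_left₀ (by positivity) ?_ 2
    rw [div_le_iff₀ hp]; linarith
  calc 28 / p ^ 2 * (2 * L) ^ 2 * (stepRatio L A * m) ^ 2
      = 112 * ((stepRatio L A ^ 2 * L ^ 2) * (m / p) ^ 2) := by field_simp; ring
    _ ≤ 112 * (1 / 484 * (1 / 2) ^ 2) := by
        gcongr
        exact stepRatio_sq_mul_left_le L A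
    _ ≤ 1 / 8 := by norm_num

/-- The constant of the rate of the variant FU. -/
def constFU (E : ℕ) (Ca Lg La Δ p : ℝ) : ℝ :=
  (2 * |Δ| / stepRatio (lossLip E Ca Lg La) (gradConst E Ca Lg La 0 0)
    + 8 * gradBound E Ca ^ 2) * (2 / p) + 2 * (1 / p * (20 + 9 / p))

theorem constFU_nonneg {E : ℕ} {Ca Lg La Δ p : ℝ} (hp : 0 < p) : 0 ≤ constFU E Ca Lg La Δ p := by
  have := stepRatio_pos (lossLip E Ca Lg La) (gradConst E Ca Lg La 0 0)
  unfold constFU; positivity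

/-- The inverse of `m` is `2/(pκ) + σ √(T/B)`. The first summand forces `m ≤ pκ/2`, as the
compression and the lazy sampling require. The second balances the optimisation terms of order `1/m`
against the noise of order `m T σ²/B`. -/
theorem exists_avgGradSqLE_FU {p : ℝ} (hp : 0 < p) (hp1 : p ≤ 1) (hS : Smooth E a D Lℓ Ca Lg La)
    (hdE : d E = 1) (hE : 0 < E) (hσ : 0 ≤ σ) (hG : StochasticGradient E a D σ)
    (hΔ : ∀ w : Weights E dw, risk a D w₁ - risk a D w ≤ Δ)
    {Cf Cb : ∀ e : ℕ, Act d e → Ξ → Act d e} (hC : Contractive E ν Cf Cb ωF ωB)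
    (rule : SamplingRule) (hB : 0 < B) {T : ℕ} (hT : 0 < T) :
    ∃ γ m : ℝ, 0 < γ ∧ 0 < m ∧ m < 1 ∧
      AvgGradSqLE a D ν
        { variant := .FU, rule := rule, Cf := Cf, Cb := Cb, γ := γ, m := m, p := p }
        w₁ B T (constFU E Ca Lg La Δ p * rateFU E B T σ ωF ωB) := by
  set L := lossLip E Ca Lg La with hL_def
  set A := gradConst E Ca Lg La 0 0 with hA_def
  set κ := pipeRate E ωF ωB with hκ_def
  have hκ : 0 < κ := pipeRate_pos hC.ωF_mem hC.ωB_mem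
  have hκ1 : κ ≤ 1 := pipeRate_le_one hC.ωF_mem hC.ωB_mem
  have hs := stepRatio_pos L A
  have hB' : (0 : ℝ) < B := by exact_mod_cast hB
  have hT' : (0 : ℝ) < T := by exact_mod_cast hT
  have hT1 : (1 : ℝ) ≤ T := by exact_mod_cast hT
  -- `h` is the inverse of the momentum coefficient
  set g := σ * T / √((B : ℝ) * T) with hg_def
  have hsq : 0 < √((B : ℝ) * T) := Real.sqrt_pos.mpr (by positivity)
  have hg : 0 ≤ g := by positivity
  have hg2 : g ^ 2 = T * (σ ^ 2 / B) := by
    rw [hg_def, div_pow, Real.sq_sqrt (by positivity)]; field_simp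
  set h := 2 / (p * κ) + g with hh_def
  have h2 : 2 / (p * κ) ≤ h := by linarith
  have hh : 0 < h := lt_of_lt_of_le (by positivity) h2
  have hmle : 1 / h ≤ p * κ / 2 := by
    rw [div_le_iff₀ hh]
    calc 1 = p * κ / 2 * (2 / (p * κ)) := by field_simp
      _ ≤ _ := by gcongr
  have hm0 : 0 < 1 / h := by positivity
  have hpκ : p * κ ≤ p := mul_le_of_le_one_right hp.le hκ1
  have hpκ' : p * κ ≤ κ := mul_le_of_le_one_left hκ.le hp1
  refine ⟨stepRatio L A * (1 / h), 1 / h, by positivity, hm0, by linarith, ?_⟩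
  set cfg : Config d Ξ :=
    { variant := .FU, rule := rule, Cf := Cf, Cb := Cb, γ := stepRatio L A * (1 / h), m := 1 / h,
      p := p }
  have hI : ∀ b : Fin B, SampleInputs a cfg w₁ b D ν 0 0 0 0 (fun _ => 0) := fun b =>
    SampleInputs.of_FU rfl
  have hN := sum_momentumNoise_le (cfg := cfg) (w₁ := w₁) hS hC hdE hE hG hB hm0
    (show 1 / h ≤ p / 2 by linarith) hp1 (integrable_wMove_sq (cfg := cfg) hS hC hdE hE hI) T
  refine avgGradSqLE_of_stepRatio (cfg := cfg) hS hC hdE hE hG hB hΔ hI hm0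
    (show 1 / h < 1 by linarith) (show 1 / h ≤ κ by linarith) rfl hT hN (by positivity)
    (coef_mul_sq_le hp hm0.le (by linarith)) ?_
  have hNle : 1 / h / p * (20 * T + 9 / p) * (σ ^ 2 / B) ≤ 1 / p * (20 + 9 / p) * g := by
    calc 1 / h / p * (20 * T + 9 / p) * (σ ^ 2 / B)
        ≤ 1 / h / p * (20 * T + 9 / p * T) * (σ ^ 2 / B) := by
          gcongr
          exact le_mul_of_one_le_right (by positivity) hT1
      _ = 1 / p * (20 + 9 / p) * (1 / h * g ^ 2) := by rw [hg2]; ring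
      _ ≤ 1 / p * (20 + 9 / p) * g := by
          gcongr
          rw [one_div, inv_mul_le_iff₀ hh, sq]
          gcongr
          linarith [show 0 < 2 / (p * κ) by positivity]
  have hrate : (T : ℝ) * rateFU E B T σ ωF ωB = g + 1 / κ := by
    have h1 : 0 < 1 - ωF := by linarith [hC.ωF_mem.2]
    have h2 : 0 < 1 - ωB := by linarith [hC.ωB_mem.2]
    rw [rateFU, hκ_def, pipeRate, hg_def]
    field_simp
  have hhle : h ≤ 2 / p * (g + 1 / κ) := by
    have : g ≤ 2 / p * g := le_mul_of_one_le_left hg (by rw [le_div_iff₀ hp]; linarith)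
    rw [hh_def, mul_add]
    have e : 2 / (p * κ) = 2 / p * (1 / κ) := by field_simp
    linarith
  have hgk : g ≤ g + 1 / κ := by linarith [show 0 < 1 / κ by positivity]
  calc 2 * |Δ| / (stepRatio L A * (1 / h)) + 8 * (gradBound E Ca ^ 2 / (1 / h)
        + 1 / h * (A / κ) ^ 2 * 0 ^ 2 + (A / κ) ^ 2 * (T * 0))
        + 2 * (1 / h / p * (20 * T + 9 / p) * (σ ^ 2 / B))
      = (2 * |Δ| / stepRatio L A + 8 * gradBound E Ca ^ 2) * h
        + 2 * (1 / h / p * (20 * T + 9 / p) * (σ ^ 2 / B)) := by field_simp; ring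
    _ ≤ (2 * |Δ| / stepRatio L A + 8 * gradBound E Ca ^ 2) * (2 / p * (g + 1 / κ))
        + 2 * (1 / p * (20 + 9 / p) * (g + 1 / κ)) := by
        refine add_le_add (by gcongr) (mul_le_mul_of_nonneg_left (hNle.trans ?_) zero_le_two)
        gcongr
    _ = T * (constFU E Ca Lg La Δ p * rateFU E B T σ ωF ωB) := by
        rw [mul_left_comm (T : ℝ), hrate, constFU]; ring

end

section

/-! ### The rate of the variant FC -/

section Rate

variable {E B T : ℕ} {σ ωF ωB : ℝ}

/-- The first of the three terms of `δ` already suffices. -/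
theorem inv_pipeRate_le_deltaFC (hF : ωF ∈ Set.Ico (0 : ℝ) 1) (hB : ωB ∈ Set.Ico (0 : ℝ) 1) :
    1 / pipeRate E ωF ωB ≤ deltaFC E ωF ωB := by
  have h1 : 0 < 1 - ωF := by linarith [hF.2]
  have h2 : 0 < 1 - ωB := by linarith [hB.2]
  have h3 := hF.1
  have h4 := hB.1
  rw [deltaFC, pipeRate, mul_comm, add_assoc]
  exact le_add_of_nonneg_right (by positivity)

theorem one_div_mul_pipeRate_le_rateFC (hσ : 0 ≤ σ) (hF : ωF ∈ Set.Ico (0 : ℝ) 1)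
    (hB : ωB ∈ Set.Ico (0 : ℝ) 1) : 1 / T / pipeRate E ωF ωB ≤ rateFC E B T σ ωF ωB := by
  have h1 : 0 < 1 - ωF := by linarith [hF.2]
  have h2 : 0 < 1 - ωB := by linarith [hB.2]
  rw [rateFC, div_right_comm]
  refine le_trans ?_ (le_add_of_nonneg_left (by positivity))
  gcongr
  exact inv_pipeRate_le_deltaFC hF hB

theorem rpow_four_thirds_le {x : ℝ} (h0 : 0 < x) (h1 : x ≤ 1) (hE : 0 < E) :
    x ^ (4 * ((E : ℝ) - 1) / 3) ≤ x ^ (E - 1) := by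
  have hE' : (1 : ℝ) ≤ E := by exact_mod_cast hE
  rw [← Real.rpow_natCast x (E - 1), Nat.cast_sub hE, Nat.cast_one]
  exact Real.rpow_le_rpow_of_exponent_ge h0 h1 (by linarith)

/-- The exponents `4(E - 1)/3` exceed `E - 1`, so the claimed rate has a smaller denominator than
`pipeRate`. Of `σ` only `σ ^ (4/3) ≥ σ₀ ^ (4/3)` is used. -/
theorem mul_div_pipeRate_le_rateFC {σ₀ : ℝ} (hσ₀ : 0 < σ₀) (hσ : σ₀ ≤ σ) (hE : 0 < E) (hB : 0 < B)
    (hT : 0 < T) (hωF : ωF ∈ Set.Ico (0 : ℝ) 1) (hωB : ωB ∈ Set.Ico (0 : ℝ) 1) {r : ℝ}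
    (hr : r ≤ 1 / ((B : ℝ) * T) ^ (1 / 3 : ℝ) + 1 / T) :
    min 1 (σ₀ ^ (4 / 3 : ℝ)) * (r / pipeRate E ωF ωB) ≤ rateFC E B T σ ωF ωB := by
  have h1 : 0 < 1 - ωF := by linarith [hωF.2]
  have h2 : 0 < 1 - ωB := by linarith [hωB.2]
  have hB' : (0 : ℝ) < B := by exact_mod_cast hB
  have hT' : (0 : ℝ) < T := by exact_mod_cast hT
  have hκ := pipeRate_pos (E := E) hωF hωB
  have hσ' : 0 ≤ σ := hσ₀.le.trans hσ
  set ρ := ((B : ℝ) * T) ^ (1 / 3 : ℝ)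
  have hρ : 0 < ρ := by positivity
  have hmin : 0 ≤ min 1 (σ₀ ^ (4 / 3 : ℝ)) := le_min zero_le_one (by positivity)
  have hden : (1 - ωB) ^ (4 * ((E : ℝ) - 1) / 3) * (1 - ωF) ^ (4 * ((E : ℝ) - 1) / 3) ≤
      pipeRate E ωF ωB := by
    rw [pipeRate, mul_comm]
    exact mul_le_mul (rpow_four_thirds_le h1 (by linarith [hωF.1]) hE)
      (rpow_four_thirds_le h2 (by linarith [hωB.1]) hE) (by positivity) (by positivity)
  calc min 1 (σ₀ ^ (4 / 3 : ℝ)) * (r / pipeRate E ωF ωB)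
      ≤ min 1 (σ₀ ^ (4 / 3 : ℝ)) * ((1 / ρ + 1 / T) / pipeRate E ωF ωB) := by gcongr
    _ = min 1 (σ₀ ^ (4 / 3 : ℝ)) / (ρ * pipeRate E ωF ωB)
        + min 1 (σ₀ ^ (4 / 3 : ℝ)) * (1 / pipeRate E ωF ωB / T) := by field_simp
    _ ≤ σ ^ (4 / 3 : ℝ) / (ρ * ((1 - ωB) ^ (4 * ((E : ℝ) - 1) / 3)
          * (1 - ωF) ^ (4 * ((E : ℝ) - 1) / 3))) + 1 * (deltaFC E ωF ωB / T) := by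
        gcongr
        · exact (min_le_right _ _).trans (Real.rpow_le_rpow hσ₀.le hσ (by norm_num))
        · exact min_le_left _ _
        · exact inv_pipeRate_le_deltaFC hωF hωB
    _ = rateFC E B T σ ωF ωB := by rw [rateFC, one_mul, mul_assoc ρ]

end Rate

variable {E B : ℕ} {d dw : ℕ → ℕ} {Ξ : Type*} [MeasurableSpace Ξ]
  {a : Layers d dw} {w₁ : Weights E dw}
  {D : Measure (Act d 0)} {ν : Measure Ξ} [IsProbabilityMeasure D] [IsProbabilityMeasure ν]
  {Lℓ Ca Lg La ωF ωB σ Δ φ M : ℝ}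

/-- The parameters of the variant FC. -/
def configFC (rule : SamplingRule) (Cf Cb : ∀ e : ℕ, Act d e → Ξ → Act d e) (s κ r : ℝ) (T : ℕ) :
    Config d Ξ where
  variant := .FC
  rule := rule
  Cf := Cf
  Cb := Cb
  γ := s * (κ / (8 * (r * T)))
  m := κ / (8 * (r * T))
  p := κ * r / 2

/-- The constant of the variant FC, from the constant `N` of its noise. -/
def paramConst (E : ℕ) (Ca Lg La Δ φ M N : ℝ) : ℝ :=
  16 * |Δ| / stepRatio (lossLip E Ca Lg La) (gradConst E Ca Lg La |M| (2 * |φ|))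
    + 64 * gradBound E Ca ^ 2 + 12 * gradConst E Ca Lg La |M| (2 * |φ|) ^ 2 + 2 * N

theorem paramConst_nonneg {Ca Lg La N : ℝ} (hN : 0 ≤ N) : 0 ≤ paramConst E Ca Lg La Δ φ M N := by
  have := stepRatio_pos (lossLip E Ca Lg La) (gradConst E Ca Lg La |M| (2 * |φ|))
  unfold paramConst; positivity

section

variable {Cf Cb : ∀ e : ℕ, Act d e → Ξ → Act d e} {rule : SamplingRule}
  (hS : Smooth E a D Lℓ Ca Lg La) (hC : Contractive E ν Cf Cb ωF ωB) (hdE : d E = 1) (hE : 0 < E)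
  (hG : StochasticGradient E a D σ) (hφ : SampleSpread D φ)
  (hM : ∀ e, 1 ≤ e → e < E → ∫⁻ x, ‖act a x w₁ e‖ₑ ^ 2 ∂D ≤ ENNReal.ofReal (M ^ 2))
  {T : ℕ} {s r : ℝ}
include hS hC hE hφ hM

theorem sampleInputs_configFC (hr : 0 < r) (hr1 : r ≤ 1) (b : Fin B) :
    SampleInputs a (configFC rule Cf Cb s (pipeRate E ωF ωB) r T) w₁ b D ν 1
      (pipeRate E ωF ωB * r / 2) |M| (2 * |φ|)
      (fun n => √(freshRate (pipeRate E ωF ωB * r / 2) (n + 1)) * |φ|) := by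
  have hκ := pipeRate_pos (E := E) hC.ωF_mem hC.ωB_mem
  have hκ1 := pipeRate_le_one (E := E) hC.ωF_mem hC.ωB_mem
  exact SampleInputs.of_FC (cfg := configFC rule Cf Cb s (pipeRate E ωF ωB) r T) hS hC hE
    (show 0 ≤ pipeRate E ωF ωB * r / 2 by positivity)
    (show pipeRate E ωF ωB * r / 2 ≤ 1 by nlinarith) hφ hM

include hdE hG

/-- The parameters are balanced: with `γ` and `m` of order `κ/(rT)` and `p = κr/2`, the terms
`Δ/(γT)` and `1/(mT)` and the sample moves, of size `p/κ²`, are all of order `r/κ`. The start-up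
error is of lower order because `rT ≥ 1`. -/
theorem avgGradSqLE_FC_of_noise (hB : 0 < B)
    (hΔ : ∀ w : Weights E dw, risk a D w₁ - risk a D w ≤ Δ) (hT : 0 < T) (hr : 0 < r) (hr1 : r ≤ 1)
    (hrt : 1 ≤ r * T)
    (hs : s = stepRatio (lossLip E Ca Lg La) (gradConst E Ca Lg La |M| (2 * |φ|))) {N k : ℝ}
    (hN : ∑ n ∈ Finset.range T, ∫ ω, ‖momentumNoise (B := B) a
        (configFC rule Cf Cb s (pipeRate E ωF ωB) r T) w₁ D n ω‖ ^ 2 ∂runLaw B D ν ≤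
      N * (r * T / pipeRate E ωF ωB) + k * ∑ n ∈ Finset.range T, ∫ ω, wMove (B := B) a
        (configFC rule Cf Cb s (pipeRate E ωF ωB) r T) w₁ n ω ^ 2 ∂runLaw B D ν)
    (hk : 0 ≤ k) (hkγ : k * (s * (pipeRate E ωF ωB / (8 * (r * T)))) ^ 2 ≤ 1 / 8) :
    AvgGradSqLE a D ν (configFC rule Cf Cb s (pipeRate E ωF ωB) r T) w₁ B T
      (paramConst E Ca Lg La Δ φ M N * (r / pipeRate E ωF ωB)) := by
  have hI := sampleInputs_configFC (B := B) (rule := rule) (s := s) (T := T) hS hC hE hφ hM hr hr1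
  have hκ := pipeRate_pos (E := E) hC.ωF_mem hC.ωB_mem
  have hκ1 := pipeRate_le_one (E := E) hC.ωF_mem hC.ωB_mem
  set κ := pipeRate E ωF ωB
  have hT' : (0 : ℝ) < T := by exact_mod_cast hT
  have hm0 : 0 < κ / (8 * (r * T)) := by positivity
  have hmκ : κ / (8 * (r * T)) ≤ κ / 8 := by
    refine div_le_div_of_nonneg_left hκ.le (by norm_num) (by linarith)
  refine avgGradSqLE_of_stepRatio (cfg := configFC rule Cf Cb s κ r T) hS hC hdE hE hG hB hΔ hI hm0
    (show κ / (8 * (r * T)) < 1 by linarith) (show κ / (8 * (r * T)) ≤ κ by linarith)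
    (by rw [← hs]; rfl) hT hN hk hkγ ?_
  set A := gradConst E Ca Lg La |M| (2 * |φ|)
  have hs0 : 0 < s := by rw [hs]; exact stepRatio_pos _ _
  have h1 : 1 / (r * T) ≤ r * T := by
    rw [div_le_iff₀ (by positivity)]; nlinarith
  calc 2 * |Δ| / (s * (κ / (8 * (r * T)))) + 8 * (gradBound E Ca ^ 2 / (κ / (8 * (r * T)))
        + κ / (8 * (r * T)) * (A / κ) ^ 2 * 1 ^ 2 + (A / κ) ^ 2 * (T * (κ * r / 2)))
        + 2 * (N * (r * T / κ))
      = (16 * |Δ| / s + 64 * gradBound E Ca ^ 2 + 4 * A ^ 2 + 2 * N) * (r * T / κ)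
        + A ^ 2 / κ * (1 / (r * T)) := by field_simp; ring
    _ ≤ (16 * |Δ| / s + 64 * gradBound E Ca ^ 2 + 4 * A ^ 2 + 2 * N) * (r * T / κ)
        + A ^ 2 / κ * (r * T) := by gcongr
    _ ≤ (16 * |Δ| / s + 64 * gradBound E Ca ^ 2 + 4 * A ^ 2 + 2 * N) * (r * T / κ)
        + 8 * (A ^ 2 / κ * (r * T)) := by
        linarith [show 0 ≤ A ^ 2 / κ * (r * T) by positivity]
    _ = T * (paramConst E Ca Lg La Δ φ M N * (r / κ)) := by
        rw [paramConst, ← hs]; ring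

/-- Small batches. -/
theorem avgGradSqLE_FC_small (hB : 0 < B)
    (hΔ : ∀ w : Weights E dw, risk a D w₁ - risk a D w ≤ Δ) (hT : 0 < T) (hr : 0 < r) (hr1 : r ≤ 1)
    (hrt : 1 ≤ r ^ 2 * T) (hrbt : 1 ≤ r ^ 3 * (B * T))
    (hs : s = stepRatio (lossLip E Ca Lg La) (gradConst E Ca Lg La |M| (2 * |φ|))) :
    AvgGradSqLE a D ν (configFC rule Cf Cb s (pipeRate E ωF ωB) r T) w₁ B T
      (paramConst E Ca Lg La Δ φ M (10 * σ ^ 2) * (r / pipeRate E ωF ωB)) := by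
  have hI := sampleInputs_configFC (B := B) (rule := rule) (s := s) (T := T) hS hC hE hφ hM hr hr1
  have hκ := pipeRate_pos (E := E) hC.ωF_mem hC.ωB_mem
  have hκ1 := pipeRate_le_one (E := E) hC.ωF_mem hC.ωB_mem
  have hT' : (0 : ℝ) < T := by exact_mod_cast hT
  have hB' : (0 : ℝ) < B := by exact_mod_cast hB
  have hrt' : 1 ≤ r * T := hrt.trans (by nlinarith [mul_pos hr hT'])
  have hm0 : 0 < pipeRate E ωF ωB / (8 * (r * T)) := by positivity
  have hp0 : 0 < pipeRate E ωF ωB * r / 2 := by positivity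
  -- In these parameters `m ≤ p / 2` means `2 * r ^ 2 * T ≥ 1`; this is the restriction that singles
  -- out small batches.
  have hmp : pipeRate E ωF ωB / (8 * (r * T)) ≤ pipeRate E ωF ωB * r / 2 / 2 := by
    rw [div_le_iff₀ (by positivity)]
    calc pipeRate E ωF ωB ≤ pipeRate E ωF ωB * (r ^ 2 * T) := le_mul_of_one_le_right hκ.le hrt
      _ ≤ _ := by nlinarith [show 0 < pipeRate E ωF ωB * (r ^ 2 * T) by positivity]
  have hN := sum_momentumNoise_le (cfg := configFC rule Cf Cb s (pipeRate E ωF ωB) r T) (w₁ := w₁)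
    hS hC hdE hE hG hB hm0 hmp (show pipeRate E ωF ωB * r / 2 ≤ 1 by nlinarith)
    (integrable_wMove_sq (cfg := configFC rule Cf Cb s (pipeRate E ωF ωB) r T) hS hC hdE hE hI) T
  refine avgGradSqLE_FC_of_noise hS hC hdE hE hG hφ hM hB hΔ hT hr hr1 hrt' hs
    (hN.trans (add_le_add_left ?_ _)) (by positivity) ?_
  · change pipeRate E ωF ωB / (8 * (r * T)) / (pipeRate E ωF ωB * r / 2)
      * (20 * T + 9 / (pipeRate E ωF ωB * r / 2)) * (σ ^ 2 / B) ≤ _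
    set κ := pipeRate E ωF ωB
    have h1 : 1 / (r ^ 2 * B) ≤ r * T := by
      rw [div_le_iff₀ (by positivity)]; linarith
    have h2 : 1 / (r ^ 3 * (B * T)) ≤ r * T := by
      rw [div_le_iff₀ (by positivity)]; nlinarith
    have h3 : r * T ≤ r * T / κ := by
      rw [le_div_iff₀ hκ]; nlinarith
    calc κ / (8 * (r * T)) / (κ * r / 2) * (20 * T + 9 / (κ * r / 2)) * (σ ^ 2 / B)
        = σ ^ 2 * (5 * (1 / (r ^ 2 * B)) + 9 / 2 * ((1 / (r ^ 3 * (B * T))) / κ)) := by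
          field_simp; ring
      _ ≤ σ ^ 2 * (5 * (r * T / κ) + 9 / 2 * (r * T / κ)) := by
          have h4 := h1.trans h3
          have h5 : 1 / (r ^ 3 * (B * T)) / κ ≤ r * T / κ := by gcongr
          exact mul_le_mul_of_nonneg_left (by linarith) (sq_nonneg _)
      _ ≤ 10 * σ ^ 2 * (r * T / κ) := by
          nlinarith [show 0 ≤ σ ^ 2 * (r * T / κ) by positivity]
  · rw [hs]
    exact coef_mul_sq_le hp0 hm0.le hmp

/-- Large batches. -/
theorem avgGradSqLE_FC_large (hB : 0 < B)
    (hΔ : ∀ w : Weights E dw, risk a D w₁ - risk a D w ≤ Δ) (hT : 0 < T) (hr : 0 < r) (hr1 : r ≤ 1)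
    (hrt : 1 ≤ r * T) (hrb : 1 ≤ r * B) (hrbt : 1 ≤ r ^ 3 * (B * T))
    (hs : s = stepRatio (lossLip E Ca Lg La) (gradConst E Ca Lg La |M| (2 * |φ|))) :
    AvgGradSqLE a D ν (configFC rule Cf Cb s (pipeRate E ωF ωB) r T) w₁ B T
      (paramConst E Ca Lg La Δ φ M
        |noiseConst (Module.finrank ℝ (Weights E dw)) (noiseBound E Ca Lg La) σ|
        * (r / pipeRate E ωF ωB)) := by
  have hI := sampleInputs_configFC (B := B) (rule := rule) (s := s) (T := T) hS hC hE hφ hM hr hr1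
  have hκ := pipeRate_pos (E := E) hC.ωF_mem hC.ωB_mem
  have hκ1 := pipeRate_le_one (E := E) hC.ωF_mem hC.ωB_mem
  have hT' : (0 : ℝ) < T := by exact_mod_cast hT
  have hs0 : 0 < s := by rw [hs]; exact stepRatio_pos _ _
  have hN := sum_integral_momentumNoise_le_large
    (cfg := configFC rule Cf Cb s (pipeRate E ωF ωB) r T) (w₁ := w₁)
    hS hC hdE hE hG hB hT hκ hκ1 hs0 (hs ▸ stepRatio_le_one _ _) hr hr1 hrt hrb hrbt rfl rfl rfl
    (integrable_wMove_sq (cfg := configFC rule Cf Cb s (pipeRate E ωF ωB) r T) hS hC hdE hE hI)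
  refine avgGradSqLE_FC_of_noise hS hC hdE hE hG hφ hM hB hΔ hT hr hr1 hrt hs
    (hN.trans (add_le_add_left ?_ _)) (by positivity) ?_
  · gcongr
    · exact le_abs_self _
    · rw [le_div_iff₀ hκ]; nlinarith [mul_pos hr hT']
  · change 1 / (16 * (s * (pipeRate E ωF ωB / (8 * (r * T)))) ^ 2)
      * (s * (pipeRate E ωF ωB / (8 * (r * T)))) ^ 2 ≤ _
    rw [one_div_mul_eq_div, div_le_iff₀ (by positivity)]
    nlinarith [show 0 < (s * (pipeRate E ωF ωB / (8 * (r * T)))) ^ 2 by positivity]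

/-- Exact gradients. -/
theorem avgGradSqLE_FC_zero (hG0 : StochasticGradient E a D 0) (hB : 0 < B)
    (hΔ : ∀ w : Weights E dw, risk a D w₁ - risk a D w ≤ Δ) (hT : 0 < T) (hr : 0 < r) (hr1 : r ≤ 1)
    (hrt : 1 ≤ r * T)
    (hs : s = stepRatio (lossLip E Ca Lg La) (gradConst E Ca Lg La |M| (2 * |φ|))) :
    AvgGradSqLE a D ν (configFC rule Cf Cb s (pipeRate E ωF ωB) r T) w₁ B T
      (paramConst E Ca Lg La Δ φ M 0 * (r / pipeRate E ωF ωB)) := by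
  refine avgGradSqLE_FC_of_noise hS hC hdE hE hG hφ hM hB hΔ hT hr hr1 hrt hs (k := 0)
    (le_of_eq ?_) le_rfl (by norm_num)
  rw [zero_mul, zero_mul, add_zero]
  exact Finset.sum_eq_zero fun n _ => integral_momentumNoise_eq_zero
    (cfg := configFC rule Cf Cb s (pipeRate E ωF ωB) r T) hS hC hdE hE hG0 n

end

/-- The constant of the rate of the variant FC, for weights of dimension `N`. -/
def constFC (E N : ℕ) (Ca Lg La Δ φ M σ₀ : ℝ) : ℝ :=
  paramConst E Ca Lg La Δ φ M (10 * (2 * gradBound E Ca) ^ 2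
    + |noiseConst N (noiseBound E Ca Lg La) (2 * gradBound E Ca)|) / min 1 (σ₀ ^ (4 / 3 : ℝ))

theorem constFC_nonneg {N : ℕ} {Ca Lg La σ₀ : ℝ} (hσ₀ : 0 < σ₀) :
    0 ≤ constFC E N Ca Lg La Δ φ M σ₀ :=
  div_nonneg (paramConst_nonneg (by positivity)) (le_min zero_le_one (by positivity))

theorem paramConst_le_mul {N : ℕ} {Ca Lg La σ₀ N' : ℝ} (hσ₀ : 0 < σ₀)
    (hN : N' ≤ 10 * (2 * gradBound E Ca) ^ 2
      + |noiseConst N (noiseBound E Ca Lg La) (2 * gradBound E Ca)|) :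
    paramConst E Ca Lg La Δ φ M N' ≤
      constFC E N Ca Lg La Δ φ M σ₀ * min 1 (σ₀ ^ (4 / 3 : ℝ)) := by
  have : 0 < min 1 (σ₀ ^ (4 / 3 : ℝ)) := lt_min one_pos (by positivity)
  rw [constFC, div_mul_cancel₀ _ this.ne', paramConst, paramConst]
  linarith

theorem AvgGradSqLE.mono {cfg : Config d Ξ} {T : ℕ} {R R' : ℝ} (h : AvgGradSqLE a D ν cfg w₁ B T R)
    (hR : R ≤ R') : AvgGradSqLE a D ν cfg w₁ B T R' :=
  ⟨h.1, h.2.trans hR⟩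

/-- Three regimes: no noise, `B ^ 2 ≤ T`, where the momentum averages the noise out, and `T ≤ B ^
2`, where the batch does. -/
theorem exists_avgGradSqLE_FC {σ₀ : ℝ} (hσ₀ : 0 < σ₀) (hS : Smooth E a D Lℓ Ca Lg La)
    (hdE : d E = 1) (hE : 0 < E) (hσ : σ = 0 ∨ σ₀ ≤ σ) (hG : StochasticGradient E a D σ)
    (hΔ : ∀ w : Weights E dw, risk a D w₁ - risk a D w ≤ Δ) (hφ : SampleSpread D φ)
    (hM : ∀ e, 1 ≤ e → e < E → ∫⁻ x, ‖act a x w₁ e‖ₑ ^ 2 ∂D ≤ ENNReal.ofReal (M ^ 2))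
    {Cf Cb : ∀ e : ℕ, Act d e → Ξ → Act d e} (hC : Contractive E ν Cf Cb ωF ωB)
    (rule : SamplingRule) (hB : 0 < B) {T : ℕ} (hT : 0 < T) :
    ∃ γ m p : ℝ, 0 < γ ∧ 0 < m ∧ m < 1 ∧ 0 < p ∧ p < 1 ∧
      AvgGradSqLE a D ν
        { variant := .FC, rule := rule, Cf := Cf, Cb := Cb, γ := γ, m := m, p := p }
        w₁ B T (constFC E (Module.finrank ℝ (Weights E dw)) Ca Lg La Δ φ M σ₀
          * rateFC E B T σ ωF ωB) := by
  have hκ := pipeRate_pos (E := E) hC.ωF_mem hC.ωB_mem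
  have hκ1 := pipeRate_le_one (E := E) hC.ωF_mem hC.ωB_mem
  have hT1 : (1 : ℝ) ≤ T := by exact_mod_cast hT
  have hB1 : (1 : ℝ) ≤ B := by exact_mod_cast hB
  set s := stepRatio (lossLip E Ca Lg La) (gradConst E Ca Lg La |M| (2 * |φ|)) with hs_def
  have hs : 0 < s := stepRatio_pos _ _
  have hmin : 0 < min 1 (σ₀ ^ (4 / 3 : ℝ)) := lt_min one_pos (by positivity)
  have hC0 := constFC_nonneg (E := E) (N := Module.finrank ℝ (Weights E dw)) (Ca := Ca) (Lg := Lg)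
    (La := La) (Δ := Δ) (φ := φ) (M := M) hσ₀
  have hb := sq_nonneg (2 * gradBound E Ca)
  have hn := abs_nonneg
    (noiseConst (Module.finrank ℝ (Weights E dw)) (noiseBound E Ca Lg La) (2 * gradBound E Ca))
  -- it suffices to choose the inverse square root of the effective number of iterations
  suffices h : ∃ r N' : ℝ, 0 < r ∧ r ≤ 1 ∧ 1 ≤ r * T ∧
      min 1 (σ₀ ^ (4 / 3 : ℝ)) * (r / pipeRate E ωF ωB) ≤ rateFC E B T σ ωF ωB ∧
      N' ≤ 10 * (2 * gradBound E Ca) ^ 2 + |noiseConst (Module.finrank ℝ (Weights E dw))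
        (noiseBound E Ca Lg La) (2 * gradBound E Ca)| ∧
      AvgGradSqLE a D ν (configFC rule Cf Cb s (pipeRate E ωF ωB) r T) w₁ B T
        (paramConst E Ca Lg La Δ φ M N' * (r / pipeRate E ωF ωB)) by
    obtain ⟨r, N', hr, hr1, hrt, hrate, hN, h⟩ := h
    have hm : pipeRate E ωF ωB / (8 * (r * T)) < 1 := by
      rw [div_lt_one (by positivity)]; linarith
    refine ⟨s * (pipeRate E ωF ωB / (8 * (r * T))), pipeRate E ωF ωB / (8 * (r * T)),
      pipeRate E ωF ωB * r / 2, by positivity, by positivity, hm, by positivity, by nlinarith,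
      h.mono ?_⟩
    calc _ ≤ constFC E (Module.finrank ℝ (Weights E dw)) Ca Lg La Δ φ M σ₀
          * min 1 (σ₀ ^ (4 / 3 : ℝ)) * (r / pipeRate E ωF ωB) :=
          mul_le_mul_of_nonneg_right (paramConst_le_mul hσ₀ hN) (by positivity)
      _ ≤ _ := by
          rw [mul_assoc]
          exact mul_le_mul_of_nonneg_left hrate hC0
  rcases hσ with rfl | hσ
  -- Without noise `r` may be as small as `1 / T`, so only the term `δ / T` of the rate is needed.
  · refine ⟨1 / T, 0, by positivity, (div_le_one (by positivity)).mpr hT1,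
      (one_div_mul_cancel (by positivity)).ge, ?_, by positivity, ?_⟩
    · refine le_trans (mul_le_of_le_one_left (by positivity) (min_le_left _ _)) ?_
      exact one_div_mul_pipeRate_le_rateFC le_rfl hC.ωF_mem hC.ωB_mem
    · exact avgGradSqLE_FC_zero hS hC hdE hE hG hφ hM hG hB hΔ hT (by positivity)
        ((div_le_one (by positivity)).mpr hT1) (one_div_mul_cancel (by positivity)).ge hs_def
  · have hG' := hG.of_bound hS hdE hE
    set ρ := ((B : ℝ) * T) ^ (1 / 3 : ℝ) with hρ_def
    have hρ3 : ρ ^ 3 = B * T := by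
      rw [hρ_def, ← Real.rpow_natCast, ← Real.rpow_mul (by positivity)]; norm_num
    have hρ : 0 < ρ := by positivity
    have hρ1 : 1 ≤ ρ := Real.one_le_rpow (by nlinarith) (by norm_num)
    rcases le_total ((B : ℝ) ^ 2) T with h | h
    -- `B ^ 2 ≤ T` gives `ρ ^ 2 ≤ T`, so `r = 1 / ρ` satisfies `r ^ 2 * T ≥ 1`; moreover `r ^ 3 * B
    -- * T = 1`.
    · have h1 : ρ ^ 2 ≤ T := by
        refine le_of_pow_le_pow_left₀ (n := 3) (by norm_num) (by positivity) ?_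
        calc (ρ ^ 2) ^ 3 = (ρ ^ 3) ^ 2 := by ring
          _ = (B : ℝ) ^ 2 * (T : ℝ) ^ 2 := by rw [hρ3, mul_pow]
          _ ≤ T * (T : ℝ) ^ 2 := by gcongr
          _ = _ := by ring
      have h2 : 1 ≤ (1 / ρ) ^ 2 * T := by
        rw [div_pow, one_pow, one_div_mul_eq_div, le_div_iff₀ (by positivity)]; linarith
      have h3 : 1 / ρ ≤ 1 := (div_le_one hρ).mpr hρ1
      refine ⟨1 / ρ, _, by positivity, h3, ?_, ?_, ?_,
        avgGradSqLE_FC_small hS hC hdE hE hG' hφ hM hB hΔ hT (by positivity) h3 h2 ?_ hs_def⟩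
      · refine h2.trans (mul_le_mul_of_nonneg_right ?_ (by positivity))
        exact pow_le_of_le_one (by positivity) h3 two_ne_zero
      · exact mul_div_pipeRate_le_rateFC hσ₀ hσ hE hB hT hC.ωF_mem hC.ωB_mem
          (le_add_of_nonneg_right (by positivity))
      · linarith
      · rw [div_pow, one_pow, hρ3]; exact (one_div_mul_cancel (by positivity)).ge
    · have h1 : ρ ≤ B := by
        refine le_of_pow_le_pow_left₀ (n := 3) (by norm_num) (by positivity) ?_
        rw [hρ3]
        calc (B : ℝ) * T ≤ B * B ^ 2 := by gcongr
          _ = _ := by ring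
      -- When `B > T ^ 2`, `1 / ρ` would violate `r * T ≥ 1`; the maximum with `1 / T` repairs this
      -- and only costs a term of order `1 / T`.
      have h2 : 1 / ρ ≤ max (1 / (T : ℝ)) (1 / ρ) := le_max_right _ _
      have h3 : 1 / (T : ℝ) ≤ max (1 / (T : ℝ)) (1 / ρ) := le_max_left _ _
      have h4 : max (1 / (T : ℝ)) (1 / ρ) ≤ 1 :=
        max_le ((div_le_one (by positivity)).mpr hT1) ((div_le_one hρ).mpr hρ1)
      have h5 : 1 ≤ max (1 / (T : ℝ)) (1 / ρ) * T := by
        rwa [div_le_iff₀ (by positivity)] at h3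
      have h6 : 1 ≤ max (1 / (T : ℝ)) (1 / ρ) * ρ := by
        rwa [div_le_iff₀ hρ] at h2
      have h7 : 0 < max (1 / (T : ℝ)) (1 / ρ) := lt_max_of_lt_right (by positivity)
      refine ⟨max (1 / (T : ℝ)) (1 / ρ), _, h7, h4, h5, ?_, ?_,
        avgGradSqLE_FC_large hS hC hdE hE hG' hφ hM hB hΔ hT h7 h4 h5 ?_ ?_ hs_def⟩
      · refine mul_div_pipeRate_le_rateFC hσ₀ hσ hE hB hT hC.ωF_mem hC.ωB_mem
          (max_le (le_add_of_nonneg_left (by positivity)) (le_add_of_nonneg_right (by positivity)))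
      · linarith
      · exact h6.trans (by gcongr)
      · rw [← hρ3, ← mul_pow]; exact one_le_pow₀ h6

end

end Clapping

end

/-! ### The two convergence rates. -/

theorem mainTheorem5 :
    -- the variant FU
    (∀ (E : ℕ) (Lℓ Ca Lg La Δ p : ℝ), 2 ≤ E → 0 < p → p ≤ 1 →
      ∃ C : ℝ, 0 ≤ C ∧
        ∀ (d dw : ℕ → ℕ) (a : Clapping.Layers d dw)
          (D : Measure (Clapping.Act d 0)) [IsProbabilityMeasure D]
          (w₁ : Clapping.Weights E dw),
          d E = 1 →
          Clapping.Smooth E a D Lℓ Ca Lg La →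
          (∀ w : Clapping.Weights E dw, Clapping.risk a D w₁ - Clapping.risk a D w ≤ Δ) →
          ∀ σ : ℝ, 0 ≤ σ → Clapping.StochasticGradient E a D σ →
          ∀ (Ξ : Type) [MeasurableSpace Ξ] (ν : Measure Ξ) [IsProbabilityMeasure ν]
            (Cf Cb : ∀ e : ℕ, Clapping.Act d e → Ξ → Clapping.Act d e) (ωF ωB : ℝ),
          Clapping.Contractive E ν Cf Cb ωF ωB →
          ∀ (rule : Clapping.SamplingRule) (B T : ℕ), 1 ≤ B → 1 ≤ T →
          ∃ γ m : ℝ, 0 < γ ∧ 0 < m ∧ m < 1 ∧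
            Clapping.AvgGradSqLE a D ν
              { variant := .FU, rule := rule, Cf := Cf, Cb := Cb, γ := γ, m := m, p := p }
              w₁ B T (C * Clapping.rateFU E B T σ ωF ωB)) ∧
    -- the variant FC
    (∀ (E : ℕ) (d dw : ℕ → ℕ) (Lℓ Ca Lg La Δ φ M σ₀ : ℝ), 2 ≤ E → d E = 1 → 0 < σ₀ →
      ∃ C : ℝ, 0 ≤ C ∧
        ∀ (a : Clapping.Layers d dw)
          (D : Measure (Clapping.Act d 0)) [IsProbabilityMeasure D]
          (w₁ : Clapping.Weights E dw),
          Clapping.Smooth E a D Lℓ Ca Lg La →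
          (∀ w : Clapping.Weights E dw, Clapping.risk a D w₁ - Clapping.risk a D w ≤ Δ) →
          Clapping.SampleSpread D φ →
          (∀ e, 1 ≤ e → e < E →
            ∫⁻ x, ‖Clapping.act a x w₁ e‖ₑ ^ 2 ∂D ≤ ENNReal.ofReal (M ^ 2)) →
          ∀ σ : ℝ, σ = 0 ∨ σ₀ ≤ σ → Clapping.StochasticGradient E a D σ →
          ∀ (Ξ : Type) [MeasurableSpace Ξ] (ν : Measure Ξ) [IsProbabilityMeasure ν]
            (Cf Cb : ∀ e : ℕ, Clapping.Act d e → Ξ → Clapping.Act d e) (ωF ωB : ℝ),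
          Clapping.Contractive E ν Cf Cb ωF ωB →
          ∀ (rule : Clapping.SamplingRule) (B T : ℕ), 1 ≤ B → 1 ≤ T →
          ∃ γ m p : ℝ, 0 < γ ∧ 0 < m ∧ m < 1 ∧ 0 < p ∧ p < 1 ∧
            Clapping.AvgGradSqLE a D ν
              { variant := .FC, rule := rule, Cf := Cf, Cb := Cb, γ := γ, m := m, p := p }
              w₁ B T (C * Clapping.rateFC E B T σ ωF ωB)) := by
  refine ⟨fun E Lℓ Ca Lg La Δ p hE hp hp1 => ⟨Clapping.constFU E Ca Lg La Δ p,
    Clapping.constFU_nonneg hp, fun d dw a D _ w₁ hdE hS hΔ σ hσ hG Ξ _ ν _ Cf Cb ωF ωB hC rule B T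
      hB hT => Clapping.exists_avgGradSqLE_FU hp hp1 hS hdE (by omega) hσ hG hΔ hC rule hB hT⟩,
    fun E d dw Lℓ Ca Lg La Δ φ M σ₀ hE hdE hσ₀ =>
      ⟨Clapping.constFC E (Module.finrank ℝ (Clapping.Weights E dw)) Ca Lg La Δ φ M σ₀,
      Clapping.constFC_nonneg hσ₀, fun a D _ w₁ hS hΔ hφ hM σ hσ hG Ξ _ ν _ Cf Cb ωF ωB hC rule B T
        hB hT =>
        Clapping.exists_avgGradSqLE_FC hσ₀ hS hdE (by omega) hσ hG hΔ hφ hM hC rule hB hT⟩⟩
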